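/- There are a universal constant $C>0$, a function $\Delta^*(p,r)$ with $$\Delta^*(p,r)\;\le\; C\,p^{-1}\log(r\,p^{-1})\qquad(0<p\le 1/2,\ r\ge 1),$$ a randomized classical algorithm, and integers $a,c$, such that the following holds. Let $G$ be a graph on $n$ vertices with maximum degree $\Delta$, let $r\ge 1$, and consider an $r$-round QAOA circuit for MAXCUT on $G$ with arbitrary real angles $\gamma_1,\dots,\gamma_r,\beta_1,\dots,\beta_r$: on the initial state $|+\rangle^{\otimes n}$, round $j$ applies $e^{i\gamma_j H_c}$, $H_c=\sum_{uv\in E(G)}Z_uZ_v$, and then $e^{i\beta_j H_m}$, $H_m=\sum_v X_v$; finally all qubits are measured in the computational basis. In each round $e^{i\gamma_jH_c}$ is implemented by layers of gates $e^{i\gamma_jZ_uZ_v}$ acting on pairwise disjoint edges of $G$, each edge being used exactly once. After every such diagonal layer (and, optionally, also after every mixer layer) the same Pauli channel $$\mathcal N(\rho)=p_I\rho+p_XX\rho X+p_YY\rho Y+p_ZZ\rho Z$$ acts on every qubit, where $p_I,p_X,p_Y,p_Z\ge 0$ sum to $1$ and $p_I\ge 1/2$. Put $p=p_Z+\min(p_X,p_Y)$,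 assume $p>0$, and let $D$ be the total number of layers (diagonal and mixer) of the circuit. If $\Delta>\Delta^*(p,r)$, then for every $\varepsilon>0$ the algorithm, given $r$, $\lceil 1/\varepsilon\rceil$, the list of operations of the circuit, and the numbers $\cos\gamma_j,\sin\gamma_j,\cos\beta_j,\sin\beta_j,p_X,p_Y,p_Z$ to $S^a$ binary digits, where $S=n+D+\lceil 1/\varepsilon\rceil$, uses at most $c\,S^c$ bit operations in the worst case and returns a string in $\{0,1\}^n$ whose law is within total variation distance $\varepsilon$ of the output distribution of the noisy circuit. -/

import Mathlib

noncomputable section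

namespace QAOA

/-! ### Operators and channels on `n` qubits -/

/-- Computational basis labels of `n` qubits. -/
abbrev Bits (n : ℕ) := Fin n → Bool

/-- Operators on `n` qubits, as matrices in the computational basis. -/
abbrev Operator (n : ℕ) := Matrix (Bits n) (Bits n) ℂ

/-- The map `ρ ↦ U ρ U†`. -/
def conj {n : ℕ} (U ρ : Operator n) : Operator n := U * ρ * U.conjTranspose

/-- A one-qubit operator acting on qubit `v`, the identity acting on the other qubits. -/
def onQubit {n : ℕ} (v : Fin n) (A : Matrix Bool Bool ℂ) : Operator n :=
  fun x y => if ∀ w, w ≠ v → x w = y w then A (x v) (y v) else 0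

def pauliX : Matrix Bool Bool ℂ := fun a b => if a = b then 0 else 1

def pauliZ : Matrix Bool Bool ℂ := fun a b => if a = b then (if a then -1 else 1) else 0

def pauliY : Matrix Bool Bool ℂ := Complex.I • (pauliX * pauliZ)

/-- The one-qubit mixer gate `e^{iβX} = cos β I + i sin β X`. -/
def mixerGate (β : ℝ) : Matrix Bool Bool ℂ :=
  (Real.cos β : ℂ) • (1 : Matrix Bool Bool ℂ) + (Complex.I * (Real.sin β : ℂ)) • pauliX

/-- The eigenvalue of `Z` on the basis state labelled by a bit. -/
def zSign (a : Bool) : ℝ := if a then -1 else 1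

/-- The diagonal two-qubit gate `e^{iγ Z_u Z_v}`. -/
def zzGate {n : ℕ} (γ : ℝ) (u v : Fin n) : Operator n :=
  Matrix.diagonal fun x => Complex.exp (Complex.I * ((γ * (zSign (x u) * zSign (x v)) : ℝ) : ℂ))

/-- The state `|+⟩⟨+|` on each of the `n` qubits: all entries are `2^{-n}`. -/
def plusState (n : ℕ) : Operator n := fun _ _ => ((2 : ℂ) ^ n)⁻¹

/-- The error probabilities of a one-qubit Pauli channel that acts as the identity with probability
at least `1/2`. -/
structure PauliNoise where
  pX : ℝ
  pY : ℝ
  pZ : ℝ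
  pX_nonneg : 0 ≤ pX
  pY_nonneg : 0 ≤ pY
  pZ_nonneg : 0 ≤ pZ
  half_le_pI : 1 / 2 ≤ 1 - pX - pY - pZ

namespace PauliNoise

def pI (N : PauliNoise) : ℝ := 1 - N.pX - N.pY - N.pZ

/-- The noise strength `p = p_Z + min(p_X, p_Y)`. -/
def strength (N : PauliNoise) : ℝ := N.pZ + min N.pX N.pY

/-- The Pauli channel acting on qubit `v`. -/
def channel (N : PauliNoise) {n : ℕ} (v : Fin n) (ρ : Operator n) : Operator n :=
  (N.pI : ℂ) • ρ + (N.pX : ℂ) • conj (onQubit v pauliX) ρ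
    + (N.pY : ℂ) • conj (onQubit v pauliY) ρ + (N.pZ : ℂ) • conj (onQubit v pauliZ) ρ

end PauliNoise

/-! ### Noisy QAOA circuits for MAXCUT -/

/-- An elementary operation of a noisy QAOA circuit with `r` rounds on `n` qubits: the gate
`e^{iγ_j Z_u Z_v}`, one noise channel on every qubit, or the mixer `e^{iβ_j X}` on every qubit. -/
inductive Op (n r : ℕ) where
  | zz (j : Fin r) (u v : Fin n)
  | noise
  | mix (j : Fin r)

/-- A layered `r`-round QAOA circuit for MAXCUT on `G`. In round `j`, the operator
`e^{iγ_j H_c}`, `H_c = ∑_{uv ∈ E(G)} Z_u Z_v`, is implemented by layers of gates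
`e^{iγ_j Z_u Z_v}` on pairwise disjoint edges, each edge of `G` occurring exactly once, and is
followed by the mixer. The flag says whether the mixer layer is followed by noise as well. -/
structure MaxCutCircuit {n : ℕ} (G : SimpleGraph (Fin n)) (r : ℕ) where
  gamma : Fin r → ℝ
  beta : Fin r → ℝ
  layers : Fin r → List (List (Fin n × Fin n))
  noisyMixer : Bool
  disjoint_in_layer : ∀ j, ∀ L ∈ layers j, (L.flatMap fun e => [e.1, e.2]).Nodup
  edge_at_most_once : ∀ j, ((layers j).flatten.map fun e => s(e.1, e.2)).Nodup
  edge_iff : ∀ j e, e ∈ ((layers j).flatten.map fun e => s(e.1, e.2)) ↔ e ∈ G.edgeSet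

namespace MaxCutCircuit

variable {n r : ℕ} {G : SimpleGraph (Fin n)}

/-- The total number of layers, each mixer counting as one layer. -/
def depth (Q : MaxCutCircuit G r) : ℕ := ∑ j, ((Q.layers j).length + 1)

/-- The operations of round `j`: every cost layer is followed by noise on every qubit. -/
def roundOps (Q : MaxCutCircuit G r) (j : Fin r) : List (Op n r) :=
  ((Q.layers j).flatMap fun L => (L.map fun e => Op.zz j e.1 e.2) ++ [Op.noise])
    ++ (if Q.noisyMixer then [Op.mix j, Op.noise] else [Op.mix j])

/-- All operations of the noisy circuit, in temporal order. -/
def ops (Q : MaxCutCircuit G r) : List (Op n r) := (List.finRange r).flatMap Q.roundOps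

/-- The action of one operation on a density matrix. -/
def applyOp (Q : MaxCutCircuit G r) (N : PauliNoise) (ρ : Operator n) : Op n r → Operator n
  | .zz j u v => conj (zzGate (Q.gamma j) u v) ρ
  | .noise => (List.finRange n).foldl (fun σ v => N.channel v σ) ρ
  | .mix j => (List.finRange n).foldl (fun σ v => conj (onQubit v (mixerGate (Q.beta j))) σ) ρ

/-- The final state of the noisy circuit, started on `|+⟩` on each qubit. -/
def finalState (Q : MaxCutCircuit G r) (N : PauliNoise) : Operator n :=
  Q.ops.foldl (Q.applyOp N) (plusState n)

/-- The probability of the outcome `x` when all qubits of the final state are measured in the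
computational basis. -/
def outputProb (Q : MaxCutCircuit G r) (N : PauliNoise) (x : Bits n) : ℝ :=
  (Q.finalState N x x).re

end MaxCutCircuit

/-! ### Randomized classical algorithms: a random access machine with bit costs -/

/-- The memory: integer variables and integer arrays. -/
structure Store where
  vars : ℕ → ℤ
  arrs : ℕ → ℕ → ℤ

namespace Store

def setVar (s : Store) (x : ℕ) (z : ℤ) : Store :=
  { s with vars := Function.update s.vars x z }

def setArr (s : Store) (a i : ℕ) (z : ℤ) : Store :=
  { s with arrs := Function.update s.arrs a (Function.update (s.arrs a) i z) }

end Store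

/-- Integer expressions; `get a i` reads the entry with index `i` of array number `a`. -/
inductive Expr where
  | lit (k : ℤ)
  | var (x : ℕ)
  | get (a : ℕ) (i : Expr)
  | add (e f : Expr)
  | sub (e f : Expr)
  | mul (e f : Expr)
  | div (e f : Expr)
  | mod (e f : Expr)
  | lt (e f : Expr)
  | eq (e f : Expr)

/-- The number of bits (with sign) of an integer. -/
def bitLen (z : ℤ) : ℕ := z.natAbs.size + 1

namespace Expr

def eval (s : Store) : Expr → ℤ
  | lit k => k
  | var x => s.vars x
  | get a i => s.arrs a (i.eval s).toNat
  | add e f => e.eval s + f.eval s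
  | sub e f => e.eval s - f.eval s
  | mul e f => e.eval s * f.eval s
  | div e f => e.eval s / f.eval s
  | mod e f => e.eval s % f.eval s
  | lt e f => if e.eval s < f.eval s then 1 else 0
  | eq e f => if e.eval s = f.eval s then 1 else 0

/-- The number of bit operations charged for evaluating an expression: linear in the bit lengths
of the operands for memory accesses, additions and comparisons, and their product for
multiplications and divisions. -/
def cost (s : Store) : Expr → ℕ
  | lit k => bitLen k
  | var x => bitLen (s.vars x)
  | get a i => i.cost s + bitLen (i.eval s) + bitLen (s.arrs a (i.eval s).toNat)
  | add e f => e.cost s + f.cost s + (bitLen (e.eval s) + bitLen (f.eval s))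
  | sub e f => e.cost s + f.cost s + (bitLen (e.eval s) + bitLen (f.eval s))
  | mul e f => e.cost s + f.cost s + bitLen (e.eval s) * bitLen (f.eval s)
  | div e f => e.cost s + f.cost s + bitLen (e.eval s) * bitLen (f.eval s)
  | mod e f => e.cost s + f.cost s + bitLen (e.eval s) * bitLen (f.eval s)
  | lt e f => e.cost s + f.cost s + (bitLen (e.eval s) + bitLen (f.eval s))
  | eq e f => e.cost s + f.cost s + (bitLen (e.eval s) + bitLen (f.eval s))

end Expr

/-- Programs. Conditions count as true when they are nonzero; `flip x` stores a fair random bit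
in the variable `x`. -/
inductive Prog where
  | skip
  | set (x : ℕ) (e : Expr)
  | store (a : ℕ) (i e : Expr)
  | flip (x : ℕ)
  | seq (c d : Prog)
  | ite (b : Expr) (c d : Prog)
  | while (b : Expr) (c : Prog)

/-- `Runs c s μ t`: started in memory `s`, the program `c` halts after at most `t` bit operations
whatever the random bits are, and the final memory has the distribution `μ`. -/
inductive Runs : Prog → Store → PMF Store → ℕ → Prop
  | skip (s : Store) : Runs .skip s (PMF.pure s) 1
  | set (s : Store) (x : ℕ) (e : Expr) :
      Runs (.set x e) s (PMF.pure (s.setVar x (e.eval s))) (e.cost s + 1)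
  | store (s : Store) (a : ℕ) (i e : Expr) :
      Runs (.store a i e) s (PMF.pure (s.setArr a (i.eval s).toNat (e.eval s)))
        (i.cost s + e.cost s + 1)
  | flip (s : Store) (x : ℕ) :
      Runs (.flip x) s
        ((PMF.uniformOfFintype Bool).map fun b => s.setVar x (if b then 1 else 0)) 1
  | seq (c d : Prog) (s : Store) (μ : PMF Store) (ν : Store → PMF Store) (t t' : ℕ) :
      Runs c s μ t → (∀ s' ∈ μ.support, Runs d s' (ν s') t') →
      Runs (.seq c d) s (μ.bind ν) (t + t')
  | ite_true (b : Expr) (c d : Prog) (s : Store) (μ : PMF Store) (t : ℕ) :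
      b.eval s ≠ 0 → Runs c s μ t → Runs (.ite b c d) s μ (b.cost s + 1 + t)
  | ite_false (b : Expr) (c d : Prog) (s : Store) (μ : PMF Store) (t : ℕ) :
      b.eval s = 0 → Runs d s μ t → Runs (.ite b c d) s μ (b.cost s + 1 + t)
  | while_true (b : Expr) (c : Prog) (s : Store) (μ : PMF Store) (ν : Store → PMF Store)
      (t t' : ℕ) :
      b.eval s ≠ 0 → Runs c s μ t → (∀ s' ∈ μ.support, Runs (.while b c) s' (ν s') t') →
      Runs (.while b c) s (μ.bind ν) (b.cost s + 1 + t + t')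
  | while_false (b : Expr) (c : Prog) (s : Store) :
      b.eval s = 0 → Runs (.while b c) s (PMF.pure s) (b.cost s + 1)
  | mono (c : Prog) (s : Store) (μ : PMF Store) (t t' : ℕ) :
      Runs c s μ t → t ≤ t' → Runs c s μ t'

/-! ### Presenting circuits to the machine -/

/-- A real number to `m` binary digits after the point, scaled to an integer. -/
def truncated (m : ℕ) (x : ℝ) : ℤ := ⌊(2 : ℝ) ^ m * x⌋

/-- Every operation is written as four integers. -/
def Op.encode {n r : ℕ} : Op n r → List ℤ
  | .zz j u v => [0, (j : ℕ), (u : ℕ), (v : ℕ)]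
  | .noise => [1, 0, 0, 0]
  | .mix j => [2, (j : ℕ), 0, 0]

namespace MaxCutCircuit

variable {n r : ℕ} {G : SimpleGraph (Fin n)}

/-- The gate parameters `cos γ_j, sin γ_j, cos β_j, sin β_j` of all rounds to `m` bits. -/
def encodeAngles (Q : MaxCutCircuit G r) (m : ℕ) : List ℤ :=
  (List.finRange r).flatMap fun j =>
    [truncated m (Real.cos (Q.gamma j)), truncated m (Real.sin (Q.gamma j)),
      truncated m (Real.cos (Q.beta j)), truncated m (Real.sin (Q.beta j))]

/-- The initial memory on the circuit `Q` with noise `N` and accuracy `1 / k`, all real parameters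
being given to `m` bits. The variables hold `n, r, k, m`, the number of operations and the noise
parameters, array `0` the gate parameters, array `1` the list of operations. -/
def input (Q : MaxCutCircuit G r) (N : PauliNoise) (k m : ℕ) : Store where
  vars := fun x => ([(n : ℤ), (r : ℤ), (k : ℤ), (m : ℤ), (Q.ops.length : ℤ),
    truncated m N.pX, truncated m N.pY, truncated m N.pZ] : List ℤ).getD x 0
  arrs := fun a i =>
    if a = 0 then (Q.encodeAngles m).getD i 0
    else if a = 1 then (Q.ops.flatMap Op.encode).getD i 0
    else 0

end MaxCutCircuit

/-- The bit string that the machine returns: the first `n` entries of array `2`. -/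
def readOutput (n : ℕ) (s : Store) : Bits n := fun v => decide (s.arrs 2 v = 1)

/-- The total variation distance between a law `μ` and a family of probabilities `P`. -/
def tvDist {α : Type*} [Fintype α] (μ : PMF α) (P : α → ℝ) : ℝ :=
  (1 / 2) * ∑ x, |(μ x).toReal - P x|

end QAOA

end

/-! The noise is useful to the classical algorithm because it dephases. Put μ = min(p_X, p_Y). The
channel is a mixture of complete dephasing (weight 2p_Z), complete dephasing followed by X (weight
2μ), and X, Y and the identity with the remaining weights, which are nonnegative because p_I ≥ 1/2
(`channel_masked`). So every noise operation independently dephases its qubit with probability 2p.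

Between two consecutive mixers on a qubit, all operations are diagonal up to bit flips. A qubit
therefore carries one classical bit on each segment of its world line; such a segment is a site.
Once the branches of the noise are fixed, amplitudes are sums, over the bits at sites, of products
of factors that read at most two neighbouring sites. A dephased site behaves as if its bit had been
measured, so the bit can be sampled and pinned. Only past sites that were never dephased, the free
ones, must be summed over coherently.

The sampler follows the circuit gate by gate and maintains a bit string distributed like a
measurement of the current state. Diagonal gates do not change it and flips permute outcomes. A
mixer on a qubit leaves the joint law of the other bits alone, so it suffices to redraw one bit from
its conditional law. This is exact (`ideal_eq`). By `psum_eq_clusterSum_mul` the conditional law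
depends only on the cluster of free sites attached to the new site, and it is computed by
enumerating the assignments of that cluster.

Clusters are small with high probability. A layer is a matching, so a vertex of degree Δ forces at
least Δ cost layers per round (`degree_le_length_layers`). Noise follows each layer on every qubit,
so a site survives undephased with probability at most (1-2p)^Δ, independently of other sites
(`undephased_le`). A cluster with more than j sites contains j free sites covered by a walk of 2j
steps (`exists_walk_cluster`), and a site has at most Δ+2 neighbours. The union bound gives
n(r+1)((Δ+2)²(1-2p)^Δ)^j (`badness_circuit_le`). The base is at most 1/2 once Δ > 10 p⁻¹ log p⁻¹
(`sq_mul_pow_le_half`), which follows from the stated threshold. Hence clusters of more than log₂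
cap sites are negligible for a polynomial cap, and the sampler may treat them arbitrarily
(`sum_abs_law_sub_ideal_le`).

Precision is handled through a special feature of the gates: c + isZZ and c + isX are multiples of
unitaries for all real c, s. The sampler with truncated parameters is thus exact for a slightly
different circuit, whose output is compared with the true one by crude operator norms. The loss is
exponential in the number of gates and is absorbed by polynomially many digits
(`sum_abs_ideal_sub_outputProb_le`).

It remains to run this on the machine. All random integers are first written on a tape, and the rest
of the program is deterministic (`expect_run`). Program rules track an invariant, a bound B on the
bit lengths of stored numbers and a bound X on the iterations of each loop; both bounds are
polynomial (`size_bounds`, `time_le`). -/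

noncomputable section

namespace QAOA

/-! ### Elementary operations and the path-sum representation -/

/-- Elementary operations: the preparation of a qubit, a two-qubit phase gate, the noise channel on
one qubit, a mixer gate on one qubit. -/
inductive El (n r : ℕ) where
  | init (v : Fin n)
  | zz (j : Fin r) (u v : Fin n)
  | noise (v : Fin n)
  | mix (j : Fin r) (v : Fin n)

/-- The site `(v, j)` stands for qubit `v` between its mixers number `j` and `j + 1`. -/
abbrev Site (n : ℕ) := Fin n × ℕ

/-- A factor of a path weight; it depends on the bits at two sites. -/
structure Fac (n : ℕ) where
  a : Site n
  b : Site n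
  val : Bool → Bool → ℂ

/-- The combinatorial part of the state of the sampler: current sites, pending bit flips, dephasing
flags of the current sites, past sites that were not dephased, and the factors. -/
structure Skel (n : ℕ) where
  seg : Fin n → ℕ
  fl : Fin n → Bool
  dp : Fin n → Bool
  free : Finset (Site n)
  facs : List (Fac n)

/-- Unnormalised gate parameters. -/
structure Gates (r : ℕ) where
  cg : Fin r → ℝ
  sg : Fin r → ℝ
  cb : Fin r → ℝ
  sb : Fin r → ℝ

/-- The parameters are not normalised. The modulus is √(c²+s²) whatever the bits are, so rounded
parameters still give a multiple of a unitary, and the sampler stays exact for the rounded circuit.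
-/
def zzVal (c s : ℝ) (a b : Bool) : ℂ := (c : ℂ) + Complex.I * (s * (zSign a * zSign b) : ℝ)

def mixVal (c s : ℝ) : Matrix Bool Bool ℂ :=
  (c : ℂ) • (1 : Matrix Bool Bool ℂ) + (Complex.I * (s : ℂ)) • pauliX

variable {n r : ℕ}

namespace Skel

def cur (k : Skel n) (v : Fin n) : Site n := (v, k.seg v)

def addFac (k : Skel n) (f : Fac n) : Skel n := { k with facs := k.facs ++ [f] }

/-- A flip creates no new site. It stays pending, and later factors read the bit xor the flip, so
that a single bit describes the whole segment. -/
def flip (k : Skel n) (v : Fin n) : Skel n := { k with fl := Function.update k.fl v (!k.fl v) }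

def dephase (k : Skel n) (v : Fin n) : Skel n := { k with dp := Function.update k.dp v true }

def zz (k : Skel n) (c s : ℝ) (u v : Fin n) : Skel n :=
  k.addFac ⟨k.cur u, k.cur v, fun a b => zzVal c s (xor a (k.fl u)) (xor b (k.fl v))⟩

def sign (k : Skel n) (v : Fin n) : Skel n :=
  k.addFac ⟨k.cur v, k.cur v, fun a _ => (zSign (xor a (k.fl v)) : ℂ)⟩

/-- The effect of the mixer on qubit `v`: a new site is created. -/
def mix (k : Skel n) (c s : ℝ) (v : Fin n) : Skel n where
  seg := Function.update k.seg v (k.seg v + 1)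
  fl := Function.update k.fl v false
  dp := Function.update k.dp v false
  -- A dephased site keeps its sampled value for ever; only an undephased one has to be summed over.
  free := if k.dp v then k.free else insert (k.cur v) k.free
  facs := k.facs ++ [⟨k.cur v, (v, k.seg v + 1), fun a b => mixVal c s b (xor a (k.fl v))⟩]

/-- The five branches of the noise channel: dephasing, a flip with dephasing, `X`, `Y`, identity. -/
def noise (k : Skel n) (v : Fin n) (ch : Fin 5) : Skel n :=
  match ch with
  | 0 => k.dephase v
  | 1 => (k.dephase v).flip v
  | 2 => k.flip v
  | 3 => (k.sign v).flip v
  | 4 => k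

def step (θ : Gates r) (e : El n r) (ch : Fin 5) (k : Skel n) : Skel n :=
  match e with
  | .init _ => k
  | .zz j u v => k.zz (θ.cg j) (θ.sg j) u v
  | .noise v => k.noise v ch
  | .mix j v => k.mix (θ.cb j) (θ.sb j) v

def start (n : ℕ) : Skel n := ⟨fun _ => 0, fun _ => false, fun _ => false, ∅, []⟩

/-- A site is linked to a free site with which it shares a factor. -/
def link (k : Skel n) (a b : Site n) : Prop :=
  b ∈ k.free ∧ ∃ f ∈ k.facs, (f.a = a ∧ f.b = b) ∨ (f.a = b ∧ f.b = a)

open Classical in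
/-- The sites reachable from `s` through free sites. -/
def cluster (k : Skel n) (s : Site n) : Finset (Site n) :=
  (insert s k.free).filter fun a => Relation.ReflTransGen k.link s a

end Skel

/-- The weight of an assignment of bits to the sites. -/
def amp (F : List (Fac n)) (x : Site n → Bool) : ℂ := (F.map fun f => f.val (x f.a) (x f.b)).prod

/-- The assignment that is `1` on `T`, `0` on the rest of `F`, and `z` outside `F`. -/
def pin (z : Site n → Bool) (F T : Finset (Site n)) : Site n → Bool :=
  fun s => if s ∈ F then decide (s ∈ T) else z s

/-- The sum of the weights over all values at the sites in `S`. -/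
def psum (F : List (Fac n)) (S : Finset (Site n)) (z : Site n → Bool) : ℂ :=
  ∑ T ∈ S.powerset, amp F (pin z S T)

def touching (C : Finset (Site n)) (F : List (Fac n)) : List (Fac n) :=
  F.filter fun f => decide (f.a ∈ C ∨ f.b ∈ C)

/-- The contribution of the cluster of `s` to the amplitude with bit `b` at `s`. -/
def clusterSum (k : Skel n) (s : Site n) (z : Site n → Bool) (b : Bool) : ℂ :=
  psum (touching (k.cluster s) k.facs) ((k.cluster s).erase s) (Function.update z s b)

def readout (k : Skel n) (z : Site n → Bool) : Bits n := fun v => xor (z (k.cur v)) (k.fl v)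

/-- Overwrite the bits at the current sites so that the readout becomes `X`. -/
def place (k : Skel n) (z : Site n → Bool) (X : Bits n) : Site n → Bool :=
  fun s => if s.2 = k.seg s.1 then xor (X s.1) (k.fl s.1) else z s

/-- The pure state represented by the skeleton and the values at the pinned sites. -/
def psi (k : Skel n) (z : Site n → Bool) (X : Bits n) : ℂ := psum k.facs k.free (place k z X)

/-- Free sites and sites in factors are not in the future, and free sites are in the past. -/
structure Skel.WF (k : Skel n) : Prop where
  free_lt : ∀ s ∈ k.free, s.2 < k.seg s.1
  a_le : ∀ f ∈ k.facs, f.a.2 ≤ k.seg f.a.1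
  b_le : ∀ f ∈ k.facs, f.b.2 ≤ k.seg f.b.1

/-! ### Sums over free sites and their factorisation over clusters -/

theorem amp_append (F G : List (Fac n)) (x : Site n → Bool) :
    amp (F ++ G) x = amp F x * amp G x := by
  simp [amp]

theorem amp_congr {F : List (Fac n)} {x y : Site n → Bool}
    (h : ∀ f ∈ F, x f.a = y f.a ∧ x f.b = y f.b) : amp F x = amp F y := by
  unfold amp
  congr 1
  apply List.map_congr_left
  intro f hf
  rw [(h f hf).1, (h f hf).2]

theorem pin_of_notMem {z : Site n → Bool} {F T : Finset (Site n)} {s : Site n} (h : s ∉ F) :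
    pin z F T s = z s := by simp [pin, h]

theorem psum_congr {F : List (Fac n)} {S : Finset (Site n)} {z z' : Site n → Bool}
    (h : ∀ f ∈ F, (f.a ∉ S → z f.a = z' f.a) ∧ (f.b ∉ S → z f.b = z' f.b)) :
    psum F S z = psum F S z' := by
  unfold psum
  refine Finset.sum_congr rfl fun T _ => amp_congr fun f hf => ⟨?_, ?_⟩
  · by_cases hs : f.a ∈ S
    · simp [pin, hs]
    · simp [pin, hs, (h f hf).1 hs]
  · by_cases hs : f.b ∈ S
    · simp [pin, hs]
    · simp [pin, hs, (h f hf).2 hs]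

theorem psum_append_pinned (F : List (Fac n)) (f : Fac n) (S : Finset (Site n)) (z : Site n → Bool)
    (ha : f.a ∉ S) (hb : f.b ∉ S) :
    psum (F ++ [f]) S z = f.val (z f.a) (z f.b) * psum F S z := by
  unfold psum
  rw [Finset.mul_sum]
  refine Finset.sum_congr rfl fun T _ => ?_
  rw [amp_append, mul_comm]
  simp [amp, pin_of_notMem ha, pin_of_notMem hb]

theorem sum_pin_insert {M : Type*} [AddCommMonoid M] (g : (Site n → Bool) → M)
    (S : Finset (Site n)) (s : Site n) (hs : s ∉ S) (z : Site n → Bool) :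
    ∑ T ∈ (insert s S).powerset, g (pin z (insert s S) T)
      = ∑ b : Bool, ∑ T ∈ S.powerset, g (pin (Function.update z s b) S T) := by
  rw [Finset.sum_powerset_insert hs, Fintype.sum_bool, add_comm]
  congr 1
  · refine Finset.sum_congr rfl fun T hT => ?_
    congr 1
    funext t
    have hTs : s ∉ T := fun h => hs (Finset.mem_powerset.1 hT h)
    by_cases h : t = s
    · subst h; simp [pin, hs]
    · simp [pin, h]
  · refine Finset.sum_congr rfl fun T hT => ?_
    congr 1
    funext t
    have hTs : s ∉ T := fun h => hs (Finset.mem_powerset.1 hT h)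
    by_cases h : t = s
    · subst h; simp [pin, hs, hTs]
    · simp [pin, h]

theorem psum_insert (F : List (Fac n)) (S : Finset (Site n)) (s : Site n) (hs : s ∉ S)
    (z : Site n → Bool) :
    psum F (insert s S) z = ∑ b : Bool, psum F S (Function.update z s b) :=
  sum_pin_insert (amp F) S s hs z

/-- Fubini: no factor of one list reads a variable summed in the other. The induction removes the
variables of `B` one at a time and turns them into pinned values. -/
theorem psum_mul_of_disjoint (F G : List (Fac n)) (A B : Finset (Site n)) (hAB : Disjoint A B)
    (hF : ∀ f ∈ F, f.a ∉ B ∧ f.b ∉ B) (hG : ∀ f ∈ G, f.a ∉ A ∧ f.b ∉ A) (z : Site n → Bool) :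
    psum (F ++ G) (A ∪ B) z = psum F A z * psum G B z := by
  induction B using Finset.induction_on generalizing z with
  | empty =>
    simp only [Finset.union_empty]
    unfold psum
    rw [Finset.sum_mul]
    refine Finset.sum_congr rfl fun T _ => ?_
    rw [amp_append]
    congr 1
    simp only [Finset.powerset_empty, Finset.sum_singleton]
    apply amp_congr
    intro f hf
    simp [pin, (hG f hf).1, (hG f hf).2]
  | insert s B hs ih =>
    rw [Finset.disjoint_insert_right] at hAB
    rw [Finset.union_insert, psum_insert _ _ _ (by simp [hs, hAB.1]), psum_insert _ _ _ hs,
      Finset.mul_sum]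
    refine Finset.sum_congr rfl fun b _ => ?_
    rw [ih hAB.2 (fun f hf => ⟨fun h => (hF f hf).1 (by simp [h]), fun h => (hF f hf).2 (by simp [h])⟩)]
    congr 1
    apply psum_congr
    intro f hf
    refine ⟨fun _ => ?_, fun _ => ?_⟩
    · rw [Function.update_of_ne]
      intro h; exact (hF f hf).1 (by simp [h])
    · rw [Function.update_of_ne]
      intro h; exact (hF f hf).2 (by simp [h])

theorem amp_touching_mul (C : Finset (Site n)) (F : List (Fac n)) (x : Site n → Bool) :
    amp F x = amp (touching C F) x * amp (F.filter fun f => !decide (f.a ∈ C ∨ f.b ∈ C)) x := by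
  induction F with
  | nil => simp [amp, touching]
  | cons f F ih =>
    unfold amp touching at *
    by_cases h : f.a ∈ C ∨ f.b ∈ C
    · simp only [List.map_cons, List.prod_cons, List.filter_cons, h, decide_true, if_true,
        Bool.not_true, ih]
      simp only [Bool.false_eq_true, if_false]
      ring
    · simp only [List.map_cons, List.prod_cons, List.filter_cons, h, decide_false,
        Bool.not_false, ih]
      simp only [Bool.false_eq_true, if_false, if_true, List.map_cons, List.prod_cons]
      ring

/-- A factor touching the cluster of `s` cannot read a free site outside it, since that site would
be linked to the cluster and belong to it. The remaining factors read neither the cluster nor `s`.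
So the sum splits, and the second part `R` is the same for both values of the bit at `s`; it cancels
in conditional probabilities. -/
theorem psum_eq_clusterSum_mul (k : Skel n) (s : Site n) (hs : s ∉ k.free) (z : Site n → Bool) :
    ∃ R : ℂ, ∀ b, psum k.facs k.free (Function.update z s b) = clusterSum k s z b * R := by
  classical
  set C := k.cluster s with hC
  set A := C.erase s with hA
  set B := k.free \ A with hB
  set G := k.facs.filter fun f => !decide (f.a ∈ C ∨ f.b ∈ C) with hG
  have hsub : A ⊆ k.free := by
    intro a ha
    rw [hA, Finset.mem_erase, hC, Skel.cluster, Finset.mem_filter, Finset.mem_insert] at ha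
    tauto
  have hsC : s ∈ C := by
    rw [hC, Skel.cluster, Finset.mem_filter]
    exact ⟨by simp, Relation.ReflTransGen.refl⟩
  have hcl : ∀ a b, a ∈ C → k.link a b → b ∈ C := by
    intro a b ha hab
    rw [hC, Skel.cluster, Finset.mem_filter] at ha ⊢
    exact ⟨by simp [hab.1], ha.2.tail hab⟩
  refine ⟨psum G B z, fun b => ?_⟩
  have hamp : ∀ x, amp k.facs x = amp (touching C k.facs ++ G) x := by
    intro x; rw [amp_append]; exact amp_touching_mul C k.facs x
  have h1 : psum k.facs k.free (Function.update z s b)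
      = psum (touching C k.facs ++ G) (A ∪ B) (Function.update z s b) := by
    rw [hB, Finset.union_sdiff_of_subset hsub]
    unfold psum
    exact Finset.sum_congr rfl fun T _ => hamp _
  rw [h1, psum_mul_of_disjoint]
  · unfold clusterSum
    congr 1
    apply psum_congr
    intro f hf
    have hf2 : ¬ (f.a ∈ C ∨ f.b ∈ C) := by
      have := (List.mem_filter.1 hf).2
      simpa using this
    push Not at hf2
    refine ⟨fun _ => ?_, fun _ => ?_⟩
    · rw [Function.update_of_ne]; intro h; exact hf2.1 (h ▸ hsC)
    · rw [Function.update_of_ne]; intro h; exact hf2.2 (h ▸ hsC)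
  · exact Finset.disjoint_sdiff
  · intro f hf
    have hf0 : f ∈ k.facs := (List.mem_filter.1 hf).1
    have hf2 : f.a ∈ C ∨ f.b ∈ C := by
      have := (List.mem_filter.1 hf).2
      simpa using this
    have key : ∀ t, t ∈ B → t ∉ C := by
      intro t ht htC
      rw [hB, Finset.mem_sdiff, hA, Finset.mem_erase] at ht
      exact ht.2 ⟨fun h => hs (h ▸ ht.1), htC⟩
    have hfree : ∀ t, t ∈ B → t ∈ k.free := fun t ht => (Finset.mem_sdiff.1 ht).1
    constructor
    · intro h
      rcases hf2 with h2 | h2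
      · exact key _ h h2
      · exact key _ h (hcl _ _ h2 ⟨hfree _ h, f, hf0, Or.inr ⟨rfl, rfl⟩⟩)
    · intro h
      rcases hf2 with h2 | h2
      · exact key _ h (hcl _ _ h2 ⟨hfree _ h, f, hf0, Or.inl ⟨rfl, rfl⟩⟩)
      · exact key _ h h2
  · intro f hf
    have hf2 : ¬ (f.a ∈ C ∨ f.b ∈ C) := by
      have := (List.mem_filter.1 hf).2
      simpa using this
    push Not at hf2
    exact ⟨fun h => hf2.1 (Finset.mem_of_mem_erase h), fun h => hf2.2 (Finset.mem_of_mem_erase h)⟩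

/-! ### The represented state under elementary operations -/

theorem place_cur (k : Skel n) (z : Site n → Bool) (X : Bits n) (v : Fin n) :
    place k z X (k.cur v) = xor (X v) (k.fl v) := by simp [place, Skel.cur]

theorem readout_place (k : Skel n) (z : Site n → Bool) (X : Bits n) :
    readout k (place k z X) = X := by
  funext v
  simp [readout, place_cur]

theorem Skel.WF.cur_notMem {k : Skel n} (h : k.WF) (v : Fin n) : k.cur v ∉ k.free :=
  fun hm => lt_irrefl _ (h.free_lt _ hm)

theorem Skel.WF.start : (Skel.start n).WF := ⟨by simp [Skel.start], by simp [Skel.start],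
  by simp [Skel.start]⟩

theorem psi_zz {k : Skel n} (h : k.WF) (c s : ℝ) (u v : Fin n) (z : Site n → Bool) (X : Bits n) :
    psi (k.zz c s u v) z X = zzVal c s (X u) (X v) * psi k z X := by
  unfold psi
  have : place (k.zz c s u v) z X = place k z X := rfl
  rw [this]
  simp only [Skel.zz, Skel.addFac]
  rw [psum_append_pinned _ _ _ _ (h.cur_notMem u) (h.cur_notMem v)]
  simp [place_cur]

theorem psi_sign {k : Skel n} (h : k.WF) (v : Fin n) (z : Site n → Bool) (X : Bits n) :
    psi (k.sign v) z X = (zSign (X v) : ℂ) * psi k z X := by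
  unfold psi
  have : place (k.sign v) z X = place k z X := rfl
  rw [this]
  simp only [Skel.sign, Skel.addFac]
  rw [psum_append_pinned _ _ _ _ (h.cur_notMem v) (h.cur_notMem v)]
  simp [place_cur]

theorem place_flip (k : Skel n) (v : Fin n) (z : Site n → Bool) (X : Bits n) :
    place (k.flip v) z X = place k z (Function.update X v (!X v)) := by
  funext s
  rcases s with ⟨w, j⟩
  by_cases hw : w = v
  · subst hw
    simp [place, Skel.flip]
  · simp [place, Skel.flip, hw]

theorem psi_flip (k : Skel n) (v : Fin n) (z : Site n → Bool) (X : Bits n) :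
    psi (k.flip v) z X = psi k z (Function.update X v (!X v)) := by
  unfold psi
  rw [place_flip]
  rfl

/-- The assignment at the sites existing before a mixer. -/
theorem psum_place_mix {k : Skel n} (h : k.WF) (c s : ℝ) (v : Fin n) (z : Site n → Bool)
    (X : Bits n) (a : Bool) :
    psum k.facs k.free (Function.update (place (k.mix c s v) z X) (k.cur v) (xor a (k.fl v)))
      = psi k z (Function.update X v a) := by
  unfold psi
  apply psum_congr
  have key : ∀ t : Site n, t.2 ≤ k.seg t.1 →
      Function.update (place (k.mix c s v) z X) (k.cur v) (xor a (k.fl v)) t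
        = place k z (Function.update X v a) t := by
    rintro ⟨w, j⟩ hj
    by_cases hw : w = v
    · subst hw
      by_cases hjs : j = k.seg w
      · subst hjs; simp [place, Skel.cur]
      · have : j ≠ k.seg w + 1 := by simp only at hj; omega
        simp [place, Skel.cur, Skel.mix, hjs, this]
    · simp [place, Skel.cur, Skel.mix, hw]
  intro f hf
  exact ⟨fun _ => key _ (h.a_le f hf), fun _ => key _ (h.b_le f hf)⟩

/-- Common core of the two mixer cases. With the old site held at a value, the new factor leaves the
sum, and older factors do not see the new site because `Skel.WF` keeps them out of the future. -/
theorem psum_mix {k : Skel n} (h : k.WF) (c s : ℝ) (v : Fin n) (z : Site n → Bool) (X : Bits n)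
    (a : Bool) :
    psum (k.mix c s v).facs k.free
        (Function.update (place (k.mix c s v) z X) (k.cur v) (xor a (k.fl v)))
      = mixVal c s (X v) a * psi k z (Function.update X v a) := by
  have h2 : (v, k.seg v + 1) ∉ k.free := fun hm => by
    have := h.free_lt _ hm
    simp at this
  simp only [Skel.mix]
  rw [psum_append_pinned _ _ _ _ (h.cur_notMem v) h2]
  have := psum_place_mix h c s v z X a
  simp only [Skel.mix] at this
  rw [this]
  simp [place, Skel.cur]

theorem psi_mix_of_not_dp {k : Skel n} (h : k.WF) (c s : ℝ) (v : Fin n) (hd : k.dp v = false)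
    (z : Site n → Bool) (X : Bits n) :
    psi (k.mix c s v) z X
      = ∑ a : Bool, mixVal c s (X v) a * psi k z (Function.update X v a) := by
  have h1 : (k.mix c s v).free = insert (k.cur v) k.free := by simp [Skel.mix, hd]
  rw [psi, h1, psum_insert _ _ _ (h.cur_notMem v)]
  -- The bit of the old site and the bit of the qubit differ by the pending flip, so the sum is
  -- reindexed by that xor; the double negation in front is the identity.
  rw [← Equiv.sum_comp (Equiv.boolNot.trans Equiv.boolNot |>.trans
    (if k.fl v then Equiv.boolNot else Equiv.refl _))]
  refine Finset.sum_congr rfl fun a _ => ?_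
  rw [← psum_mix h]
  congr 2
  cases k.fl v <;> cases a <;> rfl

theorem psi_mix_of_dp {k : Skel n} (h : k.WF) (c s : ℝ) (v : Fin n) (hd : k.dp v = true)
    (z : Site n → Bool) (X : Bits n) (a : Bool) (hz : z (k.cur v) = xor a (k.fl v)) :
    psi (k.mix c s v) z X = mixVal c s (X v) a * psi k z (Function.update X v a) := by
  have h1 : (k.mix c s v).free = k.free := by simp [Skel.mix, hd]
  rw [← psum_mix h, psi, h1]
  congr 1
  rw [← hz]
  symm
  apply Function.update_eq_self_iff.2
  simp [place, Skel.cur, Skel.mix]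

theorem Skel.WF.addFac {k : Skel n} (h : k.WF) {f : Fac n} (ha : f.a.2 ≤ k.seg f.a.1)
    (hb : f.b.2 ≤ k.seg f.b.1) : (k.addFac f).WF := by
  refine ⟨h.free_lt, ?_, ?_⟩
  · intro g hg
    rcases List.mem_append.1 hg with hg | hg
    · exact h.a_le g hg
    · rw [List.mem_singleton.1 hg]; exact ha
  · intro g hg
    rcases List.mem_append.1 hg with hg | hg
    · exact h.b_le g hg
    · rw [List.mem_singleton.1 hg]; exact hb

theorem Skel.WF.step {k : Skel n} (h : k.WF) (θ : Gates r) (e : El n r) (ch : Fin 5) :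
    (k.step θ e ch).WF := by
  have hsg : ∀ v, (k.sign v).WF := fun v => h.addFac le_rfl le_rfl
  have hfl : ∀ k : Skel n, k.WF → ∀ v, (k.flip v).WF := fun k h v => ⟨h.free_lt, h.a_le, h.b_le⟩
  have hdp : ∀ v, (k.dephase v).WF := fun v => ⟨h.free_lt, h.a_le, h.b_le⟩
  cases e with
  | init v => exact h
  | zz j u v => exact h.addFac le_rfl le_rfl
  | noise v =>
    fin_cases ch
    · exact hdp v
    · exact hfl _ (hdp v) v
    · exact hfl _ h v
    · exact hfl _ (hsg v) v
    · exact h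
  | mix j v =>
    have mono : ∀ w, k.seg w ≤ Function.update k.seg v (k.seg v + 1) w := by
      intro w
      by_cases hw : w = v
      · subst hw; simp
      · simp [hw]
    refine ⟨?_, ?_, ?_⟩
    · intro s hs
      simp only [Skel.step, Skel.mix] at hs ⊢
      have : s ∈ insert (k.cur v) k.free := by
        split_ifs at hs
        · exact Finset.mem_insert_of_mem hs
        · exact hs
      rcases Finset.mem_insert.1 this with rfl | hs
      · simp [Skel.cur]
      · exact lt_of_lt_of_le (h.free_lt s hs) (mono _)
    · intro f hf
      rcases List.mem_append.1 hf with hf | hf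
      · exact (h.a_le f hf).trans (mono _)
      · rw [List.mem_singleton.1 hf]; exact mono v
    · intro f hf
      rcases List.mem_append.1 hf with hf | hf
      · exact (h.b_le f hf).trans (mono _)
      · rw [List.mem_singleton.1 hf]; simp [Skel.step, Skel.mix]

/-! ### Elementary operations on density matrices -/

/-- Basis states agreeing with `X` off `v` are parametrised by their bit at `v`. This turns products
with `onQubit` matrices into sums over one bit. -/
theorem sum_agree {M : Type*} [AddCommMonoid M] (X : Bits n) (v : Fin n) (g : Bits n → M) :
    (∑ Z : Bits n, if ∀ w, w ≠ v → X w = Z w then g Z else 0)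
      = ∑ a : Bool, g (Function.update X v a) := by
  rw [← Finset.sum_filter]
  symm
  apply Finset.sum_nbij' (fun a => Function.update X v a) (fun Z => Z v)
  · intro a _
    simp only [Finset.mem_filter, Finset.mem_univ, true_and]
    intro w hw
    simp [hw]
  · intro Z _; simp
  · intro a _; simp
  · intro Z hZ
    simp only [Finset.mem_filter, Finset.mem_univ, true_and] at hZ
    funext w
    by_cases hw : w = v
    · subst hw; simp
    · simp [hw, hZ w hw]
  · intro a _; rfl

theorem conj_onQubit_apply (v : Fin n) (A : Matrix Bool Bool ℂ) (ρ : Operator n) (X Y : Bits n) :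
    conj (onQubit v A) ρ X Y
      = ∑ a : Bool, ∑ b : Bool, A (X v) a * star (A (Y v) b)
          * ρ (Function.update X v a) (Function.update Y v b) := by
  have h1 : ∀ Z, (onQubit v A * ρ) X Z = ∑ a : Bool, A (X v) a * ρ (Function.update X v a) Z := by
    intro Z
    rw [Matrix.mul_apply]
    have := sum_agree X v (fun W => A (X v) (W v) * ρ W Z)
    simp only [Function.update_self] at this
    rw [← this]
    refine Finset.sum_congr rfl fun W _ => ?_
    simp [onQubit]
  unfold conj
  rw [Matrix.mul_apply]
  have := sum_agree Y v (fun W => (onQubit v A * ρ) X W * star (A (Y v) (W v)))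
  simp only [Function.update_self] at this
  rw [Finset.sum_comm]
  have h2 : ∀ b, ∑ a : Bool, A (X v) a * star (A (Y v) b)
          * ρ (Function.update X v a) (Function.update Y v b)
      = (onQubit v A * ρ) X (Function.update Y v b) * star (A (Y v) b) := by
    intro b
    rw [h1, Finset.sum_mul]
    exact Finset.sum_congr rfl fun a _ => by ring
  simp only [h2]
  rw [← this]
  refine Finset.sum_congr rfl fun W _ => ?_
  simp only [Matrix.conjTranspose_apply, onQubit]
  split_ifs <;> simp

/-- A pure state with coherences between different values of the masked qubits removed. -/
def masked (mask : Fin n → Bool) (φ : Bits n → ℂ) : Operator n :=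
  fun X Y => if ∀ v, mask v = true → X v = Y v then φ X * star (φ Y) else 0

def zzMat (c s : ℝ) (u v : Fin n) : Operator n := Matrix.diagonal fun x => zzVal c s (x u) (x v)

/-- The action of an elementary operation on density matrices. -/
def applyEl (θ : Gates r) (N : PauliNoise) (ρ : Operator n) : El n r → Operator n
  | .init _ => ρ
  | .zz j u v => conj (zzMat (θ.cg j) (θ.sg j) u v) ρ
  | .noise v => N.channel v ρ
  | .mix j v => conj (onQubit v (mixVal (θ.cb j) (θ.sb j))) ρ

theorem conj_add (U ρ σ : Operator n) : conj U (ρ + σ) = conj U ρ + conj U σ := by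
  simp [conj, Matrix.mul_add, Matrix.add_mul]

theorem conj_smul (U ρ : Operator n) (a : ℂ) : conj U (a • ρ) = a • conj U ρ := by
  simp [conj]

theorem applyEl_add (θ : Gates r) (N : PauliNoise) (e : El n r) (ρ σ : Operator n) :
    applyEl θ N (ρ + σ) e = applyEl θ N ρ e + applyEl θ N σ e := by
  cases e with
  | init v => rfl
  | zz j u v => exact conj_add _ _ _
  | noise v => simp only [applyEl, PauliNoise.channel, conj_add, smul_add]; abel
  | mix j v => exact conj_add _ _ _

theorem applyEl_smul (θ : Gates r) (N : PauliNoise) (e : El n r) (a : ℂ) (ρ : Operator n) :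
    applyEl θ N (a • ρ) e = a • applyEl θ N ρ e := by
  cases e with
  | init v => rfl
  | zz j u v => exact conj_smul _ _ _
  | noise v =>
    simp only [applyEl, PauliNoise.channel, conj_smul, smul_add]
    simp only [smul_comm _ a]
  | mix j v => exact conj_smul _ _ _

theorem foldl_applyEl_add (θ : Gates r) (N : PauliNoise) (el : List (El n r)) (ρ σ : Operator n) :
    el.foldl (applyEl θ N) (ρ + σ)
      = el.foldl (applyEl θ N) ρ + el.foldl (applyEl θ N) σ := by
  induction el generalizing ρ σ with
  | nil => rfl
  | cons e el ih => simp only [List.foldl_cons, applyEl_add, ih]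

theorem foldl_applyEl_smul (θ : Gates r) (N : PauliNoise) (el : List (El n r)) (a : ℂ)
    (ρ : Operator n) :
    el.foldl (applyEl θ N) (a • ρ) = a • el.foldl (applyEl θ N) ρ := by
  induction el generalizing ρ with
  | nil => rfl
  | cons e el ih => simp only [List.foldl_cons, applyEl_smul, ih]

/-- The probabilities of the five branches of the noise channel. -/
def PauliNoise.wt (N : PauliNoise) : Fin 5 → ℝ :=
  ![2 * N.pZ, 2 * min N.pX N.pY, N.pX - min N.pX N.pY, N.pY - min N.pX N.pY, N.pI - N.pZ]

/-- The weight p_I - p_Z is where p_I ≥ 1/2 enters: p_Z ≤ 1 - p_I ≤ p_I. -/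
theorem PauliNoise.wt_nonneg (N : PauliNoise) (c : Fin 5) : 0 ≤ N.wt c := by
  have h1 := N.pX_nonneg
  have h2 := N.pY_nonneg
  have h3 := N.pZ_nonneg
  have h4 := N.half_le_pI
  have h5 := min_le_left N.pX N.pY
  have h6 := min_le_right N.pX N.pY
  have h7 := le_min h1 h2
  fin_cases c
  · show 0 ≤ 2 * N.pZ
    linarith
  · show 0 ≤ 2 * min N.pX N.pY
    linarith
  · show 0 ≤ N.pX - min N.pX N.pY
    linarith
  · show 0 ≤ N.pY - min N.pX N.pY
    linarith
  · show 0 ≤ 1 - N.pX - N.pY - N.pZ - N.pZ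
    linarith

theorem PauliNoise.sum_wt (N : PauliNoise) : ∑ c, N.wt c = 1 := by
  simp only [Fin.sum_univ_five, PauliNoise.wt, PauliNoise.pI]
  simp
  ring

theorem masked_flip (mask : Fin n → Bool) (φ : Bits n → ℂ) (v : Fin n) (X Y : Bits n) :
    masked mask (fun X => φ (Function.update X v (!X v))) X Y
      = masked mask φ (Function.update X v (!X v)) (Function.update Y v (!Y v)) := by
  unfold masked
  have : (∀ w, mask w = true → X w = Y w) ↔
      (∀ w, mask w = true → Function.update X v (!X v) w = Function.update Y v (!Y v) w) := by
    refine forall_congr' fun w => ?_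
    by_cases hw : w = v
    · subst hw; simp
    · simp [hw]
  simp only [this]

theorem masked_dephase (mask : Fin n → Bool) (φ : Bits n → ℂ) (v : Fin n) (X Y : Bits n) :
    masked (Function.update mask v true) φ X Y = if X v = Y v then masked mask φ X Y else 0 := by
  unfold masked
  have : (∀ w, Function.update mask v true w = true → X w = Y w) ↔
      X v = Y v ∧ (∀ w, mask w = true → X w = Y w) := by
    constructor
    · intro h
      refine ⟨h v (by simp), fun w hw => ?_⟩
      by_cases hv : w = v
      · subst hv; exact h w (by simp)
      · exact h w (by simp [hv, hw])
    · rintro ⟨h1, h2⟩ w hw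
      by_cases hv : w = v
      · subst hv; exact h1
      · exact h2 w (by simpa [hv] using hw)
  by_cases h1 : X v = Y v <;> simp [this, h1]

theorem masked_sign (mask : Fin n → Bool) (φ : Bits n → ℂ) (v : Fin n) (X Y : Bits n) :
    masked mask (fun X => (zSign (X v) : ℂ) * φ X) X Y
      = (if X v = Y v then 1 else -1) * masked mask φ X Y := by
  unfold masked
  by_cases h : ∀ w, mask w = true → X w = Y w
  · simp only [if_pos h]
    cases X v <;> cases Y v <;> simp [zSign]
  · simp [if_neg h]

theorem channel_apply (N : PauliNoise) (v : Fin n) (ρ : Operator n) (X Y : Bits n) :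
    N.channel v ρ X Y
      = (N.pI + (if X v = Y v then 1 else -1) * N.pZ) * ρ X Y
        + (N.pX + (if X v = Y v then 1 else -1) * N.pY)
          * ρ (Function.update X v (!X v)) (Function.update Y v (!Y v)) := by
  unfold PauliNoise.channel
  simp only [Matrix.add_apply, Matrix.smul_apply, conj_onQubit_apply, smul_eq_mul]
  have hX : Function.update X v (X v) = X := by simp
  have hY : Function.update Y v (Y v) = Y := by simp
  cases h1 : X v <;> cases h2 : Y v <;> rw [h1] at hX <;> rw [h2] at hY <;>
    simp [pauliX, pauliY, pauliZ, Matrix.mul_apply, hX, hY] <;>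
    ring

/-- Complete dephasing is (ρ + ZρZ)/2, and followed by X it is (XρX + YρY)/2. Taking these with
weights 2p_Z and 2 min(p_X, p_Y) uses up the Z part and the common part of X and Y. Every branch is
again a masked pure state, so the representation is closed under noise. -/
theorem channel_masked (N : PauliNoise) {k : Skel n} (h : k.WF) (v : Fin n) (z : Site n → Bool) :
    N.channel v (masked k.dp (psi k z))
      = ∑ c, (N.wt c : ℂ) • masked (k.noise v c).dp (psi (k.noise v c) z) := by
  ext X Y
  rw [channel_apply]
  have e0 : masked (k.noise v 0).dp (psi (k.noise v 0) z)
      = masked (Function.update k.dp v true) (psi k z) := rfl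
  have e1 : masked (k.noise v 1).dp (psi (k.noise v 1) z)
      = masked (Function.update k.dp v true) (fun X => psi k z (Function.update X v (!X v))) := by
    have : psi (k.noise v 1) z = fun X => psi k z (Function.update X v (!X v)) := by
      funext X; exact psi_flip (k.dephase v) v z X
    rw [this]; rfl
  have e2 : masked (k.noise v 2).dp (psi (k.noise v 2) z)
      = masked k.dp (fun X => psi k z (Function.update X v (!X v))) := by
    have : psi (k.noise v 2) z = fun X => psi k z (Function.update X v (!X v)) := by
      funext X; exact psi_flip k v z X
    rw [this]; rfl
  have e3 : masked (k.noise v 3).dp (psi (k.noise v 3) z)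
      = masked k.dp (fun X => (fun X => (zSign (X v) : ℂ) * psi k z X)
          (Function.update X v (!X v))) := by
    have : psi (k.noise v 3) z = fun X => (fun X => (zSign (X v) : ℂ) * psi k z X)
          (Function.update X v (!X v)) := by
      funext X
      show psi ((k.sign v).flip v) z X = _
      rw [psi_flip, psi_sign h]
    rw [this]; rfl
  have e4 : masked (k.noise v 4).dp (psi (k.noise v 4) z) = masked k.dp (psi k z) := rfl
  have m3 := masked_flip k.dp (fun X => (zSign (X v) : ℂ) * psi k z X) v X Y
  rw [masked_sign] at m3
  simp only [Fin.sum_univ_five, e0, e1, e2, e3, e4, Matrix.add_apply, Matrix.smul_apply, m3,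
    masked_dephase, masked_flip k.dp (psi k z), smul_eq_mul]
  simp only [PauliNoise.wt]
  have hh : (Function.update X v (!X v) v = Function.update Y v (!Y v) v) ↔ X v = Y v := by simp
  simp only [hh]
  by_cases hv : X v = Y v
  · simp [hv]; ring
  · simp [hv]; ring

theorem conj_zz_masked {k : Skel n} (h : k.WF) (c s : ℝ) (u v : Fin n) (z : Site n → Bool) :
    conj (zzMat c s u v) (masked k.dp (psi k z))
      = masked (k.zz c s u v).dp (psi (k.zz c s u v) z) := by
  ext X Y
  have e : (k.zz c s u v).dp = k.dp := rfl
  unfold conj zzMat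
  rw [Matrix.diagonal_conjTranspose, Matrix.mul_diagonal, Matrix.diagonal_mul, e]
  unfold masked
  simp only [psi_zz h]
  split_ifs
  · simp; ring
  · simp

theorem conj_mix_masked_of_not_dp {k : Skel n} (h : k.WF) (c s : ℝ) (v : Fin n)
    (hd : k.dp v = false) (z : Site n → Bool) :
    conj (onQubit v (mixVal c s)) (masked k.dp (psi k z))
      = masked (k.mix c s v).dp (psi (k.mix c s v) z) := by
  ext X Y
  rw [conj_onQubit_apply]
  have e : (k.mix c s v).dp = k.dp := by
    simp only [Skel.mix]
    apply Function.update_eq_self_iff.2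
    exact hd.symm
  rw [e]
  unfold masked
  simp only [psi_mix_of_not_dp h c s v hd]
  have hm : ∀ a b, (∀ w, k.dp w = true → Function.update X v a w = Function.update Y v b w) ↔
      (∀ w, k.dp w = true → X w = Y w) := by
    intro a b
    refine forall_congr' fun w => ?_
    by_cases hw : w = v
    · subst hw; simp [hd]
    · simp [hw]
  simp only [hm]
  by_cases hc : ∀ w, k.dp w = true → X w = Y w
  · simp only [if_pos hc, star_sum, star_mul', Finset.sum_mul_sum]
    exact Finset.sum_congr rfl fun a _ => Finset.sum_congr rfl fun b _ => by ring
  · simp [if_neg hc]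

/-- A masked qubit is a classical mixture of its two values, so the mixer produces one masked pure
state for each value `a`. That value is recorded at the old site, which stays pinned, and the mask
on `v` is lifted. -/
theorem conj_mix_masked_of_dp {k : Skel n} (h : k.WF) (c s : ℝ) (v : Fin n)
    (hd : k.dp v = true) (z : Site n → Bool) :
    conj (onQubit v (mixVal c s)) (masked k.dp (psi k z))
      = ∑ a : Bool, masked (k.mix c s v).dp
          (psi (k.mix c s v) (Function.update z (k.cur v) (xor a (k.fl v)))) := by
  ext X Y
  have hps : ∀ a X, psi (k.mix c s v) (Function.update z (k.cur v) (xor a (k.fl v))) X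
      = mixVal c s (X v) a * psi k z (Function.update X v a) := by
    intro a X
    rw [psi_mix_of_dp h c s v hd _ X a (by simp)]
    congr 1
    apply psum_congr
    intro f hf
    have key : ∀ t, place k (Function.update z (k.cur v) (xor a (k.fl v))) (Function.update X v a) t
        = place k z (Function.update X v a) t := by
      intro t
      by_cases ht : t = k.cur v
      · subst ht; simp [place, Skel.cur]
      · simp [place, ht]
    exact ⟨fun _ => key _, fun _ => key _⟩
  rw [conj_onQubit_apply, Matrix.sum_apply]
  unfold masked
  simp only [hps]
  refine Finset.sum_congr rfl fun a _ => ?_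
  have hm : ∀ b, (∀ w, k.dp w = true → Function.update X v a w = Function.update Y v b w) ↔
      (b = a ∧ ∀ w, (k.mix c s v).dp w = true → X w = Y w) := by
    intro b
    constructor
    · intro hc
      have h1 := hc v hd
      refine ⟨by simpa using h1.symm, fun w hw => ?_⟩
      by_cases hwv : w = v
      · subst hwv; simp [Skel.mix] at hw
      · simp only [Skel.mix, ne_eq, hwv, not_false_eq_true, Function.update_of_ne] at hw
        simpa [hwv] using hc w hw
    · rintro ⟨rfl, hc⟩ w hw
      by_cases hwv : w = v
      · subst hwv; simp
      · simpa [hwv] using hc w (by simpa [Skel.mix, hwv] using hw)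
  simp only [hm]
  by_cases hc : ∀ w, (k.mix c s v).dp w = true → X w = Y w
  · rw [Finset.sum_eq_single a]
    · rw [if_pos ⟨rfl, hc⟩, if_pos hc, star_mul']; ring
    · intro b _ hb; simp [hb]
    · simp
  · simp [hc]

/-! ### The ideal sampler -/

/-- Reset the bit at the current site of `v` when that site becomes free. -/
def Skel.forget (k : Skel n) (v : Fin n) (z : Site n → Bool) : Site n → Bool :=
  if k.dp v then z else Function.update z (k.cur v) false

def Skel.next (k : Skel n) (v : Fin n) : Site n := (v, k.seg v + 1)

/-- The conditional probability of the bit `1` at the site `s`. -/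
def condProb (k : Skel n) (s : Site n) (z : Site n → Bool) : ℝ :=
  ‖clusterSum k s z true‖ ^ 2 / (‖clusterSum k s z false‖ ^ 2 + ‖clusterSum k s z true‖ ^ 2)

/-- The output law of the sampler with exact conditional probabilities. -/
def ideal (θ : Gates r) (N : PauliNoise) (y : Bits n) :
    List (El n r) → Skel n → (Site n → Bool) → ℝ
  | [], k, z => if readout k z = y then 1 else 0
  | .init v :: el, k, z => (1 / 2) * ∑ b : Bool, ideal θ N y el k (Function.update z (v, 0) b)
  | .zz j u v :: el, k, z => ideal θ N y el (k.zz (θ.cg j) (θ.sg j) u v) z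
  | .noise v :: el, k, z => ∑ c, N.wt c * ideal θ N y el (k.noise v c) z
  | .mix j v :: el, k, z =>
    let k' := k.mix (θ.cb j) (θ.sb j) v
    let z' := k.forget v z
    (1 - condProb k' (k.next v) z') * ideal θ N y el k' (Function.update z' (k.next v) false)
      + condProb k' (k.next v) z' * ideal θ N y el k' (Function.update z' (k.next v) true)

/-- The factor by which an unnormalised gate multiplies total weight. The sampler renormalises at
each mixer, so these factors must be put back when it is compared with the evolved operator. -/
def El.sq (θ : Gates r) : El n r → ℝ
  | .zz j _ _ => θ.cg j ^ 2 + θ.sg j ^ 2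
  | .mix j _ => θ.cb j ^ 2 + θ.sb j ^ 2
  | _ => 1

theorem norm_zzVal_sq (c s : ℝ) (a b : Bool) : ‖zzVal c s a b‖ ^ 2 = c ^ 2 + s ^ 2 := by
  rw [Complex.sq_norm, Complex.normSq_apply]
  cases a <;> cases b <;> simp [zzVal, zSign] <;> ring

theorem mixVal_sum_dp (c s : ℝ) (a : Bool) (φ : ℂ) :
    ‖mixVal c s false a * φ‖ ^ 2 + ‖mixVal c s true a * φ‖ ^ 2 = (c ^ 2 + s ^ 2) * ‖φ‖ ^ 2 := by
  simp only [norm_mul, mul_pow, Complex.sq_norm, Complex.normSq_apply]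
  cases a <;> simp [mixVal, pauliX] <;> ring

/-- Unitarity up to scale. The weight carried by the other qubits' bits does not change except for
the constant c²+s², which is why redrawing one bit suffices. -/
theorem mixVal_sum (c s : ℝ) (φ : Bool → ℂ) :
    ‖∑ a, mixVal c s false a * φ a‖ ^ 2 + ‖∑ a, mixVal c s true a * φ a‖ ^ 2
      = (c ^ 2 + s ^ 2) * ∑ a, ‖φ a‖ ^ 2 := by
  simp only [Complex.sq_norm, Complex.normSq_apply, Fintype.sum_bool]
  simp [mixVal, pauliX]
  ring

/-- Exchanging the bit `X v` with the extra bit `b` is an involution on pairs. -/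
theorem sum_update_swap (v : Fin n) (h : Bool → Bits n → ℝ) :
    ∑ X : Bits n, ∑ b : Bool, h (X v) (Function.update X v b) = ∑ a : Bool, ∑ X, h a X := by
  rw [Finset.sum_comm (f := fun a X => h a X), ← Fintype.sum_prod_type', ← Fintype.sum_prod_type']
  have hinv : Function.Involutive
      (fun p : Bits n × Bool => ((Function.update p.1 v p.2, p.1 v) : Bits n × Bool)) := by
    intro p; simp
  exact Fintype.sum_equiv hinv.toPerm _ _ fun p => rfl

theorem sum_update (v : Fin n) (g : Bits n → ℝ) :
    ∑ X : Bits n, ∑ b : Bool, g (Function.update X v b) = 2 * ∑ X, g X := by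
  rw [sum_update_swap v (fun _ X => g X)]
  simp

/-- After a mixer the sampler's assignment is again a `place`, now for the new skeleton: a dephased
old site remembers its bit, a free one is reset to `false`. This lets the induction in `ideal_eq`
continue. -/
theorem place_mix (k : Skel n) (c s : ℝ) (v : Fin n) (z : Site n → Bool) (X : Bits n) (b : Bool) :
    Function.update (k.forget v (place k z X)) (k.next v) b
      = place (k.mix c s v) (Function.update z (k.cur v) (if k.dp v then xor (X v) (k.fl v) else false))
          (Function.update X v b) := by
  funext t
  rcases t with ⟨w, j⟩
  by_cases hw : w = v
  · subst hw
    by_cases hj : j = k.seg w + 1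
    · subst hj; simp [place, Skel.next, Skel.mix]
    · by_cases hj' : j = k.seg w
      · subst hj'
        cases hd : k.dp w <;> simp [place, Skel.next, Skel.mix, Skel.forget, hd, Skel.cur]
      · cases hd : k.dp w <;> simp [place, Skel.next, Skel.mix, Skel.forget, hd, Skel.cur, hj, hj']
  · cases hd : k.dp v <;> simp [place, Skel.next, Skel.mix, Skel.forget, hd, Skel.cur, hw]

/-- The common factor from `psum_eq_clusterSum_mul` cancels. If both cluster weights vanish,
`condProb` is 0 by the convention for division, and both amplitudes vanish too, so the identities
still hold. -/
theorem condProb_mul {k : Skel n} {s : Site n} (hs : s ∉ k.free) (z : Site n → Bool) :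
    (1 - condProb k s z) * (‖psum k.facs k.free (Function.update z s false)‖ ^ 2
        + ‖psum k.facs k.free (Function.update z s true)‖ ^ 2)
      = ‖psum k.facs k.free (Function.update z s false)‖ ^ 2 ∧
    condProb k s z * (‖psum k.facs k.free (Function.update z s false)‖ ^ 2
        + ‖psum k.facs k.free (Function.update z s true)‖ ^ 2)
      = ‖psum k.facs k.free (Function.update z s true)‖ ^ 2 := by
  obtain ⟨R, hR⟩ := psum_eq_clusterSum_mul k s hs z
  simp only [hR, norm_mul, mul_pow, condProb]
  set x := ‖clusterSum k s z false‖ ^ 2 with hx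
  set y := ‖clusterSum k s z true‖ ^ 2 with hy
  have hx0 : 0 ≤ x := by positivity
  have hy0 : 0 ≤ y := by positivity
  by_cases h : x + y = 0
  · have h1 : x = 0 := by linarith
    have h2 : y = 0 := by linarith
    simp [h1, h2]
  · constructor
    · field_simp
      ring
    · field_simp

theorem psi_update_free {k : Skel n} (z : Site n → Bool) {s : Site n}
    (hs : s ∈ k.free) (b : Bool) (X : Bits n) : psi k (Function.update z s b) X = psi k z X := by
  apply psum_congr
  have key : ∀ t, t ∉ k.free → place k (Function.update z s b) X t = place k z X t := by
    intro t ht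
    have : t ≠ s := fun h' => ht (h' ▸ hs)
    simp [place, this]
  exact fun f _ => ⟨key _, key _⟩

/-- `S` is the scaled weight of everything the sampler still remembers. If the old site was
dephased, its bit is remembered; otherwise it is forgotten and both of its values contribute.
Multiplying by the conditional probability yields the weight after the mixer. -/
theorem ideal_mix_aux {k : Skel n} (h : k.WF) (c s : ℝ) (v : Fin n) (z : Site n → Bool)
    (X : Bits n) :
    let k' := k.mix c s v
    let z' := k.forget v (place k z X)
    let zs := Function.update z (k.cur v) (if k.dp v then xor (X v) (k.fl v) else false)
    let S := (c ^ 2 + s ^ 2) *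
      (if k.dp v then ‖psi k z X‖ ^ 2 else ∑ a, ‖psi k z (Function.update X v a)‖ ^ 2)
    (1 - condProb k' (k.next v) z') * S = ‖psi k' zs (Function.update X v false)‖ ^ 2 ∧
      condProb k' (k.next v) z' * S = ‖psi k' zs (Function.update X v true)‖ ^ 2 := by
  intro k' z' zs S
  have hk' : k'.WF := by
    -- A dummy one-round set of gates with the given mixer parameters makes `Skel.WF.step`
    -- applicable.
    have := h.step (r := 1) ⟨fun _ => 0, fun _ => 0, fun _ => c, fun _ => s⟩ (.mix 0 v) 0
    exact this
  have hs : k.next v ∉ k'.free := by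
    have : k.next v = k'.cur v := by simp [Skel.next, Skel.cur, k', Skel.mix]
    rw [this]; exact hk'.cur_notMem v
  have hp : ∀ b, psum k'.facs k'.free (Function.update z' (k.next v) b)
      = psi k' zs (Function.update X v b) := by
    intro b
    rw [psi, ← place_mix]
  have hS : S = ‖psi k' zs (Function.update X v false)‖ ^ 2
      + ‖psi k' zs (Function.update X v true)‖ ^ 2 := by
    cases hd : k.dp v
    · have e : ∀ b, psi k' zs (Function.update X v b)
          = ∑ a : Bool, mixVal c s b a * psi k z (Function.update X v a) := by
        intro b
        have hm : k.cur v ∈ k'.free := by simp [k', Skel.mix, hd]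
        simp only [zs]
        rw [psi_update_free _ hm, psi_mix_of_not_dp h c s v hd]
        simp
      simp only [e, mixVal_sum, S, hd]
      simp
    · have e : ∀ b, psi k' zs (Function.update X v b) = mixVal c s b (X v) * psi k z X := by
        intro b
        rw [psi_mix_of_dp h c s v hd _ _ (X v) (by simp [zs, hd])]
        simp only [Function.update_idem, Function.update_self, Function.update_eq_self]
        congr 1
        apply psum_congr
        have key : ∀ t, place k zs X t = place k z X t := by
          intro t
          by_cases ht : t = k.cur v
          · subst ht; simp [place, Skel.cur]
          · simp [place, zs, ht]
        exact fun f _ => ⟨fun _ => key _, fun _ => key _⟩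
      simp only [e, mixVal_sum_dp, S, hd]
      simp
  have := condProb_mul hs z'
  simp only [hp] at this
  rw [hS]
  exact this

/-- The ideal sampler, started from the represented state, reproduces the noisy evolution. -/
theorem ideal_eq (θ : Gates r) (N : PauliNoise) (y : Bits n) (el : List (El n r))
    (hel : ∀ v, El.init v ∉ el) {k : Skel n} (h : k.WF) (z : Site n → Bool) :
    (∑ X, ‖psi k z X‖ ^ 2 * ideal θ N y el k (place k z X)) * (el.map (El.sq θ)).prod
      = (el.foldl (applyEl θ N) (masked k.dp (psi k z)) y y).re := by
  induction el generalizing k z with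
  | nil =>
    simp only [ideal, readout_place, List.map_nil, List.prod_nil, mul_one, List.foldl_nil]
    simp [masked, Complex.mul_conj, Complex.normSq_eq_norm_sq, -Complex.ofReal_pow]
  | cons e el ih =>
    have hel' : ∀ v, El.init v ∉ el := fun v hv => hel v (List.mem_cons_of_mem _ hv)
    cases e with
    | init v => exact absurd List.mem_cons_self (hel v)
    | zz j u v =>
      have hw := h.step θ (.zz j u v) 0
      simp only [List.foldl_cons, applyEl, conj_zz_masked h, List.map_cons, List.prod_cons, ideal]
      have := ih hel' hw z
      simp only [Skel.step] at this
      rw [← this, ← mul_assoc]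
      congr 1
      rw [Finset.sum_mul]
      refine Finset.sum_congr rfl fun X _ => ?_
      rw [psi_zz h, norm_mul, mul_pow, norm_zzVal_sq]
      simp only [El.sq]
      have : place (k.zz (θ.cg j) (θ.sg j) u v) z X = place k z X := rfl
      rw [this]; ring
    | noise v =>
      simp only [List.foldl_cons, applyEl, channel_masked N h, List.map_cons, List.prod_cons, ideal]
      have hlin : ∀ S : Finset (Fin 5), (el.foldl (applyEl θ N)
          (∑ c ∈ S, (N.wt c : ℂ) • masked (k.noise v c).dp (psi (k.noise v c) z)))
          = ∑ c ∈ S, (N.wt c : ℂ) •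
            el.foldl (applyEl θ N) (masked (k.noise v c).dp (psi (k.noise v c) z)) := by
        intro S
        induction S using Finset.induction_on with
        | empty =>
          simp only [Finset.sum_empty]
          have := foldl_applyEl_smul θ N el 0 (0 : Operator n)
          simpa using this
        | insert c S hc ih2 =>
          rw [Finset.sum_insert hc, Finset.sum_insert hc, foldl_applyEl_add, ih2,
            foldl_applyEl_smul]
      rw [hlin, Matrix.sum_apply, Complex.re_sum]
      simp only [Matrix.smul_apply, smul_eq_mul, Complex.re_ofReal_mul]
      simp only [El.sq, one_mul, Finset.mul_sum]
      rw [Finset.sum_comm, Finset.sum_mul]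
      refine Finset.sum_congr rfl fun c _ => ?_
      have hw := h.step θ (.noise v) c
      have h2 := ih hel' hw z
      simp only [Skel.step] at h2
      rw [← h2, ← mul_assoc]
      congr 1
      rw [Finset.mul_sum]
      have hinv : Function.Involutive
          (fun X : Bits n => (Function.update X v (!X v) : Bits n)) := by
        intro X; simp
      have hn : ∀ X, ‖psi (k.sign v) z X‖ = ‖psi k z X‖ := by
        intro X
        rw [psi_sign h, norm_mul]
        cases X v <;> simp [zSign]
      -- A flip permutes the outcomes, so the sum over `X` is reindexed by the involution negating
      -- bit `v`.
      have hflip : ∀ k' : Skel n, (∀ X, ‖psi k' z X‖ = ‖psi k z X‖) →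
          (∀ X, place k' z X = place k z X) →
          ∑ X, ‖psi k z X‖ ^ 2 * (N.wt c * ideal θ N y el (k'.flip v) (place k z X))
          = ∑ X, N.wt c * (‖psi (k'.flip v) z X‖ ^ 2
              * ideal θ N y el (k'.flip v) (place (k'.flip v) z X)) := by
        intro k' h1 h2
        refine Fintype.sum_equiv hinv.toPerm _ _ fun X => ?_
        simp only [Function.Involutive.coe_toPerm, psi_flip, place_flip, h1, h2]
        simp only [Function.update_idem, Function.update_self, Bool.not_not,
          Function.update_eq_self]
        ring
      fin_cases c
      · exact Finset.sum_congr rfl fun X _ => by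
          show ‖psi k z X‖ ^ 2 * (N.wt 0 * ideal θ N y el (k.noise v 0) (place k z X)) =
            N.wt 0 * (‖psi k z X‖ ^ 2 * ideal θ N y el (k.noise v 0) (place k z X))
          ring
      · exact hflip (k.dephase v) (fun _ => rfl) (fun _ => rfl)
      · exact hflip k (fun _ => rfl) (fun _ => rfl)
      · exact hflip (k.sign v) hn (fun _ => rfl)
      · exact Finset.sum_congr rfl fun X _ => by
          show ‖psi k z X‖ ^ 2 * (N.wt 4 * ideal θ N y el k (place k z X)) =
            N.wt 4 * (‖psi k z X‖ ^ 2 * ideal θ N y el k (place k z X))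
          ring
    | mix j v =>
      have hw := h.step θ (.mix j v) 0
      simp only [Skel.step] at hw
      simp only [List.foldl_cons, applyEl, List.map_cons, List.prod_cons, ideal]
      set c := θ.cb j
      set s := θ.sb j
      set k' := k.mix c s v with hk'
      have haux := fun X => ideal_mix_aux h c s v z X
      have hsq : El.sq (n := n) θ (.mix j v) = c ^ 2 + s ^ 2 := rfl
      rw [hsq, ← mul_assoc]
      cases hd : k.dp v
      · rw [conj_mix_masked_of_not_dp h c s v hd]
        -- The value stored at the freed site is immaterial because `psi` sums over it; it is reset
        -- to agree with the sampler.
        set zs := Function.update z (k.cur v) false with hzs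
        have hz : ∀ X, psi k' zs X = psi k' z X :=
          fun X => psi_update_free z (by simp [hk', Skel.mix, hd]) false X
        have h2 := ih hel' hw zs
        have hz' : psi k' zs = psi k' z := funext hz
        rw [hz'] at h2
        rw [← h2]
        congr 1
        have h3 : ∀ X, (∑ a, ‖psi k z (Function.update X v a)‖ ^ 2) * (c ^ 2 + s ^ 2) *
            ((1 - condProb k' (k.next v) (k.forget v (place k z X))) *
              ideal θ N y el k'
                (Function.update (k.forget v (place k z X)) (k.next v) false) +
            condProb k' (k.next v) (k.forget v (place k z X)) *
              ideal θ N y el k'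
                (Function.update (k.forget v (place k z X)) (k.next v) true))
            = ∑ b : Bool, (‖psi k' z (Function.update X v b)‖ ^ 2
                * ideal θ N y el k' (place k' zs (Function.update X v b))) := by
          intro X
          obtain ⟨h4, h5⟩ := haux X
          simp only [hd, Bool.false_eq_true, if_false] at h4 h5
          rw [← hzs, hz] at h4 h5
          conv_rhs => rw [Fintype.sum_bool, ← h4, ← h5]
          simp only [place_mix k c s, hd, Bool.false_eq_true, if_false]
          ring
        -- Summing over all `X` counts each configuration of the other qubits twice, both before the
        -- mixer (`h7`) and after it (`h6`); the factor 2 then cancels.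
        have h6 := sum_update v (fun X => ‖psi k' z X‖ ^ 2 * ideal θ N y el k' (place k' zs X))
        simp only [← h3] at h6
        have h7 := sum_update v (fun X => ‖psi k z X‖ ^ 2 * (c ^ 2 + s ^ 2) *
            ((1 - condProb k' (k.next v) (k.forget v (place k z X))) *
              ideal θ N y el k'
                (Function.update (k.forget v (place k z X)) (k.next v) false) +
            condProb k' (k.next v) (k.forget v (place k z X)) *
              ideal θ N y el k'
                (Function.update (k.forget v (place k z X)) (k.next v) true)))
        have h8 : ∀ X a, k.forget v (place k z (Function.update X v a))
            = k.forget v (place k z X) := by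
          intro X a
          simp only [Skel.forget, hd, Bool.false_eq_true, if_false]
          funext t
          rcases t with ⟨w, i⟩
          by_cases ht : (w, i) = k.cur v
          · rw [ht]; simp
          · by_cases hwv : w = v
            · subst hwv
              have : i ≠ k.seg w := fun hi => ht (by rw [hi]; rfl)
              simp [ht, place, this]
            · simp [ht, place, hwv]
        simp only [h8, ← Finset.sum_mul] at h7
        rw [h7] at h6
        have h9 := mul_left_cancel₀ (two_ne_zero) h6
        rw [← h9, Finset.sum_mul]
        exact Finset.sum_congr rfl fun X _ => by ring
      · rw [conj_mix_masked_of_dp h c s v hd, Fintype.sum_bool, foldl_applyEl_add,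
          Matrix.add_apply, Complex.add_re, ← ih hel' hw, ← ih hel' hw, ← add_mul]
        congr 1
        -- The old bit `X v` becomes the pinned value `a` and the new bit takes its place in `X`.
        have h2 := sum_update_swap v (fun a X =>
          ‖psi k' (Function.update z (k.cur v) (xor a (k.fl v))) X‖ ^ 2 * ideal θ N y el k'
            (place k' (Function.update z (k.cur v) (xor a (k.fl v))) X))
        rw [Fintype.sum_bool] at h2
        rw [← h2, Finset.sum_mul]
        refine Finset.sum_congr rfl fun X _ => ?_
        obtain ⟨h4, h5⟩ := haux X
        simp only [hd, if_true] at h4 h5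
        rw [Fintype.sum_bool, ← h4, ← h5]
        simp only [place_mix k c s, hd, if_true]
        ring

/-! ### The ideal sampler as a probability distribution -/

theorem condProb_nonneg (k : Skel n) (s : Site n) (z : Site n → Bool) : 0 ≤ condProb k s z := by
  unfold condProb; positivity

theorem condProb_le_one (k : Skel n) (s : Site n) (z : Site n → Bool) : condProb k s z ≤ 1 := by
  unfold condProb
  apply div_le_one_of_le₀
  · have : 0 ≤ ‖clusterSum k s z false‖ ^ 2 := by positivity
    linarith
  · positivity

theorem ideal_nonneg (θ : Gates r) (N : PauliNoise) (y : Bits n) (el : List (El n r)) (k : Skel n)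
    (z : Site n → Bool) : 0 ≤ ideal θ N y el k z := by
  induction el generalizing k z with
  | nil => simp only [ideal]; split_ifs <;> norm_num
  | cons e el ih =>
    cases e with
    | init v => exact mul_nonneg (by norm_num) (Finset.sum_nonneg fun b _ => ih _ _)
    | zz j u v => exact ih _ _
    | noise v => exact Finset.sum_nonneg fun c _ => mul_nonneg (N.wt_nonneg c) (ih _ _)
    | mix j v =>
      exact add_nonneg (mul_nonneg (sub_nonneg.2 (condProb_le_one _ _ _)) (ih _ _))
        (mul_nonneg (condProb_nonneg _ _ _) (ih _ _))

theorem sum_ideal (θ : Gates r) (N : PauliNoise) (el : List (El n r)) (k : Skel n)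
    (z : Site n → Bool) : ∑ y, ideal θ N y el k z = 1 := by
  induction el generalizing k z with
  | nil => simp [ideal]
  | cons e el ih =>
    cases e with
    | init v =>
      simp only [ideal, ← Finset.mul_sum]
      rw [Finset.sum_comm]
      simp [ih]
    | zz j u v => exact ih _ _
    | noise v =>
      simp only [ideal]
      rw [Finset.sum_comm]
      simp only [← Finset.mul_sum, ih, mul_one, N.sum_wt]
    | mix j v =>
      simp only [ideal]
      rw [Finset.sum_add_distrib, ← Finset.mul_sum, ← Finset.mul_sum, ih, ih]
      ring

/-- All amplitudes of |+⟩ are equal, so the preparations amount to independent fair bits at the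
sites of segment 0. -/
theorem ideal_init (θ : Gates r) (N : PauliNoise) (y : Bits n) (el : List (El n r)) (k : Skel n)
    (l : List (Fin n)) (hl : l.Nodup) (z : Site n → Bool) :
    ideal θ N y (l.map El.init ++ el) k z
      = ((2 : ℝ) ^ n)⁻¹ * ∑ X : Bits n,
          ideal θ N y el k (fun s => if s.2 = 0 ∧ s.1 ∈ l then X s.1 else z s) := by
  induction l generalizing z with
  | nil => simp
  | cons v l ih =>
    rw [List.nodup_cons] at hl
    have h := sum_update v (fun X : Bits n =>
      ideal θ N y el k (fun s => if s.2 = 0 ∧ s.1 ∈ v :: l then X s.1 else z s))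
    simp only [List.map_cons, List.cons_append, ideal, ih hl.2]
    rw [← Finset.mul_sum, Finset.sum_comm]
    have h2 : ∀ (X : Bits n) (b : Bool),
        (fun s : Site n => if s.2 = 0 ∧ s.1 ∈ l then X s.1 else Function.update z (v, 0) b s)
        = (fun s : Site n => if s.2 = 0 ∧ s.1 ∈ v :: l then Function.update X v b s.1 else z s) := by
      intro X b
      funext s
      rcases s with ⟨w, j⟩
      by_cases hw : w = v
      · subst hw
        by_cases hj : j = 0
        · subst hj; simp [hl.1]
        · simp [hj]
      · simp [hw]
    simp only [h2]
    rw [h]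
    ring

/-! ### Elementary operations of a circuit -/

def Op.expand : Op n r → List (El n r)
  | .zz j u v => [.zz j u v]
  | .noise => (List.finRange n).map El.noise
  | .mix j => (List.finRange n).map (El.mix j)

namespace MaxCutCircuit

variable {G : SimpleGraph (Fin n)}

def els (Q : MaxCutCircuit G r) : List (El n r) := Q.ops.flatMap Op.expand

def allEls (Q : MaxCutCircuit G r) : List (El n r) := (List.finRange n).map El.init ++ Q.els

def gates (Q : MaxCutCircuit G r) : Gates r where
  cg j := Real.cos (Q.gamma j)
  sg j := Real.sin (Q.gamma j)
  cb j := Real.cos (Q.beta j)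
  sb j := Real.sin (Q.beta j)

/-- The gate parameters that the machine reads. -/
def intGates (Q : MaxCutCircuit G r) (m : ℕ) : Gates r where
  cg j := truncated m (Real.cos (Q.gamma j))
  sg j := truncated m (Real.sin (Q.gamma j))
  cb j := truncated m (Real.cos (Q.beta j))
  sb j := truncated m (Real.sin (Q.beta j))

end MaxCutCircuit

theorem init_notMem_els {G : SimpleGraph (Fin n)} (Q : MaxCutCircuit G r) (v : Fin n) :
    El.init v ∉ Q.els := by
  intro h
  obtain ⟨o, _, ho⟩ := List.mem_flatMap.1 h
  cases o <;> simp [Op.expand] at ho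

theorem zzGate_eq (γ : ℝ) (u v : Fin n) : zzGate γ u v = zzMat (Real.cos γ) (Real.sin γ) u v := by
  unfold zzGate zzMat
  congr 1
  funext x
  have h : ∀ s : ℝ, s = 1 ∨ s = -1 → Complex.exp (Complex.I * ((γ * s : ℝ) : ℂ))
      = (Real.cos γ : ℂ) + Complex.I * ((Real.sin γ * s : ℝ) : ℂ) := by
    intro s hs
    rw [mul_comm, Complex.exp_mul_I, ← Complex.ofReal_cos, ← Complex.ofReal_sin]
    rcases hs with rfl | rfl
    · simp; ring
    · simp; ring
  apply h
  cases x u <;> cases x v <;> simp [zSign]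

theorem finalState_eq {G : SimpleGraph (Fin n)} (Q : MaxCutCircuit G r) (N : PauliNoise) :
    Q.finalState N = Q.els.foldl (applyEl Q.gates N) (plusState n) := by
  unfold MaxCutCircuit.finalState MaxCutCircuit.els
  rw [List.foldl_flatMap]
  congr 1
  funext ρ o
  cases o with
  | zz j u v => simp [MaxCutCircuit.applyOp, Op.expand, applyEl, zzGate_eq, MaxCutCircuit.gates]
  | noise => simp only [Op.expand, List.foldl_map]; rfl
  | mix j => simp only [Op.expand, List.foldl_map]; rfl

theorem ideal_allEls (θ : Gates r) (N : PauliNoise) {G : SimpleGraph (Fin n)}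
    (Q : MaxCutCircuit G r) (y : Bits n) :
    ideal θ N y Q.allEls (Skel.start n) (fun _ => false) * (Q.els.map (El.sq θ)).prod
      = (Q.els.foldl (applyEl θ N) (plusState n) y y).re := by
  have h := ideal_eq θ N y Q.els (init_notMem_els Q) (Skel.WF.start (n := n)) (fun _ => false)
  have hpsi : psi (Skel.start n) (fun _ => false) = fun _ => 1 := by
    funext X; simp [psi, psum, Skel.start, amp]
  have hm : plusState n = (((2 : ℝ) ^ n)⁻¹ : ℂ) •
      masked (Skel.start n).dp (psi (Skel.start n) (fun _ => false)) := by
    ext X Y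
    rw [hpsi]
    simp [plusState, masked, Skel.start]
  rw [hm, foldl_applyEl_smul, Matrix.smul_apply, smul_eq_mul]
  have : ((((2 : ℝ) : ℂ) ^ n)⁻¹ : ℂ) = (((2 : ℝ) ^ n)⁻¹ : ℝ) := by push_cast; rfl
  rw [this, Complex.re_ofReal_mul, ← h, MaxCutCircuit.allEls,
    ideal_init _ _ _ _ _ _ (List.nodup_finRange n), ← mul_assoc]
  congr 2
  refine Finset.sum_congr rfl fun X _ => ?_
  rw [hpsi]
  simp only [norm_one, one_pow, one_mul]
  congr 1
  funext s
  simp [place, Skel.start]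

/-- Normalisation comes from the sampler: as cos² + sin² = 1, the output probabilities are exactly
the law of the ideal sampler. -/
theorem sum_outputProb {G : SimpleGraph (Fin n)} (Q : MaxCutCircuit G r) (N : PauliNoise) :
    ∑ y, Q.outputProb N y = 1 := by
  have h := fun y => ideal_allEls Q.gates N Q y
  have h1 : (Q.els.map (El.sq Q.gates)).prod = 1 := by
    apply List.prod_eq_one
    intro x hx
    obtain ⟨e, _, rfl⟩ := List.mem_map.1 hx
    cases e <;> simp [El.sq, MaxCutCircuit.gates, Real.cos_sq_add_sin_sq]
  simp only [h1, mul_one] at h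
  unfold MaxCutCircuit.outputProb
  rw [finalState_eq]
  simp only [← h, sum_ideal]

/-! ### Perturbation of the gate parameters -/

section Perturbation

attribute [local instance] Matrix.linftyOpNormedRing Matrix.linftyOpNormedAlgebra

theorem opNorm_le {m : Type*} [Fintype m] [DecidableEq m] (A : Matrix m m ℂ) {c : ℝ} (hc : 0 ≤ c)
    (h : ∀ i, ∑ j, ‖A i j‖ ≤ c) : ‖A‖ ≤ c := by
  lift c to NNReal using hc
  rw [Matrix.linfty_opNorm_def, NNReal.coe_le_coe]
  refine Finset.sup_le fun i _ => ?_
  rw [← NNReal.coe_le_coe]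
  push_cast
  exact h i

theorem entry_le_opNorm {m : Type*} [Fintype m] [DecidableEq m] (A : Matrix m m ℂ) (i j : m) :
    ‖A i j‖ ≤ ‖A‖ := by
  rw [Matrix.linfty_opNorm_def]
  have h1 : ‖A i j‖₊ ≤ ∑ j, ‖A i j‖₊ :=
    Finset.single_le_sum (f := fun j => ‖A i j‖₊) (fun _ _ => zero_le) (Finset.mem_univ j)
  have h2 := Finset.le_sup (f := fun i => ∑ j, ‖A i j‖₊) (Finset.mem_univ i)
  exact_mod_cast h1.trans h2

theorem opNorm_onQubit_le (v : Fin n) (A : Matrix Bool Bool ℂ) {c : ℝ} (hc : 0 ≤ c)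
    (h : ∀ a b, ‖A a b‖ ≤ c) : ‖onQubit v A‖ ≤ 2 * c := by
  apply opNorm_le _ (by positivity)
  intro X
  have h1 := sum_agree X v (fun Z => ‖A (X v) (Z v)‖)
  have h2 : ∀ Z, ‖onQubit v A X Z‖ = if ∀ w, w ≠ v → X w = Z w then ‖A (X v) (Z v)‖ else 0 := by
    intro Z; simp only [onQubit]; split_ifs <;> simp
  simp only [h2, h1, Fintype.sum_bool, Function.update_self]
  linarith [h (X v) true, h (X v) false]

theorem conjTranspose_onQubit (v : Fin n) (A : Matrix Bool Bool ℂ) :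
    (onQubit v A).conjTranspose = onQubit v A.conjTranspose := by
  ext X Y
  simp only [Matrix.conjTranspose_apply, onQubit]
  have : (∀ w, w ≠ v → Y w = X w) ↔ (∀ w, w ≠ v → X w = Y w) :=
    forall_congr' fun w => forall_congr' fun _ => eq_comm
  simp only [this]
  split_ifs <;> simp

theorem norm_conj_le (U ρ : Operator n) {c : ℝ} (h1 : ‖U‖ ≤ c) (h2 : ‖U.conjTranspose‖ ≤ c) :
    ‖conj U ρ‖ ≤ c * c * ‖ρ‖ := by
  have hc : 0 ≤ c := (norm_nonneg _).trans h1
  unfold conj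
  calc ‖U * ρ * U.conjTranspose‖ ≤ ‖U‖ * ‖ρ‖ * ‖U.conjTranspose‖ :=
        (norm_mul_le _ _).trans (by gcongr; exact norm_mul_le _ _)
    _ ≤ c * ‖ρ‖ * c := by gcongr
    _ = c * c * ‖ρ‖ := by ring

theorem norm_conj_sub_le (U V ρ : Operator n) {c d : ℝ} (h1 : ‖U.conjTranspose‖ ≤ c)
    (h2 : ‖V‖ ≤ c) (h3 : ‖U - V‖ ≤ d) (h4 : ‖(U - V).conjTranspose‖ ≤ d) :
    ‖conj U ρ - conj V ρ‖ ≤ 2 * c * d * ‖ρ‖ := by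
  have hc : 0 ≤ c := (norm_nonneg _).trans h2
  have hd : 0 ≤ d := (norm_nonneg _).trans h3
  have : conj U ρ - conj V ρ = (U - V) * ρ * U.conjTranspose + V * ρ * (U - V).conjTranspose := by
    simp only [conj, Matrix.conjTranspose_sub, Matrix.sub_mul, Matrix.mul_sub]
    abel
  rw [this]
  calc _ ≤ ‖U - V‖ * ‖ρ‖ * ‖U.conjTranspose‖ + ‖V‖ * ‖ρ‖ * ‖(U - V).conjTranspose‖ := by
        refine (norm_add_le _ _).trans (add_le_add ?_ ?_) <;>
          exact (norm_mul_le _ _).trans (by gcongr; exact norm_mul_le _ _)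
    _ ≤ d * ‖ρ‖ * c + c * ‖ρ‖ * d := by gcongr
    _ = 2 * c * d * ‖ρ‖ := by ring

theorem norm_mixVal_entry_le (c s : ℝ) {x : ℝ} (hc : |c| ≤ x) (hs : |s| ≤ x) (a b : Bool) :
    ‖mixVal c s a b‖ ≤ x := by
  cases a <;> cases b <;> simp [mixVal, pauliX, hc, hs]

theorem norm_zzVal_le (c s : ℝ) {x : ℝ} (hc : |c| ≤ x) (hs : |s| ≤ x) (a b : Bool) :
    ‖zzVal c s a b‖ ≤ 2 * x := by
  refine (norm_add_le _ _).trans ?_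
  have : ‖Complex.I * ((s * (zSign a * zSign b) : ℝ) : ℂ)‖ ≤ x := by
    rw [norm_mul, Complex.norm_I, one_mul, Complex.norm_real]
    cases a <;> cases b <;> simp [zSign, hs]
  have h2 : ‖(c : ℂ)‖ ≤ x := by rw [Complex.norm_real]; exact hc
  linarith

theorem opNorm_diagonal_le (d : Bits n → ℂ) {x : ℝ} (hx : 0 ≤ x) (h : ∀ X, ‖d X‖ ≤ x) :
    ‖(Matrix.diagonal d : Operator n)‖ ≤ x := by
  apply opNorm_le _ hx
  intro X
  rw [Finset.sum_eq_single X]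
  · simpa using h X
  · intro Y _ hY; simp [Matrix.diagonal_apply_ne' _ hY]
  · simp

theorem opNorm_mix_le (v : Fin n) (c s : ℝ) {x : ℝ} (hc : |c| ≤ x) (hs : |s| ≤ x) :
    ‖onQubit v (mixVal c s)‖ ≤ 2 * x ∧ ‖(onQubit v (mixVal c s)).conjTranspose‖ ≤ 2 * x := by
  have hx : 0 ≤ x := (abs_nonneg _).trans hc
  refine ⟨opNorm_onQubit_le v _ hx (norm_mixVal_entry_le c s hc hs), ?_⟩
  rw [conjTranspose_onQubit]
  apply opNorm_onQubit_le v _ hx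
  intro a b
  rw [Matrix.conjTranspose_apply, norm_star]
  exact norm_mixVal_entry_le c s hc hs b a

theorem opNorm_zz_le (u v : Fin n) (c s : ℝ) {x : ℝ} (hc : |c| ≤ x) (hs : |s| ≤ x) :
    ‖zzMat c s u v‖ ≤ 2 * x ∧ ‖(zzMat c s u v).conjTranspose‖ ≤ 2 * x := by
  have hx : 0 ≤ 2 * x := by linarith [(abs_nonneg _).trans hc]
  refine ⟨opNorm_diagonal_le _ hx fun X => norm_zzVal_le c s hc hs _ _, ?_⟩
  unfold zzMat
  rw [Matrix.diagonal_conjTranspose]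
  refine opNorm_diagonal_le _ hx fun X => ?_
  rw [Pi.star_apply, norm_star]
  exact norm_zzVal_le c s hc hs _ _

theorem norm_channel_le (N : PauliNoise) (v : Fin n) (ρ : Operator n) :
    ‖N.channel v ρ‖ ≤ 4 * ‖ρ‖ := by
  have hp : ∀ A : Matrix Bool Bool ℂ, (∀ a b, ‖A a b‖ ≤ 1) → ‖conj (onQubit v A) ρ‖ ≤ 4 * ‖ρ‖ := by
    intro A hA
    have h1 := opNorm_onQubit_le v A zero_le_one hA
    have h2 := opNorm_onQubit_le v A.conjTranspose zero_le_one
      (fun a b => by rw [Matrix.conjTranspose_apply, norm_star]; exact hA b a)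
    rw [← conjTranspose_onQubit] at h2
    have := norm_conj_le (onQubit v A) ρ h1 h2
    linarith
  have hX := hp pauliX (by intro a b; cases a <;> cases b <;> simp [pauliX])
  have hY := hp pauliY (by
    intro a b; cases a <;> cases b <;> simp [pauliY, pauliX, pauliZ, Matrix.mul_apply])
  have hZ := hp pauliZ (by intro a b; cases a <;> cases b <;> simp [pauliZ])
  have h1 := N.pX_nonneg
  have h2 := N.pY_nonneg
  have h3 := N.pZ_nonneg
  have h4 := N.half_le_pI
  have h5 : 0 ≤ N.pI := by unfold PauliNoise.pI; linarith
  have h0 := norm_nonneg ρ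
  unfold PauliNoise.channel
  calc _ ≤ N.pI * ‖ρ‖ + N.pX * (4 * ‖ρ‖) + N.pY * (4 * ‖ρ‖) + N.pZ * (4 * ‖ρ‖) := by
        refine (norm_add_le _ _).trans (add_le_add ((norm_add_le _ _).trans
          (add_le_add ((norm_add_le _ _).trans (add_le_add ?_ ?_)) ?_)) ?_) <;>
        · rw [norm_smul, Complex.norm_real, Real.norm_of_nonneg (by assumption)] <;> gcongr
    _ ≤ 4 * ‖ρ‖ := by
        have : N.pI + N.pX + N.pY + N.pZ = 1 := by unfold PauliNoise.pI; ring
        nlinarith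

/-- The entries of the gate parameters are bounded by `x`. -/
def Gates.Le (θ : Gates r) (x : ℝ) : Prop :=
  ∀ j, |θ.cg j| ≤ x ∧ |θ.sg j| ≤ x ∧ |θ.cb j| ≤ x ∧ |θ.sb j| ≤ x

def Gates.sub (θ η : Gates r) : Gates r where
  cg j := θ.cg j - η.cg j
  sg j := θ.sg j - η.sg j
  cb j := θ.cb j - η.cb j
  sb j := θ.sb j - η.sb j

/-- The row-sum norm makes the constant 4 wasteful, but over L operations it costs only a factor
4^L, that is, O(L) digits of precision. -/
theorem norm_applyEl_le {θ : Gates r} (hθ : θ.Le 1) (N : PauliNoise) (ρ : Operator n)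
    (e : El n r) : ‖applyEl θ N ρ e‖ ≤ 4 * ‖ρ‖ := by
  cases e with
  | init v => simp only [applyEl]; linarith [norm_nonneg ρ]
  | zz j u v =>
    obtain ⟨h1, h2⟩ := opNorm_zz_le u v _ _ (hθ j).1 (hθ j).2.1
    have := norm_conj_le _ ρ h1 h2
    simp only [applyEl]; linarith
  | noise v => exact norm_channel_le N v ρ
  | mix j v =>
    obtain ⟨h1, h2⟩ := opNorm_mix_le v _ _ (hθ j).2.2.1 (hθ j).2.2.2
    have := norm_conj_le _ ρ h1 h2
    simp only [applyEl]; linarith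

theorem norm_applyEl_sub_le {θ η : Gates r} (hθ : θ.Le 1) (hη : η.Le 1) {δ : ℝ} (hδ : 0 ≤ δ)
    (hd : (θ.sub η).Le δ) (N : PauliNoise) (ρ : Operator n) (e : El n r) :
    ‖applyEl θ N ρ e - applyEl η N ρ e‖ ≤ 8 * δ * ‖ρ‖ := by
  cases e with
  | init v => simp only [applyEl, sub_self, norm_zero]; positivity
  | zz j u v =>
    obtain ⟨_, h2⟩ := opNorm_zz_le u v _ _ (hθ j).1 (hθ j).2.1
    obtain ⟨h3, _⟩ := opNorm_zz_le u v _ _ (hη j).1 (hη j).2.1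
    obtain ⟨h5, h6⟩ := opNorm_zz_le u v _ _ (hd j).1 (hd j).2.1
    have hs : zzMat ((θ.sub η).cg j) ((θ.sub η).sg j) u v
        = zzMat (θ.cg j) (θ.sg j) u v - zzMat (η.cg j) (η.sg j) u v := by
      simp only [zzMat, Matrix.diagonal_sub, Gates.sub]
      congr 1
      funext x
      simp only [zzVal]
      push_cast; ring
    rw [hs] at h5 h6
    have := norm_conj_sub_le _ _ ρ h2 h3 h5 h6
    simp only [applyEl]; linarith
  | noise v => simp only [applyEl, sub_self, norm_zero]; positivity
  | mix j v =>
    obtain ⟨_, h2⟩ := opNorm_mix_le v _ _ (hθ j).2.2.1 (hθ j).2.2.2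
    obtain ⟨h3, _⟩ := opNorm_mix_le v _ _ (hη j).2.2.1 (hη j).2.2.2
    obtain ⟨h5, h6⟩ := opNorm_mix_le v _ _ (hd j).2.2.1 (hd j).2.2.2
    have hs : onQubit v (mixVal ((θ.sub η).cb j) ((θ.sub η).sb j))
        = onQubit v (mixVal (θ.cb j) (θ.sb j)) - onQubit v (mixVal (η.cb j) (η.sb j)) := by
      ext X Y
      simp only [onQubit, Matrix.sub_apply, Gates.sub, mixVal]
      split_ifs
      · simp only [Matrix.add_apply, Matrix.smul_apply, smul_eq_mul]
        push_cast; ring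
      · simp
    rw [hs] at h5 h6
    have := norm_conj_sub_le _ _ ρ h2 h3 h5 h6
    simp only [applyEl]; linarith

/-- Telescoping: at every operation the accumulated error grows by at most 4 and a new error 8δ
times the current norm is added. That norm is itself bounded by a power of 4. -/
theorem norm_foldl_applyEl_sub_le {θ η : Gates r} (hθ : θ.Le 1) (hη : η.Le 1) {δ : ℝ}
    (hδ : 0 ≤ δ) (hd : (θ.sub η).Le δ) (N : PauliNoise) (el : List (El n r)) (ρ σ : Operator n) :
    ‖el.foldl (applyEl θ N) ρ - el.foldl (applyEl η N) σ‖
      ≤ 4 ^ el.length * ‖ρ - σ‖ + el.length * (8 * δ) * 4 ^ el.length * ‖σ‖ := by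
  induction el generalizing ρ σ with
  | nil => simp
  | cons e el ih =>
    simp only [List.foldl_cons, List.length_cons]
    refine (ih _ _).trans ?_
    have h1 : ‖applyEl θ N ρ e - applyEl η N σ e‖ ≤ 4 * ‖ρ - σ‖ + 8 * δ * ‖σ‖ := by
      have e1 : applyEl θ N ρ e - applyEl η N σ e
          = applyEl θ N (ρ - σ) e + (applyEl θ N σ e - applyEl η N σ e) := by
        have := applyEl_add θ N e (ρ - σ) σ
        rw [sub_add_cancel] at this
        rw [this]; abel
      rw [e1]
      exact (norm_add_le _ _).trans
        (add_le_add (norm_applyEl_le hθ N _ e) (norm_applyEl_sub_le hθ hη hδ hd N σ e))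
    have h2 := norm_applyEl_le hη N σ e
    have h0 := norm_nonneg σ
    calc _ ≤ 4 ^ el.length * (4 * ‖ρ - σ‖ + 8 * δ * ‖σ‖)
          + el.length * (8 * δ) * 4 ^ el.length * (4 * ‖σ‖) := by gcongr
      _ = 4 ^ (el.length + 1) * ‖ρ - σ‖ + (el.length * 4 + 1) * (8 * δ) * 4 ^ el.length * ‖σ‖ := by
        ring
      _ ≤ 4 ^ (el.length + 1) * ‖ρ - σ‖ + (el.length * 4 + 4) * (8 * δ) * 4 ^ el.length * ‖σ‖ := by
        gcongr; norm_num
      _ = _ := by push_cast; ring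

theorem norm_plusState_le : ‖plusState n‖ ≤ 1 := by
  apply opNorm_le _ zero_le_one
  intro X
  simp [plusState]

theorem abs_foldl_plusState_sub_le {θ η : Gates r} (hθ : θ.Le 1) (hη : η.Le 1) {δ : ℝ}
    (hδ : 0 ≤ δ) (hd : (θ.sub η).Le δ) (N : PauliNoise) (el : List (El n r)) (y : Bits n) :
    |(el.foldl (applyEl θ N) (plusState n) y y).re - (el.foldl (applyEl η N) (plusState n) y y).re|
      ≤ el.length * (8 * δ) * 4 ^ el.length := by
  have h := norm_foldl_applyEl_sub_le hθ hη hδ hd N el (plusState n) (plusState n)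
  rw [sub_self, norm_zero, mul_zero, zero_add] at h
  rw [← Complex.sub_re, ← Matrix.sub_apply]
  refine (Complex.abs_re_le_norm _).trans ((entry_le_opNorm _ y y).trans (h.trans ?_))
  exact mul_le_of_le_one_right (by positivity) norm_plusState_le

end Perturbation

/-! ### Scaled and truncated gate parameters -/

def Gates.scale (a : ℝ) (θ : Gates r) : Gates r where
  cg j := a * θ.cg j
  sg j := a * θ.sg j
  cb j := a * θ.cb j
  sb j := a * θ.sb j

theorem conj_smul_left (a : ℝ) (U ρ : Operator n) :
    conj ((a : ℂ) • U) ρ = ((a * a : ℝ) : ℂ) • conj U ρ := by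
  ext X Y
  simp [conj, Matrix.conjTranspose_smul, Matrix.smul_apply]
  ring

/-- Each gate contributes a², noise contributes 1. The machine works with integers near 2^m cos and
2^m sin; the resulting positive factor Λ is never computed, since conditional probabilities do not
see it. -/
theorem foldl_applyEl_scale {a : ℝ} (ha : 0 < a) (θ : Gates r) (N : PauliNoise)
    (el : List (El n r)) : ∃ Λ : ℝ, 0 < Λ ∧ ∀ ρ : Operator n,
      el.foldl (applyEl (θ.scale a) N) ρ = (Λ : ℂ) • el.foldl (applyEl θ N) ρ := by
  induction el with
  | nil => exact ⟨1, one_pos, fun ρ => by simp⟩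
  | cons e el ih =>
    obtain ⟨Λ, hΛ, h⟩ := ih
    have he : ∃ μ : ℝ, 0 < μ ∧ ∀ ρ : Operator n,
        applyEl (θ.scale a) N ρ e = (μ : ℂ) • applyEl θ N ρ e := by
      cases e with
      | init v => exact ⟨1, one_pos, fun ρ => by simp [applyEl]⟩
      | noise v => exact ⟨1, one_pos, fun ρ => by simp [applyEl]⟩
      | zz j u v =>
        refine ⟨a * a, by positivity, fun ρ => ?_⟩
        simp only [applyEl]
        rw [← conj_smul_left]
        congr 1
        ext X Y
        simp only [zzMat, Matrix.smul_apply, Matrix.diagonal_apply, Gates.scale]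
        split_ifs
        · simp only [zzVal, smul_eq_mul]; push_cast; ring
        · simp
      | mix j v =>
        refine ⟨a * a, by positivity, fun ρ => ?_⟩
        simp only [applyEl]
        rw [← conj_smul_left]
        congr 1
        ext X Y
        simp only [onQubit, Matrix.smul_apply, Gates.scale]
        split_ifs
        · simp only [mixVal, Matrix.add_apply, Matrix.smul_apply, smul_eq_mul]; push_cast; ring
        · simp
    obtain ⟨μ, hμ, he⟩ := he
    refine ⟨Λ * μ, by positivity, fun ρ => ?_⟩
    simp only [List.foldl_cons, he, h, foldl_applyEl_smul, smul_smul]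
    push_cast
    rfl

theorem truncated_bounds (m : ℕ) {x : ℝ} (hx : |x| ≤ 1) :
    |(2 ^ m : ℝ)⁻¹ * truncated m x| ≤ 1 ∧ |(2 ^ m : ℝ)⁻¹ * truncated m x - x| ≤ (2 ^ m : ℝ)⁻¹ := by
  have h2 : (0 : ℝ) < 2 ^ m := by positivity
  have hf1 := Int.floor_le ((2 : ℝ) ^ m * x)
  have hf2 := Int.lt_floor_add_one ((2 : ℝ) ^ m * x)
  obtain ⟨hx1, hx2⟩ := abs_le.1 hx
  have hf3 : (-(2 : ℝ) ^ m) ≤ (truncated m x : ℝ) := by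
    have : (-(2 : ℤ) ^ m) ≤ truncated m x := by
      apply Int.le_floor.2
      push_cast
      nlinarith
    exact_mod_cast this
  unfold truncated at *
  set t : ℝ := ((⌊(2 : ℝ) ^ m * x⌋ : ℤ) : ℝ) with ht
  constructor
  · rw [abs_le]
    constructor
    · rw [le_inv_mul_iff₀ h2]; linarith
    · rw [inv_mul_le_iff₀ h2]; nlinarith
  · have : (2 ^ m : ℝ)⁻¹ * t - x = (2 ^ m : ℝ)⁻¹ * (t - 2 ^ m * x) := by field_simp
    rw [this, abs_mul, abs_of_pos (inv_pos.2 h2)]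
    apply mul_le_of_le_one_right (inv_pos.2 h2).le
    rw [abs_le]; constructor <;> linarith

/-- The output law of the ideal sampler with truncated parameters is close to that of the
circuit. -/
theorem sum_abs_ideal_sub_outputProb_le {G : SimpleGraph (Fin n)} (Q : MaxCutCircuit G r)
    (N : PauliNoise) (m : ℕ) :
    ∑ y, |ideal (Q.intGates m) N y Q.allEls (Skel.start n) (fun _ => false) - Q.outputProb N y|
      ≤ 2 * (2 ^ n * (Q.els.length * (8 * (2 ^ m : ℝ)⁻¹) * 4 ^ Q.els.length)) := by
  set D : ℝ := Q.els.length * (8 * (2 ^ m : ℝ)⁻¹) * 4 ^ Q.els.length with hD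
  set θ := Gates.scale (2 ^ m : ℝ)⁻¹ (Q.intGates m) with hθ
  have hsc : θ.scale (2 ^ m : ℝ) = Q.intGates m := by
    simp only [hθ, Gates.scale]
    simp
  obtain ⟨Λ, hΛ, hfold⟩ := foldl_applyEl_scale (n := n) (by positivity : (0 : ℝ) < 2 ^ m) θ N Q.els
  rw [hsc] at hfold
  set I := fun y => ideal (Q.intGates m) N y Q.allEls (Skel.start n) (fun _ => false) with hI
  -- The sampler renormalises while the truncated circuit does not. Here κ is the total weight of
  -- the truncated output, since the law `I` sums to 1; summing the entrywise errors shows that κ is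
  -- close to 1.
  set κ := (Q.els.map (El.sq (Q.intGates m))).prod / Λ with hκ
  have h1 : ∀ y, I y * κ = (Q.els.foldl (applyEl θ N) (plusState n) y y).re := by
    intro y
    have := ideal_allEls (Q.intGates m) N Q y
    rw [hfold, Matrix.smul_apply, smul_eq_mul, Complex.re_ofReal_mul] at this
    rw [hκ, ← mul_div_assoc, this]
    field_simp
  have hle1 : θ.Le 1 := fun j =>
    ⟨(truncated_bounds m (Real.abs_cos_le_one _)).1, (truncated_bounds m (Real.abs_sin_le_one _)).1,
      (truncated_bounds m (Real.abs_cos_le_one _)).1, (truncated_bounds m (Real.abs_sin_le_one _)).1⟩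
  have hle2 : Q.gates.Le 1 := fun j =>
    ⟨Real.abs_cos_le_one _, Real.abs_sin_le_one _, Real.abs_cos_le_one _, Real.abs_sin_le_one _⟩
  have hle3 : (θ.sub Q.gates).Le (2 ^ m : ℝ)⁻¹ := fun j =>
    ⟨(truncated_bounds m (Real.abs_cos_le_one _)).2, (truncated_bounds m (Real.abs_sin_le_one _)).2,
      (truncated_bounds m (Real.abs_cos_le_one _)).2, (truncated_bounds m (Real.abs_sin_le_one _)).2⟩
  have h2 : ∀ y, |I y * κ - Q.outputProb N y| ≤ D := by
    intro y
    rw [h1]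
    unfold MaxCutCircuit.outputProb
    rw [finalState_eq]
    exact abs_foldl_plusState_sub_le hle1 hle2 (by positivity) hle3 N Q.els y
  have h3 : ∑ y, |I y * κ - Q.outputProb N y| ≤ 2 ^ n * D := by
    refine (Finset.sum_le_sum fun y _ => h2 y).trans ?_
    simp
  have hI1 : ∑ y, I y = 1 := sum_ideal _ _ _ _ _
  have h4 : |κ - 1| ≤ 2 ^ n * D := by
    have : κ - 1 = ∑ y, (I y * κ - Q.outputProb N y) := by
      rw [Finset.sum_sub_distrib, ← Finset.sum_mul, hI1, sum_outputProb, one_mul]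
    rw [this]
    exact (Finset.abs_sum_le_sum_abs _ _).trans h3
  have h5 : ∀ y, |I y - Q.outputProb N y| ≤ I y * |κ - 1| + |I y * κ - Q.outputProb N y| := by
    intro y
    have hIy : 0 ≤ I y := ideal_nonneg _ _ _ _ _ _
    have e : I y - Q.outputProb N y = -(I y * (κ - 1)) + (I y * κ - Q.outputProb N y) := by ring
    rw [e]
    refine (abs_add_le _ _).trans ?_
    rw [abs_neg, abs_mul, abs_of_nonneg hIy]
  refine (Finset.sum_le_sum fun y _ => h5 y).trans ?_
  rw [Finset.sum_add_distrib, ← Finset.sum_mul, hI1]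
  linarith

/-! ### The sampler driven by uniform random integers -/

/-- The branch of the noise channel selected by a random integer, the error probabilities being
given as integers. -/
def chOf (a b z u : ℕ) : Fin 5 :=
  if u < 2 * z then 0
  else if u < 2 * z + 2 * min a b then 1
  else if u < 2 * z + min a b + a then 2
  else if u < 2 * z + a + b then 3
  else 4

/-- The squared modulus of a cluster sum, replaced by zero if the cluster is too large. -/
def capWeight (cap : ℕ) (k : Skel n) (s : Site n) (z : Site n → Bool) (b : Bool) : ℝ :=
  if 2 ^ (k.cluster s).card ≤ cap then ‖clusterSum k s z b‖ ^ 2 else 0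

/-- The condition u/M < w₁/(w₀+w₁) without division. For a cluster that is too large both weights
are 0, the condition reads 0 < 0, and the bit is `false`. -/
def sampleBit (M cap : ℕ) (k : Skel n) (s : Site n) (z : Site n → Bool) (u : ℕ) : Bool :=
  decide ((u : ℝ) * (capWeight cap k s z false + capWeight cap k s z true)
    < capWeight cap k s z true * M)

/-- One elementary step of the sampler, with the random integer `u < M`. -/
def sampleStep (θ : Gates r) (ch : ℕ → Fin 5) (M cap : ℕ) (e : El n r) (u : ℕ)
    (p : Skel n × (Site n → Bool)) : Skel n × (Site n → Bool) :=
  (p.1.step θ e (ch u),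
    match e with
    | .init v => Function.update p.2 (v, 0) (decide (u % 2 = 1))
    | .zz _ _ _ => p.2
    | .noise _ => p.2
    | .mix _ v => Function.update (p.1.forget v p.2) (p.1.next v)
        (sampleBit M cap (p.1.step θ e (ch u)) (p.1.next v) (p.1.forget v p.2) u))

/-- The output law of the sampler. -/
def law (θ : Gates r) (ch : ℕ → Fin 5) (M cap : ℕ) (y : Bits n) :
    List (El n r) → Skel n × (Site n → Bool) → ℝ
  | [], p => if readout p.1 p.2 = y then 1 else 0
  | e :: el, p => (∑ u ∈ Finset.range M, law θ ch M cap y el (sampleStep θ ch M cap e u p)) / M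

/-- The expected number of too large clusters. -/
def badness (θ : Gates r) (N : PauliNoise) (cap : ℕ) : List (El n r) → Skel n → ℝ
  | [], _ => 0
  | .init v :: el, k => badness θ N cap el (k.step θ (.init v) 0)
  | .zz j u v :: el, k => badness θ N cap el (k.step θ (.zz j u v) 0)
  | .noise v :: el, k => ∑ c, N.wt c * badness θ N cap el (k.step θ (.noise v) c)
  | .mix j v :: el, k =>
    (if 2 ^ ((k.step θ (.mix j v) 0).cluster (k.next v)).card ≤ cap then 0 else 1)
      + badness θ N cap el (k.step θ (.mix j v) 0)

theorem sum_comp_eq {ι α : Type*} [Fintype α] [DecidableEq α] (S : Finset ι) (g : ι → α)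
    (F : α → ℝ) : ∑ u ∈ S, F (g u) = ∑ c, ((S.filter fun u => g u = c).card : ℝ) * F c := by
  have h : ∀ u ∈ S, F (g u) = ∑ c, if g u = c then F c else 0 := fun u _ => by simp
  rw [Finset.sum_congr rfl h, Finset.sum_comm]
  refine Finset.sum_congr rfl fun c _ => ?_
  rw [← Finset.sum_filter, Finset.sum_const, nsmul_eq_mul]

theorem law_nonneg (θ : Gates r) (ch : ℕ → Fin 5) (M cap : ℕ) (y : Bits n) (el : List (El n r))
    (p : Skel n × (Site n → Bool)) : 0 ≤ law θ ch M cap y el p := by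
  induction el generalizing p with
  | nil => simp only [law]; split_ifs <;> norm_num
  | cons e el ih => exact div_nonneg (Finset.sum_nonneg fun u _ => ih _) (Nat.cast_nonneg _)

theorem sum_law (θ : Gates r) (ch : ℕ → Fin 5) {M : ℕ} (hM : M ≠ 0) (cap : ℕ) (el : List (El n r))
    (p : Skel n × (Site n → Bool)) : ∑ y, law θ ch M cap y el p = 1 := by
  induction el generalizing p with
  | nil => simp [law]
  | cons e el ih =>
    simp only [law]
    rw [← Finset.sum_div, Finset.sum_comm]
    simp [ih, hM]

/-- Hybrid argument for mixtures: replacing the weights costs their ℓ¹ distance, replacing the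
components costs the average of their distances. -/
theorem sum_abs_mixture_sub_le {α β : Type*} [Fintype α] [Fintype β] (a b : α → ℝ)
    (f g : α → β → ℝ) (hb : ∀ c, 0 ≤ b c) (hf : ∀ c y, 0 ≤ f c y) (hf1 : ∀ c, ∑ y, f c y = 1) :
    ∑ y, |∑ c, a c * f c y - ∑ c, b c * g c y|
      ≤ ∑ c, |a c - b c| + ∑ c, b c * ∑ y, |f c y - g c y| := by
  have h : ∀ y, |∑ c, a c * f c y - ∑ c, b c * g c y|
      ≤ ∑ c, (|a c - b c| * f c y + b c * |f c y - g c y|) := by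
    intro y
    rw [← Finset.sum_sub_distrib]
    refine (Finset.abs_sum_le_sum_abs _ _).trans (Finset.sum_le_sum fun c _ => ?_)
    have : a c * f c y - b c * g c y = (a c - b c) * f c y + b c * (f c y - g c y) := by ring
    rw [this]
    refine (abs_add_le _ _).trans ?_
    rw [abs_mul, abs_mul, abs_of_nonneg (hf c y), abs_of_nonneg (hb c)]
  refine (Finset.sum_le_sum fun y _ => h y).trans ?_
  rw [Finset.sum_comm, ← Finset.sum_add_distrib]
  refine Finset.sum_le_sum fun c _ => ?_
  rw [Finset.sum_add_distrib, ← Finset.mul_sum, hf1, mul_one, ← Finset.mul_sum]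

/-- The admissible integers are exactly those below ⌈yM/(x+y)⌉, so rounding costs less than one
integer out of M. If x = y = 0, both quotients are 0. -/
theorem abs_card_threshold_sub_le {M : ℕ} (hM : M ≠ 0) {x y : ℝ} (hx : 0 ≤ x) (hy : 0 ≤ y) :
    |((((Finset.range M).filter fun u : ℕ => (u : ℝ) * (x + y) < y * M).card : ℕ) : ℝ) / M
      - y / (x + y)| ≤ 1 / M := by
  have hM' : (0 : ℝ) < M := by exact_mod_cast Nat.pos_of_ne_zero hM
  rcases eq_or_lt_of_le (add_nonneg hx hy) with h | h
  · have h1 : y = 0 := by linarith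
    have h2 : x = 0 := by linarith
    subst h1 h2
    simp
  · have hle : y * M / (x + y) ≤ M := by
      rw [div_le_iff₀ h]; nlinarith
    have hset : ((Finset.range M).filter fun u : ℕ => (u : ℝ) * (x + y) < y * M)
        = Finset.range ⌈y * M / (x + y)⌉₊ := by
      ext u
      simp only [Finset.mem_filter, Finset.mem_range, Nat.lt_ceil, lt_div_iff₀ h]
      constructor
      · exact fun h => h.2
      · intro hu
        refine ⟨?_, hu⟩
        rw [← lt_div_iff₀ h] at hu
        exact_mod_cast hu.trans_le hle
    rw [hset, Finset.card_range]
    have h1 := Nat.le_ceil (y * M / (x + y))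
    have h2 := Nat.ceil_lt_add_one (a := y * M / (x + y)) (by positivity)
    have e : (⌈y * M / (x + y)⌉₊ : ℝ) / M - y / (x + y)
        = (⌈y * M / (x + y)⌉₊ - y * M / (x + y)) / M := by field_simp
    rw [e, abs_div, abs_of_pos hM', div_le_div_iff_of_pos_right hM', abs_le]
    constructor <;> linarith

theorem card_even_range {M : ℕ} (hM : Even M) (b : Bool) :
    (((Finset.range M).filter fun u => decide (u % 2 = 1) = b).card : ℝ) = M / 2 := by
  obtain ⟨t, rfl⟩ := hM
  have : ∀ t : ℕ, ((Finset.range (t + t)).filter fun u => decide (u % 2 = 1) = b).card = t := by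
    intro t
    induction t with
    | zero => simp
    | succ t ih =>
      have e : t + 1 + (t + 1) = t + t + 1 + 1 := by ring
      rw [e, Finset.range_add_one, Finset.range_add_one, Finset.filter_insert,
        Finset.filter_insert]
      have h1 : (t + t) % 2 = 0 := by omega
      have h2 : (t + t + 1) % 2 = 1 := by omega
      rw [h1, h2]
      cases b
      · simpa using ih
      · simpa using ih
  rw [this]
  push_cast; ring

/-- Every elementary step costs at most η for rounding its probabilities, and a cluster that is too
large costs at most 2, the largest ℓ¹ distance of two laws. The skeleton evolves independently of
the sampled bits, so the number of such clusters is averaged over the noise branches alone. -/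
theorem sum_abs_law_sub_ideal_le (θ : Gates r) (N : PauliNoise) (ch : ℕ → Fin 5) {M : ℕ}
    (hM : M ≠ 0) (hM2 : Even M) (cap : ℕ) {η : ℝ} (hη : 2 / M ≤ η)
    (hch : ∑ c, |(((Finset.range M).filter fun u => ch u = c).card : ℝ) / M - N.wt c| ≤ η)
    (el : List (El n r)) (k : Skel n) (z : Site n → Bool) :
    ∑ y, |law θ ch M cap y el (k, z) - ideal θ N y el k z|
      ≤ el.length * η + 2 * badness θ N cap el k := by
  have hM' : (0 : ℝ) < M := by exact_mod_cast Nat.pos_of_ne_zero hM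
  have hη0 : 0 ≤ η := le_trans (by positivity) hη
  induction el generalizing k z with
  | nil => simp [law, ideal, badness]
  | cons e el ih =>
    have hmix : ∀ {α : Type} [Fintype α] [DecidableEq α] (g : ℕ → α)
        (S : α → Skel n × (Site n → Bool)) (b : α → ℝ),
        (∀ c, 0 ≤ b c) → (∑ c, b c = 1) →
        ∑ y, |(∑ u ∈ Finset.range M, law θ ch M cap y el (S (g u))) / M
          - ∑ c, b c * ideal θ N y el (S c).1 (S c).2|
        ≤ ∑ c, |(((Finset.range M).filter fun u => g u = c).card : ℝ) / M - b c|
          + (el.length * η + ∑ c, b c * (2 * badness θ N cap el (S c).1)) := by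
      intro α _ _ g S b hb hb1
      have h1 := fun y => sum_comp_eq (Finset.range M) g (fun c => law θ ch M cap y el (S c))
      have h2 : ∀ y, (∑ u ∈ Finset.range M, law θ ch M cap y el (S (g u))) / M
          = ∑ c, (((Finset.range M).filter fun u => g u = c).card : ℝ) / M
              * law θ ch M cap y el (S c) := by
        intro y
        rw [h1, Finset.sum_div]
        exact Finset.sum_congr rfl fun c _ => by ring
      simp only [h2]
      refine (sum_abs_mixture_sub_le _ b _ _ hb (fun c y => law_nonneg _ _ _ _ _ _ _)
        (fun c => sum_law _ _ hM _ _ _)).trans ?_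
      gcongr
      have h3 : ∀ c, b c * ∑ y, |law θ ch M cap y el (S c) - ideal θ N y el (S c).1 (S c).2|
          ≤ b c * (el.length * η) + b c * (2 * badness θ N cap el (S c).1) := by
        intro c
        rw [← mul_add]
        exact mul_le_mul_of_nonneg_left (ih _ _) (hb c)
      refine (Finset.sum_le_sum fun c _ => h3 c).trans ?_
      rw [Finset.sum_add_distrib, ← Finset.sum_mul, hb1, one_mul]
    have hlen : ((e :: el).length : ℝ) * η = el.length * η + η := by
      push_cast [List.length_cons]; ring
    rw [hlen]
    cases e with
    | init v =>
      have h := hmix (fun u => decide (u % 2 = 1))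
        (fun b => (k, Function.update z (v, 0) b)) (fun _ => 1 / 2) (fun _ => by norm_num)
        (by simp)
      simp only [card_even_range hM2] at h
      have h0 : (M : ℝ) / 2 / M - 1 / 2 = 0 := by field_simp; ring
      simp only [h0, abs_zero, Finset.sum_const_zero, zero_add, ← Finset.mul_sum] at h
      simp only [law, ideal, sampleStep, badness, Skel.step] at h ⊢
      refine h.trans ?_
      simp
      linarith
    | zz j u v =>
      -- A phase gate ignores its random integer: a mixture with one component.
      have h := hmix (fun u => ())
        (fun _ => (k.zz (θ.cg j) (θ.sg j) u v, z)) (fun _ => 1) (fun _ => by norm_num)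
        (by simp)
      simp [hM] at h
      simp only [law, ideal, sampleStep, badness, Skel.step]
      simp [hM]
      linarith
    | noise v =>
      have h := hmix ch (fun c => (k.noise v c, z)) N.wt N.wt_nonneg N.sum_wt
      simp only [law, ideal, sampleStep, badness, Skel.step] at h ⊢
      refine h.trans ?_
      have : ∑ c, N.wt c * (2 * badness θ N cap el (k.noise v c))
          = 2 * ∑ c, N.wt c * badness θ N cap el (k.noise v c) := by
        rw [Finset.mul_sum]; exact Finset.sum_congr rfl fun c _ => by ring
      rw [this]
      linarith
    | mix j v =>
      set k' := k.mix (θ.cb j) (θ.sb j) v with hk'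
      set z' := k.forget v z with hz'
      set s := k.next v with hs
      set p := condProb k' s z' with hp
      have hp0 : 0 ≤ p := condProb_nonneg _ _ _
      have hp1 : p ≤ 1 := condProb_le_one _ _ _
      set t := (((Finset.range M).filter fun u => sampleBit M cap k' s z' u = true).card : ℝ) / M
        with ht
      have h := hmix (fun u => sampleBit M cap k' s z' u)
        (fun b => (k', Function.update z' s b)) (fun b => if b then p else 1 - p)
        (fun b => by cases b <;> simp [hp0, hp1]) (by simp)
      have hfalse : (((Finset.range M).filter fun u => sampleBit M cap k' s z' u = false).card : ℝ)
          / M = 1 - t := by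
        have h1 := Finset.card_filter_add_card_filter_not (s := Finset.range M)
          (fun u => sampleBit M cap k' s z' u = true)
        simp only [Bool.not_eq_true, Finset.card_range] at h1
        rw [ht, eq_sub_iff_add_eq, ← add_div, div_eq_one_iff_eq hM'.ne']
        have h2 : (((Finset.range M).filter fun u => sampleBit M cap k' s z' u = true).card : ℝ)
          + ((Finset.range M).filter fun u => sampleBit M cap k' s z' u = false).card = M := by
          exact_mod_cast h1
        linarith
      simp only [Fintype.sum_bool, hfalse, if_true, Bool.false_eq_true, if_false, ← ht] at h
      have habs : |1 - t - (1 - p)| = |t - p| := by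
        rw [← abs_neg]; congr 1; ring
      have ht0 : 0 ≤ t := by positivity
      have ht1 : t ≤ 1 := by
        have : 0 ≤ 1 - t := by rw [← hfalse]; positivity
        linarith
      -- Half of η, because the deviation is counted once for each of the two outcomes.
      have hdiff : |t - p| ≤ η / 2 + if 2 ^ (k'.cluster s).card ≤ cap then 0 else 1 := by
        split_ifs with hc
        · have := abs_card_threshold_sub_le hM (sq_nonneg ‖clusterSum k' s z' false‖)
            (sq_nonneg ‖clusterSum k' s z' true‖)
          have e : ∀ u, (sampleBit M cap k' s z' u = true) ↔
              (u : ℝ) * (‖clusterSum k' s z' false‖ ^ 2 + ‖clusterSum k' s z' true‖ ^ 2)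
                < ‖clusterSum k' s z' true‖ ^ 2 * M := by
            intro u; simp [sampleBit, capWeight, hc]
          simp only [← e] at this
          have h3 : (2 : ℝ) / M = 2 * (1 / M) := by ring
          have h4 : |t - p| ≤ 1 / M := this
          linarith
        · rw [abs_le]; constructor <;> linarith
      rw [habs] at h
      have hl : ∀ y, law θ ch M cap y (El.mix j v :: el) (k, z)
          = (∑ u ∈ Finset.range M, law θ ch M cap y el
              (k', Function.update z' s (sampleBit M cap k' s z' u))) / M := fun y => rfl
      have hi : ∀ y, ideal θ N y (El.mix j v :: el) k z
          = p * ideal θ N y el k' (Function.update z' s true)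
            + (1 - p) * ideal θ N y el k' (Function.update z' s false) := by
        intro y
        simp only [ideal]
        rw [add_comm]
      have hb : badness θ N cap (El.mix j v :: el) k
          = (if 2 ^ (k'.cluster s).card ≤ cap then 0 else 1) + badness θ N cap el k' := rfl
      simp only [hl, hi, hb]
      refine h.trans ?_
      linarith

/-! ### Selecting the branch of the noise channel -/

theorem card_filter_Ico (M lo hi : ℕ) (h : hi ≤ M) (P : ℕ → Prop) [DecidablePred P]
    (hP : ∀ u < M, P u ↔ lo ≤ u ∧ u < hi) : ((Finset.range M).filter P).card = hi - lo := by
  have : (Finset.range M).filter P = Finset.Ico lo hi := by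
    ext u
    simp only [Finset.mem_filter, Finset.mem_range, Finset.mem_Ico]
    constructor
    · rintro ⟨h1, h2⟩; exact (hP u h1).1 h2
    · intro h1
      have : u < M := by omega
      exact ⟨this, (hP u this).2 h1⟩
  rw [this, Nat.card_Ico]

/-- The five branches occupy consecutive intervals of integers. Since the parameters are rounded
down by less than 1, the lengths of the first four are off by at most 2 and that of the last by at
most 4, which makes 12 in all. -/
theorem sum_abs_chOf_sub_wt_le (N : PauliNoise) {M a b z : ℕ} (hM : M ≠ 0)
    (ha : (a : ℝ) ≤ M * N.pX) (ha' : M * N.pX < a + 1)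
    (hb : (b : ℝ) ≤ M * N.pY) (hb' : M * N.pY < b + 1)
    (hz : (z : ℝ) ≤ M * N.pZ) (hz' : M * N.pZ < z + 1) :
    ∑ c, |(((Finset.range M).filter fun u => chOf a b z u = c).card : ℝ) / M - N.wt c|
      ≤ 12 / M := by
  have hM' : (0 : ℝ) < M := by exact_mod_cast Nat.pos_of_ne_zero hM
  have hX := N.pX_nonneg
  have hY := N.pY_nonneg
  have hZ := N.pZ_nonneg
  have hI := N.half_le_pI
  have htot : 2 * z + a + b ≤ M := by
    have : (2 * z + a + b : ℝ) ≤ M := by nlinarith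
    exact_mod_cast this
  have hm1 : min a b ≤ a := min_le_left _ _
  have hm2 : min a b ≤ b := min_le_right _ _
  have key : ∀ c : Fin 5, ∀ lo hi : ℕ, lo ≤ hi → hi ≤ M →
      (∀ u < M, chOf a b z u = c ↔ lo ≤ u ∧ u < hi) → ∀ d : ℝ, ∀ w : ℝ, N.wt c = w →
      |((hi : ℝ) - lo) - M * w| ≤ d →
      |(((Finset.range M).filter fun u => chOf a b z u = c).card : ℝ) / M - N.wt c| ≤ d / M := by
    intro c lo hi hlh hh hP d w hw hd
    rw [card_filter_Ico M lo hi hh _ hP, Nat.cast_sub hlh, hw]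
    have : ((hi : ℝ) - lo) / M - w = ((hi - lo) - M * w) / M := by field_simp
    rw [this, abs_div, abs_of_pos hM']
    gcongr
  have hmin : |((min a b : ℕ) : ℝ) - M * min N.pX N.pY| ≤ 1 := by
    rw [Nat.cast_min, mul_min_of_nonneg _ _ hM'.le, abs_le]
    constructor
    · have h1 := min_le_min ha'.le hb'.le
      rw [min_add_add_right] at h1
      linarith
    · have := min_le_min ha hb
      linarith
  obtain ⟨hn1, hn2⟩ := abs_le.1 hmin
  rw [Nat.cast_min] at hn1 hn2
  have h0 := key 0 0 (2 * z) (by omega) (by omega)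
    (by intro u _; unfold chOf; split_ifs <;> simp <;> omega) 2 (2 * N.pZ) rfl
    (by rw [abs_le]; push_cast; constructor <;> nlinarith)
  have h1 := key 1 (2 * z) (2 * z + 2 * min a b) (by omega) (by omega)
    (by intro u _; unfold chOf; split_ifs <;> simp <;> omega) 2 (2 * min N.pX N.pY) rfl
    (by rw [abs_le]; push_cast; constructor <;> nlinarith)
  have h2 := key 2 (2 * z + 2 * min a b) (2 * z + min a b + a) (by omega) (by omega)
    (by intro u _; unfold chOf; split_ifs <;> simp <;> omega) 2 (N.pX - min N.pX N.pY) rfl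
    (by rw [abs_le]; push_cast; constructor <;> nlinarith)
  have h3 := key 3 (2 * z + min a b + a) (2 * z + a + b) (by omega) (by omega)
    (by intro u _; unfold chOf; split_ifs <;> simp <;> omega) 2 (N.pY - min N.pX N.pY) rfl
    (by rw [abs_le]; push_cast; constructor <;> nlinarith)
  have h4 := key 4 (2 * z + a + b) M (by omega) (by omega)
    (by intro u hu; unfold chOf; split_ifs <;> simp <;> omega) 4 (N.pI - N.pZ) rfl
    (by unfold PauliNoise.pI; rw [abs_le]; push_cast; constructor <;> nlinarith)
  rw [Fin.sum_univ_five]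
  have : (12 : ℝ) / M = 2 / M + 2 / M + 2 / M + 2 / M + 4 / M := by ring
  rw [this]
  linarith

/-! ### Walks in space-time -/

/-- Adjacency of space-time sites. -/
def Nbr (G : SimpleGraph (Fin n)) (a b : Site n) : Prop :=
  (a.2 = b.2 ∧ G.Adj a.1 b.1) ∨ (a.1 = b.1 ∧ (a.2 = b.2 + 1 ∨ b.2 = a.2 + 1))

theorem Nbr.symm {G : SimpleGraph (Fin n)} {a b : Site n} (h : Nbr G a b) : Nbr G b a := by
  rcases h with ⟨h1, h2⟩ | ⟨h1, h2⟩
  · exact Or.inl ⟨h1.symm, h2.symm⟩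
  · exact Or.inr ⟨h1.symm, h2.symm⟩

/-- At segment 0 the subtraction is truncated and lists the site itself; an extra element does no
harm, as only an upper bound for the number of neighbours is needed. -/
def nbrs (G : SimpleGraph (Fin n)) [DecidableRel G.Adj] (a : Site n) : Finset (Site n) :=
  (G.neighborFinset a.1).image (fun w => (w, a.2)) ∪ {(a.1, a.2 + 1), (a.1, a.2 - 1)}

theorem mem_nbrs {G : SimpleGraph (Fin n)} [DecidableRel G.Adj] {a b : Site n} (h : Nbr G a b) :
    b ∈ nbrs G a := by
  rcases a with ⟨u, i⟩
  rcases b with ⟨v, j⟩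
  unfold nbrs
  rcases h with ⟨h1, h2⟩ | ⟨h1, h2 | h2⟩ <;> simp only at h1 h2 <;> subst h1
  · exact Finset.mem_union_left _ (Finset.mem_image.2 ⟨v, by simpa using h2, rfl⟩)
  · subst h2; simp
  · subst h2; simp

theorem card_nbrs_le (G : SimpleGraph (Fin n)) [DecidableRel G.Adj] (a : Site n) :
    (nbrs G a).card ≤ G.maxDegree + 2 := by
  refine (Finset.card_union_le _ _).trans (add_le_add ?_ Finset.card_le_two)
  exact Finset.card_image_le.trans (G.degree_le_maxDegree a.1)

/-- The walks with `L` steps starting at a site. -/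
def walks (G : SimpleGraph (Fin n)) [DecidableRel G.Adj] : ℕ → Site n → Finset (List (Site n))
  | 0, s => {[s]}
  | L + 1, s => (nbrs G s).biUnion fun b => (walks G L b).image (s :: ·)

theorem card_walks_le (G : SimpleGraph (Fin n)) [DecidableRel G.Adj] (L : ℕ) (s : Site n) :
    (walks G L s).card ≤ (G.maxDegree + 2) ^ L := by
  induction L generalizing s with
  | zero => simp [walks]
  | succ L ih =>
    refine Finset.card_biUnion_le.trans ?_
    refine (Finset.sum_le_card_nsmul _ _ _
      (fun b _ => Finset.card_image_le.trans (ih b))).trans ?_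
    rw [smul_eq_mul, pow_succ, mul_comm]
    exact Nat.mul_le_mul_left _ (card_nbrs_le G s)

theorem mem_walks {G : SimpleGraph (Fin n)} [DecidableRel G.Adj] {s : Site n} {w : List (Site n)}
    (h : List.IsChain (Nbr G) (s :: w)) : s :: w ∈ walks G w.length s := by
  induction w generalizing s with
  | nil => simp [walks]
  | cons b w ih =>
    rw [List.isChain_cons_cons] at h
    exact Finset.mem_biUnion.2 ⟨b, mem_nbrs h.1, Finset.mem_image.2 ⟨_, ih h.2, rfl⟩⟩

/-- All factors connect adjacent sites. -/
def Skel.Local (G : SimpleGraph (Fin n)) (k : Skel n) : Prop :=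
  ∀ f ∈ k.facs, f.a = f.b ∨ Nbr G f.a f.b

/-- A closed walk around a spanning tree uses every edge twice. Inductively, if the walk has not
covered the cluster, connectivity gives a link from a visited site `a` to an unvisited site `b`; the
detour a, b, a adds two steps and one site. -/
theorem exists_walk_cluster {G : SimpleGraph (Fin n)} {k : Skel n} (hk : k.Local G) (s : Site n)
    (j : ℕ) (hj : j + 1 ≤ (k.cluster s).card) :
    ∃ w : List (Site n), List.IsChain (Nbr G) (s :: w) ∧ w.length = 2 * j ∧
      (s :: w).toFinset ⊆ k.cluster s ∧ (s :: w).toFinset.card = j + 1 := by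
  classical
  have hs : s ∈ k.cluster s := by
    simp only [Skel.cluster, Finset.mem_filter, Finset.mem_insert, true_or, true_and]
    exact Relation.ReflTransGen.refl
  induction j with
  | zero => exact ⟨[], by simp, rfl, by simpa using hs, by simp⟩
  | succ j ih =>
    obtain ⟨w, hw, hlen, hsub, hcard⟩ := ih (by omega)
    set T := (s :: w).toFinset with hT
    have hne : ∃ c ∈ k.cluster s, c ∉ T := by
      by_contra hcon
      push Not at hcon
      have := Finset.card_le_card hcon
      omega
    obtain ⟨c, hc, hcT⟩ := hne
    have hcross : ∃ a b, a ∈ T ∧ b ∉ T ∧ b ∈ k.cluster s ∧ k.link a b := by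
      have hreach : Relation.ReflTransGen k.link s c := by
        simp only [Skel.cluster, Finset.mem_filter] at hc
        exact hc.2
      clear hc
      induction hreach with
      | refl => exact absurd (by simp [hT]) hcT
      | @tail b c hsb hbc ih2 =>
        by_cases hb : b ∈ T
        · refine ⟨b, c, hb, hcT, ?_, hbc⟩
          simp only [Skel.cluster, Finset.mem_filter]
          exact ⟨by simp [hbc.1], hsb.tail hbc⟩
        · exact ih2 hb
    obtain ⟨a, b, ha, hb, hbC, -, f, hf, hfab⟩ := hcross
    have hab : Nbr G a b := by
      have hne : a ≠ b := fun h => hb (h ▸ ha)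
      rcases hfab with ⟨rfl, rfl⟩ | ⟨rfl, rfl⟩
      · exact (hk f hf).resolve_left hne
      · exact ((hk f hf).resolve_left hne.symm).symm
    rw [hT, List.mem_toFinset] at ha
    obtain ⟨A, B, hAB⟩ := List.append_of_mem ha
    -- The detour is inserted at an occurrence of `a`, so the starting point of the walk is
    -- preserved.
    have hchain : List.IsChain (Nbr G) (A ++ a :: b :: a :: B) := by
      rw [hAB, List.isChain_split] at hw
      rw [List.isChain_split]
      refine ⟨hw.1, ?_⟩
      rw [List.isChain_cons_cons, List.isChain_cons_cons]
      exact ⟨hab, hab.symm, hw.2⟩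
    have hset : (A ++ a :: b :: a :: B).toFinset = insert b T := by
      rw [hT, hAB]
      ext t
      simp only [List.mem_toFinset, List.mem_append, List.mem_cons, Finset.mem_insert]
      tauto
    have hhead : ∃ w', A ++ a :: b :: a :: B = s :: w' := by
      cases A with
      | nil =>
        simp only [List.nil_append, List.cons.injEq] at hAB ⊢
        exact ⟨_, hAB.1.symm, rfl⟩
      | cons x A =>
        simp only [List.cons_append, List.cons.injEq] at hAB ⊢
        exact ⟨_, hAB.1.symm, rfl⟩
    obtain ⟨w', hw'⟩ := hhead
    refine ⟨w', hw' ▸ hchain, ?_, ?_, ?_⟩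
    · have h1 := congrArg List.length hw'
      have h2 := congrArg List.length hAB
      simp only [List.length_append, List.length_cons] at h1 h2
      omega
    · rw [← hw', hset]
      exact Finset.insert_subset hbC hsub
    · rw [← hw', hset, Finset.card_insert_of_notMem hb, hcard]

/-! ### The probability that given sites are never dephased -/

/-- The probability that all sites in `A` are free in the end. -/
def undephased (θ : Gates r) (N : PauliNoise) (A : Finset (Site n)) : List (El n r) → Skel n → ℝ
  | [], k => if A ⊆ k.free then 1 else 0
  | e :: el, k => ∑ c, N.wt c * undephased θ N A el (k.step θ e c)

/-- The number of noise operations at a site. -/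
def slots : List (El n r) → (Fin n → ℕ) → Site n → ℕ
  | [], _, _ => 0
  | .init _ :: el, seg, a => slots el seg a
  | .zz _ _ _ :: el, seg, a => slots el seg a
  | .noise v :: el, seg, a => (if (v, seg v) = a then 1 else 0) + slots el seg a
  | .mix _ v :: el, seg, a => slots el (Function.update seg v (seg v + 1)) a

theorem undephased_nonneg (θ : Gates r) (N : PauliNoise) (A : Finset (Site n))
    (el : List (El n r)) (k : Skel n) : 0 ≤ undephased θ N A el k := by
  induction el generalizing k with
  | nil => simp only [undephased]; split_ifs <;> norm_num
  | cons e el ih => exact Finset.sum_nonneg fun c _ => mul_nonneg (N.wt_nonneg c) (ih _)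

theorem free_subset_step (θ : Gates r) (e : El n r) (c : Fin 5) (k : Skel n) :
    k.free ⊆ (k.step θ e c).free := by
  cases e with
  | init v => exact subset_rfl
  | zz j u v => exact subset_rfl
  | noise v => fin_cases c <;> exact subset_rfl
  | mix j v =>
    simp only [Skel.step, Skel.mix]
    split_ifs
    · exact subset_rfl
    · exact Finset.subset_insert _ _

theorem undephased_of_subset (θ : Gates r) (N : PauliNoise) (A : Finset (Site n))
    (el : List (El n r)) (k : Skel n) (h : A ⊆ k.free) : undephased θ N A el k = 1 := by
  induction el generalizing k with
  | nil => simp [undephased, h]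
  | cons e el ih =>
    simp only [undephased]
    rw [Finset.sum_congr rfl fun c _ => by rw [ih _ (h.trans (free_subset_step θ e c k)), mul_one]]
    exact N.sum_wt

/-- A site becomes free only at the mixer ending its segment, and only if it is not flagged then. So
a flagged current site, or a past site that is not free, never becomes free. -/
theorem undephased_eq_zero (θ : Gates r) (N : PauliNoise) (A : Finset (Site n))
    (el : List (El n r)) (k : Skel n) (a : Site n) (ha : a ∈ A) (hf : a ∉ k.free)
    (hd : a.2 < k.seg a.1 ∨ (a.2 = k.seg a.1 ∧ k.dp a.1 = true)) :
    undephased θ N A el k = 0 := by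
  induction el generalizing k with
  | nil => simp only [undephased]; exact if_neg fun h => hf (h ha)
  | cons e el ih =>
    refine Finset.sum_eq_zero fun c _ => ?_
    rw [ih, mul_zero]
    · cases e with
      | init v => exact hf
      | zz j u v => exact hf
      | noise v => fin_cases c <;> exact hf
      | mix j v =>
        simp only [Skel.step, Skel.mix]
        split_ifs with h
        · exact hf
        · rw [Finset.mem_insert, not_or]
          refine ⟨?_, hf⟩
          rintro rfl
          simp only [Skel.cur] at hd
          rcases hd with hd | hd
          · exact lt_irrefl _ hd
          · exact h hd.2
    · cases e with
      | init v => exact hd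
      | zz j u v => exact hd
      | noise v =>
        have hdp : ∀ b, k.dp b = true → (Function.update k.dp v true) b = true := by
          intro b hb
          by_cases h : b = v
          · subst h; simp
          · simpa [h] using hb
        fin_cases c
        · exact hd.imp id fun h => ⟨h.1, hdp _ h.2⟩
        · exact hd.imp id fun h => ⟨h.1, hdp _ h.2⟩
        · exact hd
        · exact hd
        · exact hd
      | mix j v =>
        simp only [Skel.step, Skel.mix]
        by_cases h : a.1 = v
        · left
          subst h
          simp only [Function.update_self]
          rcases hd with hd | hd <;> omega
        · simpa [h] using hd

/-- The probability that the noise on one qubit does not dephase. -/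
theorem wt_two_add (N : PauliNoise) :
    N.wt 2 + N.wt 3 + N.wt 4 = 1 - 2 * N.strength := by
  show N.pX - min N.pX N.pY + (N.pY - min N.pX N.pY) + (N.pI - N.pZ) = _
  unfold PauliNoise.strength PauliNoise.pI
  ring

theorem strength_bounds (N : PauliNoise) : 0 ≤ N.strength ∧ N.strength ≤ 1 / 2 := by
  have h1 := N.pX_nonneg
  have h2 := N.pY_nonneg
  have h3 := N.pZ_nonneg
  have h4 := N.half_le_pI
  have h5 := min_le_left N.pX N.pY
  have h6 := le_min h1 h2
  unfold PauliNoise.strength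
  constructor <;> linarith

/-- The branches are chosen independently. Each noise operation at a site of `A` must avoid the two
dephasing branches, which has probability 1 - 2p; all other operations have total weight 1 and
change nothing in the bound. -/
theorem undephased_le (θ : Gates r) (N : PauliNoise) (A : Finset (Site n))
    (el : List (El n r)) {k : Skel n} (hk : k.WF) :
    undephased θ N A el k ≤ (1 - 2 * N.strength) ^ ∑ a ∈ A, slots el k.seg a := by
  obtain ⟨hs0, hs1⟩ := strength_bounds N
  have hx0 : 0 ≤ 1 - 2 * N.strength := by linarith
  induction el generalizing k with
  | nil => simp only [undephased, slots, Finset.sum_const_zero, pow_zero]; split_ifs <;> norm_num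
  | cons e el ih =>
    have hgen : ∀ m : ℕ, (∀ c, ∑ a ∈ A, slots el (k.step θ e c).seg a = m) →
        undephased θ N A (e :: el) k ≤ (1 - 2 * N.strength) ^ m := by
      intro m hm
      simp only [undephased]
      calc _ ≤ ∑ c, N.wt c * (1 - 2 * N.strength) ^ m := by
            refine Finset.sum_le_sum fun c _ => mul_le_mul_of_nonneg_left ?_ (N.wt_nonneg c)
            rw [← hm c]; exact ih (hk.step θ e c)
        _ = _ := by rw [← Finset.sum_mul, N.sum_wt, one_mul]
    cases e with
    | init v => exact hgen _ fun c => rfl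
    | zz j u v => exact hgen _ fun c => rfl
    | mix j v => exact hgen _ fun c => rfl
    | noise v =>
      have hseg : ∀ c, (k.step θ (.noise v) c).seg = k.seg := by
        intro c; fin_cases c <;> rfl
      simp only [slots, Finset.sum_add_distrib, Finset.sum_ite_eq]
      by_cases hv : (v, k.seg v) ∈ A
      · rw [if_pos hv, pow_add, pow_one]
        have hz : ∀ c, c = 0 ∨ c = 1 → undephased θ N A el (k.step θ (.noise v) c) = 0 := by
          intro c hc
          apply undephased_eq_zero θ N A el _ _ hv
          · rcases hc with rfl | rfl <;> exact hk.cur_notMem v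
          · right
            rcases hc with rfl | rfl <;> simp [Skel.step, Skel.noise, Skel.dephase, Skel.flip]
        simp only [undephased]
        rw [Fin.sum_univ_five, hz 0 (Or.inl rfl), hz 1 (Or.inr rfl), ← wt_two_add, add_mul, add_mul,
          mul_zero, mul_zero, zero_add, zero_add]
        have h := fun c => ih (hk.step θ (.noise v) c)
        simp only [hseg, ← wt_two_add] at h
        have hw := N.wt_nonneg
        gcongr
        · exact hw 2
        · exact h 2
        · exact hw 3
        · exact h 3
        · exact hw 4
        · exact h 4
      · rw [if_neg hv, zero_add]
        exact hgen _ fun c => by rw [hseg]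

/-! ### The expected number of large clusters -/

/-- Phase gates act on adjacent qubits in the same segment, and there are at most `r` mixers on every
qubit. -/
def Admissible (G : SimpleGraph (Fin n)) : List (El n r) → (Fin n → ℕ) → Prop
  | [], _ => True
  | .init _ :: el, seg => Admissible G el seg
  | .zz _ u v :: el, seg => (G.Adj u v ∧ seg u = seg v) ∧ Admissible G el seg
  | .noise _ :: el, seg => Admissible G el seg
  | .mix _ v :: el, seg => seg v + 1 ≤ r ∧ Admissible G el (Function.update seg v (seg v + 1))

/-- Sets of `j` sites covered by a walk that starts outside. -/
def animals (G : SimpleGraph (Fin n)) [DecidableRel G.Adj] (r j : ℕ) : Finset (Finset (Site n)) :=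
  (((Finset.univ : Finset (Fin n)) ×ˢ Finset.range (r + 1)).biUnion fun s =>
    (walks G (2 * j) s).image fun w => w.toFinset.erase s).filter fun A =>
      A.card = j ∧ ∀ a ∈ A, a.2 < r

theorem card_animals_le (G : SimpleGraph (Fin n)) [DecidableRel G.Adj] (r j : ℕ) :
    (animals G r j).card ≤ n * (r + 1) * (G.maxDegree + 2) ^ (2 * j) := by
  refine (Finset.card_filter_le _ _).trans (Finset.card_biUnion_le.trans ?_)
  refine (Finset.sum_le_card_nsmul _ _ _
    (fun s _ => Finset.card_image_le.trans (card_walks_le G _ s))).trans ?_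
  simp

/-- The root is removed from the walk's range since it is a current site and not free; the remaining
`j` sites are free, hence lie in the first `r` segments. -/
theorem exists_animal {G : SimpleGraph (Fin n)} [DecidableRel G.Adj] {k : Skel n} (hwf : k.WF)
    (hk : k.Local G) (hseg : ∀ v, k.seg v ≤ r) (v : Fin n) {j : ℕ}
    (hj : j + 1 ≤ (k.cluster (k.cur v)).card) : ∃ A ∈ animals G r j, A ⊆ k.free := by
  obtain ⟨w, h1, h2, h3, h4⟩ := exists_walk_cluster hk (k.cur v) j hj
  have hsub : (k.cur v :: w).toFinset.erase (k.cur v) ⊆ k.free := by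
    intro a ha
    rw [Finset.mem_erase] at ha
    have := h3 ha.2
    simp only [Skel.cluster, Finset.mem_filter, Finset.mem_insert] at this
    exact this.1.resolve_left ha.1
  refine ⟨_, ?_, hsub⟩
  rw [animals, Finset.mem_filter]
  refine ⟨Finset.mem_biUnion.2 ⟨k.cur v, ?_, Finset.mem_image.2 ⟨_, h2 ▸ mem_walks h1, rfl⟩⟩, ?_, ?_⟩
  · simp only [Finset.mem_product, Finset.mem_univ, Finset.mem_range, true_and]
    have := hseg v
    simp only [Skel.cur]; omega
  · rw [Finset.card_erase_of_mem (by simp), h4]; rfl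
  · intro a ha
    exact (hwf.free_lt a (hsub ha)).trans_le (hseg a.1)

theorem Skel.Local.addFac {G : SimpleGraph (Fin n)} {k : Skel n} (hk : k.Local G) {f : Fac n}
    (hf : f.a = f.b ∨ Nbr G f.a f.b) : (k.addFac f).Local G := by
  intro g hg
  rcases List.mem_append.1 hg with hg | hg
  · exact hk g hg
  · rw [List.mem_singleton.1 hg]; exact hf

/-- Union bound. When a mixer meets a cluster that is too large, some animal already consists of
free sites; free sites stay free, so its probability of being undephased in the end is 1. The sum
over animals is an expectation and is preserved on average by each step, so it is charged at most
once for each operation. -/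
theorem badness_le {G : SimpleGraph (Fin n)} [DecidableRel G.Adj] (θ : Gates r) (N : PauliNoise)
    (cap : ℕ) (el : List (El n r)) {k : Skel n} (hwf : k.WF) (hk : k.Local G)
    (hseg : ∀ v, k.seg v ≤ r) (had : Admissible G el k.seg) :
    badness θ N cap el k
      ≤ el.length * ∑ A ∈ animals G r (Nat.log 2 cap), undephased θ N A el k := by
  have hnn : ∀ (el : List (El n r)) k,
      0 ≤ ∑ A ∈ animals G r (Nat.log 2 cap), undephased θ N A el k :=
    fun el k => Finset.sum_nonneg fun A _ => undephased_nonneg _ _ _ _ _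
  induction el generalizing k with
  | nil => simp [badness]
  | cons e el ih =>
    have hconst : ∀ k' : Skel n, (∀ c, k.step θ e c = k') → ∀ A,
        undephased θ N A (e :: el) k = undephased θ N A el k' := by
      intro k' h A
      simp only [undephased, h, ← Finset.sum_mul, N.sum_wt, one_mul]
    have hlen : ((e :: el).length : ℝ) = el.length + 1 := by simp
    rw [hlen, add_mul, one_mul]
    cases e with
    | init v =>
      refine le_add_of_le_of_nonneg ?_ (hnn _ _)
      simp only [badness, hconst k fun _ => rfl]
      exact ih hwf hk hseg had
    | zz j u v =>
      refine le_add_of_le_of_nonneg ?_ (hnn _ _)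
      simp only [badness, hconst (k.zz (θ.cg j) (θ.sg j) u v) fun _ => rfl]
      refine ih (hwf.step θ (.zz j u v) 0) (hk.addFac ?_) hseg had.2
      exact Or.inr (Or.inl ⟨had.1.2, had.1.1⟩)
    | noise v =>
      refine le_add_of_le_of_nonneg ?_ (hnn _ _)
      simp only [badness, undephased]
      rw [Finset.sum_comm, Finset.mul_sum]
      refine Finset.sum_le_sum fun c _ => ?_
      rw [← Finset.mul_sum, ← mul_assoc, mul_comm (el.length : ℝ), mul_assoc]
      refine mul_le_mul_of_nonneg_left ?_ (N.wt_nonneg c)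
      have hs : (k.step θ (.noise v) c).seg = k.seg := by fin_cases c <;> rfl
      refine ih (hwf.step θ (.noise v) c) ?_ (by rw [hs]; exact hseg) (by rw [hs]; exact had)
      have hsg : (k.sign v).Local G := hk.addFac (Or.inl rfl)
      fin_cases c
      · exact hk
      · exact hk
      · exact hk
      · exact hsg
      · exact hk
    | mix j v =>
      set k' := k.mix (θ.cb j) (θ.sb j) v with hk'
      have hwf' : k'.WF := hwf.step θ (.mix j v) 0
      have hloc' : k'.Local G := by
        intro f hf
        rcases List.mem_append.1 hf with hf | hf
        · exact hk f hf
        · rw [List.mem_singleton.1 hf]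
          exact Or.inr (Or.inr ⟨rfl, Or.inr rfl⟩)
      have hseg' : ∀ w, k'.seg w ≤ r := by
        intro w
        by_cases hw : w = v
        · subst hw; simp only [hk', Skel.mix, Function.update_self]; exact had.1
        · simp only [hk', Skel.mix, ne_eq, hw, not_false_eq_true, Function.update_of_ne]
          exact hseg w
      have hcur : k.next v = k'.cur v := by simp [Skel.next, Skel.cur, hk', Skel.mix]
      simp only [hconst k' fun _ => rfl]
      simp only [badness, Skel.step, ← hk']
      rw [add_comm]
      refine add_le_add (ih hwf' hloc' hseg' had.2) ?_
      split_ifs with hc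
      · exact hnn _ _
      -- From cap < 2^|cluster|; the logarithm bound needs a nonzero exponent, and the cluster
      -- contains its root.
      · have hbig : Nat.log 2 cap + 1 ≤ (k'.cluster (k'.cur v)).card := by
          rw [hcur] at hc
          exact Nat.log_lt_of_lt_pow' (by
            intro h0
            rw [h0] at hc
            have : 0 < (k'.cluster (k'.cur v)).card := Finset.card_pos.2
              ⟨k'.cur v, by
                simp only [Skel.cluster, Finset.mem_filter, Finset.mem_insert, true_or, true_and]
                exact Relation.ReflTransGen.refl⟩
            omega) (not_le.1 hc)
        obtain ⟨A, hA, hAf⟩ := exists_animal hwf' hloc' hseg' v hbig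
        rw [← undephased_of_subset θ N A el k' hAf]
        exact Finset.single_le_sum (f := fun A => undephased θ N A el k')
          (fun A _ => undephased_nonneg _ _ _ _ _) hA

/-! ### Counting in a circuit -/

def segAfter : List (El n r) → (Fin n → ℕ) → Fin n → ℕ
  | [], seg => seg
  | .init _ :: el, seg => segAfter el seg
  | .zz _ _ _ :: el, seg => segAfter el seg
  | .noise _ :: el, seg => segAfter el seg
  | .mix _ v :: el, seg => segAfter el (Function.update seg v (seg v + 1))

theorem segAfter_append (l₁ l₂ : List (El n r)) (seg : Fin n → ℕ) :
    segAfter (l₁ ++ l₂) seg = segAfter l₂ (segAfter l₁ seg) := by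
  induction l₁ generalizing seg with
  | nil => rfl
  | cons e l ih => cases e <;> exact ih _

theorem slots_append (l₁ l₂ : List (El n r)) (seg : Fin n → ℕ) (a : Site n) :
    slots (l₁ ++ l₂) seg a = slots l₁ seg a + slots l₂ (segAfter l₁ seg) a := by
  induction l₁ generalizing seg with
  | nil => simp [slots, segAfter]
  | cons e l ih => cases e <;> simp only [List.cons_append, slots, segAfter, ih, add_assoc]

theorem admissible_append {G : SimpleGraph (Fin n)} (l₁ l₂ : List (El n r)) (seg : Fin n → ℕ) :
    Admissible G (l₁ ++ l₂) seg ↔ Admissible G l₁ seg ∧ Admissible G l₂ (segAfter l₁ seg) := by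
  induction l₁ generalizing seg with
  | nil => simp [Admissible, segAfter]
  | cons e l ih => cases e <;> simp only [List.cons_append, Admissible, segAfter, ih, and_assoc]

/-- The part of round `j` before its mixer. -/
def MaxCutCircuit.costEls {G : SimpleGraph (Fin n)} (Q : MaxCutCircuit G r) (j : Fin r) :
    List (El n r) :=
  (Q.layers j).flatMap fun L => L.map (fun e => El.zz j e.1 e.2) ++ (List.finRange n).map El.noise

def MaxCutCircuit.mixEls {G : SimpleGraph (Fin n)} (Q : MaxCutCircuit G r) (j : Fin r) :
    List (El n r) :=
  (List.finRange n).map (El.mix j)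
    ++ if Q.noisyMixer then (List.finRange n).map El.noise else []

theorem els_eq {G : SimpleGraph (Fin n)} (Q : MaxCutCircuit G r) :
    Q.els = (List.finRange r).flatMap fun j => Q.costEls j ++ Q.mixEls j := by
  unfold MaxCutCircuit.els MaxCutCircuit.ops
  rw [List.flatMap_assoc]
  congr 1
  funext j
  unfold MaxCutCircuit.roundOps MaxCutCircuit.costEls MaxCutCircuit.mixEls
  rw [List.flatMap_append, List.flatMap_assoc]
  congr 1
  · congr 1
    funext L
    have : (L.map fun e => Op.zz j e.1 e.2).flatMap Op.expand
        = L.map fun e => (El.zz j e.1 e.2 : El n r) := by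
      rw [List.flatMap_map, List.map_eq_flatMap]
      rfl
    rw [List.flatMap_append, this]
    simp [Op.expand]
  · split_ifs <;> simp [Op.expand]

theorem noise_static {G : SimpleGraph (Fin n)} (l : List (Fin n)) (seg : Fin n → ℕ) :
    segAfter (r := r) (l.map El.noise) seg = seg ∧ Admissible (r := r) G (l.map El.noise) seg ∧
      ∀ v, slots (r := r) (l.map El.noise) seg (v, seg v) = l.count v := by
  induction l with
  | nil => simp [segAfter, Admissible, slots]
  | cons w l ih =>
    refine ⟨ih.1, ih.2.1, fun v => ?_⟩
    simp only [List.map_cons, slots, ih.2.2, List.count_cons]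
    by_cases h : w = v
    · subst h; simp [add_comm]
    · simp [h]

theorem zz_static {G : SimpleGraph (Fin n)} (j : Fin r) (L : List (Fin n × Fin n))
    (hL : ∀ e ∈ L, G.Adj e.1 e.2) (t : ℕ) :
    segAfter (L.map fun e => El.zz j e.1 e.2) (fun _ => t) = (fun _ => t) ∧
      Admissible G (L.map fun e => El.zz j e.1 e.2) (fun _ => t) ∧
      ∀ a, slots (L.map fun e => El.zz j e.1 e.2) (fun _ => t) a = 0 := by
  induction L with
  | nil => simp [segAfter, Admissible, slots]
  | cons e L ih =>
    have := ih fun e he => hL e (List.mem_cons_of_mem _ he)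
    exact ⟨this.1, ⟨⟨hL e List.mem_cons_self, rfl⟩, this.2.1⟩, this.2.2⟩

theorem mix_static {G : SimpleGraph (Fin n)} (j : Fin r) (l : List (Fin n)) (hl : l.Nodup)
    (seg : Fin n → ℕ) (hs : ∀ v ∈ l, seg v + 1 ≤ r) :
    segAfter (l.map (El.mix j)) seg = (fun v => if v ∈ l then seg v + 1 else seg v) ∧
      Admissible G (l.map (El.mix j)) seg := by
  induction l generalizing seg with
  | nil => simp [segAfter, Admissible]
  | cons w l ih =>
    rw [List.nodup_cons] at hl
    have h1 : ∀ v ∈ l, v ≠ w := fun v hv h => hl.1 (h ▸ hv)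
    have := ih hl.2 (Function.update seg w (seg w + 1)) fun v hv => by
      simpa [h1 v hv] using hs v (List.mem_cons_of_mem _ hv)
    refine ⟨?_, hs w List.mem_cons_self, this.2⟩
    simp only [List.map_cons, segAfter, this.1]
    funext v
    by_cases hv : v = w
    · subst hv; simp [hl.1]
    · simp [hv]

theorem adj_of_mem_layer {G : SimpleGraph (Fin n)} (Q : MaxCutCircuit G r) (j : Fin r)
    {L : List (Fin n × Fin n)} (hL : L ∈ Q.layers j) {e : Fin n × Fin n} (he : e ∈ L) :
    G.Adj e.1 e.2 := by
  have := (Q.edge_iff j s(e.1, e.2)).1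
    (List.mem_map.2 ⟨e, List.mem_flatten.2 ⟨L, hL, he⟩, rfl⟩)
  exact this

theorem costEls_static {G : SimpleGraph (Fin n)} (Q : MaxCutCircuit G r) (j : Fin r) (t : ℕ) :
    segAfter (Q.costEls j) (fun _ => t) = (fun _ => t) ∧
      Admissible G (Q.costEls j) (fun _ => t) ∧
      ∀ v, slots (Q.costEls j) (fun _ => t) (v, t) = (Q.layers j).length := by
  have hL : ∀ L ∈ Q.layers j, ∀ e ∈ L, G.Adj e.1 e.2 := fun L hL e he => adj_of_mem_layer Q j hL he
  unfold MaxCutCircuit.costEls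
  generalize Q.layers j = Ls at hL
  induction Ls with
  | nil => simp [segAfter, Admissible, slots]
  | cons L Ls ih =>
    obtain ⟨h1, h2, h3⟩ := ih fun L hL' => hL L (List.mem_cons_of_mem _ hL')
    obtain ⟨z1, z2, z3⟩ := zz_static j L (hL L List.mem_cons_self) t
    obtain ⟨n1, n2, n3⟩ := noise_static (r := r) (G := G) (List.finRange n) (fun _ => t)
    simp only [List.flatMap_cons, segAfter_append, admissible_append, slots_append, z1, n1, h1, h2,
      z2, n2, z3, h3, true_and]
    intro v
    rw [n3 v, List.count_eq_one_of_mem (List.nodup_finRange n) (List.mem_finRange v),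
      List.length_cons]
    omega

theorem mixEls_static {G : SimpleGraph (Fin n)} (Q : MaxCutCircuit G r) (j : Fin r) (t : ℕ)
    (ht : t + 1 ≤ r) :
    segAfter (Q.mixEls j) (fun _ => t) = (fun _ => t + 1) ∧
      Admissible G (Q.mixEls j) (fun _ => t) := by
  obtain ⟨m1, m2⟩ := mix_static (G := G) j (List.finRange n) (List.nodup_finRange n) (fun _ => t)
    fun _ _ => ht
  simp only [List.mem_finRange, if_true] at m1
  obtain ⟨n1, n2, -⟩ := noise_static (r := r) (G := G) (List.finRange n) (fun _ => t + 1)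
  unfold MaxCutCircuit.mixEls
  rw [segAfter_append, admissible_append, m1]
  split_ifs
  · exact ⟨n1, m2, n2⟩
  · exact ⟨rfl, m2, trivial⟩

/-- The cost layers of the `i`-th listed round hit the sites of segment t + i. Noise after a mixer
already belongs to the next segment, which is why only an inequality is claimed. -/
theorem rounds_static {G : SimpleGraph (Fin n)} (Q : MaxCutCircuit G r) (js : List (Fin r))
    (t : ℕ) (ht : t + js.length ≤ r) :
    Admissible G (js.flatMap fun j => Q.costEls j ++ Q.mixEls j) (fun _ => t) ∧
      ∀ v i (hi : i < js.length), (Q.layers js[i]).length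
        ≤ slots (js.flatMap fun j => Q.costEls j ++ Q.mixEls j) (fun _ => t) (v, t + i) := by
  induction js generalizing t with
  | nil => simp [Admissible]
  | cons j js ih =>
    rw [List.length_cons] at ht
    obtain ⟨c1, c2, c3⟩ := costEls_static Q j t
    obtain ⟨m1, m2⟩ := mixEls_static Q j t (by omega)
    obtain ⟨h1, h2⟩ := ih (t + 1) (by omega)
    simp only [List.flatMap_cons, admissible_append, segAfter_append, c1, m1, slots_append]
    refine ⟨⟨⟨c2, m2⟩, h1⟩, fun v i hi => ?_⟩
    cases i with
    | zero =>
      have := c3 v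
      simp only [add_zero, List.getElem_cons_zero, this]
      omega
    | succ i =>
      have := h2 v i (by simpa using hi)
      have e : t + (i + 1) = t + 1 + i := by ring
      simp only [List.getElem_cons_succ, e]
      omega

/-- A layer is a matching, so it contains at most one edge at `v`, and all edges at `v` must be used
in each round. -/
theorem degree_le_length_layers {G : SimpleGraph (Fin n)} [DecidableRel G.Adj]
    (Q : MaxCutCircuit G r) (j : Fin r) (v : Fin n) : G.degree v ≤ (Q.layers j).length := by
  classical
  have h1 : ∀ L ∈ Q.layers j, L.countP (fun e => decide (v = e.1 ∨ v = e.2)) ≤ 1 := by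
    intro L hL
    have hd := Q.disjoint_in_layer j L hL
    clear hL
    induction L with
    | nil => simp
    | cons e L ih =>
      rw [List.flatMap_cons, List.nodup_append] at hd
      rw [List.countP_cons]
      split_ifs with hv
      · have : L.countP (fun e => decide (v = e.1 ∨ v = e.2)) = 0 := by
          rw [List.countP_eq_zero]
          intro e' he' hv'
          have a1 : v ∈ [e.1, e.2] := by simpa using hv
          have a2 : v ∈ L.flatMap fun e => [e.1, e.2] :=
            List.mem_flatMap.2 ⟨e', he', by simpa using hv'⟩
          exact hd.2.2 v a1 v a2 rfl
        omega
      · simpa using ih hd.2.1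
  have h2 : ∀ Ls : List (List (Fin n × Fin n)),
      (∀ L ∈ Ls, L.countP (fun e => decide (v = e.1 ∨ v = e.2)) ≤ 1) →
      Ls.flatten.countP (fun e => decide (v = e.1 ∨ v = e.2)) ≤ Ls.length := by
    intro Ls
    induction Ls with
    | nil => simp
    | cons L Ls ih =>
      intro h
      rw [List.flatten_cons, List.countP_append, List.length_cons]
      have := ih fun L hL => h L (List.mem_cons_of_mem _ hL)
      have := h L List.mem_cons_self
      omega
  refine le_trans ?_ (h2 _ h1)
  rw [← SimpleGraph.card_incidenceFinset_eq_degree, List.countP_eq_length_filter]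
  have h3 : G.incidenceFinset v ⊆ (((Q.layers j).flatten.filter
      fun e => decide (v = e.1 ∨ v = e.2)).map fun e => s(e.1, e.2)).toFinset := by
    intro e he
    rw [SimpleGraph.mem_incidenceFinset] at he
    obtain ⟨e', he', rfl⟩ := List.mem_map.1 ((Q.edge_iff j e).2 he.1)
    rw [List.mem_toFinset, List.mem_map]
    refine ⟨e', List.mem_filter.2 ⟨he', ?_⟩, rfl⟩
    have := he.2
    rw [Sym2.mem_iff] at this
    simpa using this
  refine (Finset.card_le_card h3).trans ((List.toFinset_card_le _).trans ?_)
  rw [List.length_map]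

theorem badness_init (θ : Gates r) (N : PauliNoise) (cap : ℕ) (el : List (El n r)) (k : Skel n)
    (l : List (Fin n)) : badness θ N cap (l.map El.init ++ el) k = badness θ N cap el k := by
  induction l with
  | nil => rfl
  | cons v l ih => exact ih

/-- Noise follows each layer on all qubits, idle ones included. Hence a vertex of maximal degree
guarantees `G.maxDegree` noise operations at every site of the first `r` segments, also for qubits
of small degree. Each animal with K sites then survives with probability at most (1-2p)^(Δ·K). -/
theorem badness_circuit_le {G : SimpleGraph (Fin n)} [DecidableRel G.Adj] (Q : MaxCutCircuit G r)
    (θ : Gates r) (N : PauliNoise) (cap : ℕ) :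
    badness θ N cap Q.allEls (Skel.start n)
      ≤ Q.els.length * (n * (r + 1) * (((G.maxDegree : ℝ) + 2) ^ 2
          * (1 - 2 * N.strength) ^ G.maxDegree) ^ Nat.log 2 cap) := by
  obtain ⟨hs0, hs1⟩ := strength_bounds N
  have hx0 : 0 ≤ 1 - 2 * N.strength := by linarith
  have hx1 : 1 - 2 * N.strength ≤ 1 := by linarith
  obtain ⟨r1, r2⟩ := rounds_static Q (List.finRange r) 0 (by simp)
  rw [← els_eq] at r1 r2
  have hslots : ∀ a : Site n, a.2 < r → G.maxDegree ≤ slots Q.els (Skel.start n).seg a := by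
    rintro ⟨v, j⟩ hj
    have h1 := r2 v j (by simpa using hj)
    rw [zero_add] at h1
    refine le_trans ?_ h1
    apply SimpleGraph.maxDegree_le_of_forall_degree_le
    exact fun w => degree_le_length_layers Q _ w
  rw [MaxCutCircuit.allEls, badness_init]
  refine (badness_le (G := G) θ N cap Q.els Skel.WF.start (by intro f hf; simp [Skel.start] at hf)
    (by simp [Skel.start]) r1).trans ?_
  refine mul_le_mul_of_nonneg_left ?_ (Nat.cast_nonneg _)
  set K := Nat.log 2 cap
  have h1 : ∀ A ∈ animals G r K, undephased θ N A Q.els (Skel.start n)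
      ≤ ((1 - 2 * N.strength) ^ G.maxDegree) ^ K := by
    intro A hA
    obtain ⟨-, hA1, hA2⟩ := Finset.mem_filter.1 hA
    refine (undephased_le θ N A Q.els Skel.WF.start).trans ?_
    rw [← pow_mul]
    apply pow_le_pow_of_le_one hx0 hx1
    rw [← hA1, mul_comm, ← smul_eq_mul]
    exact Finset.card_nsmul_le_sum _ _ _ fun a ha => hslots a (hA2 a ha)
  refine (Finset.sum_le_card_nsmul _ _ _ h1).trans ?_
  rw [nsmul_eq_mul, mul_pow, ← mul_assoc]
  refine mul_le_mul_of_nonneg_right ?_ (by positivity)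
  have := card_animals_le G r K
  rw [← pow_mul]
  exact_mod_cast this

/-! ### Reasoning about programs -/

@[simp] theorem Store.setVar_vars (s : Store) (x : ℕ) (z : ℤ) (y : ℕ) :
    (s.setVar x z).vars y = if y = x then z else s.vars y := by
  simp [Store.setVar, Function.update_apply]

@[simp] theorem Store.setVar_arrs (s : Store) (x : ℕ) (z : ℤ) : (s.setVar x z).arrs = s.arrs := rfl

@[simp] theorem Store.setArr_vars (s : Store) (a i : ℕ) (z : ℤ) : (s.setArr a i z).vars = s.vars := rfl

@[simp] theorem Store.setArr_arrs (s : Store) (a i : ℕ) (z : ℤ) (b : ℕ) :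
    (s.setArr a i z).arrs b = if b = a then Function.update (s.arrs a) i z else s.arrs b := by
  simp [Store.setArr, Function.update_apply]

/-- All entries of the memory have at most `B` bits. -/
def Bdd (B : ℕ) (s : Store) : Prop :=
  (∀ x, (s.vars x).natAbs < 2 ^ B) ∧ ∀ a i, (s.arrs a i).natAbs < 2 ^ B

theorem Bdd.setVar {B : ℕ} {s : Store} (h : Bdd B s) (x : ℕ) {z : ℤ} (hz : z.natAbs < 2 ^ B) :
    Bdd B (s.setVar x z) := by
  refine ⟨fun y => ?_, h.2⟩
  rw [Store.setVar_vars]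
  split_ifs
  · exact hz
  · exact h.1 y

theorem Bdd.setArr {B : ℕ} {s : Store} (h : Bdd B s) (a i : ℕ) {z : ℤ} (hz : z.natAbs < 2 ^ B) :
    Bdd B (s.setArr a i z) := by
  refine ⟨h.1, fun b j => ?_⟩
  rw [Store.setArr_arrs]
  split_ifs
  · rw [Function.update_apply]
    split_ifs
    · exact hz
    · exact h.2 a j
  · exact h.2 b j

def Expr.sz : Expr → ℕ
  | lit k => k.natAbs + 1
  | var _ => 1
  | get _ i => i.sz + 1
  | add e f => e.sz + f.sz + 1
  | sub e f => e.sz + f.sz + 1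
  | mul e f => e.sz + f.sz + 1
  | div e f => e.sz + f.sz + 1
  | mod e f => e.sz + f.sz + 1
  | lt e f => e.sz + f.sz + 1
  | eq e f => e.sz + f.sz + 1

theorem Expr.one_le_sz (e : Expr) : 1 ≤ e.sz := by
  cases e <;> simp [Expr.sz]

theorem bitLen_le_iff {z : ℤ} {b : ℕ} : bitLen z ≤ b + 1 ↔ z.natAbs < 2 ^ b := by
  unfold bitLen
  rw [Nat.add_le_add_iff_right, Nat.size_le]

theorem natAbs_lt_bitLen (z : ℤ) : z.natAbs < 2 ^ (bitLen z - 1) := Nat.lt_size_self _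

theorem bitLen_pos (z : ℤ) : 1 ≤ bitLen z := by unfold bitLen; omega

theorem bitLen_le_of_natAbs_le {x y : ℤ} (h : x.natAbs ≤ y.natAbs) : bitLen x ≤ bitLen y := by
  unfold bitLen
  exact Nat.add_le_add_right (Nat.size_le_size h) 1

theorem bitLen_add_le (x y : ℤ) : bitLen (x + y) ≤ bitLen x + bitLen y := by
  have h1 := natAbs_lt_bitLen x
  have h2 := natAbs_lt_bitLen y
  have h3 := bitLen_pos x
  have h4 := bitLen_pos y
  have : bitLen (x + y) ≤ (bitLen x + bitLen y - 1) + 1 := by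
    rw [bitLen_le_iff]
    have hx : 2 ^ (bitLen x - 1) ≤ 2 ^ (bitLen x + bitLen y - 2) :=
      Nat.pow_le_pow_right (by norm_num) (by omega)
    have hy : 2 ^ (bitLen y - 1) ≤ 2 ^ (bitLen x + bitLen y - 2) :=
      Nat.pow_le_pow_right (by norm_num) (by omega)
    have e : 2 ^ (bitLen x + bitLen y - 1) = 2 * 2 ^ (bitLen x + bitLen y - 2) := by
      rw [← pow_succ']; congr 1; omega
    have := Int.natAbs_add_le x y
    omega
  omega

theorem bitLen_neg (x : ℤ) : bitLen (-x) = bitLen x := by simp [bitLen]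

theorem bitLen_mul_le (x y : ℤ) : bitLen (x * y) ≤ bitLen x + bitLen y := by
  have h1 := natAbs_lt_bitLen x
  have h2 := natAbs_lt_bitLen y
  have h3 := bitLen_pos x
  have h4 := bitLen_pos y
  have : bitLen (x * y) ≤ (bitLen x - 1 + (bitLen y - 1)) + 1 := by
    rw [bitLen_le_iff, Int.natAbs_mul, pow_add]
    exact Nat.mul_lt_mul'' h1 h2
  omega

theorem bitLen_div_le (x y : ℤ) : bitLen (x / y) ≤ bitLen x :=
  bitLen_le_of_natAbs_le (Int.natAbs_ediv_le_natAbs x y)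

theorem bitLen_mod_le (x y : ℤ) : bitLen (x % y) ≤ bitLen x + bitLen y := by
  by_cases hy : y = 0
  · subst hy; simp
  · have h1 := Int.emod_nonneg x hy
    have h2 := Int.emod_lt_abs x hy
    rw [Int.abs_eq_natAbs] at h2
    have : (x % y).natAbs ≤ y.natAbs := by omega
    exact (bitLen_le_of_natAbs_le this).trans (by omega)

theorem Expr.bitLen_eval_le {B : ℕ} {s : Store} (h : Bdd B s) (e : Expr) :
    bitLen (e.eval s) ≤ e.sz * (B + 1) := by
  have hone : ∀ b : Prop, [Decidable b] → bitLen (if b then 1 else 0) ≤ 2 := by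
    intro b _; split_ifs <;> decide
  induction e with
  | lit k =>
    have : bitLen k ≤ k.natAbs + 1 := bitLen_le_iff.2 Nat.lt_two_pow_self
    simp only [eval, sz]; nlinarith
  | var x => simp only [eval, sz]; rw [one_mul]; exact bitLen_le_iff.2 (h.1 x)
  | get a i ih =>
    have := bitLen_le_iff.2 (h.2 a (i.eval s).toNat)
    simp only [eval, sz]; nlinarith
  | add e f ihe ihf =>
    have := bitLen_add_le (e.eval s) (f.eval s)
    simp only [eval, sz]; nlinarith
  | sub e f ihe ihf =>
    have := bitLen_add_le (e.eval s) (-f.eval s)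
    rw [bitLen_neg, ← sub_eq_add_neg] at this
    simp only [eval, sz]; nlinarith
  | mul e f ihe ihf =>
    have := bitLen_mul_le (e.eval s) (f.eval s)
    simp only [eval, sz]; nlinarith
  | div e f ihe ihf =>
    have := bitLen_div_le (e.eval s) (f.eval s)
    simp only [eval, sz]; nlinarith
  | mod e f ihe ihf =>
    have := bitLen_mod_le (e.eval s) (f.eval s)
    simp only [eval, sz]; nlinarith
  | lt e f ihe ihf =>
    have := hone (e.eval s < f.eval s)
    have h1 := e.one_le_sz
    have h2 := f.one_le_sz
    simp only [eval, sz]; nlinarith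
  | eq e f ihe ihf =>
    have := hone (e.eval s = f.eval s)
    have h1 := e.one_le_sz
    have h2 := f.one_le_sz
    simp only [eval, sz]; nlinarith

/-- Values have length linear in the size of the expression, so one operation costs at most
quadratically many bit operations in size and B. The cube leaves room to sum over subexpressions. -/
theorem Expr.cost_le {B : ℕ} {s : Store} (h : Bdd B s) (e : Expr) :
    e.cost s ≤ e.sz ^ 3 * (B + 1) ^ 2 := by
  set Y := B + 1 with hY
  have hY1 : 1 ≤ Y := by omega
  have hYY : Y ≤ Y ^ 2 := by nlinarith
  have hL := fun e => Expr.bitLen_eval_le h e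
  simp only [← hY] at hL
  have hsum : ∀ e f : Expr, e.cost s ≤ e.sz ^ 3 * Y ^ 2 → f.cost s ≤ f.sz ^ 3 * Y ^ 2 →
      ∀ t, t ≤ (e.sz + f.sz) * Y ^ 2 ∨ t ≤ e.sz * f.sz * Y ^ 2 →
      e.cost s + f.cost s + t ≤ (e.sz + f.sz + 1) ^ 3 * Y ^ 2 := by
    intro e f he hf t ht
    have h1 : t ≤ (e.sz + f.sz + e.sz * f.sz) * Y ^ 2 := by
      rcases ht with ht | ht <;> nlinarith [Nat.zero_le (e.sz * f.sz * Y ^ 2),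
        Nat.zero_le ((e.sz + f.sz) * Y ^ 2)]
    have h2 : e.sz ^ 3 + f.sz ^ 3 + (e.sz + f.sz + e.sz * f.sz) ≤ (e.sz + f.sz + 1) ^ 3 := by
      generalize e.sz = a
      generalize f.sz = b
      ring_nf
      nlinarith [Nat.zero_le (a * b), Nat.zero_le (a ^ 2 * b), Nat.zero_le (a * b ^ 2),
        Nat.zero_le (a ^ 2), Nat.zero_le (b ^ 2)]
    calc _ ≤ (e.sz ^ 3 + f.sz ^ 3 + (e.sz + f.sz + e.sz * f.sz)) * Y ^ 2 := by
          rw [add_mul, add_mul]; omega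
      _ ≤ _ := Nat.mul_le_mul_right _ h2
  have hlin : ∀ e f : Expr, bitLen (e.eval s) + bitLen (f.eval s) ≤ (e.sz + f.sz) * Y ^ 2 := by
    intro e f
    have h1 := hL e
    have h2 := hL f
    have h3 : e.sz * Y ≤ e.sz * Y ^ 2 := Nat.mul_le_mul_left _ hYY
    have h4 : f.sz * Y ≤ f.sz * Y ^ 2 := Nat.mul_le_mul_left _ hYY
    rw [add_mul]; omega
  have hmul : ∀ e f : Expr, bitLen (e.eval s) * bitLen (f.eval s) ≤ e.sz * f.sz * Y ^ 2 := by
    intro e f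
    calc _ ≤ (e.sz * Y) * (f.sz * Y) := Nat.mul_le_mul (hL e) (hL f)
      _ = _ := by ring
  induction e with
  | lit k =>
    have : bitLen k ≤ k.natAbs + 1 := bitLen_le_iff.2 Nat.lt_two_pow_self
    simp only [cost, sz]
    calc bitLen k ≤ (k.natAbs + 1) * 1 := by omega
      _ ≤ (k.natAbs + 1) ^ 3 * Y ^ 2 :=
        Nat.mul_le_mul (Nat.le_self_pow (by norm_num) _) (Nat.one_le_pow _ _ hY1)
  | var x =>
    have := bitLen_le_iff.2 (h.1 x)
    simp only [cost, sz]; omega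
  | get a i ih =>
    have h1 := bitLen_le_iff.2 (h.2 a (i.eval s).toNat)
    have h2 := hL i
    have h3 : i.sz * Y ≤ i.sz * Y ^ 2 := Nat.mul_le_mul_left _ hYY
    simp only [cost, sz]
    calc _ ≤ (i.sz ^ 3 + i.sz + 1) * Y ^ 2 := by
          rw [add_mul, add_mul]; omega
      _ ≤ _ := by
          apply Nat.mul_le_mul_right
          ring_nf
          nlinarith [Nat.zero_le (i.sz ^ 2)]
  | add e f ihe ihf => exact hsum e f ihe ihf _ (Or.inl (hlin e f))
  | sub e f ihe ihf => exact hsum e f ihe ihf _ (Or.inl (hlin e f))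
  | mul e f ihe ihf => exact hsum e f ihe ihf _ (Or.inr (hmul e f))
  | div e f ihe ihf => exact hsum e f ihe ihf _ (Or.inr (hmul e f))
  | mod e f ihe ihf => exact hsum e f ihe ihf _ (Or.inr (hmul e f))
  | lt e f ihe ihf => exact hsum e f ihe ihf _ (Or.inl (hlin e f))
  | eq e f ihe ihf => exact hsum e f ihe ihf _ (Or.inl (hlin e f))

/-- A bound for the cost of one basic step on numbers with `B` bits. -/
def stepCost (B : ℕ) : ℕ := 10 ^ 6 * (B + 1) ^ 2

theorem cost_add_one_le {B : ℕ} {s : Store} (h : Bdd B s) {e : Expr} (he : e.sz ≤ 60) :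
    e.cost s + 1 ≤ stepCost B := by
  have h1 := e.cost_le h
  have h2 : e.sz ^ 3 ≤ 60 ^ 3 := Nat.pow_le_pow_left he 3
  have h3 : 1 ≤ (B + 1) ^ 2 := Nat.one_le_pow _ _ (by omega)
  unfold stepCost
  nlinarith

/-- All expressions of the sampler have size at most 60; the constant 10⁶ in `stepCost` covers 2·60³
+ 1. -/
theorem cost_add_cost_le {B : ℕ} {s : Store} (h : Bdd B s) {i e : Expr} (hi : i.sz ≤ 60)
    (he : e.sz ≤ 60) : i.cost s + e.cost s + 1 ≤ stepCost B := by
  have h1 := e.cost_le h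
  have h1' := i.cost_le h
  have h2 : e.sz ^ 3 ≤ 60 ^ 3 := Nat.pow_le_pow_left he 3
  have h2' : i.sz ^ 3 ≤ 60 ^ 3 := Nat.pow_le_pow_left hi 3
  have h3 : 1 ≤ (B + 1) ^ 2 := Nat.one_le_pow _ _ (by omega)
  unfold stepCost
  nlinarith

namespace Prog

/-- A bound for the number of steps when every loop makes at most `X` iterations. -/
def tm (X : ℕ) : Prog → ℕ
  | skip => 1
  | set _ _ => 1
  | store _ _ _ => 1
  | flip _ => 1
  | seq c d => c.tm X + d.tm X
  | ite _ c d => 1 + c.tm X + d.tm X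
  | .while _ c => (X + 1) * (1 + c.tm X)

/-- The variables a program assigns to. -/
def wv : Prog → List ℕ
  | skip => []
  | set x _ => [x]
  | store _ _ _ => []
  | flip x => [x]
  | seq c d => c.wv ++ d.wv
  | ite _ c d => c.wv ++ d.wv
  | .while _ c => c.wv

/-- The arrays a program writes to. -/
def wa : Prog → List ℕ
  | skip => []
  | set _ _ => []
  | store a _ _ => [a]
  | flip _ => []
  | seq c d => c.wa ++ d.wa
  | ite _ c d => c.wa ++ d.wa
  | .while _ c => c.wa

/-- `for i < N do body`. -/
def loop (i N : ℕ) (body : Prog) : Prog :=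
  seq (set i (.lit 0))
    (.while (.lt (.var i) (.var N)) (seq body (set i (.add (.var i) (.lit 1)))))

end Prog

/-- Only the variables and arrays that `c` writes to may differ. -/
def Keep (c : Prog) (s s' : Store) : Prop :=
  (∀ x, x ∉ c.wv → s'.vars x = s.vars x) ∧ ∀ a, a ∉ c.wa → s'.arrs a = s.arrs a

theorem Keep.refl (c : Prog) (s : Store) : Keep c s s := ⟨fun _ _ => rfl, fun _ _ => rfl⟩

theorem Keep.trans' {c d e : Prog} {s s' s'' : Store} (h : Keep c s s') (h' : Keep d s' s'')
    (h1 : c.wv ⊆ e.wv) (h2 : d.wv ⊆ e.wv) (h3 : c.wa ⊆ e.wa) (h4 : d.wa ⊆ e.wa) : Keep e s s'' :=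
  ⟨fun x hx => (h'.1 x fun hm => hx (h2 hm)).trans (h.1 x fun hm => hx (h1 hm)),
    fun a ha => (h'.2 a fun hm => ha (h4 hm)).trans (h.2 a fun hm => ha (h3 hm))⟩

/-- The program halts within its time bound, the abstraction `g` of the final memory has the law
`κ`, and the final memory satisfies `Q`. -/
def DoesR (X B : ℕ) {α : Type} (c : Prog) (s : Store) (g : Store → α) (κ : PMF α)
    (Q : Store → Prop) : Prop :=
  ∃ μ, Runs c s μ (c.tm X * stepCost B) ∧ (∀ s' ∈ μ.support, Bdd B s' ∧ Keep c s s' ∧ Q s') ∧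
    μ.map g = κ

/-- The program halts within its time bound, without randomness, in a memory satisfying `Q`. -/
def Does (X B : ℕ) (c : Prog) (s : Store) (Q : Store → Prop) : Prop :=
  ∃ s', Runs c s (PMF.pure s') (c.tm X * stepCost B) ∧ Bdd B s' ∧ Keep c s s' ∧ Q s'

/-! ### Proof rules for sequencing, branching and loops -/

section Rules

variable {X B : ℕ} {s : Store} {Q P : Store → Prop}

theorem Does.mono {c : Prog} (h : Does X B c s P)
    (hPQ : ∀ s', Bdd B s' → Keep c s s' → P s' → Q s') : Does X B c s Q := by
  obtain ⟨s', h1, h2, h3, h4⟩ := h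
  exact ⟨s', h1, h2, h3, hPQ s' h2 h3 h4⟩

theorem does_skip (hs : Bdd B s) (hQ : Q s) : Does X B .skip s Q := by
  refine ⟨s, Runs.mono _ _ _ _ _ (Runs.skip s) ?_, hs, Keep.refl _ _, hQ⟩
  have := cost_add_one_le hs (e := .lit 0) (by decide)
  simp only [Prog.tm]; omega

theorem does_set {x : ℕ} {e : Expr} (hs : Bdd B s) (he : e.sz ≤ 60)
    (hv : (e.eval s).natAbs < 2 ^ B) (hQ : Q (s.setVar x (e.eval s))) :
    Does X B (.set x e) s Q := by
  refine ⟨_, Runs.mono _ _ _ _ _ (Runs.set s x e) ?_, hs.setVar x hv, ⟨?_, fun _ _ => rfl⟩, hQ⟩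
  · have := cost_add_one_le hs he
    simp only [Prog.tm]; omega
  · intro y hy
    have : y ≠ x := by simpa [Prog.wv] using hy
    simp [this]

theorem does_store {a : ℕ} {i e : Expr} (hs : Bdd B s) (hi : i.sz ≤ 60) (he : e.sz ≤ 60)
    (hv : (e.eval s).natAbs < 2 ^ B) (hQ : Q (s.setArr a (i.eval s).toNat (e.eval s))) :
    Does X B (.store a i e) s Q := by
  refine ⟨_, Runs.mono _ _ _ _ _ (Runs.store s a i e) ?_, hs.setArr a _ hv, ⟨fun _ _ => rfl, ?_⟩, hQ⟩
  · have := cost_add_cost_le hs hi he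
    simp only [Prog.tm]; omega
  · intro b hb
    have : b ≠ a := by simpa [Prog.wa] using hb
    simp [this]

theorem does_seq {c d : Prog} (hc : Does X B c s P)
    (hd : ∀ s', Bdd B s' → Keep c s s' → P s' → Does X B d s' Q) : Does X B (.seq c d) s Q := by
  obtain ⟨s', h1, h2, h3, h4⟩ := hc
  obtain ⟨s'', k1, k2, k3, k4⟩ := hd s' h2 h3 h4
  refine ⟨s'', ?_, k2, h3.trans' k3 ?_ ?_ ?_ ?_, k4⟩
  · have := Runs.seq c d s (PMF.pure s') (fun _ => PMF.pure s'') _ (d.tm X * stepCost B) h1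
      (by
        intro t ht
        rw [PMF.support_pure, Set.mem_singleton_iff] at ht
        subst ht; exact k1)
    rw [PMF.pure_bind] at this
    simp only [Prog.tm, add_mul]
    exact this
  all_goals simp [Prog.wv, Prog.wa]

theorem does_ite {b : Expr} {c d : Prog} (hs : Bdd B s) (hb : b.sz ≤ 60)
    (hc : b.eval s ≠ 0 → Does X B c s Q) (hd : b.eval s = 0 → Does X B d s Q) :
    Does X B (.ite b c d) s Q := by
  have h0 := cost_add_one_le hs hb
  by_cases h : b.eval s = 0
  · obtain ⟨s', h1, h2, h3, h4⟩ := hd h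
    refine ⟨s', Runs.mono _ _ _ _ _ (Runs.ite_false b c d s _ _ h h1) ?_, h2, ?_, h4⟩
    · simp only [Prog.tm]; nlinarith [Nat.zero_le (c.tm X * stepCost B)]
    · exact (Keep.refl c s).trans' h3 (by simp [Prog.wv]) (by simp [Prog.wv]) (by simp [Prog.wa])
        (by simp [Prog.wa])
  · obtain ⟨s', h1, h2, h3, h4⟩ := hc h
    refine ⟨s', Runs.mono _ _ _ _ _ (Runs.ite_true b c d s _ _ h h1) ?_, h2, ?_, h4⟩
    · simp only [Prog.tm]; nlinarith [Nat.zero_le (d.tm X * stepCost B)]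
    · exact (Keep.refl c s).trans' h3 (by simp [Prog.wv]) (by simp [Prog.wv]) (by simp [Prog.wa])
        (by simp [Prog.wa])

variable {α : Type}

theorem doesR_of_does {c : Prog} {g : Store → α} {a : α} (h : Does X B c s fun s' => g s' = a ∧ Q s') :
    DoesR X B c s g (PMF.pure a) Q := by
  obtain ⟨s', h1, h2, h3, h4, h5⟩ := h
  refine ⟨_, h1, ?_, ?_⟩
  · intro t ht
    rw [PMF.support_pure, Set.mem_singleton_iff] at ht
    subst ht; exact ⟨h2, h3, h5⟩
  · rw [PMF.pure_map, h4]

/-- Only the law of the abstraction `g` is tracked. The second program may start in many memories,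
but the law of `h` may depend on them through `g` alone, so the kernels compose. -/
theorem doesR_seq {β : Type} {c d : Prog} {g : Store → α} {h : Store → β} {κ : PMF α}
    {κ' : α → PMF β} (hc : DoesR X B c s g κ P)
    (hd : ∀ s', Bdd B s' → Keep c s s' → P s' → DoesR X B d s' h (κ' (g s')) Q) :
    DoesR X B (.seq c d) s h (κ.bind κ') Q := by
  classical
  obtain ⟨μ, h1, h2, h3⟩ := hc
  -- Outside the support of `μ` the continuation is an arbitrary point mass; it has weight 0.
  have hd' : ∀ s', ∃ ν, s' ∈ μ.support → Runs d s' ν (d.tm X * stepCost B) ∧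
      (∀ s'' ∈ ν.support, Bdd B s'' ∧ Keep d s' s'' ∧ Q s'') ∧ ν.map h = κ' (g s') := by
    intro s'
    by_cases hs : s' ∈ μ.support
    · obtain ⟨ν, hν⟩ := hd s' (h2 s' hs).1 (h2 s' hs).2.1 (h2 s' hs).2.2
      exact ⟨ν, fun _ => hν⟩
    · exact ⟨PMF.pure s', fun hs' => absurd hs' hs⟩
  choose ν hν using hd'
  refine ⟨μ.bind ν, ?_, ?_, ?_⟩
  · simp only [Prog.tm, add_mul]
    exact Runs.seq c d s μ ν _ _ h1 fun s' hs' => (hν s' hs').1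
  · intro s'' hs''
    rw [PMF.mem_support_bind_iff] at hs''
    obtain ⟨s', hs', hs''⟩ := hs''
    obtain ⟨k1, k2, k3⟩ := (hν s' hs').2.1 s'' hs''
    refine ⟨k1, (h2 s' hs').2.1.trans' k2 ?_ ?_ ?_ ?_, k3⟩
    all_goals simp [Prog.wv, Prog.wa]
  · rw [PMF.map_bind, ← h3, PMF.bind_map]
    ext y
    simp only [PMF.bind_apply, Function.comp]
    refine tsum_congr fun s' => ?_
    by_cases hs : s' ∈ μ.support
    · rw [(hν s' hs).2.2]
    · rw [PMF.mem_support_iff, not_not] at hs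
      simp [hs]

/-- The law after `j` steps of the kernels `K k, K (k + 1), …`. -/
def iterK (K : ℕ → α → PMF α) : ℕ → ℕ → α → PMF α
  | 0, _, a => PMF.pure a
  | j + 1, k, a => (K k a).bind (iterK K j (k + 1))

/-- The counter is increased after the body, so the step must establish the invariant for the memory
in which the counter already has its new value. The law of round `k` depends on `k` and on the
abstraction, which must not see the counter. -/
theorem doesR_loop {i N : ℕ} {body : Prog} (hi : i ∉ body.wv) (hN : N ∉ body.wv) (hiN : i ≠ N)
    {m : ℕ} (hs : Bdd B s) (hm : s.vars N = m) (hmX : m ≤ X) (hmB : m < 2 ^ B)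
    (g : Store → α) (hg : ∀ s z, g (s.setVar i z) = g s) (K : ℕ → α → PMF α)
    (I : ℕ → Store → Prop) (h0 : I 0 (s.setVar i 0))
    (hstep : ∀ k < m, ∀ s', Bdd B s' → Keep (Prog.loop i N body) s s' → s'.vars i = k → I k s' →
      DoesR X B body s' g (K k (g s')) fun s'' => I (k + 1) (s''.setVar i (k + 1))) :
    DoesR X B (Prog.loop i N body) s g (iterK K m 0 (g s)) (I m) := by
  set step := Prog.seq body (.set i (.add (.var i) (.lit 1))) with hstepdef
  set w := Prog.while (.lt (.var i) (.var N)) step with hw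
  have hBpos : (0 : ℕ) < 2 ^ B := by positivity
  have hcond : ∀ s', Bdd B s' → (Expr.lt (.var i) (.var N)).cost s' + 1 ≤ stepCost B :=
    fun s' hs' => cost_add_one_le hs' (by simp [Expr.sz])
  have hsub : ∀ x, x ∈ step.wv → x ∈ (Prog.loop i N body).wv := by
    intro x hx
    simp only [Prog.loop, Prog.wv, hstepdef] at hx ⊢
    exact List.mem_append_right _ hx
  have hNl : N ∉ (Prog.loop i N body).wv := by
    simp only [Prog.loop, Prog.wv, List.mem_append, List.mem_singleton]
    tauto
  have main : ∀ j k, k + j = m → ∀ s', Bdd B s' → Keep (Prog.loop i N body) s s' → s'.vars i = k →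
      I k s' → ∃ μ, Runs w s' μ ((j * (1 + step.tm X) + 1) * stepCost B) ∧
        (∀ s'' ∈ μ.support, Bdd B s'' ∧ Keep (Prog.loop i N body) s s'' ∧ I m s'') ∧
        μ.map g = iterK K j k (g s') := by
    intro j
    induction j with
    | zero =>
      intro k hk s' hs' hkeep hik hI
      have hN' : s'.vars N = m := (hkeep.1 N hNl).trans hm
      refine ⟨PMF.pure s', ?_, ?_, ?_⟩
      · refine Runs.mono _ _ _ _ _ (Runs.while_false _ _ _ ?_) ?_
        · simp only [Expr.eval, hik, hN']; simp; omega
        · have := hcond s' hs'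
          omega
      · intro t ht
        rw [PMF.support_pure, Set.mem_singleton_iff] at ht
        subst ht
        have : k = m := by omega
        exact ⟨hs', hkeep, this ▸ hI⟩
      · rw [PMF.pure_map]; rfl
    | succ j ih =>
      intro k hk s' hs' hkeep hik hI
      have hN' : s'.vars N = m := (hkeep.1 N hNl).trans hm
      have hbody := hstep k (by omega) s' hs' hkeep hik hI
      have hstp : DoesR X B step s' g (K k (g s')) fun s'' =>
          I (k + 1) s'' ∧ s''.vars i = (k + 1 : ℕ) := by
        have := doesR_seq (d := .set i (.add (.var i) (.lit 1))) (h := g) (κ' := PMF.pure)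
          (Q := fun s'' => I (k + 1) s'' ∧ s''.vars i = (k + 1 : ℕ)) hbody (by
            intro t ht hkt hIt
            apply doesR_of_does
            have hti : t.vars i = k := (hkt.1 i hi).trans hik
            have he : (Expr.add (.var i) (.lit 1)).eval t = (k + 1 : ℕ) := by
              simp [Expr.eval, hti]
            refine does_set ht (by simp [Expr.sz]) ?_ ⟨hg _ _, ?_, ?_⟩
            · rw [he]
              have : (((k + 1 : ℕ) : ℤ)).natAbs = k + 1 := rfl
              rw [this]; omega
            · rw [he]; exact_mod_cast hIt
            · rw [he]; simp)
        rwa [PMF.bind_pure] at this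
      obtain ⟨μ, r1, r2, r3⟩ := hstp
      have hk2 : ∀ t ∈ μ.support, Keep (Prog.loop i N body) s t := by
        intro t ht
        refine hkeep.trans' (r2 t ht).2.1 (fun _ h => h) hsub (fun _ h => h) ?_
        intro a ha
        simp only [Prog.loop, Prog.wa, hstepdef] at ha ⊢
        exact List.mem_append_right _ ha
      have hih : ∀ t, ∃ ν, t ∈ μ.support →
          Runs w t ν ((j * (1 + step.tm X) + 1) * stepCost B) ∧
          (∀ s'' ∈ ν.support, Bdd B s'' ∧ Keep (Prog.loop i N body) s s'' ∧ I m s'') ∧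
          ν.map g = iterK K j (k + 1) (g t) := by
        intro t
        by_cases ht : t ∈ μ.support
        · obtain ⟨ν, hν⟩ := ih (k + 1) (by omega) t (r2 t ht).1 (hk2 t ht) (r2 t ht).2.2.2
            (r2 t ht).2.2.1
          exact ⟨ν, fun _ => hν⟩
        · exact ⟨PMF.pure t, fun h => absurd h ht⟩
      choose ν hν using hih
      refine ⟨μ.bind ν, ?_, ?_, ?_⟩
      · refine Runs.mono _ _ _ _ _ (Runs.while_true _ _ _ μ ν _ _ ?_ r1
          fun t ht => (hν t ht).1) ?_
        · simp only [Expr.eval, hik, hN']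
          have : (k : ℤ) < m := by exact_mod_cast (by omega : k < m)
          simp [this]
        · have := hcond s' hs'
          have e : ((j + 1) * (1 + step.tm X) + 1) * stepCost B = stepCost B + step.tm X * stepCost B
            + (j * (1 + step.tm X) + 1) * stepCost B := by ring
          rw [e]; omega
      · intro t ht
        rw [PMF.mem_support_bind_iff] at ht
        obtain ⟨s1, hs1, ht⟩ := ht
        exact (hν s1 hs1).2.1 t ht
      · rw [PMF.map_bind, iterK, ← r3, PMF.bind_map]
        ext y
        simp only [PMF.bind_apply, Function.comp]
        refine tsum_congr fun s1 => ?_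
        by_cases hs1 : s1 ∈ μ.support
        · rw [(hν s1 hs1).2.2]
        · rw [PMF.mem_support_iff, not_not] at hs1
          simp [hs1]
  have hs0 : Bdd B (s.setVar i 0) := hs.setVar i (by simp)
  have hkeep0 : Keep (Prog.loop i N body) s (s.setVar i 0) := by
    refine ⟨fun x hx => ?_, fun _ _ => rfl⟩
    have : x ≠ i := by
      rintro rfl
      exact hx (by simp [Prog.loop, Prog.wv])
    simp [this]
  obtain ⟨μ, r1, r2, r3⟩ := main m 0 (by omega) _ hs0 hkeep0 (by simp) h0
  refine ⟨μ, ?_, r2, by rw [r3, hg]⟩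
  have hset : Runs (.set i (.lit 0)) s (PMF.pure (s.setVar i 0)) (stepCost B) :=
    Runs.mono _ _ _ _ _ (Runs.set s i (.lit 0)) (cost_add_one_le hs (by decide))
  have := Runs.seq (.set i (.lit 0)) w s _ (fun _ => μ) _
    ((m * (1 + step.tm X) + 1) * stepCost B) hset (by
      intro t ht
      rw [PMF.support_pure, Set.mem_singleton_iff] at ht
      subst ht; exact r1)
  rw [PMF.pure_bind] at this
  refine Runs.mono _ _ _ _ _ this ?_
  have e : (Prog.loop i N body).tm X = 1 + (X + 1) * (1 + step.tm X) := rfl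
  rw [e, add_mul (1 : ℕ), one_mul]
  gcongr
  nlinarith

/-- The deterministic counterpart of `doesR_loop`: all laws are point masses and the final memory is
produced explicitly. -/
theorem does_loop {i N : ℕ} {body : Prog} (hi : i ∉ body.wv) (hN : N ∉ body.wv) (hiN : i ≠ N)
    {m : ℕ} (hs : Bdd B s) (hm : s.vars N = m) (hmX : m ≤ X) (hmB : m < 2 ^ B)
    (I : ℕ → Store → Prop) (h0 : I 0 (s.setVar i 0))
    (hstep : ∀ k < m, ∀ s', Bdd B s' → Keep (Prog.loop i N body) s s' → s'.vars i = k → I k s' →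
      Does X B body s' fun s'' => I (k + 1) (s''.setVar i (k + 1))) :
    Does X B (Prog.loop i N body) s (I m) := by
  set step := Prog.seq body (.set i (.add (.var i) (.lit 1))) with hstepdef
  set w := Prog.while (.lt (.var i) (.var N)) step with hw
  have hBpos : (0 : ℕ) < 2 ^ B := by positivity
  have hcond : ∀ s', Bdd B s' → (Expr.lt (.var i) (.var N)).cost s' + 1 ≤ stepCost B :=
    fun s' hs' => cost_add_one_le hs' (by simp [Expr.sz])
  have hNl : N ∉ (Prog.loop i N body).wv := by
    simp only [Prog.loop, Prog.wv, List.mem_append, List.mem_singleton]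
    tauto
  have main : ∀ j k, k + j = m → ∀ s', Bdd B s' → Keep (Prog.loop i N body) s s' → s'.vars i = k →
      I k s' → ∃ s'', Runs w s' (PMF.pure s'') ((j * (1 + step.tm X) + 1) * stepCost B) ∧
        Bdd B s'' ∧ Keep (Prog.loop i N body) s s'' ∧ I m s'' := by
    intro j
    induction j with
    | zero =>
      intro k hk s' hs' hkeep hik hI
      have hN' : s'.vars N = m := (hkeep.1 N hNl).trans hm
      have : k = m := by omega
      refine ⟨s', ?_, hs', hkeep, this ▸ hI⟩
      refine Runs.mono _ _ _ _ _ (Runs.while_false _ _ _ ?_) ?_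
      · simp only [Expr.eval, hik, hN']; simp; omega
      · have := hcond s' hs'
        omega
    | succ j ih =>
      intro k hk s' hs' hkeep hik hI
      have hN' : s'.vars N = m := (hkeep.1 N hNl).trans hm
      have hstp : Does X B step s' fun s'' => I (k + 1) s'' ∧ s''.vars i = (k + 1 : ℕ) := by
        refine does_seq (hstep k (by omega) s' hs' hkeep hik hI) ?_
        intro t ht hkt hIt
        have hti : t.vars i = k := (hkt.1 i hi).trans hik
        have he : (Expr.add (.var i) (.lit 1)).eval t = (k + 1 : ℕ) := by
          simp [Expr.eval, hti]
        refine does_set ht (by simp [Expr.sz]) ?_ ⟨?_, ?_⟩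
        · rw [he]
          have : (((k + 1 : ℕ) : ℤ)).natAbs = k + 1 := rfl
          rw [this]; omega
        · rw [he]; exact_mod_cast hIt
        · rw [he]; simp
      obtain ⟨t, r1, r2, r3, r4, r5⟩ := hstp
      have hkt : Keep (Prog.loop i N body) s t := by
        refine hkeep.trans' r3 (fun _ h => h) ?_ (fun _ h => h) ?_
        · intro x hx
          simp only [Prog.loop, Prog.wv, hstepdef] at hx ⊢
          exact List.mem_append_right _ hx
        · intro a ha
          simp only [Prog.loop, Prog.wa, hstepdef] at ha ⊢
          exact List.mem_append_right _ ha
      obtain ⟨s'', q1, q2⟩ := ih (k + 1) (by omega) t r2 hkt r5 r4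
      refine ⟨s'', ?_, q2⟩
      have := Runs.while_true (.lt (.var i) (.var N)) step s' (PMF.pure t) (fun _ => PMF.pure s'')
        (step.tm X * stepCost B) ((j * (1 + step.tm X) + 1) * stepCost B) (by
          simp only [Expr.eval, hik, hN']
          have : (k : ℤ) < m := by exact_mod_cast (by omega : k < m)
          simp [this]) r1 (by
          intro t' ht'
          rw [PMF.support_pure, Set.mem_singleton_iff] at ht'
          subst ht'; exact q1)
      rw [PMF.pure_bind] at this
      refine Runs.mono _ _ _ _ _ this ?_
      have := hcond s' hs'
      have e : ((j + 1) * (1 + step.tm X) + 1) * stepCost B = stepCost B + step.tm X * stepCost B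
        + (j * (1 + step.tm X) + 1) * stepCost B := by ring
      rw [e]; omega
  have hs0 : Bdd B (s.setVar i 0) := hs.setVar i (by simp)
  have hkeep0 : Keep (Prog.loop i N body) s (s.setVar i 0) := by
    refine ⟨fun x hx => ?_, fun _ _ => rfl⟩
    have : x ≠ i := by
      rintro rfl
      exact hx (by simp [Prog.loop, Prog.wv])
    simp [this]
  obtain ⟨s'', q1, q2⟩ := main m 0 (by omega) _ hs0 hkeep0 (by simp) h0
  refine ⟨s'', ?_, q2⟩
  have hset : Runs (.set i (.lit 0)) s (PMF.pure (s.setVar i 0)) (stepCost B) :=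
    Runs.mono _ _ _ _ _ (Runs.set s i (.lit 0)) (cost_add_one_le hs (by decide))
  have := Runs.seq (.set i (.lit 0)) w s _ (fun _ => PMF.pure s'') _
    ((m * (1 + step.tm X) + 1) * stepCost B) hset (by
      intro t ht
      rw [PMF.support_pure, Set.mem_singleton_iff] at ht
      subst ht; exact q1)
  rw [PMF.pure_bind] at this
  refine Runs.mono _ _ _ _ _ this ?_
  have e : (Prog.loop i N body).tm X = 1 + (X + 1) * (1 + step.tm X) := rfl
  rw [e, add_mul (1 : ℕ), one_mul]
  gcongr
  nlinarith

end Rules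

/-! ### Enumerating clusters -/

/-- Sites are numbered segment by segment, so passing to the next segment adds `n` to the code. -/
def enc (a : Site n) : ℕ := a.1 + n * a.2

theorem enc_injective : Function.Injective (enc (n := n)) := by
  rintro ⟨u, i⟩ ⟨v, j⟩ h
  simp only [enc] at h
  have hu := u.2
  have hv := v.2
  have h1 : (u : ℕ) = v := by
    have := congrArg (· % n) h
    simpa [Nat.add_mul_mod_self_left, Nat.mod_eq_of_lt hu, Nat.mod_eq_of_lt hv] using this
  have h2 : i = j := by
    rw [h1] at h
    exact Nat.eq_of_mul_eq_mul_left (by omega) (Nat.add_left_cancel h)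
  rw [Prod.mk.injEq]
  exact ⟨Fin.ext h1, h2⟩

theorem exists_enc_eq (hn : 0 < n) (i : ℕ) : ∃ a : Site n, enc a = i :=
  ⟨(⟨i % n, Nat.mod_lt _ hn⟩, i / n), Nat.mod_add_div i n⟩

theorem enc_lt {a : Site n} {t : ℕ} (h : a.2 ≤ t) : enc a < n * (t + 1) := by
  have h1 := a.1.2
  have h2 : n * a.2 ≤ n * t := Nat.mul_le_mul_left n h
  unfold enc
  rw [mul_add]
  omega

/-- Add the ends of a factor to a set that contains the other end, if they are free. -/
def Skel.absorb (k : Skel n) (S : Finset (Site n)) (f : Fac n) : Finset (Site n) :=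
  let S' := if f.a ∈ S ∧ f.b ∈ k.free then insert f.b S else S
  if f.b ∈ S' ∧ f.a ∈ k.free then insert f.a S' else S'

def Skel.pass (k : Skel n) (S : Finset (Site n)) : Finset (Site n) := k.facs.foldl k.absorb S

theorem mem_cluster {k : Skel n} {s a : Site n} :
    a ∈ k.cluster s ↔ a ∈ insert s k.free ∧ Relation.ReflTransGen k.link s a := by
  simp [Skel.cluster]

theorem self_mem_cluster (k : Skel n) (s : Site n) : s ∈ k.cluster s :=
  mem_cluster.2 ⟨Finset.mem_insert_self _ _, Relation.ReflTransGen.refl⟩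

theorem mem_cluster_of_link {k : Skel n} {s a b : Site n} (ha : a ∈ k.cluster s) (h : k.link a b) :
    b ∈ k.cluster s :=
  mem_cluster.2 ⟨Finset.mem_insert_of_mem h.1, (mem_cluster.1 ha).2.tail h⟩

theorem subset_absorb (k : Skel n) (S : Finset (Site n)) (f : Fac n) : S ⊆ k.absorb S f := by
  intro x hx
  unfold Skel.absorb
  simp only
  split_ifs <;> simp [hx]

theorem subset_foldl_absorb (k : Skel n) (l : List (Fac n)) (S : Finset (Site n)) :
    S ⊆ l.foldl k.absorb S := by
  induction l generalizing S with
  | nil => exact fun _ h => h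
  | cons f l ih => exact (subset_absorb k S f).trans (ih _)

theorem b_mem_absorb {k : Skel n} {S : Finset (Site n)} {f : Fac n} (h : f.a ∈ S)
    (hb : f.b ∈ k.free) : f.b ∈ k.absorb S f := by
  unfold Skel.absorb
  simp only [h, hb, and_self, if_true]
  split_ifs <;> simp

theorem a_mem_absorb {k : Skel n} {S : Finset (Site n)} {f : Fac n} (h : f.b ∈ S)
    (ha : f.a ∈ k.free) : f.a ∈ k.absorb S f := by
  unfold Skel.absorb
  simp only
  split_ifs <;> simp_all

theorem mem_foldl_absorb {k : Skel n} {l : List (Fac n)} {S : Finset (Site n)} {f : Fac n}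
    (hf : f ∈ l) {a b : Site n} (hab : (f.a = a ∧ f.b = b) ∨ (f.a = b ∧ f.b = a)) (ha : a ∈ S)
    (hb : b ∈ k.free) : b ∈ l.foldl k.absorb S := by
  induction l generalizing S with
  | nil => simp at hf
  | cons g l ih =>
    rw [List.foldl_cons]
    rcases List.mem_cons.1 hf with rfl | hf
    · apply subset_foldl_absorb
      rcases hab with ⟨rfl, rfl⟩ | ⟨rfl, rfl⟩
      · exact b_mem_absorb ha hb
      · exact a_mem_absorb ha hb
    · exact ih hf (subset_absorb k S g ha)

theorem foldl_absorb_subset {k : Skel n} {s : Site n} {l : List (Fac n)} (hl : ∀ f ∈ l, f ∈ k.facs)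
    {S : Finset (Site n)} (hS : S ⊆ k.cluster s) : l.foldl k.absorb S ⊆ k.cluster s := by
  induction l generalizing S with
  | nil => exact hS
  | cons f l ih =>
    refine ih (fun g hg => hl g (List.mem_cons_of_mem _ hg)) ?_
    have hf := hl f List.mem_cons_self
    have h1 : (if f.a ∈ S ∧ f.b ∈ k.free then insert f.b S else S) ⊆ k.cluster s := by
      split_ifs with h
      · exact Finset.insert_subset
          (mem_cluster_of_link (hS h.1) ⟨h.2, f, hf, Or.inl ⟨rfl, rfl⟩⟩) hS
      · exact hS
    unfold Skel.absorb
    simp only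
    set S' := if f.a ∈ S ∧ f.b ∈ k.free then insert f.b S else S
    split_ifs with h
    · exact Finset.insert_subset
        (mem_cluster_of_link (h1 h.1) ⟨h.2, f, hf, Or.inr ⟨rfl, rfl⟩⟩) h1
    · exact h1

/-- Every pass stays inside the cluster. A pass that changes the set adds at least one site; a pass
that does not shows that the set is closed under links and hence is the cluster. So as many passes
as the cluster has sites suffice. -/
theorem iterate_pass_eq_cluster (k : Skel n) (s : Site n) {K : ℕ} (hK : (k.cluster s).card ≤ K) :
    k.pass^[K] {s} = k.cluster s := by
  have hsub : ∀ j, k.pass^[j] {s} ⊆ k.cluster s := by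
    intro j
    induction j with
    | zero => simpa using self_mem_cluster k s
    | succ j ih =>
      rw [Function.iterate_succ_apply']
      exact foldl_absorb_subset (fun _ h => h) ih
  have hmem : ∀ j, s ∈ k.pass^[j] {s} := by
    intro j
    induction j with
    | zero => simp
    | succ j ih =>
      rw [Function.iterate_succ_apply']
      exact subset_foldl_absorb k _ _ ih
  have hclosed : ∀ S : Finset (Site n), s ∈ S → k.pass S = S → k.cluster s ⊆ S := by
    intro S hs hS a ha'
    have ha := (mem_cluster.1 ha').2
    clear ha'
    induction ha with
    | refl => exact hs
    | tail _ h ih =>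
      obtain ⟨hf, f, hfm, hab⟩ := h
      rw [← hS]
      exact mem_foldl_absorb hfm hab ih hf
  have key : ∀ j, k.pass^[j] {s} = k.cluster s ∨ j + 1 ≤ (k.pass^[j] {s}).card := by
    intro j
    induction j with
    | zero => right; simp
    | succ j ih =>
      rw [Function.iterate_succ_apply']
      have h1 : k.pass^[j] {s} ⊆ k.pass (k.pass^[j] {s}) := subset_foldl_absorb k _ _
      rcases ih with ih | ih
      · left
        apply Finset.Subset.antisymm
        · have := hsub (j + 1)
          rwa [Function.iterate_succ_apply'] at this
        · rwa [← ih]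
      · by_cases h : k.pass (k.pass^[j] {s}) = k.pass^[j] {s}
        · left
          apply Finset.Subset.antisymm
          · rw [h]; exact hsub j
          · rw [h]; exact hclosed _ (hmem j) h
        · right
          have := Finset.card_lt_card (h1.ssubset_of_ne (Ne.symm h))
          omega
  rcases key K with h | h
  · exact h
  · have := Finset.card_le_card (hsub K)
    omega

/-- The number of members of `C` before `a`. -/
def rank (C : Finset (Site n)) (i : ℕ) : ℕ := (C.filter fun b => enc b < i).card

/-- The assignment on `C` given by the binary digits of `t`. -/
def digits (C : Finset (Site n)) (z : Site n → Bool) (t : ℕ) : Site n → Bool :=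
  fun a => if a ∈ C then decide (t / 2 ^ rank C (enc a) % 2 = 1) else z a

/-- The members of `C`, ordered by code, are matched with the binary digits of `t`. The induction
adds the member with the largest code, which gets the top digit and leaves the ranks of the others
unchanged. -/
theorem sum_digits {M : Type*} [AddCommMonoid M] (g : (Site n → Bool) → M) (C : Finset (Site n))
    (z : Site n → Bool) :
    ∑ t ∈ Finset.range (2 ^ C.card), g (digits C z t) = ∑ T ∈ C.powerset, g (pin z C T) := by
  induction C using Finset.induction_on_max_value enc generalizing z with
  | empty =>
    have : digits ∅ z 0 = pin z ∅ ∅ := by funext a; simp [digits, pin]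
    simp [this]
  | insert a C ha hmax ih =>
    have hlt : ∀ b ∈ C, enc b < enc a := fun b hb =>
      lt_of_le_of_ne (hmax b hb) fun h => ha (enc_injective h ▸ hb)
    have hra : rank (insert a C) (enc a) = C.card := by
      unfold rank
      rw [Finset.filter_insert, if_neg (lt_irrefl _), Finset.filter_true_of_mem hlt]
    have hrb : ∀ b ∈ C, rank (insert a C) (enc b) = rank C (enc b) := by
      intro b hb
      unfold rank
      rw [Finset.filter_insert, if_neg (by have := hlt b hb; omega)]
    have hrlt : ∀ b ∈ C, rank C (enc b) < C.card := by
      intro b hb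
      refine Finset.card_lt_card (Finset.filter_ssubset.2 ⟨b, hb, lt_irrefl _⟩)
    rw [sum_pin_insert g C a ha, Finset.card_insert_of_notMem ha, pow_succ', two_mul,
      Finset.sum_range_add, Fintype.sum_bool, add_comm, ← ih, ← ih]
    congr 1
    · refine Finset.sum_congr rfl fun t ht => ?_
      congr 1
      have htl : t < 2 ^ C.card := Finset.mem_range.1 ht
      funext b
      by_cases hb : b = a
      · subst hb
        simp only [digits, Finset.mem_insert_self, if_true, hra, ha, if_false, Function.update_self]
        rw [Nat.add_div_left _ (by positivity), Nat.div_eq_of_lt htl]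
        simp
      · by_cases hbC : b ∈ C
        · simp only [digits, Finset.mem_insert, hb, hbC, or_true, if_true, hrb b hbC]
          obtain ⟨d, hd⟩ := Nat.exists_eq_add_of_lt (hrlt b hbC)
          congr 1
          rw [hd, show rank C (enc b) + d + 1 = rank C (enc b) + (d + 1) by ring, pow_add,
            Nat.mul_add_div (by positivity), pow_succ, Nat.mul_comm, Nat.mul_add_mod]
        · simp [digits, hb, hbC]
    · refine Finset.sum_congr rfl fun t ht => ?_
      congr 1
      have htl : t < 2 ^ C.card := Finset.mem_range.1 ht
      funext b
      by_cases hb : b = a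
      · subst hb
        simp only [digits, Finset.mem_insert_self, if_true, hra, ha, if_false, Function.update_self]
        rw [Nat.div_eq_of_lt htl]
        simp
      · by_cases hbC : b ∈ C
        · simp [digits, hbC, hrb b hbC]
        · simp [digits, hb, hbC]

/-- The root is enumerated along with the rest of the cluster, and terms are sorted by its bit. A
single enumeration thus yields the sums for both values of the root. -/
theorem sum_digits_amp (k : Skel n) (s : Site n) (z : Site n → Bool) (b : Bool) :
    ∑ t ∈ Finset.range (2 ^ (k.cluster s).card),
      (if digits (k.cluster s) z t s = b then
        amp (touching (k.cluster s) k.facs) (digits (k.cluster s) z t) else 0)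
      = clusterSum k s z b := by
  rw [sum_digits fun x => if x s = b then amp (touching (k.cluster s) k.facs) x else 0]
  unfold clusterSum psum
  have hs := self_mem_cluster k s
  generalize touching (k.cluster s) k.facs = F
  generalize k.cluster s = C at hs
  obtain ⟨D, hD, rfl⟩ : ∃ D, s ∉ D ∧ insert s D = C :=
    ⟨C.erase s, Finset.notMem_erase s C, Finset.insert_erase hs⟩
  rw [sum_pin_insert (fun x => if x s = b then amp F x else 0) D s hD z, Finset.erase_insert hD,
    Finset.sum_eq_single b]
  · exact Finset.sum_congr rfl fun T _ => by simp [pin_of_notMem hD]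
  · exact fun b' _ hb' => Finset.sum_eq_zero fun T _ => by simp [pin_of_notMem hD, hb']
  · simp

/-! ### Expectations and runs -/

open scoped ENNReal

/-- The expectation of a function under a discrete law. -/
def expect {α : Type*} (μ : PMF α) (f : α → ℝ≥0∞) : ℝ≥0∞ := ∑' a, μ a * f a

theorem expect_pure {α : Type*} (a : α) (f : α → ℝ≥0∞) : expect (PMF.pure a) f = f a := by
  classical
  unfold expect
  rw [tsum_eq_single a]
  · simp
  · intro b hb; simp [PMF.pure_apply, hb]

theorem expect_bind {α β : Type*} (μ : PMF α) (κ : α → PMF β) (f : β → ℝ≥0∞) :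
    expect (μ.bind κ) f = expect μ fun a => expect (κ a) f := by
  unfold expect
  simp only [PMF.bind_apply, ← ENNReal.tsum_mul_right, ← ENNReal.tsum_mul_left]
  rw [ENNReal.tsum_comm]
  exact tsum_congr fun a => tsum_congr fun b => mul_assoc _ _ _

theorem expect_map {α β : Type*} (μ : PMF α) (g : α → β) (f : β → ℝ≥0∞) :
    expect (μ.map g) f = expect μ (f ∘ g) := by
  unfold PMF.map
  rw [expect_bind]
  simp only [Function.comp, expect_pure]
  rfl

theorem map_apply_eq_expect {α β : Type*} [DecidableEq β] (μ : PMF α) (g : α → β) (y : β) :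
    μ.map g y = expect μ fun a => if g a = y then 1 else 0 := by
  rw [PMF.map_apply]
  unfold expect
  refine tsum_congr fun a => ?_
  by_cases h : g a = y
  · simp [h]
  · simp [h, Ne.symm h]

theorem expect_bool (f : Bool → ℝ≥0∞) :
    expect (PMF.uniformOfFintype Bool) f = (f false + f true) / 2 := by
  unfold expect
  rw [tsum_bool]
  simp only [PMF.uniformOfFintype_apply, Fintype.card_bool, Nat.cast_ofNat]
  rw [← mul_add, mul_comm, ENNReal.div_eq_inv_mul, mul_comm]

/-- One step of the generation of a random integer by binary digits. -/
def bitK (x : ℤ) : PMF ℤ := (PMF.uniformOfFintype Bool).map fun b => x + x + if b then 1 else 0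

/-- Appending `j` fair binary digits to `x` gives 2^j x + u with u uniform below 2^j. -/
theorem expect_iterK_bitK (j l : ℕ) (x : ℤ) (f : ℤ → ℝ≥0∞) :
    expect (iterK (fun _ => bitK) j l x) f
      = (∑ u ∈ Finset.range (2 ^ j), f (2 ^ j * x + u)) / 2 ^ j := by
  induction j generalizing l x with
  | zero => simp [iterK, expect_pure]
  | succ j ih =>
    have h2 : (2 : ℝ≥0∞) ^ j ≠ 0 := by positivity
    have h3 : (2 : ℝ≥0∞) ^ j ≠ ⊤ := by finiteness
    simp only [iterK, bitK]
    rw [expect_bind, expect_map, expect_bool]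
    simp only [Function.comp]
    rw [ih, ih, pow_succ (2 : ℕ), mul_two, Finset.sum_range_add, ← ENNReal.add_div,
      ENNReal.div_eq_inv_mul, ENNReal.div_eq_inv_mul, ENNReal.div_eq_inv_mul, ← mul_assoc,
      pow_succ (2 : ℝ≥0∞), ENNReal.mul_inv (Or.inl h2) (Or.inl h3), mul_comm (2 : ℝ≥0∞)⁻¹]
    congr 2
    · refine Finset.sum_congr rfl fun u _ => ?_
      congr 1
      simp; ring
    · refine Finset.sum_congr rfl fun u _ => ?_
      congr 1
      simp; ring

/-- Fill one entry of the tape with a random integer of `m` digits. -/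
def tapeK (m i : ℕ) (τ : ℕ → ℤ) : PMF (ℕ → ℤ) :=
  (iterK (fun _ => bitK) m 0 0).map fun x => Function.update τ i x

/-- Run the sampler on a tape. -/
def runFrom (θ : Gates r) (ch : ℕ → Fin 5) (M cap : ℕ) (τ : ℕ → ℤ) :
    List (El n r) → ℕ → Skel n × (Site n → Bool) → Skel n × (Site n → Bool)
  | [], _, p => p
  | e :: el, i, p => runFrom θ ch M cap τ el (i + 1) (sampleStep θ ch M cap e (τ i).toNat p)

theorem runFrom_append (θ : Gates r) (ch : ℕ → Fin 5) (M cap : ℕ) (τ : ℕ → ℤ)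
    (l₁ l₂ : List (El n r)) (i : ℕ) (p : Skel n × (Site n → Bool)) :
    runFrom θ ch M cap τ (l₁ ++ l₂) i p
      = runFrom θ ch M cap τ l₂ (i + l₁.length) (runFrom θ ch M cap τ l₁ i p) := by
  induction l₁ generalizing i p with
  | nil => rfl
  | cons e l ih =>
    simp only [List.cons_append, runFrom, List.length_cons]
    rw [ih, Nat.add_right_comm, Nat.add_assoc]

/-- The tape is filled from left to right, so entries before position `i` are final. -/
theorem iterK_support_agree (m j i : ℕ) (τ τ' : ℕ → ℤ)
    (h : τ' ∈ (iterK (tapeK m) j i τ).support) : ∀ l < i, τ' l = τ l := by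
  induction j generalizing i τ with
  | zero =>
    simp only [iterK, PMF.support_pure, Set.mem_singleton_iff] at h
    subst h; exact fun _ _ => rfl
  | succ j ih =>
    simp only [iterK, PMF.mem_support_bind_iff, tapeK, PMF.mem_support_map_iff] at h
    obtain ⟨τ₁, ⟨x, -, rfl⟩, h⟩ := h
    intro l hl
    rw [ih _ _ h l (by omega), Function.update_of_ne (by omega)]

theorem expect_congr_support {α : Type*} (μ : PMF α) {f g : α → ℝ≥0∞}
    (h : ∀ a ∈ μ.support, f a = g a) : expect μ f = expect μ g := by
  refine tsum_congr fun a => ?_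
  by_cases ha : a ∈ μ.support
  · rw [h a ha]
  · rw [PMF.mem_support_iff, not_not] at ha
    simp [ha]

/-- The indicator of the output `y`. -/
def hit (y : Bits n) (p : Skel n × (Site n → Bool)) : ℝ≥0∞ := if readout p.1 p.2 = y then 1 else 0

/-- Drawing all randomness in advance has the same effect as drawing it when needed, because step
`i` reads entry `i` only. A tape longer than the list of operations does no harm. -/
theorem expect_run (θ : Gates r) (ch : ℕ → Fin 5) (m cap : ℕ) (y : Bits n) (el : List (El n r))
    (j i : ℕ) (hj : el.length ≤ j) (τ : ℕ → ℤ) (p : Skel n × (Site n → Bool)) :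
    expect (iterK (tapeK m) j i τ) (fun τ' => hit y (runFrom θ ch (2 ^ m) cap τ' el i p)) = ENNReal.ofReal (law θ ch (2 ^ m) cap y el p) := by
  induction el generalizing j i τ p with
  | nil =>
    simp only [runFrom, law]
    unfold expect
    rw [ENNReal.tsum_mul_right, PMF.tsum_coe, one_mul]
    unfold hit
    split_ifs <;> simp
  | cons e el ih =>
    obtain ⟨j, rfl⟩ : ∃ j', j = j' + 1 := ⟨j - 1, by simp at hj; omega⟩
    simp only [iterK, tapeK]
    rw [expect_bind, expect_map, expect_iterK_bitK]
    simp only [law, runFrom, Function.comp]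
    rw [ENNReal.ofReal_div_of_pos (by positivity), ENNReal.ofReal_sum_of_nonneg
      fun u _ => law_nonneg _ _ _ _ _ _ _]
    push_cast
    rw [ENNReal.ofReal_pow (by norm_num), ENNReal.ofReal_ofNat]
    congr 1
    refine Finset.sum_congr rfl fun u _ => ?_
    rw [← ih j (i + 1) (by simpa using hj) (Function.update τ i (2 ^ m * 0 + (u : ℤ)))]
    refine expect_congr_support _ fun τ' hτ' => ?_
    have := iterK_support_agree m j (i + 1) _ _ hτ' i (by omega)
    rw [this]
    simp

/-! ### Straight-line programs -/

instance : Add Expr := ⟨Expr.add⟩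
instance : Sub Expr := ⟨Expr.sub⟩
instance : Mul Expr := ⟨Expr.mul⟩
instance : Div Expr := ⟨Expr.div⟩
instance : Mod Expr := ⟨Expr.mod⟩
instance (k : ℕ) : OfNat Expr k := ⟨Expr.lit k⟩

namespace Expr

variable (s : Store) (e f : Expr)

@[simp] theorem eval_add : (e + f).eval s = e.eval s + f.eval s := rfl
@[simp] theorem eval_sub : (e - f).eval s = e.eval s - f.eval s := rfl
@[simp] theorem eval_mul : (e * f).eval s = e.eval s * f.eval s := rfl
@[simp] theorem eval_div : (e / f).eval s = e.eval s / f.eval s := rfl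
@[simp] theorem eval_mod : (e % f).eval s = e.eval s % f.eval s := rfl
@[simp] theorem eval_ofNat (k : ℕ) [k.AtLeastTwo] :
    (no_index (OfNat.ofNat k) : Expr).eval s = OfNat.ofNat k := rfl
@[simp] theorem eval_zero : (0 : Expr).eval s = 0 := rfl
@[simp] theorem eval_one : (1 : Expr).eval s = 1 := rfl
@[simp] theorem eval_var (x : ℕ) : (var x).eval s = s.vars x := rfl
@[simp] theorem eval_get (a : ℕ) : (get a e).eval s = s.arrs a (e.eval s).toNat := rfl
@[simp] theorem eval_lt : (lt e f).eval s = if e.eval s < f.eval s then 1 else 0 := rfl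
@[simp] theorem eval_eq : (eq e f).eval s = if e.eval s = f.eval s then 1 else 0 := rfl

end Expr

namespace Prog

/-- The effect of a program without loops and random bits. -/
def run : Prog → Store → Store
  | set x e, s => s.setVar x (e.eval s)
  | store a i e, s => s.setArr a (i.eval s).toNat (e.eval s)
  | seq c d, s => d.run (c.run s)
  | _, s => s

/-- The numbers written by a program without loops and random bits have at most `B` bits. -/
def Ok (B : ℕ) : Prog → Store → Prop
  | skip, _ => True
  | set _ e, s => e.sz ≤ 60 ∧ (e.eval s).natAbs < 2 ^ B
  | store _ i e, s => (i.sz ≤ 60 ∧ e.sz ≤ 60) ∧ (e.eval s).natAbs < 2 ^ B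
  | seq c d, s => c.Ok B s ∧ d.Ok B (c.run s)
  | _, _ => False

end Prog

/-- For straight-line code, verification reduces to simplifying the final memory and checking that
every stored value fits into B bits. -/
theorem does_run {X B : ℕ} {c : Prog} {s : Store} {Q : Store → Prop} (hs : Bdd B s) (hc : c.Ok B s)
    (hQ : Q (c.run s)) : Does X B c s Q := by
  induction c generalizing s Q with
  | skip => exact does_skip hs hQ
  | set x e => exact does_set hs hc.1 hc.2 hQ
  | store a i e => exact does_store hs hc.1.1 hc.1.2 hc.2 hQ
  | flip x => exact hc.elim
  | seq c d ihc ihd =>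
    refine does_seq (P := fun s' => s' = c.run s) (ihc hs hc.1 rfl) ?_
    rintro s' hs' - rfl
    exact ihd hs' hc.2 hQ
  | ite b c d => exact hc.elim
  | _ b c => exact hc.elim

/-- Size bounds come from norms of complex amplitudes, whereas the machine stores integer real and
imaginary parts; this passes from one to the other. -/
theorem natAbs_lt_of_abs_le {B : ℕ} {z : ℤ} (e : ℕ) (h : |(z : ℝ)| ≤ 2 ^ e) (he : e < B) :
    z.natAbs < 2 ^ B := by
  have h1 : (z.natAbs : ℝ) ≤ 2 ^ e := by rwa [Nat.cast_natAbs, Int.cast_abs]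
  have h2 : z.natAbs ≤ 2 ^ e := by exact_mod_cast h1
  exact h2.trans_lt (Nat.pow_lt_pow_right (by norm_num) he)

/-- A truth value as an integer. -/
def bit (b : Bool) : ℤ := if b then 1 else 0

@[simp] theorem bit_true : bit true = 1 := rfl
@[simp] theorem bit_false : bit false = 0 := rfl

theorem bit_decide (p : Prop) [Decidable p] : bit (decide p) = if p then 1 else 0 := by
  by_cases h : p <;> simp [h]

theorem natAbs_bit_lt {B : ℕ} (hB : 0 < B) (b : Bool) : (bit b).natAbs < 2 ^ B := by
  have : 1 < 2 ^ B := Nat.one_lt_two_pow (by omega)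
  cases b
  · simp
  · simpa using this

/-! ### Representation of the sampler in memory -/

/-- The array `4`: the current sites. -/
def CurRep (k : Skel n) (s : Store) : Prop := ∀ v : Fin n, s.arrs 4 v = enc (k.cur v)

/-- The array `5`: the pending flips. -/
def FlRep (k : Skel n) (s : Store) : Prop := ∀ v : Fin n, s.arrs 5 v = bit (k.fl v)

/-- The array `6`: the dephasing flags. -/
def DpRep (k : Skel n) (s : Store) : Prop := ∀ v : Fin n, s.arrs 6 v = bit (k.dp v)

/-- The array `7`: the bits at the sites. -/
def ZRep (z : Site n → Bool) (s : Store) : Prop := ∀ a : Site n, s.arrs 7 (enc a) = bit (z a)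

/-- The array `8`: the free sites. -/
def FreeRep (k : Skel n) (s : Store) : Prop :=
  ∀ a : Site n, s.arrs 8 (enc a) = bit (decide (a ∈ k.free))

/-- The arrays `11` to `14`: the factors; their number is in the variable `19`. -/
def FacsRep (F : List (Fac n)) (s : Store) : Prop :=
  s.vars 19 = F.length ∧ ∀ i (h : i < F.length), s.arrs 11 i = enc F[i].a ∧ s.arrs 12 i = enc F[i].b ∧
    ∀ x y : Bool, (s.arrs 13 (4 * i + 2 * x.toNat + y.toNat) : ℝ) = (F[i].val x y).re ∧
      (s.arrs 14 (4 * i + 2 * x.toNat + y.toNat) : ℝ) = (F[i].val x y).im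

theorem FacsRep.keep {F : List (Fac n)} {c : Prog} {s s' : Store} (h : FacsRep F s)
    (hk : Keep c s s') (hv : 19 ∉ c.wv) (h1 : 11 ∉ c.wa) (h2 : 12 ∉ c.wa) (h3 : 13 ∉ c.wa)
    (h4 : 14 ∉ c.wa) : FacsRep F s' := by
  unfold FacsRep
  rw [hk.1 _ hv, hk.2 _ h1, hk.2 _ h2, hk.2 _ h3, hk.2 _ h4]
  exact h

/-- Append the factor whose sites are in the variables `25`, `26` and whose values are in the
variables `27` to `34`. -/
def pFac : Prog :=
  .seq (.store 11 (.var 19) (.var 25)) <| .seq (.store 12 (.var 19) (.var 26)) <|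
  .seq (.store 13 (4 * .var 19) (.var 27)) <| .seq (.store 13 (4 * .var 19 + 1) (.var 28)) <|
  .seq (.store 13 (4 * .var 19 + 2) (.var 29)) <| .seq (.store 13 (4 * .var 19 + 3) (.var 30)) <|
  .seq (.store 14 (4 * .var 19) (.var 31)) <| .seq (.store 14 (4 * .var 19 + 1) (.var 32)) <|
  .seq (.store 14 (4 * .var 19 + 2) (.var 33)) <| .seq (.store 14 (4 * .var 19 + 3) (.var 34)) <|
  .set 19 (.var 19 + 1)

/-- The variables `25` to `34` describe a factor. -/
def VarsFac (f : Fac n) (s : Store) : Prop :=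
  s.vars 25 = enc f.a ∧ s.vars 26 = enc f.b ∧
  (((s.vars 27 : ℝ) = (f.val false false).re ∧ (s.vars 28 : ℝ) = (f.val false true).re ∧
    (s.vars 29 : ℝ) = (f.val true false).re ∧ (s.vars 30 : ℝ) = (f.val true true).re) ∧
   ((s.vars 31 : ℝ) = (f.val false false).im ∧ (s.vars 32 : ℝ) = (f.val false true).im ∧
    (s.vars 33 : ℝ) = (f.val true false).im ∧ (s.vars 34 : ℝ) = (f.val true true).im))

theorem does_pFac {X B : ℕ} {s : Store} (hs : Bdd B s) {F : List (Fac n)} {f : Fac n}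
    (hF : FacsRep F s) (hf : VarsFac f s) (hB : F.length + 1 < 2 ^ B) :
    Does X B pFac s (FacsRep (F ++ [f])) := by
  obtain ⟨h19, hF⟩ := hF
  obtain ⟨h25, h26, ⟨h27, h28, h29, h30⟩, h31, h32, h33, h34⟩ := hf
  have e0 : (4 * (F.length : ℤ)).toNat = 4 * F.length := by omega
  have e1 : (4 * (F.length : ℤ) + 1).toNat = 4 * F.length + 1 := by omega
  have e2 : (4 * (F.length : ℤ) + 2).toNat = 4 * F.length + 2 := by omega
  have e3 : (4 * (F.length : ℤ) + 3).toNat = 4 * F.length + 3 := by omega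
  have hB' : ((F.length : ℤ) + 1).natAbs < 2 ^ B := by
    have : ((F.length : ℤ) + 1).natAbs = F.length + 1 := by omega
    rwa [this]
  refine does_run hs ?_ ?_
  · have hv := hs.1
    simp only [pFac, Prog.Ok, Prog.run, Store.setArr_vars, Expr.eval_var, Expr.eval_add,
      Expr.eval_one, h19]
    refine ⟨⟨by decide, hv _⟩, ⟨by decide, hv _⟩, ⟨by decide, hv _⟩, ⟨by decide, hv _⟩,
      ⟨by decide, hv _⟩, ⟨by decide, hv _⟩, ⟨by decide, hv _⟩, ⟨by decide, hv _⟩,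
      ⟨by decide, hv _⟩, ⟨by decide, hv _⟩, by decide, hB'⟩
  · simp only [pFac, Prog.run, FacsRep]
    refine ⟨by simp [h19], fun i hi => ?_⟩
    rcases Nat.lt_or_ge i F.length with hlt | hge
    · obtain ⟨g1, g2, g3⟩ := hF i hlt
      refine ⟨?_, ?_, fun x y => ?_⟩
      · simp [h19, hlt.ne, g1, List.getElem_append_left hlt]
      · simp [h19, hlt.ne, g2, List.getElem_append_left hlt]
      · rw [List.getElem_append_left hlt, ← (g3 x y).1, ← (g3 x y).2]
        have hx := x.toNat_le
        have hy := y.toNat_le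
        have d0 : 4 * i + 2 * x.toNat + y.toNat ≠ 4 * F.length := by omega
        have d1 : 4 * i + 2 * x.toNat + y.toNat ≠ 4 * F.length + 1 := by omega
        have d2 : 4 * i + 2 * x.toNat + y.toNat ≠ 4 * F.length + 2 := by omega
        have d3 : 4 * i + 2 * x.toNat + y.toNat ≠ 4 * F.length + 3 := by omega
        constructor <;> simp [h19, e0, e1, e2, e3, d0, d1, d2, d3]
    · have hi' : i = F.length := by simp at hi; omega
      subst hi'
      refine ⟨?_, ?_, fun x y => ?_⟩
      · simp [h19, h25]
      · simp [h19, h26]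
      · cases x <;> cases y <;> constructor <;>
          simp [*]

/-! ### Sampling a bit -/

/-- The data from which the bit at the site `a` is sampled. -/
structure SampleEnv (X B m cap NS : ℕ) (k : Skel n) (z : Site n → Bool) (a : Site n) (s : Store) :
    Prop where
  facs : FacsRep k.facs s
  free : FreeRep k s
  bits : ZRep z s
  site : s.vars 26 = enc a
  size : s.vars 10 = NS
  facs_lt : ∀ f ∈ k.facs, enc f.a < NS ∧ enc f.b < NS
  free_lt : ∀ b ∈ k.free, enc b < NS
  site_lt : enc a < NS
  norm_le : ∀ f ∈ k.facs, ∀ x y, ‖f.val x y‖ ≤ 2 ^ (m + 1)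
  bound : (m + 1) * k.facs.length + k.facs.length + cap + NS + 4 ≤ B
  size_le : NS ≤ X
  length_le : k.facs.length ≤ X
  cap_le : cap ≤ X

/-! ### Marking a cluster and ranking its members -/

section

variable {X B m cap NS : ℕ} {k : Skel n} {z : Site n → Bool} {a : Site n} {s s' : Store}

/-- Variables from 40 on and the arrays 9, 10, 15 are scratch space of the bit sampler; its data lie
elsewhere. -/
theorem SampleEnv.keep {c : Prog} (h : SampleEnv X B m cap NS k z a s) (hk : Keep c s s')
    (hv : ∀ x ∈ c.wv, 40 ≤ x) (ha : ∀ b ∈ c.wa, b = 9 ∨ b = 10 ∨ b = 15) :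
    SampleEnv X B m cap NS k z a s' := by
  have hv' : ∀ x, x < 40 → x ∉ c.wv := fun x hx h => by have := hv x h; omega
  have ha' : ∀ b, ¬ (b = 9 ∨ b = 10 ∨ b = 15) → b ∉ c.wa := fun b hb h => hb (ha b h)
  refine { h with facs := ?_, free := ?_, bits := ?_, site := ?_, size := ?_ }
  · exact h.facs.keep hk (hv' _ (by decide)) (ha' _ (by decide)) (ha' _ (by decide))
      (ha' _ (by decide)) (ha' _ (by decide))
  · intro b; rw [hk.2 _ (ha' _ (by decide))]; exact h.free b
  · intro b; rw [hk.2 _ (ha' _ (by decide))]; exact h.bits b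
  · rw [hk.1 _ (hv' _ (by decide))]; exact h.site
  · rw [hk.1 _ (hv' _ (by decide))]; exact h.size

/-- The array `9` marks the members of `S`. -/
def MkRep (NS : ℕ) (S : Finset (Site n)) (s : Store) : Prop :=
  ∀ a : Site n, enc a < NS → s.arrs 9 (enc a) = bit (decide (a ∈ S))

theorem lt_two_pow_of_le {B x : ℕ} (hx : x ≤ B) : x < 2 ^ B :=
  hx.trans_lt Nat.lt_two_pow_self

def pClear : Prog := .loop 41 10 (.store 9 (.var 41) 0)

theorem does_pClear (hs : Bdd B s) (h : SampleEnv X B m cap NS k z a s) :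
    Does X B pClear s (MkRep NS (∅ : Finset (Site n))) := by
  have hb := h.bound
  refine (does_loop (by decide) (by decide) (by decide) hs h.size h.size_le (lt_two_pow_of_le (by omega))
    (fun i s' => ∀ b : Site n, enc b < i → s'.arrs 9 (enc b) = 0) (by simp) ?_).mono ?_
  · intro i hi s' hs' hk hi' hI
    refine does_run hs' ⟨⟨by decide, by decide⟩, by simp⟩ ?_
    intro b hbi
    simp only [Prog.run, Expr.eval_var, hi', Int.toNat_natCast, Expr.eval_zero,
      Store.setVar_arrs, Store.setArr_arrs, if_true, Function.update_apply]
    split_ifs with h1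
    · rfl
    · exact hI b (by omega)
  · intro s' _ _ hI b hb
    rw [hI b hb]; simp

def Skel.mark (k : Skel n) (S : Finset (Site n)) (a b : Site n) : Finset (Site n) :=
  if a ∈ S ∧ b ∈ k.free then insert b S else S

/-- With marks in {0, 1}, positivity of mark(c) + mark(b)·free(c) computes "marked already, or
linked to a marked site and free". -/
theorem mkRep_mark {S : Finset (Site n)} (h : MkRep NS S s) (hf : FreeRep k s) {b c : Site n}
    (hb : enc b < NS) (hc : enc c < NS) :
    MkRep NS (k.mark S b c) (s.setArr 9 (enc c)
      (if 0 < s.arrs 9 (enc c) + s.arrs 9 (enc b) * s.arrs 8 (enc c) then 1 else 0)) := by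
  intro x hx
  rw [Store.setArr_arrs, if_pos rfl, Function.update_apply, h b hb, h c hc, hf c]
  unfold Skel.mark
  by_cases hxc : x = c
  · subst hxc
    rw [if_pos rfl]
    by_cases h1 : b ∈ S <;> by_cases h2 : x ∈ k.free <;> by_cases h3 : x ∈ S <;> simp [h1, h2, h3]
  · rw [if_neg fun he => hxc (enc_injective he), h x hx]
    split_ifs <;> simp [hxc]

def pAbsorb : Prog :=
  .seq (.store 9 (.get 12 (.var 43)) (.lt 0 (.get 9 (.get 12 (.var 43))
    + .get 9 (.get 11 (.var 43)) * .get 8 (.get 12 (.var 43)))))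
  (.store 9 (.get 11 (.var 43)) (.lt 0 (.get 9 (.get 11 (.var 43))
    + .get 9 (.get 12 (.var 43)) * .get 8 (.get 11 (.var 43)))))

theorem natAbs_ite_lt (hB : 0 < B) (p : Prop) [Decidable p] :
    (if p then 1 else 0 : ℤ).natAbs < 2 ^ B := by
  have := natAbs_bit_lt hB (decide p)
  unfold bit at this
  simpa using this

theorem does_pAbsorb (hs : Bdd B s) (h : SampleEnv X B m cap NS k z a s) {S : Finset (Site n)}
    (hS : MkRep NS S s) {i : ℕ} (hi : i < k.facs.length) (h43 : s.vars 43 = i) :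
    Does X B pAbsorb s (MkRep NS (k.absorb S k.facs[i])) := by
  have hb := h.bound
  obtain ⟨g1, g2, -⟩ := h.facs.2 i hi
  obtain ⟨l1, l2⟩ := h.facs_lt _ (List.getElem_mem hi)
  have key := mkRep_mark hS h.free l1 l2
  set s1 := s.setArr 9 (enc k.facs[i].b) (if 0 < s.arrs 9 (enc k.facs[i].b)
    + s.arrs 9 (enc k.facs[i].a) * s.arrs 8 (enc k.facs[i].b) then 1 else 0) with hs1
  have hr : Prog.run (.store 9 (.get 12 (.var 43)) (.lt 0 (.get 9 (.get 12 (.var 43))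
    + .get 9 (.get 11 (.var 43)) * .get 8 (.get 12 (.var 43))))) s = s1 := by
    simp [Prog.run, h43, g1, g2, hs1]
  have hfree : FreeRep k s1 := h.free
  have g1' : s1.arrs 11 i = enc k.facs[i].a := g1
  have g2' : s1.arrs 12 i = enc k.facs[i].b := g2
  have h43' : s1.vars 43 = i := h43
  refine does_run hs ⟨⟨⟨by decide, by decide⟩, ?_⟩, ⟨⟨by decide, by decide⟩, ?_⟩⟩ ?_
  · exact natAbs_ite_lt (by omega) _
  · exact natAbs_ite_lt (by omega) _
  · have := mkRep_mark key hfree l2 l1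
    simp only [pAbsorb, Prog.run.eq_3]
    rw [hr]
    simp only [Prog.run, Expr.eval_get, Expr.eval_var, h43', Int.toNat_natCast, g1', g2',
      Expr.eval_lt, Expr.eval_add, Expr.eval_mul, Expr.eval_zero]
    exact this

def pPass : Prog := .loop 43 19 pAbsorb

theorem does_pPass (hs : Bdd B s) (h : SampleEnv X B m cap NS k z a s) {S : Finset (Site n)}
    (hS : MkRep NS S s) : Does X B pPass s (MkRep NS (k.pass S)) := by
  have hb := h.bound
  refine (does_loop (by decide) (by decide) (by decide) hs h.facs.1 h.length_le
    (lt_two_pow_of_le (by omega)) (fun i s' => MkRep NS ((k.facs.take i).foldl k.absorb S) s')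
    hS ?_).mono ?_
  · intro i hi s' hs' hk hi' hI
    refine (does_pAbsorb hs' (h.keep hk (by decide) (by decide)) hI hi hi').mono ?_
    intro s'' _ _ hQ
    rw [List.take_succ_eq_append_getElem hi, List.foldl_append]
    exact hQ
  · intro s' _ _ hI
    rwa [List.take_length] at hI

/-- The number of passes is the number of site codes, in variable 10, which bounds the size of any
cluster. -/
def pMark : Prog := .seq pClear <| .seq (.store 9 (.var 26) 1) (.loop 42 10 pPass)

theorem card_cluster_le (h : SampleEnv X B m cap NS k z a s) : (k.cluster a).card ≤ NS := by
  have : (k.cluster a).image enc ⊆ Finset.range NS := by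
    intro x hx
    obtain ⟨b, hb, rfl⟩ := Finset.mem_image.1 hx
    rw [Finset.mem_range]
    rcases Finset.mem_insert.1 (mem_cluster.1 hb).1 with rfl | hb
    · exact h.site_lt
    · exact h.free_lt b hb
  have := Finset.card_le_card this
  rwa [Finset.card_image_of_injective _ enc_injective, Finset.card_range] at this

theorem does_pMark (hs : Bdd B s) (h : SampleEnv X B m cap NS k z a s) :
    Does X B pMark s (MkRep NS (k.cluster a)) := by
  have hb := h.bound
  refine does_seq (does_pClear hs h) ?_
  intro s1 hs1 k1 h1
  have e1 := h.keep k1 (by decide) (by decide)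
  refine does_seq (P := MkRep NS {a}) (does_run hs1 ⟨⟨by decide, by decide⟩, ?_⟩ ?_) ?_
  · exact natAbs_bit_lt (by omega) true
  · intro x hx
    simp only [Prog.run, Expr.eval_var, e1.site, Int.toNat_natCast, Store.setArr_arrs, if_true,
      Function.update_apply, Expr.eval_one]
    by_cases hxa : x = a
    · simp [hxa]
    · rw [if_neg fun he => hxa (enc_injective he), h1 x hx]; simp [hxa]
  · intro s2 hs2 k2 h2
    have e2 := e1.keep k2 (by decide) (by decide)
    refine (does_loop (by decide) (by decide) (by decide) hs2 e2.size e2.size_le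
      (lt_two_pow_of_le (by omega)) (fun i s' => MkRep NS (k.pass^[i] {a}) s') h2 ?_).mono ?_
    · intro i hi s' hs' hk hi' hI
      refine (does_pPass hs' (e2.keep hk (by decide) (by decide)) hI).mono ?_
      intro s'' _ _ hQ
      rw [Function.iterate_succ_apply']
      exact hQ
    · intro s' _ _ hI
      rwa [iterate_pass_eq_cluster k a (card_cluster_le h)] at hI

/-- A running power of two, doubled after each marked site: its value on reaching a member is that
member's place value, and its final value is the number of assignments of the cluster. -/
def pRank : Prog :=
  .seq (.set 40 1) <| .loop 41 10 <| .seq (.store 10 (.var 41) (.var 40))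
    (.set 40 (.var 40 * (1 + .get 9 (.var 41))))

/-- The array `10` holds the place values of the members of `C`. -/
def RankRep (C : Finset (Site n)) (s : Store) : Prop :=
  ∀ b ∈ C, s.arrs 10 (enc b) = 2 ^ rank C (enc b)

theorem rank_succ (C : Finset (Site n)) (b : Site n) :
    rank C (enc b + 1) = rank C (enc b) + if b ∈ C then 1 else 0 := by
  unfold rank
  have : (C.filter fun c => enc c < enc b + 1)
      = (C.filter fun c => enc c < enc b) ∪ C.filter fun c => c = b := by
    ext c
    simp only [Finset.mem_union, Finset.mem_filter]
    constructor
    · rintro ⟨h1, h2⟩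
      by_cases hc : c = b
      · exact Or.inr ⟨h1, hc⟩
      · have : enc c ≠ enc b := fun he => hc (enc_injective he)
        exact Or.inl ⟨h1, by omega⟩
    · rintro (⟨h1, h2⟩ | ⟨h1, rfl⟩)
      · exact ⟨h1, by omega⟩
      · exact ⟨h1, by omega⟩
  rw [this, Finset.card_union_of_disjoint]
  · congr 1
    rw [Finset.filter_eq']
    split_ifs <;> simp
  · rw [Finset.disjoint_filter]
    rintro c - h1 rfl
    omega

theorem rank_le_card (C : Finset (Site n)) (i : ℕ) : rank C i ≤ C.card :=
  Finset.card_le_card (Finset.filter_subset _ _)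

theorem cluster_lt (h : SampleEnv X B m cap NS k z a s) : ∀ b ∈ k.cluster a, enc b < NS := by
  intro b hb
  rcases Finset.mem_insert.1 (mem_cluster.1 hb).1 with rfl | hb
  · exact h.site_lt
  · exact h.free_lt b hb

theorem does_pRank (hs : Bdd B s) (h : SampleEnv X B m cap NS k z a s)
    (hm : MkRep NS (k.cluster a) s) :
    Does X B pRank s fun s' => RankRep (k.cluster a) s' ∧ s'.vars 40 = 2 ^ (k.cluster a).card := by
  have hb := h.bound
  refine does_seq (P := fun s' => s'.vars 40 = 1)
    (does_run hs ⟨by decide, natAbs_bit_lt (by omega) true⟩ (by simp [Prog.run])) ?_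
  intro s1 hs1 k1 h1
  have e1 := h.keep k1 (by decide) (by decide)
  have hm1 : MkRep NS (k.cluster a) s1 := by
    intro b hb; rw [k1.2 _ (by decide)]; exact hm b hb
  refine (does_loop (by decide) (by decide) (by decide) hs1 e1.size e1.size_le
    (lt_two_pow_of_le (by omega)) (fun i s' => s'.vars 40 = 2 ^ rank (k.cluster a) i ∧
      ∀ b ∈ k.cluster a, enc b < i → s'.arrs 10 (enc b) = 2 ^ rank (k.cluster a) (enc b))
    ⟨by simp [h1, rank], by simp⟩ ?_).mono ?_
  · rintro i hi s' hs' hk hi' ⟨h40, hI⟩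
    obtain ⟨b, rfl⟩ := exists_enc_eq a.1.pos i
    have h9 : s'.arrs 9 (enc b) = bit (decide (b ∈ k.cluster a)) := by
      rw [hk.2 _ (by decide)]; exact hm1 b hi
    have hval : (2 : ℤ) ^ rank (k.cluster a) (enc b) * (1 + bit (decide (b ∈ k.cluster a)))
        = 2 ^ rank (k.cluster a) (enc b + 1) := by
      rw [rank_succ]
      by_cases hc : b ∈ k.cluster a
      · simp [hc, pow_succ]
      · simp [hc]
    have hlt : ((2 : ℤ) ^ rank (k.cluster a) (enc b + 1)).natAbs < 2 ^ B := by
      rw [Int.natAbs_pow]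
      have := (rank_le_card (k.cluster a) (enc b + 1)).trans (card_cluster_le h)
      exact Nat.pow_lt_pow_right (by norm_num) (by omega)
    refine does_run hs' ⟨⟨⟨by decide, by decide⟩, hs'.1 _⟩, by decide, ?_⟩ ⟨?_, ?_⟩
    · simpa [Prog.run, h40, hi', h9, hval] using hlt
    · simp [Prog.run, h40, hi', h9, hval]
    · intro c hc hcb
      simp only [Prog.run, Expr.eval_var, hi', Int.toNat_natCast, Store.setVar_arrs,
        Store.setArr_arrs, if_true, Function.update_apply, h40]
      split_ifs with h1
      · rw [h1]
      · exact hI c hc (by omega)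
  · rintro s' _ _ ⟨h40, hI⟩
    refine ⟨fun b hb => hI b hb (cluster_lt h b hb), ?_⟩
    rw [h40]
    unfold rank
    rw [Finset.filter_true_of_mem (cluster_lt h)]

end

/-! ### Evaluating one assignment of a cluster -/

section

variable {X B m cap NS : ℕ} {k : Skel n} {z : Site n → Bool} {a : Site n} {s s' : Store}

/-- The mark acts as a selector: members of the cluster get a binary digit of the counter in
variable 44, all other sites keep their stored bit. -/
def pFill : Prog :=
  .loop 41 10 <| .store 15 (.var 41) (.get 9 (.var 41) * ((.var 44 / .get 10 (.var 41)) % 2)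
    + (1 - .get 9 (.var 41)) * .get 7 (.var 41))

/-- The array `15` holds the bits of `x`. -/
def XRep (NS : ℕ) (x : Site n → Bool) (s : Store) : Prop :=
  ∀ b : Site n, enc b < NS → s.arrs 15 (enc b) = bit (x b)

theorem bit_decide_mod (t : ℕ) : bit (decide (t % 2 = 1)) = ((t % 2 : ℕ) : ℤ) := by
  rcases Nat.mod_two_eq_zero_or_one t with h | h <;> simp [h]

theorem does_pFill (hs : Bdd B s) (h : SampleEnv X B m cap NS k z a s)
    (hm : MkRep NS (k.cluster a) s) (hr : RankRep (k.cluster a) s) {t : ℕ} (ht : s.vars 44 = t) :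
    Does X B pFill s (XRep NS (digits (k.cluster a) z t)) := by
  have hb := h.bound
  refine (does_loop (by decide) (by decide) (by decide) hs h.size h.size_le
    (lt_two_pow_of_le (by omega)) (fun i s' => ∀ b : Site n, enc b < i →
      s'.arrs 15 (enc b) = bit (digits (k.cluster a) z t b)) (by simp) ?_).mono ?_
  · intro i hi s' hs' hk hi' hI
    obtain ⟨b, rfl⟩ := exists_enc_eq a.1.pos i
    have hval : (Expr.get 9 (.var 41) * ((.var 44 / .get 10 (.var 41)) % 2)
        + (1 - .get 9 (.var 41)) * .get 7 (.var 41)).eval s' = bit (digits (k.cluster a) z t b) := by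
      simp only [Expr.eval_add, Expr.eval_mul, Expr.eval_get, Expr.eval_var, Expr.eval_mod,
        Expr.eval_div, Expr.eval_sub, Expr.eval_one, Expr.eval_ofNat, hi', Int.toNat_natCast]
      rw [hk.1 44 (by decide), hk.2 9 (by decide), hk.2 10 (by decide), hk.2 7 (by decide),
        hm b hi, h.bits b, ht]
      unfold digits
      by_cases hc : b ∈ k.cluster a
      · rw [hr b hc, if_pos hc, bit_decide_mod]
        simp [hc]
      · simp [hc]
    refine does_run hs' ⟨⟨by decide, by decide⟩, ?_⟩ ?_
    · rw [hval]; exact natAbs_bit_lt (by omega) _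
    · intro c hcb
      simp only [Prog.run]
      rw [hval]
      simp only [Expr.eval_var, hi', Int.toNat_natCast, Store.setVar_arrs, Store.setArr_arrs,
        if_true, Function.update_apply]
      split_ifs with h1
      · rw [enc_injective h1]
      · exact hI c (by omega)
  · exact fun s' _ _ hI b hb => hI b hb

/-- The variables `45` and `46` hold the real and the imaginary part of `w`. -/
def AccRep (w : ℂ) (s : Store) : Prop := (s.vars 45 : ℝ) = w.re ∧ (s.vars 46 : ℝ) = w.im

/-- A complex multiplication without branching. Variable 54 tells whether the factor touches the
cluster; if not, it is replaced by 1. -/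
def pFactor : Prog :=
  .seq (.set 54 (.lt 0 (.get 9 (.get 11 (.var 43)) + .get 9 (.get 12 (.var 43))))) <|
  .seq (.set 56 (4 * .var 43 + 2 * .get 15 (.get 11 (.var 43)) + .get 15 (.get 12 (.var 43)))) <|
  .seq (.set 51 ((1 - .var 54) + .var 54 * .get 13 (.var 56))) <|
  .seq (.set 52 (.var 54 * .get 14 (.var 56))) <|
  .seq (.set 53 (.var 45 * .var 51 - .var 46 * .var 52)) <|
  .seq (.set 46 (.var 45 * .var 52 + .var 46 * .var 51)) <|
  .set 45 (.var 53)

/-- The value of a factor if it touches `C`, and `1` otherwise. -/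
def gated (C : Finset (Site n)) (f : Fac n) (x : Site n → Bool) : ℂ :=
  if f.a ∈ C ∨ f.b ∈ C then f.val (x f.a) (x f.b) else 1

theorem amp_touching_eq (C : Finset (Site n)) (F : List (Fac n)) (x : Site n → Bool) :
    amp (touching C F) x = (F.map fun f => gated C f x).prod := by
  induction F with
  | nil => rfl
  | cons f F ih =>
    rw [List.map_cons, List.prod_cons, ← ih]
    unfold touching gated amp
    by_cases h : f.a ∈ C ∨ f.b ∈ C
    · rw [if_pos h, List.filter_cons_of_pos (by simpa using h)]; simp
    · rw [if_neg h, List.filter_cons_of_neg (by simpa using h)]; simp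

theorem norm_gated_le {F : List (Fac n)} (hF : ∀ f ∈ F, ∀ x y, ‖f.val x y‖ ≤ 2 ^ (m + 1))
    (C : Finset (Site n)) {f : Fac n} (hf : f ∈ F) (x : Site n → Bool) :
    ‖gated C f x‖ ≤ 2 ^ (m + 1) := by
  unfold gated
  split_ifs
  · exact hF f hf _ _
  · rw [norm_one]; exact one_le_pow₀ (by norm_num)

/-- Each factor contributes at most m + 1 bits. Applied to initial segments of the list, this bounds
every intermediate product. -/
theorem norm_amp_touching_le {F : List (Fac n)}
    (hF : ∀ f ∈ F, ∀ x y, ‖f.val x y‖ ≤ 2 ^ (m + 1)) (C : Finset (Site n)) (x : Site n → Bool) :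
    ‖amp (touching C F) x‖ ≤ 2 ^ ((m + 1) * F.length) := by
  rw [amp_touching_eq]
  induction F with
  | nil => simp
  | cons f F ih =>
    rw [List.map_cons, List.prod_cons, norm_mul, List.length_cons, mul_add, mul_one, add_comm,
      pow_add]
    exact mul_le_mul (norm_gated_le hF C List.mem_cons_self x)
      (ih fun g hg => hF g (List.mem_cons_of_mem _ hg)) (norm_nonneg _) (by positivity)

theorem does_pFactor (hs : Bdd B s) (h : SampleEnv X B m cap NS k z a s) {C : Finset (Site n)}
    {x : Site n → Bool} (hm : MkRep NS C s) (hx : XRep NS x s) {i : ℕ} (hi : i < k.facs.length)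
    (h43 : s.vars 43 = i) {w : ℂ} (hw : AccRep w s) {e : ℕ} (he : e < B)
    (hle : ‖w * gated C k.facs[i] x‖ ≤ 2 ^ e) :
    Does X B pFactor s (AccRep (w * gated C k.facs[i] x)) := by
  have hb := h.bound
  obtain ⟨g1, g2, g3⟩ := h.facs.2 i hi
  obtain ⟨l1, l2⟩ := h.facs_lt _ (List.getElem_mem hi)
  have hn := h.norm_le _ (List.getElem_mem hi)
  set f := k.facs[i] with hf
  obtain ⟨v1, v2⟩ := g3 (x f.a) (x f.b)
  set j := 4 * i + 2 * (x f.a).toNat + (x f.b).toNat with hj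
  have hidx : 4 * (i : ℤ) + 2 * bit (x f.a) + bit (x f.b) = j := by
    rw [hj]; cases x f.a <;> cases x f.b <;> simp
  have hjlt : (j : ℤ).natAbs < 2 ^ B := by
    have h1 := (x f.a).toNat_le
    have h2 := (x f.b).toNat_le
    have h3 : k.facs.length < 2 ^ k.facs.length := Nat.lt_two_pow_self
    have h4 : 2 ^ (k.facs.length + 4) ≤ 2 ^ B := Nat.pow_le_pow_right (by norm_num) (by omega)
    rw [pow_add] at h4
    have h5 : j < 2 ^ B := by
      refine lt_of_lt_of_le ?_ h4
      rw [hj]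
      omega
    exact h5
  have hgate : (if 0 < bit (decide (f.a ∈ C)) + bit (decide (f.b ∈ C)) then 1 else 0 : ℤ)
      = bit (decide (f.a ∈ C ∨ f.b ∈ C)) := by
    by_cases h1 : f.a ∈ C <;> by_cases h2 : f.b ∈ C <;> simp [h1, h2]
  set q : Bool := decide (f.a ∈ C ∨ f.b ∈ C) with hq
  have hgre : ((1 - bit q + bit q * s.arrs 13 j : ℤ) : ℝ) = (gated C f x).re := by
    unfold gated
    by_cases h1 : f.a ∈ C ∨ f.b ∈ C
    · simp [hq, h1, v1]
    · simp [hq, h1]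
  have hgim : ((bit q * s.arrs 14 j : ℤ) : ℝ) = (gated C f x).im := by
    unfold gated
    by_cases h1 : f.a ∈ C ∨ f.b ∈ C
    · simp [hq, h1, v2]
    · simp [hq, h1]
  have hBpos : 0 < B := by omega
  have hpr : (1 - bit q + bit q * s.arrs 13 j).natAbs < 2 ^ B := by
    cases q
    · simpa using natAbs_bit_lt hBpos true
    · simpa using hs.2 13 j
  have hpi : (bit q * s.arrs 14 j).natAbs < 2 ^ B := by
    cases q
    · simp
    · simpa using hs.2 14 j
  have hre : ((s.vars 45 * (1 - bit q + bit q * s.arrs 13 j) - s.vars 46 * (bit q * s.arrs 14 j) : ℤ)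
      : ℝ) = (w * gated C f x).re := by
    rw [Int.cast_sub, Int.cast_mul, Int.cast_mul, hgre, hgim, hw.1, hw.2, Complex.mul_re]
  have him : ((s.vars 45 * (bit q * s.arrs 14 j) + s.vars 46 * (1 - bit q + bit q * s.arrs 13 j) : ℤ)
      : ℝ) = (w * gated C f x).im := by
    rw [Int.cast_add, Int.cast_mul, Int.cast_mul (s.vars 46), hgre, hgim, hw.1, hw.2, Complex.mul_im]
  have hreb : (s.vars 45 * (1 - bit q + bit q * s.arrs 13 j)
      - s.vars 46 * (bit q * s.arrs 14 j)).natAbs < 2 ^ B := by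
    refine natAbs_lt_of_abs_le e ?_ he
    rw [hre]; exact (Complex.abs_re_le_norm _).trans hle
  have himb : (s.vars 45 * (bit q * s.arrs 14 j)
      + s.vars 46 * (1 - bit q + bit q * s.arrs 13 j)).natAbs < 2 ^ B := by
    refine natAbs_lt_of_abs_le e ?_ he
    rw [him]; exact (Complex.abs_im_le_norm _).trans hle
  have hbq : (bit q).natAbs < 2 ^ B := natAbs_bit_lt (by omega) q
  refine does_run hs ?_ ⟨?_, ?_⟩
  · simp only [pFactor, Prog.Ok, Prog.run, Expr.eval_lt, Expr.eval_zero, Expr.eval_one,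
      Expr.eval_add, Expr.eval_sub, Expr.eval_mul, Expr.eval_get, Expr.eval_var, Expr.eval_ofNat,
      Store.setVar_arrs, Store.setVar_vars, Nat.reduceEqDiff, reduceIte, h43, Int.toNat_natCast, g1,
      g2, hm _ l1, hm _ l2, hgate, hx _ l1, hx _ l2, hidx]
    exact ⟨⟨by decide, hbq⟩, ⟨by decide, hjlt⟩, ⟨by decide, hpr⟩, ⟨by decide, hpi⟩,
      ⟨by decide, hreb⟩, ⟨by decide, himb⟩, by decide, hreb⟩
  · rw [← hre]
    simp [pFactor, Prog.run, h43, g1, g2, hm _ l1, hm _ l2, hgate, hx _ l1, hx _ l2, hidx]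
  · rw [← him]
    simp [pFactor, Prog.run, h43, g1, g2, hm _ l1, hm _ l2, hgate, hx _ l1, hx _ l2, hidx]

def pProd : Prog := .seq (.set 45 1) <| .seq (.set 46 0) <| .loop 43 19 pFactor

theorem does_pProd (hs : Bdd B s) (h : SampleEnv X B m cap NS k z a s) {C : Finset (Site n)}
    {x : Site n → Bool} (hm : MkRep NS C s) (hx : XRep NS x s) :
    Does X B pProd s (AccRep (amp (touching C k.facs) x)) := by
  have hb := h.bound
  refine does_seq (P := fun s' => s'.vars 45 = 1)
    (does_run hs ⟨by decide, natAbs_bit_lt (by omega) true⟩ (by simp [Prog.run])) ?_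
  intro s1 hs1 k1 h1
  refine does_seq (P := fun s' => s'.vars 45 = 1 ∧ s'.vars 46 = 0)
    (does_run hs1 ⟨by decide, by simp⟩ (by simp [Prog.run, h1])) ?_
  intro s2 hs2 k2 h2
  have e2 := (h.keep k1 (by decide) (by decide)).keep k2 (by decide) (by decide)
  have hm2 : MkRep NS C s2 := by
    intro b hb; rw [k2.2 _ (by decide), k1.2 _ (by decide)]; exact hm b hb
  have hx2 : XRep NS x s2 := by
    intro b hb; rw [k2.2 _ (by decide), k1.2 _ (by decide)]; exact hx b hb
  refine (does_loop (by decide) (by decide) (by decide) hs2 e2.facs.1 h.length_le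
    (lt_two_pow_of_le (by omega))
    (fun i s' => AccRep (amp (touching C (k.facs.take i)) x) s') ?_ ?_).mono ?_
  · simp [AccRep, h2, touching, amp]
  · intro i hi s' hs' hk hi' hI
    have hstep : amp (touching C (k.facs.take (i + 1))) x
        = amp (touching C (k.facs.take i)) x * gated C k.facs[i] x := by
      rw [amp_touching_eq, amp_touching_eq, List.take_succ_eq_append_getElem hi, List.map_append,
        List.prod_append, List.map_singleton, List.prod_singleton]
    have hle := norm_amp_touching_le (m := m) (F := k.facs.take (i + 1))
      (fun f hf => h.norm_le f (List.mem_of_mem_take hf)) C x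
    rw [hstep] at hle
    have hlen : (m + 1) * (k.facs.take (i + 1)).length ≤ (m + 1) * k.facs.length :=
      Nat.mul_le_mul_left _ (List.length_take_le' _ _)
    have hm' : MkRep NS C s' := by
      intro b hb; rw [hk.2 _ (by decide)]; exact hm2 b hb
    have hx' : XRep NS x s' := by
      intro b hb; rw [hk.2 _ (by decide)]; exact hx2 b hb
    refine (does_pFactor hs' (e2.keep hk (by decide) (by decide)) hm' hx' hi hi' hI
      (by omega) hle).mono ?_
    intro s'' _ _ hQ
    rw [hstep]
    simpa [AccRep] using hQ
  · intro s' _ _ hI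
    rwa [List.take_length] at hI

end

/-! ### Summing over a cluster and drawing the bit -/

section

variable {X B m cap NS : ℕ} {k : Skel n} {z : Site n → Bool} {a : Site n} {s s' : Store}

/-- The variables `47` to `50` hold the real and imaginary parts of the values of `w`. -/
def SumRep (w : Bool → ℂ) (s : Store) : Prop :=
  (s.vars 47 : ℝ) = (w false).re ∧ (s.vars 48 : ℝ) = (w false).im ∧
    (s.vars 49 : ℝ) = (w true).re ∧ (s.vars 50 : ℝ) = (w true).im

def pAcc : Prog :=
  .seq (.set 47 (.var 47 + (1 - .get 15 (.var 26)) * .var 45)) <|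
  .seq (.set 48 (.var 48 + (1 - .get 15 (.var 26)) * .var 46)) <|
  .seq (.set 49 (.var 49 + .get 15 (.var 26) * .var 45)) <|
  .set 50 (.var 50 + .get 15 (.var 26) * .var 46)

theorem does_pAcc (hs : Bdd B s) {x : Bool} (hx : s.arrs 15 (enc a) = bit x)
    (h26 : s.vars 26 = enc a) {w : Bool → ℂ} {u : ℂ} (hw : SumRep w s) (hu : AccRep u s) {e : ℕ}
    (he : e < B) (hle : ∀ b, ‖w b + if x = b then u else 0‖ ≤ 2 ^ e) :
    Does X B pAcc s (SumRep fun b => w b + if x = b then u else 0) := by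
  obtain ⟨w1, w2, w3, w4⟩ := hw
  obtain ⟨u1, u2⟩ := hu
  have hre : ∀ b, |(w b + if x = b then u else 0).re| ≤ 2 ^ e := fun b =>
    (Complex.abs_re_le_norm _).trans (hle b)
  have him : ∀ b, |(w b + if x = b then u else 0).im| ≤ 2 ^ e := fun b =>
    (Complex.abs_im_le_norm _).trans (hle b)
  have f1 : ((s.vars 47 + (1 - bit x) * s.vars 45 : ℤ) : ℝ)
      = (w false + if x = false then u else 0).re := by
    cases x <;> simp [w1, u1]
  have f2 : ((s.vars 48 + (1 - bit x) * s.vars 46 : ℤ) : ℝ)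
      = (w false + if x = false then u else 0).im := by
    cases x <;> simp [w2, u2]
  have f3 : ((s.vars 49 + bit x * s.vars 45 : ℤ) : ℝ)
      = (w true + if x = true then u else 0).re := by
    cases x <;> simp [w3, u1]
  have f4 : ((s.vars 50 + bit x * s.vars 46 : ℤ) : ℝ)
      = (w true + if x = true then u else 0).im := by
    cases x <;> simp [w4, u2]
  refine does_run hs ?_ ?_
  · simp only [pAcc, Prog.Ok, Prog.run, Expr.eval_one, Expr.eval_add, Expr.eval_sub, Expr.eval_mul,
      Expr.eval_get, Expr.eval_var, Store.setVar_arrs, Store.setVar_vars, Nat.reduceEqDiff, reduceIte,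
      h26, Int.toNat_natCast, hx]
    exact ⟨⟨by decide, natAbs_lt_of_abs_le e (f1 ▸ hre false) he⟩,
      ⟨by decide, natAbs_lt_of_abs_le e (f2 ▸ him false) he⟩,
      ⟨by decide, natAbs_lt_of_abs_le e (f3 ▸ hre true) he⟩,
      by decide, natAbs_lt_of_abs_le e (f4 ▸ him true) he⟩
  · rw [SumRep, ← f1, ← f2, ← f3, ← f4]
    simp [pAcc, Prog.run, h26, hx]

def pEnum : Prog :=
  .seq (.seq (.set 47 0) <| .seq (.set 48 0) <| .seq (.set 49 0) (.set 50 0)) <|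
  .loop 44 40 <| .seq pFill <| .seq pProd pAcc

/-- The contribution of the first `t` assignments to the cluster sum. -/
def partialSum (k : Skel n) (a : Site n) (z : Site n → Bool) (t : ℕ) (b : Bool) : ℂ :=
  ∑ t' ∈ Finset.range t, if digits (k.cluster a) z t' a = b then
    amp (touching (k.cluster a) k.facs) (digits (k.cluster a) z t') else 0

theorem norm_partialSum_le (h : SampleEnv X B m cap NS k z a s) {t : ℕ} (ht : t ≤ cap) (b : Bool) :
    ‖partialSum k a z t b‖ ≤ 2 ^ (cap + (m + 1) * k.facs.length) := by
  unfold partialSum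
  refine (norm_sum_le _ _).trans ?_
  have hle : ∀ t' ∈ Finset.range t, ‖if digits (k.cluster a) z t' a = b then
      amp (touching (k.cluster a) k.facs) (digits (k.cluster a) z t') else 0‖
      ≤ (2 : ℝ) ^ ((m + 1) * k.facs.length) := by
    intro t' _
    split_ifs
    · exact norm_amp_touching_le h.norm_le _ _
    · rw [norm_zero]; positivity
  refine (Finset.sum_le_card_nsmul _ _ _ hle).trans ?_
  rw [Finset.card_range, nsmul_eq_mul, pow_add]
  gcongr
  have : t ≤ 2 ^ cap := ht.trans Nat.lt_two_pow_self.le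
  exact_mod_cast this

theorem does_pEnum (hs : Bdd B s) (h : SampleEnv X B m cap NS k z a s)
    (hm : MkRep NS (k.cluster a) s) (hr : RankRep (k.cluster a) s) {t : ℕ} (ht : s.vars 40 = t)
    (htc : t ≤ cap) : Does X B pEnum s (SumRep (partialSum k a z t)) := by
  have hb := h.bound
  refine does_seq (P := SumRep fun _ => 0) (does_run hs ?_ ?_) ?_
  · refine ⟨⟨by decide, ?_⟩, ⟨by decide, ?_⟩, ⟨by decide, ?_⟩, by decide, ?_⟩ <;> simp
  · simp [SumRep, Prog.run]
  intro s1 hs1 k1 h1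
  have e1 := h.keep k1 (by decide) (by decide)
  refine (does_loop (by decide) (by decide) (by decide) hs1 (m := t)
    ((k1.1 40 (by decide)).trans ht) (htc.trans h.cap_le) (lt_two_pow_of_le (by omega))
    (fun i s' => SumRep (partialSum k a z i) s') ?_ ?_)
  · simpa [SumRep, partialSum] using h1
  · intro i hi s' hs' hk hi' hI
    have e' := e1.keep hk (by decide) (by decide)
    have hm' : MkRep NS (k.cluster a) s' := by
      intro b hb; rw [hk.2 _ (by decide), k1.2 _ (by decide)]; exact hm b hb
    have hr' : RankRep (k.cluster a) s' := by
      intro b hb; rw [hk.2 _ (by decide), k1.2 _ (by decide)]; exact hr b hb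
    refine does_seq (does_pFill hs' e' hm' hr' hi') ?_
    intro s2 hs2 k2 h2
    have e2 := e'.keep k2 (by decide) (by decide)
    have hm2 : MkRep NS (k.cluster a) s2 := by
      intro b hb; rw [k2.2 _ (by decide)]; exact hm' b hb
    refine does_seq (does_pProd hs2 e2 hm2 h2) ?_
    intro s3 hs3 k3 h3
    have hstep : ∀ b, partialSum k a z (i + 1) b = partialSum k a z i b
        + if digits (k.cluster a) z i a = b then
          amp (touching (k.cluster a) k.facs) (digits (k.cluster a) z i) else 0 := fun b =>
      Finset.sum_range_succ _ _
    have hw : SumRep (partialSum k a z i) s3 := by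
      unfold SumRep
      rw [k3.1 _ (by decide), k2.1 _ (by decide), k3.1 _ (by decide), k2.1 _ (by decide),
        k3.1 _ (by decide), k2.1 _ (by decide), k3.1 _ (by decide), k2.1 _ (by decide)]
      exact hI
    refine (does_pAcc hs3 (a := a) (x := digits (k.cluster a) z i a) ?_ ?_ hw h3
      (e := cap + (m + 1) * k.facs.length) (by omega) ?_).mono ?_
    · rw [k3.2 _ (by decide)]; exact h2 a h.site_lt
    · rw [k3.1 _ (by decide)]; exact e2.site
    · intro b
      rw [← hstep]
      exact norm_partialSum_le h (by omega) b
    · intro s4 _ _ h4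
      have : partialSum k a z (i + 1) = fun b => partialSum k a z i b
        + if digits (k.cluster a) z i a = b then
          amp (touching (k.cluster a) k.facs) (digits (k.cluster a) z i) else 0 := funext hstep
      rw [this]
      simpa [SumRep] using h4

/-- Multiplication by the comparison with cap + 1 sets the number of assignments to 0 when it
exceeds the cap. The enumeration is then empty, both weights are 0 as `capWeight` demands, and the
running time is bounded in every case. -/
def pSample : Prog :=
  .seq pMark <| .seq pRank <| .seq (.set 40 (.var 40 * .lt (.var 40) (.var 11 + 1))) <|
  .seq pEnum <| .set 55 <| .lt
    (.var 24 * ((.var 47 * .var 47 + .var 48 * .var 48) + (.var 49 * .var 49 + .var 50 * .var 50)))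
    ((.var 49 * .var 49 + .var 50 * .var 50) * .var 9)

theorem does_pSample (hs : Bdd B s) (h : SampleEnv X B m cap NS k z a s) (hcap : s.vars 11 = cap)
    {M u : ℕ} (hM : s.vars 9 = M) (hu : s.vars 24 = u) :
    Does X B pSample s fun s' => s'.vars 55 = bit (sampleBit M cap k a z u) := by
  have hb := h.bound
  refine does_seq (does_pMark hs h) ?_
  intro s1 hs1 k1 h1
  have e1 := h.keep k1 (by decide) (by decide)
  refine does_seq (does_pRank hs1 e1 h1) ?_
  rintro s2 hs2 k2 ⟨h2, h40⟩
  have e2 := e1.keep k2 (by decide) (by decide)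
  set c := (k.cluster a).card with hc
  set t := if 2 ^ c ≤ cap then 2 ^ c else 0 with htdef
  have h11 : s2.vars 11 = cap := by rw [k2.1 _ (by decide), k1.1 _ (by decide)]; exact hcap
  have htval : (Expr.var 40 * .lt (.var 40) (.var 11 + 1)).eval s2 = (t : ℤ) := by
    simp only [Expr.eval_mul, Expr.eval_var, Expr.eval_lt, Expr.eval_add, Expr.eval_one, h40, h11, htdef]
    by_cases hle : 2 ^ c ≤ cap
    · have : (2 : ℤ) ^ c < cap + 1 := by exact_mod_cast Nat.lt_succ_of_le hle
      rw [if_pos this, if_pos hle]; simp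
    · have : ¬ (2 : ℤ) ^ c < cap + 1 := by
        intro h'; apply hle
        have : (2 : ℕ) ^ c < cap + 1 := by exact_mod_cast h'
        omega
      rw [if_neg this, if_neg hle]; simp
  have htc : t ≤ cap := by rw [htdef]; split_ifs <;> omega
  refine does_seq (P := fun s' => s'.vars 40 = t) (does_run hs2 ⟨by decide, ?_⟩ ?_) ?_
  · rw [htval]
    exact lt_two_pow_of_le (by omega : t ≤ B)
  · simp [Prog.run, htval]
  intro s3 hs3 k3 h3
  have e3 := e2.keep k3 (by decide) (by decide)
  have hm3 : MkRep NS (k.cluster a) s3 := by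
    intro b hb; rw [k3.2 _ (by decide), k2.2 _ (by decide)]; exact h1 b hb
  have hr3 : RankRep (k.cluster a) s3 := by
    intro b hb; rw [k3.2 _ (by decide)]; exact h2 b hb
  refine does_seq (does_pEnum hs3 e3 hm3 hr3 h3 htc) ?_
  rintro s4 hs4 k4 ⟨w1, w2, w3, w4⟩
  have hcw : ∀ b, capWeight cap k a z b
      = (partialSum k a z t b).re ^ 2 + (partialSum k a z t b).im ^ 2 := by
    intro b
    unfold capWeight
    rw [htdef]
    by_cases hle : 2 ^ c ≤ cap
    · rw [if_pos hle, if_pos hle, partialSum, hc, sum_digits_amp, Complex.sq_norm,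
        Complex.normSq_apply]
      ring
    · rw [if_neg hle, if_neg hle]; simp [partialSum]
  have h24 : s4.vars 24 = u := by
    rw [k4.1 _ (by decide), k3.1 _ (by decide), k2.1 _ (by decide), k1.1 _ (by decide)]; exact hu
  have h9 : s4.vars 9 = M := by
    rw [k4.1 _ (by decide), k3.1 _ (by decide), k2.1 _ (by decide), k1.1 _ (by decide)]; exact hM
  have hval : (Expr.lt (.var 24 * ((.var 47 * .var 47 + .var 48 * .var 48)
      + (.var 49 * .var 49 + .var 50 * .var 50)))
      ((.var 49 * .var 49 + .var 50 * .var 50) * .var 9)).eval s4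
      = bit (sampleBit M cap k a z u) := by
    simp only [Expr.eval_mul, Expr.eval_var, Expr.eval_lt, Expr.eval_add, h24, h9]
    unfold sampleBit
    rw [hcw, hcw, ← w1, ← w2, ← w3, ← w4, bit_decide]
    refine if_congr ?_ rfl rfl
    rw [← Int.cast_lt (R := ℝ)]
    push_cast
    simp only [sq]
  -- Only the truth value is stored. The large products occur inside the expression, where the size
  -- bound controls their cost, so they need not fit into B bits.
  refine does_run hs4 ⟨by decide, ?_⟩ ?_
  · rw [hval]; exact natAbs_bit_lt (by omega) _
  · simp [Prog.run, hval]

end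

/-! ### The elementary steps of the sampler -/

/-- Memory that stays fixed while the sampler runs. -/
structure Static (X B m cap T : ℕ) (θ : Gates r) (a b c : ℕ) (τ : ℕ → ℤ) (n : ℕ) (s : Store) :
    Prop where
  v0 : s.vars 0 = n
  v5 : s.vars 5 = a
  v6 : s.vars 6 = b
  v7 : s.vars 7 = c
  v9 : s.vars 9 = (2 ^ m : ℕ)
  v10 : s.vars 10 = (n * (T + 1) : ℕ)
  v11 : s.vars 11 = cap
  v12 : s.vars 12 = (min a b : ℕ)
  ang : ∀ j : Fin r, ((s.arrs 0 (4 * j) : ℝ) = θ.cg j ∧ (s.arrs 0 (4 * j + 1) : ℝ) = θ.sg j) ∧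
    (s.arrs 0 (4 * j + 2) : ℝ) = θ.cb j ∧ (s.arrs 0 (4 * j + 3) : ℝ) = θ.sb j
  tape : ∀ i < T, s.arrs 3 i = τ i ∧ 0 ≤ τ i
  le : θ.Le (2 ^ m)
  bound : (m + 1) * T + T + cap + n * (T + 1) + 2 * m + 8 ≤ B
  size_le : n * (T + 1) ≤ X
  tape_le : T ≤ X
  cap_le : cap ≤ X

/-- The memory represents the state of the sampler. -/
structure Rep (k : Skel n) (z : Site n → Bool) (s : Store) : Prop where
  cur : CurRep k s
  fl : FlRep k s
  dp : DpRep k s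
  bits : ZRep z s
  free : FreeRep k s
  facs : FacsRep k.facs s

/-- Bounds for the state of the sampler after `c` steps. -/
structure Inv (m c : ℕ) (k : Skel n) : Prop where
  wf : k.WF
  seg_le : ∀ v, k.seg v ≤ c
  len_le : k.facs.length ≤ c
  norm_le : ∀ f ∈ k.facs, ∀ x y, ‖f.val x y‖ ≤ 2 ^ (m + 1)

section

variable {X B m cap T a b c : ℕ} {θ : Gates r} {τ : ℕ → ℤ} {s s' : Store} {k : Skel n}
  {z : Site n → Bool}

theorem Static.keep {d : Prog} (h : Static X B m cap T θ a b c τ n s) (hk : Keep d s s')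
    (hv : ∀ x ∈ d.wv, 16 ≤ x) (ha : ∀ x ∈ d.wa, x ≠ 0 ∧ x ≠ 3) :
    Static X B m cap T θ a b c τ n s' := by
  have hv' : ∀ x, x < 16 → s'.vars x = s.vars x := fun x hx =>
    hk.1 x fun h => by have := hv x h; omega
  have h0 : s'.arrs 0 = s.arrs 0 := hk.2 0 fun h => (ha 0 h).1 rfl
  have h3 : s'.arrs 3 = s.arrs 3 := hk.2 3 fun h => (ha 3 h).2 rfl
  constructor
  any_goals rw [hv' _ (by decide)]
  · exact h.v0
  · exact h.v5
  · exact h.v6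
  · exact h.v7
  · exact h.v9
  · exact h.v10
  · exact h.v11
  · exact h.v12
  · rw [h0]; exact h.ang
  · rw [h3]; exact h.tape
  · exact h.le
  · exact h.bound
  · exact h.size_le
  · exact h.tape_le
  · exact h.cap_le

theorem Rep.keep {d : Prog} (h : Rep k z s) (hk : Keep d s s') (hv : 19 ∉ d.wv)
    (ha : ∀ x ∈ d.wa, x ∉ [4, 5, 6, 7, 8, 11, 12, 13, 14]) : Rep k z s' := by
  have ha' : ∀ x, x ∈ [4, 5, 6, 7, 8, 11, 12, 13, 14] → x ∉ d.wa := fun x hx h => ha x h hx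
  constructor
  · intro v; rw [hk.2 _ (ha' _ (by decide))]; exact h.cur v
  · intro v; rw [hk.2 _ (ha' _ (by decide))]; exact h.fl v
  · intro v; rw [hk.2 _ (ha' _ (by decide))]; exact h.dp v
  · intro v; rw [hk.2 _ (ha' _ (by decide))]; exact h.bits v
  · intro v; rw [hk.2 _ (ha' _ (by decide))]; exact h.free v
  · exact h.facs.keep hk hv (ha' _ (by decide)) (ha' _ (by decide)) (ha' _ (by decide))
      (ha' _ (by decide))

theorem Rep.addFac {f : Fac n} (h : Rep k z s) (hk : Keep pFac s s')
    (hf : FacsRep (k.facs ++ [f]) s') : Rep (k.addFac f) z s' := by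
  constructor
  · intro v; rw [hk.2 _ (by decide)]; exact h.cur v
  · intro v; rw [hk.2 _ (by decide)]; exact h.fl v
  · intro v; rw [hk.2 _ (by decide)]; exact h.dp v
  · intro v; rw [hk.2 _ (by decide)]; exact h.bits v
  · intro v; rw [hk.2 _ (by decide)]; exact h.free v
  · exact hf

theorem norm_zSign (b : Bool) : ‖(zSign b : ℂ)‖ = 1 := by cases b <;> simp [zSign]

theorem Inv.addFac {f : Fac n} (h : Inv m c k) (ha : f.a.2 ≤ k.seg f.a.1) (hb : f.b.2 ≤ k.seg f.b.1)
    (hf : ∀ x y, ‖f.val x y‖ ≤ 2 ^ (m + 1)) : Inv m (c + 1) (k.addFac f) := by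
  refine ⟨h.wf.addFac ha hb, fun v => (h.seg_le v).trans (by omega), ?_, ?_⟩
  · have := h.len_le
    simp [Skel.addFac]; omega
  · intro g hg
    rcases List.mem_append.1 hg with hg | hg
    · exact h.norm_le g hg
    · rw [List.mem_singleton.1 hg]; exact hf

/-- An elementary step adds at most one factor and opens at most one segment. The bound 2^(m+1) is
twice the bound on the parameters, since a phase factor has two terms. -/
theorem Inv.step (h : Inv m c k) (hθ : θ.Le (2 ^ m)) (e : El n r) (ch : Fin 5) :
    Inv m (c + 1) (k.step θ e ch) := by
  have hwf := h.wf.step θ e ch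
  have hp : (2 : ℝ) * 2 ^ m = 2 ^ (m + 1) := by rw [pow_succ]; ring
  have h1 : (1 : ℝ) ≤ 2 ^ m := one_le_pow₀ (by norm_num)
  have hsame : Inv m (c + 1) k := ⟨h.wf, fun v => (h.seg_le v).trans (by omega), by
    have := h.len_le; omega, h.norm_le⟩
  match e with
  | .init v => exact hsame
  | .zz j u v =>
    refine h.addFac le_rfl le_rfl fun x y => ?_
    have := norm_zzVal_le (θ.cg j) (θ.sg j) (hθ j).1 (hθ j).2.1 (xor x (k.fl u)) (xor y (k.fl v))
    linarith
  | .noise v =>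
    have hs : Inv m (c + 1) (k.sign v) := by
      refine h.addFac le_rfl le_rfl fun x y => ?_
      simp only [norm_zSign]
      exact one_le_pow₀ (by norm_num)
    match ch with
    | 0 => exact ⟨hwf, hsame.seg_le, hsame.len_le, hsame.norm_le⟩
    | 1 => exact ⟨hwf, hsame.seg_le, hsame.len_le, hsame.norm_le⟩
    | 2 => exact ⟨hwf, hsame.seg_le, hsame.len_le, hsame.norm_le⟩
    | 3 => exact ⟨hwf, hs.seg_le, hs.len_le, hs.norm_le⟩
    | 4 => exact hsame
  | .mix j v =>
    refine ⟨hwf, ?_, ?_, ?_⟩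
    · intro w
      have := h.seg_le w
      have := h.seg_le v
      simp only [Skel.step, Skel.mix, Function.update_apply]
      split_ifs <;> omega
    · have := h.len_le
      simp [Skel.step, Skel.mix]; omega
    · intro g hg
      rcases List.mem_append.1 hg with hg | hg
      · exact h.norm_le g hg
      · rw [List.mem_singleton.1 hg]
        intro x y
        have := norm_mixVal_entry_le (θ.cb j) (θ.sb j) (hθ j).2.2.1 (hθ j).2.2.2 y (xor x (k.fl v))
        linarith

/-- The state of the sampler after `i` steps. -/
def State (m : ℕ) (i : ℕ) (p : Skel n × (Site n → Bool)) (s : Store) : Prop :=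
  Rep p.1 p.2 s ∧ s.vars 18 = i ∧ Inv m i p.1

end

section

variable {X B m cap T a b c : ℕ} {θ : Gates r} {τ : ℕ → ℤ} {s s' : Store}
  {p : Skel n × (Site n → Bool)}

theorem Static.pos (h : Static X B m cap T θ a b c τ n s) : 0 < B := by have := h.bound; omega

theorem Static.succ_lt (h : Static X B m cap T θ a b c τ n s) {i : ℕ} (hi : i < T) :
    ((i : ℤ) + 1).natAbs < 2 ^ B := by
  have := h.bound
  exact lt_two_pow_of_le (by omega : i + 1 ≤ B)

theorem Static.length_lt (h : Static X B m cap T θ a b c τ n s) {i : ℕ} (hi : i < T)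
    (hinv : Inv m i p.1) : p.1.facs.length + 1 < 2 ^ B := by
  have := h.bound
  have := hinv.len_le
  exact lt_two_pow_of_le (by omega)

theorem bit_add_mod (x y : Bool) : (bit x + bit y) % 2 = bit (xor x y) := by
  cases x <;> cases y <;> rfl

def pNext : Prog := .set 18 (.var 18 + 1)

theorem does_pNext (h : Static X B m cap T θ a b c τ n s) (hs : Bdd B s) {i : ℕ} (hi : i < T)
    {k : Skel n} {z : Site n → Bool} (hr : Rep k z s) (h18 : s.vars 18 = i)
    (hinv : Inv m (i + 1) k) : Does X B pNext s (State m (i + 1) (k, z)) := by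
  have hr' : Rep k z (pNext.run s) := hr.keep (d := pNext) ⟨fun x hx => by
    have : x ≠ 18 := by simpa [pNext, Prog.wv] using hx
    simp [pNext, Prog.run, this], fun _ _ => rfl⟩ (by decide) (by decide)
  refine does_run hs ⟨by decide, ?_⟩ ⟨hr', ?_, hinv⟩
  · simpa [h18] using h.succ_lt hi
  · simp [pNext, Prog.run, h18]

/-- The phase depends on the product of two signs, so only the parity of the two pending flips, in
variable 24, matters. -/
def pZZVals : Prog :=
  .seq (.set 25 (.get 4 (.var 22))) <| .seq (.set 26 (.get 4 (.var 23))) <|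
  .seq (.set 24 ((.get 5 (.var 22) + .get 5 (.var 23)) % 2)) <|
  .seq (.set 35 (.get 0 (4 * .var 21))) <| .seq (.set 36 (.get 0 (4 * .var 21 + 1))) <|
  .seq (.set 27 (.var 35)) <| .seq (.set 28 (.var 35)) <| .seq (.set 29 (.var 35)) <|
  .seq (.set 30 (.var 35)) <| .seq (.set 31 (.var 36 * (1 - 2 * .var 24))) <|
  .seq (.set 32 (.var 36 * (2 * .var 24 - 1))) <| .seq (.set 33 (.var 36 * (2 * .var 24 - 1))) <|
  .set 34 (.var 36 * (1 - 2 * .var 24))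

theorem does_pZZVals (h : Static X B m cap T θ a b c τ n s) (hs : Bdd B s) {k : Skel n}
    {z : Site n → Bool} (hr : Rep k z s) {j : Fin r} {u w : Fin n} (h21 : s.vars 21 = (j : ℕ))
    (h22 : s.vars 22 = (u : ℕ)) (h23 : s.vars 23 = (w : ℕ)) :
    Does X B pZZVals s (VarsFac ⟨k.cur u, k.cur w,
      fun x y => zzVal (θ.cg j) (θ.sg j) (xor x (k.fl u)) (xor y (k.fl w))⟩) := by
  have e0 : (4 * ((j : ℕ) : ℤ)).toNat = 4 * j := by omega
  have e1 : (4 * ((j : ℕ) : ℤ) + 1).toNat = 4 * j + 1 := by omega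
  obtain ⟨⟨a1, a2⟩, -⟩ := h.ang j
  have c1 := hr.cur u
  have c2 := hr.cur w
  have f1 := hr.fl u
  have f2 := hr.fl w
  have hq := bit_add_mod (k.fl u) (k.fl w)
  set q := xor (k.fl u) (k.fl w) with hqdef
  have hb1 : (s.arrs 0 (4 * j + 1) * (1 - 2 * bit q)).natAbs < 2 ^ B := by
    have := hs.2 0 (4 * j + 1)
    cases q <;> simpa using this
  have hb2 : (s.arrs 0 (4 * j + 1) * (2 * bit q - 1)).natAbs < 2 ^ B := by
    have := hs.2 0 (4 * j + 1)
    cases q <;> simpa using this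
  refine does_run hs ?_ ?_
  · simp only [pZZVals, Prog.Ok, Prog.run, Expr.eval_one, Expr.eval_add, Expr.eval_sub,
      Expr.eval_mul, Expr.eval_mod, Expr.eval_get, Expr.eval_var, Expr.eval_ofNat, Store.setVar_arrs,
      Store.setVar_vars, Nat.reduceEqDiff, reduceIte, h21, h22, h23, Int.toNat_natCast, e0, e1, f1, f2, hq]
    exact ⟨⟨by decide, hs.2 _ _⟩, ⟨by decide, hs.2 _ _⟩, ⟨by decide, natAbs_bit_lt h.pos q⟩,
      ⟨by decide, hs.2 _ _⟩, ⟨by decide, hs.2 _ _⟩, ⟨by decide, hs.2 _ _⟩, ⟨by decide, hs.2 _ _⟩,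
      ⟨by decide, hs.2 _ _⟩, ⟨by decide, hs.2 _ _⟩, ⟨by decide, hb1⟩, ⟨by decide, hb2⟩,
      ⟨by decide, hb2⟩, by decide, hb1⟩
  · unfold VarsFac
    refine ⟨?_, ?_, ⟨?_, ?_, ?_, ?_⟩, ?_, ?_, ?_, ?_⟩
    · simp [pZZVals, Prog.run, h22, c1]
    · simp [pZZVals, Prog.run, h23, c2]
    all_goals
      simp only [pZZVals, Prog.run, Expr.eval_one, Expr.eval_add, Expr.eval_sub,
        Expr.eval_mul, Expr.eval_mod, Expr.eval_get, Expr.eval_var, Expr.eval_ofNat, Store.setVar_arrs,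
        Store.setVar_vars, Nat.reduceEqDiff, reduceIte, h21, h22, h23, Int.toNat_natCast, e0, e1, f1,
        f2, hq]
      push_cast
      simp only [a1, a2, hqdef]
      cases k.fl u <;> cases k.fl w <;> simp [zzVal, zSign]
    all_goals ring

def pZZ : Prog := .seq pZZVals <| .seq pFac pNext

theorem does_pZZ (h : Static X B m cap T θ a b c τ n s) (hs : Bdd B s) {i : ℕ} (hi : i < T)
    (hst : State m i p s) {j : Fin r} {u w : Fin n} (h21 : s.vars 21 = (j : ℕ))
    (h22 : s.vars 22 = (u : ℕ)) (h23 : s.vars 23 = (w : ℕ)) (ch : ℕ → Fin 5) (M : ℕ) :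
    Does X B pZZ s (State m (i + 1) (sampleStep θ ch M cap (.zz j u w) (τ i).toNat p)) := by
  obtain ⟨hr, h18, hinv⟩ := hst
  refine does_seq (does_pZZVals h hs hr h21 h22 h23) ?_
  intro s1 hs1 k1 h1
  have r1 := hr.keep k1 (by decide) (by decide)
  refine does_seq (does_pFac hs1 r1.facs h1 (h.length_lt hi hinv)) ?_
  intro s2 hs2 k2 h2
  have st2 := (h.keep k1 (by decide) (by decide)).keep k2 (by decide) (by decide)
  exact does_pNext st2 hs2 hi (r1.addFac k2 h2)
    (by rw [k2.1 _ (by decide), k1.1 _ (by decide)]; exact h18)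
    (hinv.step h.le (.zz j u w) (ch (τ i).toNat))

/-! ### Noise -/

def pSignVals : Prog :=
  .seq (.set 25 (.get 4 (.var 17))) <| .seq (.set 26 (.get 4 (.var 17))) <|
  .seq (.set 27 (1 - 2 * .get 5 (.var 17))) <| .seq (.set 28 (1 - 2 * .get 5 (.var 17))) <|
  .seq (.set 29 (2 * .get 5 (.var 17) - 1)) <| .seq (.set 30 (2 * .get 5 (.var 17) - 1)) <|
  .seq (.set 31 0) <| .seq (.set 32 0) <| .seq (.set 33 0) (.set 34 0)

theorem does_pSignVals (hB : 0 < B) (hs : Bdd B s) {k : Skel n}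
    {z : Site n → Bool} (hr : Rep k z s) {v : Fin n} (h17 : s.vars 17 = (v : ℕ)) :
    Does X B pSignVals s (VarsFac ⟨k.cur v, k.cur v,
      fun x _ => (zSign (xor x (k.fl v)) : ℂ)⟩) := by
  have c1 := hr.cur v
  have f1 := hr.fl v
  have hb1 : (1 - 2 * bit (k.fl v)).natAbs < 2 ^ B := by
    have := natAbs_bit_lt hB true
    cases k.fl v <;> simpa using this
  have hb2 : (2 * bit (k.fl v) - 1).natAbs < 2 ^ B := by
    have := natAbs_bit_lt hB true
    cases k.fl v <;> simpa using this
  have hb0 : (0 : ℤ).natAbs < 2 ^ B := by simp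
  refine does_run hs ?_ ?_
  · simp only [pSignVals, Prog.Ok, Prog.run, Expr.eval_zero, Expr.eval_one, Expr.eval_sub,
      Expr.eval_mul, Expr.eval_get, Expr.eval_var, Expr.eval_ofNat, Store.setVar_arrs,
      Store.setVar_vars, Nat.reduceEqDiff, reduceIte, h17, Int.toNat_natCast, f1]
    exact ⟨⟨by decide, hs.2 _ _⟩, ⟨by decide, hs.2 _ _⟩, ⟨by decide, hb1⟩, ⟨by decide, hb1⟩,
      ⟨by decide, hb2⟩, ⟨by decide, hb2⟩, ⟨by decide, hb0⟩, ⟨by decide, hb0⟩, ⟨by decide, hb0⟩,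
      by decide, hb0⟩
  · unfold VarsFac
    refine ⟨?_, ?_, ⟨?_, ?_, ?_, ?_⟩, ?_, ?_, ?_, ?_⟩
    · simp [pSignVals, Prog.run, h17, c1]
    · simp [pSignVals, Prog.run, h17, c1]
    all_goals
      simp only [pSignVals, Prog.run, Expr.eval_zero, Expr.eval_one, Expr.eval_sub,
        Expr.eval_mul, Expr.eval_get, Expr.eval_var, Expr.eval_ofNat, Store.setVar_arrs,
        Store.setVar_vars, Nat.reduceEqDiff, reduceIte, h17, Int.toNat_natCast, f1]
      push_cast
      cases k.fl v <;> norm_num [zSign]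

/-- The thresholds of `chOf` as comparisons: the branches below 2z + 2 min(a, b) dephase, the
branches from 2z up to 2z + a + b flip, and the last interval among these carries the sign of Y. -/
def pNoiseFlags : Prog :=
  .seq (.set 24 (.get 3 (.var 18))) <|
  .seq (.set 35 (.lt (.var 24) (2 * .var 7 + 2 * .var 12))) <|
  .seq (.set 36 (.lt (.var 24) (2 * .var 7 + .var 5 + .var 6) - .lt (.var 24) (2 * .var 7))) <|
  .set 37 (.lt (.var 24) (2 * .var 7 + .var 5 + .var 6)
    - .lt (.var 24) (2 * .var 7 + .var 12 + .var 5))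

/-- Whether a branch of the noise channel dephases, flips, or contributes a sign. -/
def dephases (ch : Fin 5) : Bool := decide (ch = 0 ∨ ch = 1)
def flips (ch : Fin 5) : Bool := decide (ch = 1 ∨ ch = 2 ∨ ch = 3)
def signs (ch : Fin 5) : Bool := decide (ch = 3)

/-- A uniform description of the five branches by three flags, matching the assignments made by the
program. -/
theorem noise_eq (k : Skel n) (v : Fin n) (ch : Fin 5) :
    k.noise v ch = { (if signs ch then k.sign v else k) with
      dp := Function.update k.dp v (k.dp v || dephases ch)
      fl := Function.update k.fl v (xor (k.fl v) (flips ch)) } := by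
  fin_cases ch <;> simp [Skel.noise, signs, dephases, flips, Skel.dephase, Skel.flip, Skel.sign,
    Skel.addFac]

theorem does_pNoiseFlags (h : Static X B m cap T θ a b c τ n s) (hs : Bdd B s) {i : ℕ} (hi : i < T)
    (h18 : s.vars 18 = i) : Does X B pNoiseFlags s fun s' =>
      s'.vars 35 = bit (dephases (chOf a b c (τ i).toNat)) ∧
      s'.vars 36 = bit (flips (chOf a b c (τ i).toNat)) ∧
      s'.vars 37 = bit (signs (chOf a b c (τ i).toNat)) := by
  obtain ⟨ht, ht0⟩ := h.tape i hi
  obtain ⟨u, hu⟩ : ∃ u : ℕ, τ i = u := ⟨(τ i).toNat, by omega⟩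
  rw [hu] at ht ⊢
  rw [Int.toNat_natCast]
  have q1 : (if (u : ℤ) < 2 * c + 2 * (min a b : ℕ) then 1 else 0) = bit (dephases (chOf a b c u)) := by
    unfold chOf dephases
    split_ifs <;> simp <;> omega
  have q2 : (if (u : ℤ) < 2 * c + a + b then 1 else 0) - (if (u : ℤ) < 2 * c then 1 else 0)
      = bit (flips (chOf a b c u)) := by
    unfold chOf flips
    split_ifs <;> simp <;> omega
  have q3 : (if (u : ℤ) < 2 * c + a + b then 1 else 0)
      - (if (u : ℤ) < 2 * c + (min a b : ℕ) + a then 1 else 0) = bit (signs (chOf a b c u)) := by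
    unfold chOf signs
    split_ifs <;> simp <;> omega
  refine does_run hs ?_ ?_
  · simp only [pNoiseFlags, Prog.Ok, Prog.run, Expr.eval_lt, Expr.eval_add, Expr.eval_sub,
      Expr.eval_mul, Expr.eval_get, Expr.eval_var, Expr.eval_ofNat, Store.setVar_vars,
      Nat.reduceEqDiff, reduceIte, h18, Int.toNat_natCast, ht, h.v5, h.v6, h.v7,
      h.v12, q1, q2, q3]
    refine ⟨⟨by decide, ?_⟩, ⟨by decide, natAbs_bit_lt h.pos _⟩,
      ⟨by decide, natAbs_bit_lt h.pos _⟩, by decide, natAbs_bit_lt h.pos _⟩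
    rw [← ht]; exact hs.2 _ _
  · simp only [pNoiseFlags, Prog.run, Expr.eval_lt, Expr.eval_add, Expr.eval_sub,
      Expr.eval_mul, Expr.eval_get, Expr.eval_var, Expr.eval_ofNat, Store.setVar_vars,
      Nat.reduceEqDiff, reduceIte, h18, Int.toNat_natCast, ht, h.v5, h.v6, h.v7,
      h.v12, q1, q2, q3, and_self]

def pNoise : Prog :=
  .seq pNoiseFlags <| .seq (.ite (.var 37) (.seq pSignVals pFac) .skip) <|
  .seq (.seq (.store 6 (.var 17) (.lt 0 (.get 6 (.var 17) + .var 35)))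
    (.store 5 (.var 17) ((.get 5 (.var 17) + .var 36) % 2))) pNext

theorem does_pNoise (h : Static X B m cap T θ a b c τ n s) (hs : Bdd B s) {i : ℕ} (hi : i < T)
    (hst : State m i p s) {v : Fin n} (h17 : s.vars 17 = (v : ℕ)) (M : ℕ) :
    Does X B pNoise s
      (State m (i + 1) (sampleStep θ (chOf a b c) M cap (.noise v) (τ i).toNat p)) := by
  obtain ⟨hr, h18, hinv⟩ := hst
  refine does_seq (does_pNoiseFlags h hs hi h18) ?_
  rintro s1 hs1 k1 ⟨h35, h36, h37⟩
  have r1 := hr.keep k1 (by decide) (by decide)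
  have st1 := h.keep k1 (by decide) (by decide)
  have h17' : s1.vars 17 = (v : ℕ) := by rw [k1.1 _ (by decide)]; exact h17
  set ch := chOf a b c (τ i).toNat with hch
  refine does_seq (P := Rep (if signs ch then p.1.sign v else p.1) p.2) (does_ite hs1 (by decide) ?_ ?_) ?_
  · intro hb
    have hsg : signs ch = true := by
      by_contra hn
      rw [Bool.not_eq_true] at hn
      exact hb (by simp [h37, hn])
    rw [hsg, if_pos rfl]
    refine does_seq (does_pSignVals h.pos hs1 r1 h17') ?_
    intro s2 hs2 k2 h2
    have r2 := r1.keep k2 (by decide) (by decide)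
    refine (does_pFac hs2 r2.facs h2 (h.length_lt hi hinv)).mono ?_
    exact fun s3 _ k3 h3 => r2.addFac k3 h3
  · intro hb
    have hsg : signs ch = false := by
      by_contra hn
      rw [Bool.not_eq_false] at hn
      rw [Expr.eval_var, h37, hn] at hb
      exact one_ne_zero hb
    rw [hsg]
    exact does_skip hs1 r1
  intro s2 hs2 k2 r2
  have h35' : s2.vars 35 = bit (dephases ch) := by rw [k2.1 _ (by decide)]; exact h35
  have h36' : s2.vars 36 = bit (flips ch) := by rw [k2.1 _ (by decide)]; exact h36
  have h17'' : s2.vars 17 = (v : ℕ) := by rw [k2.1 _ (by decide)]; exact h17'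
  have st2 := st1.keep k2 (by decide) (by decide)
  have hdp : (if signs ch then p.1.sign v else p.1).dp = p.1.dp := by split_ifs <;> rfl
  have hfl : (if signs ch then p.1.sign v else p.1).fl = p.1.fl := by split_ifs <;> rfl
  have d1 : (if 0 < s2.arrs 6 v + bit (dephases ch) then 1 else 0 : ℤ)
      = bit (p.1.dp v || dephases ch) := by
    rw [r2.dp v, hdp]
    cases p.1.dp v <;> cases dephases ch <;> rfl
  have d2 : (s2.arrs 5 v + bit (flips ch)) % 2 = bit (xor (p.1.fl v) (flips ch)) := by
    rw [r2.fl v, hfl, bit_add_mod]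
  refine does_seq (P := fun s' => Rep (p.1.noise v ch) p.2 s') (does_run hs2 ?_ ?_) ?_
  · simp only [Prog.Ok, Prog.run, Expr.eval_lt, Expr.eval_zero, Expr.eval_add, Expr.eval_mod,
      Expr.eval_get, Expr.eval_var, Expr.eval_ofNat, Store.setArr_arrs,
      Store.setArr_vars, Nat.reduceEqDiff, reduceIte, h17'', Int.toNat_natCast, h35', h36', d1, d2]
    exact ⟨⟨⟨by decide, by decide⟩, natAbs_bit_lt h.pos _⟩, ⟨by decide, by decide⟩,
      natAbs_bit_lt h.pos _⟩
  · simp only [Prog.run, Expr.eval_lt, Expr.eval_zero, Expr.eval_add, Expr.eval_mod,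
      Expr.eval_get, Expr.eval_var, Expr.eval_ofNat, Store.setArr_arrs,
      Store.setArr_vars, Nat.reduceEqDiff, reduceIte, h17'', Int.toNat_natCast, h35', h36', d1, d2]
    rw [noise_eq]
    refine ⟨?_, ?_, ?_, ?_, ?_, ?_⟩
    · exact r2.cur
    · intro w
      simp only [Store.setArr_arrs, reduceIte, Function.update_apply, Nat.reduceEqDiff, Fin.val_inj]
      split_ifs with hw
      · rfl
      · have := r2.fl w; rwa [hfl] at this
    · intro w
      simp only [Store.setArr_arrs, reduceIte, Function.update_apply, Nat.reduceEqDiff, Fin.val_inj]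
      split_ifs with hw
      · rfl
      · have := r2.dp w; rwa [hdp] at this
    · exact r2.bits
    · exact r2.free
    · exact r2.facs
  · intro s3 hs3 k3 r3
    have st3 := st2.keep k3 (by decide) (by decide)
    exact does_pNext st3 hs3 hi r3
      (by rw [k3.1 _ (by decide), k2.1 _ (by decide), k1.1 _ (by decide)]; exact h18)
      (hinv.step h.le (.noise v) ch)

end

section

variable {X B m cap T a b c : ℕ} {θ : Gates r} {τ : ℕ → ℤ} {s s' : Store}
  {p : Skel n × (Site n → Bool)}

/-! ### Mixers and preparations -/

def pMixVals : Prog :=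
  .seq (.set 25 (.get 4 (.var 17))) <| .seq (.set 26 (.get 4 (.var 17) + .var 0)) <|
  .seq (.set 24 (.get 5 (.var 17))) <|
  .seq (.set 35 (.get 0 (4 * .var 21 + 2))) <| .seq (.set 36 (.get 0 (4 * .var 21 + 3))) <|
  .seq (.set 27 (.var 35 * (1 - .var 24))) <| .seq (.set 28 (.var 35 * .var 24)) <|
  .seq (.set 29 (.var 35 * .var 24)) <| .seq (.set 30 (.var 35 * (1 - .var 24))) <|
  .seq (.set 31 (.var 36 * .var 24)) <| .seq (.set 32 (.var 36 * (1 - .var 24))) <|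
  .seq (.set 33 (.var 36 * (1 - .var 24))) <| .set 34 (.var 36 * .var 24)

/-- The reason why the program finds the new site by adding variable 0. -/
theorem enc_next (k : Skel n) (v : Fin n) : enc (k.next v) = enc (k.cur v) + n := by
  simp only [enc, Skel.next, Skel.cur]; ring

theorem does_pMixVals (h : Static X B m cap T θ a b c τ n s) (hs : Bdd B s) {k : Skel n}
    {z : Site n → Bool} (hr : Rep k z s) {j : Fin r} {v : Fin n} (h21 : s.vars 21 = (j : ℕ))
    (h17 : s.vars 17 = (v : ℕ)) (hnext : enc (k.next v) < 2 ^ B) :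
    Does X B pMixVals s (VarsFac ⟨k.cur v, k.next v,
      fun x y => mixVal (θ.cb j) (θ.sb j) y (xor x (k.fl v))⟩) := by
  have e0 : (4 * ((j : ℕ) : ℤ) + 2).toNat = 4 * j + 2 := by omega
  have e1 : (4 * ((j : ℕ) : ℤ) + 3).toNat = 4 * j + 3 := by omega
  obtain ⟨-, a1, a2⟩ := h.ang j
  have c1 := hr.cur v
  have f1 := hr.fl v
  have c2 : (enc (k.cur v) : ℤ) + n = enc (k.next v) := by rw [enc_next]; push_cast; ring
  have hb1 : ∀ l, (s.arrs 0 l * (1 - bit (k.fl v))).natAbs < 2 ^ B := by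
    intro l
    have := hs.2 0 l
    cases k.fl v
    · simpa using this
    · simp
  have hb2 : ∀ l, (s.arrs 0 l * bit (k.fl v)).natAbs < 2 ^ B := by
    intro l
    have := hs.2 0 l
    cases k.fl v
    · simp
    · simpa using this
  refine does_run hs ?_ ?_
  · simp only [pMixVals, Prog.Ok, Prog.run, Expr.eval_one, Expr.eval_add, Expr.eval_sub,
      Expr.eval_mul, Expr.eval_get, Expr.eval_var, Expr.eval_ofNat, Store.setVar_arrs,
      Store.setVar_vars, Nat.reduceEqDiff, reduceIte, h21, h17, Int.toNat_natCast, e0, e1, f1, c1,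
      h.v0, c2]
    exact ⟨⟨by decide, by rw [← c1]; exact hs.2 _ _⟩, ⟨by decide, hnext⟩, ⟨by decide, natAbs_bit_lt h.pos _⟩,
      ⟨by decide, hs.2 _ _⟩, ⟨by decide, hs.2 _ _⟩, ⟨by decide, hb1 _⟩, ⟨by decide, hb2 _⟩,
      ⟨by decide, hb2 _⟩, ⟨by decide, hb1 _⟩, ⟨by decide, hb2 _⟩, ⟨by decide, hb1 _⟩,
      ⟨by decide, hb1 _⟩, by decide, hb2 _⟩
  · unfold VarsFac
    refine ⟨?_, ?_, ⟨?_, ?_, ?_, ?_⟩, ?_, ?_, ?_, ?_⟩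
    · simp [pMixVals, Prog.run, h17, c1]
    · simp [pMixVals, Prog.run, h17, c1, h.v0, c2]
    all_goals
      simp only [pMixVals, Prog.run, Expr.eval_one, Expr.eval_add, Expr.eval_sub,
        Expr.eval_mul, Expr.eval_get, Expr.eval_var, Expr.eval_ofNat, Store.setVar_arrs,
        Store.setVar_vars, Nat.reduceEqDiff, reduceIte, h21, h17, Int.toNat_natCast, e0, e1, f1]
      push_cast
      simp only [a1, a2]
      cases k.fl v <;> simp [mixVal, pauliX]

/-- The order matters: the update of the free sites and the reset of the stored bit read the
dephasing flag before it is cleared. The last assignment loads the random integer for the coming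
sample. -/
def pAdvance : Prog :=
  .seq (.store 8 (.var 25) (.lt 0 (.get 8 (.var 25) + (1 - .get 6 (.var 17))))) <|
  .seq (.store 7 (.var 25) (.get 7 (.var 25) * .get 6 (.var 17))) <|
  .seq (.store 6 (.var 17) 0) <| .seq (.store 5 (.var 17) 0) <|
  .seq (.store 4 (.var 17) (.var 26)) <| .set 24 (.get 3 (.var 18))

theorem does_pAdvance (hB : 0 < B) (hs : Bdd B s) {k : Skel n} {z : Site n → Bool} {f : Fac n}
    {x y : ℝ} {v : Fin n} (hr : Rep (k.addFac f) z s)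
    (hf : f = ⟨k.cur v, k.next v, fun a b => mixVal x y b (xor a (k.fl v))⟩)
    (h17 : s.vars 17 = (v : ℕ)) (h25 : s.vars 25 = enc (k.cur v)) (h26 : s.vars 26 = enc (k.next v)) :
    Does X B pAdvance s fun s' =>
      Rep (k.mix x y v) (k.forget v z) s' ∧ s'.vars 24 = s.arrs 3 (s.vars 18).toNat := by
  have d0 : s.arrs 6 v = bit (k.dp v) := hr.dp v
  have d1 : (if 0 < s.arrs 8 (enc (k.cur v)) + (1 - bit (k.dp v)) then 1 else 0 : ℤ)
      = bit (decide (k.cur v ∈ (k.mix x y v).free)) := by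
    have : s.arrs 8 (enc (k.cur v)) = bit (decide (k.cur v ∈ k.free)) := hr.free _
    rw [this]
    simp only [Skel.mix]
    by_cases hd : k.dp v = true <;> by_cases hc : k.cur v ∈ k.free <;> simp [hd, hc]
  have d2 : s.arrs 7 (enc (k.cur v)) * bit (k.dp v) = bit (k.forget v z (k.cur v)) := by
    rw [hr.bits (k.cur v)]
    unfold Skel.forget
    cases k.dp v <;> simp
  have hb0 : (0 : ℤ).natAbs < 2 ^ B := by simp
  refine does_run hs ?_ ?_
  · simp only [pAdvance, Prog.Ok, Prog.run, Expr.eval_lt, Expr.eval_zero, Expr.eval_one, Expr.eval_add,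
      Expr.eval_sub, Expr.eval_mul, Expr.eval_get, Expr.eval_var, Store.setArr_arrs,
      Store.setArr_vars, Nat.reduceEqDiff, reduceIte, h17, Int.toNat_natCast, h25, d0, d1, d2]
    exact ⟨⟨⟨by decide, by decide⟩, natAbs_bit_lt hB _⟩, ⟨⟨by decide, by decide⟩, natAbs_bit_lt hB _⟩,
      ⟨⟨by decide, by decide⟩, hb0⟩, ⟨⟨by decide, by decide⟩, hb0⟩, ⟨⟨by decide, by decide⟩, hs.1 _⟩,
      by decide, hs.2 _ _⟩
  · simp only [pAdvance, Prog.run, Expr.eval_lt, Expr.eval_zero, Expr.eval_one, Expr.eval_add,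
      Expr.eval_sub, Expr.eval_mul, Expr.eval_get, Expr.eval_var, Store.setArr_arrs,
      Store.setArr_vars, Nat.reduceEqDiff, reduceIte, h17, Int.toNat_natCast, h25, d0, d1, d2, h26]
    refine ⟨⟨?_, ?_, ?_, ?_, ?_, ?_⟩, by simp⟩
    · intro w
      have := hr.cur w
      simp only [Store.setVar_arrs, Store.setArr_arrs, Nat.reduceEqDiff, reduceIte, Function.update_apply, Fin.val_inj]
      split_ifs with hw
      · subst hw; simp [Skel.cur, Skel.next, Skel.mix]
      · rw [this]; simp [Skel.cur, Skel.addFac, Skel.mix, hw]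
    · intro w
      have := hr.fl w
      simp only [Store.setVar_arrs, Store.setArr_arrs, Nat.reduceEqDiff, reduceIte, Function.update_apply, Fin.val_inj]
      split_ifs with hw
      · subst hw; simp [Skel.mix]
      · rw [this]; simp [Skel.addFac, Skel.mix, hw]
    · intro w
      have := hr.dp w
      simp only [Store.setVar_arrs, Store.setArr_arrs, Nat.reduceEqDiff, reduceIte, Function.update_apply, Fin.val_inj]
      split_ifs with hw
      · subst hw; simp [Skel.mix]
      · rw [this]; simp [Skel.addFac, Skel.mix, hw]
    · intro w
      have := hr.bits w
      simp only [Store.setVar_arrs, Store.setArr_arrs, Nat.reduceEqDiff, reduceIte, Function.update_apply]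
      split_ifs with hw
      · rw [enc_injective hw]
      · have hw' : w ≠ k.cur v := fun h => hw (by rw [h])
        rw [this]; unfold Skel.forget; split_ifs <;> simp [hw']
    · intro w
      have : s.arrs 8 (enc w) = bit (decide (w ∈ k.free)) := hr.free w
      simp only [Store.setVar_arrs, Store.setArr_arrs, Nat.reduceEqDiff, reduceIte, Function.update_apply]
      split_ifs with hw
      · rw [enc_injective hw]
      · have hw' : w ≠ k.cur v := fun h => hw (by rw [h])
        rw [this]; simp only [Skel.mix]; split_ifs <;> simp [hw']
    · have : (k.mix x y v).facs = k.facs ++ [f] := by rw [hf]; rfl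
      rw [this]
      exact hr.facs

def pMix : Prog :=
  .seq pMixVals <| .seq pFac <| .seq pAdvance <| .seq pSample <| .seq (.store 7 (.var 26) (.var 55)) pNext

theorem does_pMix (h : Static X B m cap T θ a b c τ n s) (hs : Bdd B s) {i : ℕ} (hi : i < T)
    (hst : State m i p s) {j : Fin r} {v : Fin n} (h21 : s.vars 21 = (j : ℕ))
    (h17 : s.vars 17 = (v : ℕ)) (ch : ℕ → Fin 5) :
    Does X B pMix s (State m (i + 1) (sampleStep θ ch (2 ^ m) cap (.mix j v) (τ i).toNat p)) := by
  obtain ⟨hr, h18, hinv⟩ := hst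
  have hbd := h.bound
  have hinv' : Inv m (i + 1) (p.1.mix (θ.cb j) (θ.sb j) v) := hinv.step h.le (.mix j v) 4
  set k' := p.1.mix (θ.cb j) (θ.sb j) v with hk'
  -- Before step `i` a qubit has had at most `i` < `T` mixers, so the new segment has index at most
  -- `T` and its code is below the size of the site arrays.
  have hcurlt : enc (p.1.next v) < n * (T + 1) :=
    enc_lt (by have := hinv.seg_le v; simp only [Skel.next]; omega)
  refine does_seq (does_pMixVals h hs hr h21 h17 (lt_two_pow_of_le (by omega))) ?_
  intro s1 hs1 k1 h1
  have r1 := hr.keep k1 (by decide) (by decide)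
  have st1 := h.keep k1 (by decide) (by decide)
  refine does_seq (does_pFac hs1 r1.facs h1 (h.length_lt hi hinv)) ?_
  intro s2 hs2 k2 h2
  have st2 := st1.keep k2 (by decide) (by decide)
  refine does_seq (does_pAdvance h.pos hs2 (r1.addFac k2 h2) rfl
    (by rw [k2.1 _ (by decide), k1.1 _ (by decide)]; exact h17)
    (by rw [k2.1 _ (by decide)]; exact h1.1) (by rw [k2.1 _ (by decide)]; exact h1.2.1)) ?_
  rintro s3 hs3 k3 ⟨r3, h24⟩
  have st3 := st2.keep k3 (by decide) (by decide)
  obtain ⟨ht, ht0⟩ := st2.tape i hi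
  have h18' : s2.vars 18 = i := by rw [k2.1 _ (by decide), k1.1 _ (by decide)]; exact h18
  rw [h18', Int.toNat_natCast, ht] at h24
  obtain ⟨u, hu⟩ : ∃ u : ℕ, τ i = u := ⟨(τ i).toNat, by omega⟩
  have h26 : s3.vars 26 = enc (p.1.next v) := by
    rw [k3.1 _ (by decide), k2.1 _ (by decide)]; exact h1.2.1
  have env : SampleEnv X B m cap (n * (T + 1)) k' (p.1.forget v p.2) (p.1.next v) s3 := by
    refine ⟨r3.facs, r3.free, r3.bits, h26, st3.v10, ?_, ?_, hcurlt, hinv'.norm_le, ?_,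
      h.size_le, ?_, h.cap_le⟩
    · intro f hf
      have q1 := hinv'.wf.a_le f hf
      have q2 := hinv'.wf.b_le f hf
      have q3 := hinv'.seg_le f.a.1
      have q4 := hinv'.seg_le f.b.1
      exact ⟨enc_lt (by omega), enc_lt (by omega)⟩
    · intro x hx
      have q1 := hinv'.wf.free_lt x hx
      have q2 := hinv'.seg_le x.1
      exact enc_lt (by omega)
    · have q1 : k'.facs.length ≤ T := hinv'.len_le.trans hi
      have q2 : (m + 1) * k'.facs.length ≤ (m + 1) * T := Nat.mul_le_mul_left _ q1
      omega
    · exact (hinv'.len_le.trans hi).trans h.tape_le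
  refine does_seq (does_pSample hs3 env st3.v11 st3.v9 (h24.trans hu)) ?_
  intro s4 hs4 k4 h4
  have r4 := r3.keep k4 (by decide) (by decide)
  have st4 := st3.keep k4 (by decide) (by decide)
  have h26' : s4.vars 26 = enc (p.1.next v) := by rw [k4.1 _ (by decide)]; exact h26
  refine does_seq (P := Rep k' (Function.update (p.1.forget v p.2) (p.1.next v)
    (sampleBit (2 ^ m) cap k' (p.1.next v) (p.1.forget v p.2) u)))
    (does_run hs4 ⟨⟨by decide, by decide⟩, hs4.1 _⟩ ?_) ?_
  · refine ⟨r4.cur, r4.fl, r4.dp, ?_, r4.free, r4.facs⟩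
    intro w
    have := r4.bits w
    simp only [Prog.run, Store.setArr_arrs, reduceIte, Expr.eval_var, h26', Int.toNat_natCast,
      Function.update_apply, h4]
    by_cases hw : w = p.1.next v
    · rw [if_pos (by rw [hw]), if_pos hw]
    · rw [if_neg fun h => hw (enc_injective h), if_neg hw]; exact this
  · intro s5 hs5 k5 r5
    have st5 := st4.keep k5 (by decide) (by decide)
    have := does_pNext st5 hs5 hi r5 (by
      rw [k5.1 _ (by decide), k4.1 _ (by decide), k3.1 _ (by decide)]; exact h18') hinv'
    rw [hu, Int.toNat_natCast]
    exact this

def pInit : Prog := .seq (.store 7 (.var 17) (.get 3 (.var 18) % 2)) pNext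

theorem does_pInit (h : Static X B m cap T θ a b c τ n s) (hs : Bdd B s) {i : ℕ} (hi : i < T)
    (hst : State m i p s) {v : Fin n} (h17 : s.vars 17 = (v : ℕ)) (ch : ℕ → Fin 5) (M : ℕ) :
    Does X B pInit s (State m (i + 1) (sampleStep θ ch M cap (.init v) (τ i).toNat p)) := by
  obtain ⟨hr, h18, hinv⟩ := hst
  obtain ⟨ht, ht0⟩ := h.tape i hi
  obtain ⟨u, hu⟩ : ∃ u : ℕ, τ i = u := ⟨(τ i).toNat, by omega⟩
  have hval : (Expr.get 3 (.var 18) % 2).eval s = bit (decide (u % 2 = 1)) := by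
    simp only [Expr.eval_mod, Expr.eval_get, Expr.eval_var, h18, Int.toNat_natCast, ht, hu,
      Expr.eval_ofNat]
    rw [bit_decide_mod]; rfl
  rw [hu, Int.toNat_natCast]
  refine does_seq (P := Rep p.1 (Function.update p.2 (v, 0) (decide (u % 2 = 1))))
    (does_run hs ⟨⟨by decide, by decide⟩, ?_⟩ ?_) ?_
  · rw [hval]; exact natAbs_bit_lt h.pos _
  · refine ⟨hr.cur, hr.fl, hr.dp, ?_, hr.free, hr.facs⟩
    intro w
    have := hr.bits w
    simp only [Prog.run]
    rw [hval]
    have hv : enc ((v, 0) : Site n) = v := by simp [enc]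
    simp only [Store.setArr_arrs, reduceIte, Expr.eval_var, h17, Int.toNat_natCast,
      Function.update_apply, ← hv]
    by_cases hw : w = (v, 0)
    · rw [if_pos (by rw [hw]), if_pos hw]
    · rw [if_neg fun h => hw (enc_injective h), if_neg hw]; exact this
  · intro s1 hs1 k1 r1
    exact does_pNext (h.keep k1 (by decide) (by decide)) hs1 hi r1
      (by rw [k1.1 _ (by decide)]; exact h18) (hinv.step h.le (.init v) 4)

end

section

variable {X B m cap T a b c : ℕ} {θ : Gates r} {τ : ℕ → ℤ} {s s' : Store}
  {p : Skel n × (Site n → Bool)}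

/-! ### The sampler as a program -/

theorem State.setVar {i x : ℕ} {y : ℤ} (h : State m i p s) (h8 : x ≠ 18) (h9 : x ≠ 19) :
    State m i p (s.setVar x y) := by
  obtain ⟨hr, h18, hinv⟩ := h
  refine ⟨⟨hr.cur, hr.fl, hr.dp, hr.bits, hr.free, ?_, hr.facs.2⟩, ?_, hinv⟩
  · rw [Store.setVar_vars, if_neg h9.symm]; exact hr.facs.1
  · rw [Store.setVar_vars, if_neg h8.symm]; exact h18

/-- Lifts a one-qubit step to a loop over all qubits. The predicate `E` carries facts that the loop
preserves, such as the round number used by a mixer. -/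
theorem does_each {body : Prog} {ch : ℕ → Fin 5} {M : ℕ} (e : Fin n → El n r) (E : Store → Prop)
    (hE : ∀ s s', Keep (Prog.loop 17 0 body) s s' → E s → E s') (h17 : 17 ∉ body.wv)
    (h0 : 0 ∉ body.wv) (hwv : ∀ x ∈ (Prog.loop 17 0 body).wv, 16 ≤ x)
    (hwa : ∀ x ∈ (Prog.loop 17 0 body).wa, x ≠ 0 ∧ x ≠ 3)
    (hbody : ∀ (v : Fin n) (i : ℕ) (p : Skel n × (Site n → Bool)) (s : Store),
      Static X B m cap T θ a b c τ n s → Bdd B s → i < T → State m i p s → E s →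
      s.vars 17 = (v : ℕ) →
      Does X B body s (State m (i + 1) (sampleStep θ ch M cap (e v) (τ i).toNat p)))
    (h : Static X B m cap T θ a b c τ n s) (hs : Bdd B s) {i : ℕ} (hi : i + n ≤ T)
    (hst : State m i p s) (hEs : E s) :
    Does X B (Prog.loop 17 0 body) s
      (State m (i + n) (runFrom θ ch M cap τ ((List.finRange n).map e) i p)) := by
  have hbd := h.bound
  have hnX : n ≤ X := by
    have := h.size_le
    nlinarith
  have hnB : n ≤ B := by nlinarith
  refine (does_loop h17 h0 (by decide) hs h.v0 hnX (lt_two_pow_of_le hnB)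
    (fun j s' => State m (i + j) (runFrom θ ch M cap τ (((List.finRange n).map e).take j) i p) s')
    ?_ ?_).mono ?_
  · exact hst.setVar (by decide) (by decide)
  · intro j hj s' hs' hk hj' hI
    have hlen : j < ((List.finRange n).map e).length := by simpa using hj
    refine (hbody ⟨j, hj⟩ (i + j) _ s' (h.keep hk hwv hwa) hs' (by omega) hI (hE _ _ hk hEs) hj').mono ?_
    intro s'' _ _ hQ
    rw [List.take_succ_eq_append_getElem hlen, runFrom_append, List.length_take,
      min_eq_left hlen.le]
    have : ((List.finRange n).map e)[j] = e ⟨j, hj⟩ := by simp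
    rw [this]
    exact hQ.setVar (by decide) (by decide)
  · intro s' _ _ hI
    have : ((List.finRange n).map e).take n = (List.finRange n).map e :=
      List.take_of_length_le (by simp)
    rwa [this] at hI

theorem getD_flatMap_four {α : Type*} (f : α → List ℤ) (hf : ∀ a, (f a).length = 4) (l : List α)
    {i t : ℕ} (hi : i < l.length) (ht : t < 4) :
    (l.flatMap f).getD (4 * i + t) 0 = (f l[i]).getD t 0 := by
  induction l generalizing i with
  | nil => simp at hi
  | cons a l ih =>
    rw [List.flatMap_cons]
    cases i with
    | zero =>
      rw [List.getD_append _ _ _ _ (by rw [hf]; omega)]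
      simp
    | succ i =>
      rw [List.getD_append_right _ _ _ _ (by rw [hf]; omega), hf,
        show 4 * (i + 1) + t - 4 = 4 * i + t by omega, ih (by simpa using hi)]
      simp

theorem Op.length_encode (o : Op n r) : o.encode.length = 4 := by cases o <;> rfl

def pOp : Prog :=
  .seq (.seq (.set 20 (.get 1 (4 * .var 16))) <| .seq (.set 21 (.get 1 (4 * .var 16 + 1))) <|
    .seq (.set 22 (.get 1 (4 * .var 16 + 2))) (.set 23 (.get 1 (4 * .var 16 + 3)))) <|
  .ite (.eq (.var 20) 0) pZZ <|
  .ite (.eq (.var 20) 1) (.loop 17 0 pNoise) (.loop 17 0 pMix)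

/-- The array `1` holds the list of operations. -/
def OpsRep (l : List (Op n r)) (s : Store) : Prop :=
  ∀ i, s.arrs 1 i = (l.flatMap Op.encode).getD i 0

theorem does_pOp (h : Static X B m cap T θ a b c τ n s) (hs : Bdd B s) {l : List (Op n r)}
    (hl : OpsRep l s) {i : ℕ} (hi : i < l.length) (h16 : s.vars 16 = i) {j : ℕ}
    (hj : j + (l[i].expand).length ≤ T) (hst : State m j p s) :
    Does X B pOp s (State m (j + (l[i].expand).length)
      (runFrom θ (chOf a b c) (2 ^ m) cap τ l[i].expand j p)) := by
  have e0 : (4 * (i : ℤ)).toNat = 4 * i + 0 := by omega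
  have e1 : (4 * (i : ℤ) + 1).toNat = 4 * i + 1 := by omega
  have e2 : (4 * (i : ℤ) + 2).toNat = 4 * i + 2 := by omega
  have e3 : (4 * (i : ℤ) + 3).toNat = 4 * i + 3 := by omega
  have hrd : ∀ t < 4, s.arrs 1 (4 * i + t) = l[i].encode.getD t 0 := fun t ht => by
    rw [hl, getD_flatMap_four _ Op.length_encode _ hi ht]
  refine does_seq (P := fun s' => s'.vars 20 = l[i].encode.getD 0 0 ∧
    s'.vars 21 = l[i].encode.getD 1 0 ∧ s'.vars 22 = l[i].encode.getD 2 0 ∧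
    s'.vars 23 = l[i].encode.getD 3 0) (does_run hs ?_ ?_) ?_
  · simp only [Prog.Ok, Prog.run, Expr.eval_one, Expr.eval_add, Expr.eval_mul, Expr.eval_get,
      Expr.eval_var, Expr.eval_ofNat, Store.setVar_arrs, Store.setVar_vars, Nat.reduceEqDiff,
      reduceIte, h16]
    exact ⟨⟨by decide, hs.2 _ _⟩, ⟨by decide, hs.2 _ _⟩, ⟨by decide, hs.2 _ _⟩, by decide, hs.2 _ _⟩
  · simp only [Prog.run, Expr.eval_one, Expr.eval_add, Expr.eval_mul, Expr.eval_get,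
      Expr.eval_var, Expr.eval_ofNat, Store.setVar_arrs, Store.setVar_vars, Nat.reduceEqDiff,
      reduceIte, h16, e0, e1, e2, e3, hrd 0 (by decide), hrd 1 (by decide), hrd 2 (by decide),
      hrd 3 (by decide), and_self]
  rintro s1 hs1 k1 ⟨h20, h21, h22, h23⟩
  have st1 := h.keep k1 (by decide) (by decide)
  have hst1 : State m j p s1 := ⟨hst.1.keep k1 (by decide) (by decide),
    (k1.1 18 (by decide)).trans hst.2.1, hst.2.2⟩
  generalize l[i] = o at *
  cases o with
  | zz j' u w =>
    simp only [Op.encode, List.getD_cons_zero, List.getD_cons_succ] at h20 h21 h22 h23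
    refine does_ite hs1 (by decide) (fun _ => ?_) (fun h0 => absurd h0 (by simp [h20]))
    simp only [Op.expand, List.length_singleton] at hj
    exact does_pZZ st1 hs1 (by omega) hst1 h21 h22 h23 (chOf a b c) (2 ^ m)
  | noise =>
    simp only [Op.encode, List.getD_cons_zero, List.getD_cons_succ] at h20 h21 h22 h23
    refine does_ite hs1 (by decide) (fun h0 => absurd h0 (by simp [h20])) (fun _ => ?_)
    refine does_ite hs1 (by decide) (fun _ => ?_) (fun h0 => absurd h0 (by simp [h20]))
    simp only [Op.expand, List.length_map, List.length_finRange] at hj ⊢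
    exact does_each _ (fun _ => True) (fun _ _ _ _ => trivial) (by decide) (by decide) (by decide)
      (by decide) (fun v i p s hst hs hi hp _ hv => does_pNoise hst hs hi hp hv _) st1 hs1 hj hst1 trivial
  | mix j' =>
    simp only [Op.encode, List.getD_cons_zero, List.getD_cons_succ] at h20 h21 h22 h23
    refine does_ite hs1 (by decide) (fun h0 => absurd h0 (by simp [h20])) (fun _ => ?_)
    refine does_ite hs1 (by decide) (fun h0 => absurd h0 (by simp [h20])) (fun _ => ?_)
    simp only [Op.expand, List.length_map, List.length_finRange] at hj ⊢
    exact does_each _ (fun s => s.vars 21 = (j' : ℕ))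
      (fun s s' hk hE => (hk.1 21 (by decide)).trans hE) (by decide) (by decide) (by decide)
      (by decide) (fun v i p s hst hs hi hp hE hv => does_pMix hst hs hi hp hE hv _) st1 hs1 hj hst1 h21

def pCurs : Prog := .loop 17 0 (.store 4 (.var 17) (.var 17))

def pOut : Prog := .loop 17 0 (.store 2 (.var 17) ((.get 7 (.get 4 (.var 17)) + .get 5 (.var 17)) % 2))

/-- The deterministic part of the sampler. -/
def pMain : Prog := .seq pCurs <| .seq (.loop 17 0 pInit) <| .seq (.loop 16 4 pOp) pOut

theorem does_pMain (h : Static X B m cap T θ a b c τ n s) (hs : Bdd B s) {l : List (Op n r)}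
    (hl : OpsRep l s) (h4 : s.vars 4 = l.length) (hlX : l.length ≤ X) (hlB : l.length ≤ B)
    (hT : n + (l.flatMap Op.expand).length ≤ T) (h18 : s.vars 18 = 0) (h19 : s.vars 19 = 0)
    (hz : ∀ x, 4 ≤ x → ∀ y, s.arrs x y = 0) :
    Does X B pMain s fun s' => readOutput n s'
      = let q := runFrom θ (chOf a b c) (2 ^ m) cap τ
          ((List.finRange n).map El.init ++ l.flatMap Op.expand) 0 (Skel.start n, fun _ => false)
        readout q.1 q.2 := by
  have hbd := h.bound
  have hnX : n ≤ X := by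
    have := h.size_le
    nlinarith
  have hnB : n ≤ B := by nlinarith
  have hcur := does_loop (X := X) (B := B) (i := 17) (N := 0) (body := .store 4 (.var 17) (.var 17))
    (by decide) (by decide) (by decide) hs h.v0 hnX (lt_two_pow_of_le hnB)
    (fun j s' => ∀ v < j, s'.arrs 4 v = v) (by simp) (by
      intro j hj s' hs' hk hj' hI
      refine does_run hs' ⟨⟨by decide, by decide⟩, hs'.1 _⟩ ?_
      intro v hv
      simp only [Prog.run, Expr.eval_var, hj', Int.toNat_natCast, Store.setVar_arrs,
        Store.setArr_arrs, reduceIte, Function.update_apply]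
      split_ifs with hvj
      · rw [hvj]
      · exact hI v (by omega))
  refine does_seq hcur ?_
  intro s1 hs1 k1 h1
  have st1 := h.keep k1 (by decide) (by decide)
  -- Zero arrays already represent an empty skeleton without flips, flags or free sites, with all
  -- bits 0; only the current sites had to be written.
  have hz1 : ∀ x, 4 ≤ x → x ≠ 4 → ∀ y, s1.arrs x y = 0 := by
    intro x hx hx4 y
    rw [k1.2 x (by simpa [pCurs, Prog.loop, Prog.wa] using hx4)]
    exact hz x hx y
  have r1 : State m 0 (Skel.start n, fun _ => false) s1 := by
    refine ⟨⟨?_, ?_, ?_, ?_, ?_, ?_, ?_⟩, ?_, ⟨Skel.WF.start, ?_, ?_, ?_⟩⟩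
    · intro v; rw [h1 v v.2]; simp [Skel.start, Skel.cur, enc]
    · intro v; rw [hz1 5 (by decide) (by decide)]; rfl
    · intro v; rw [hz1 6 (by decide) (by decide)]; rfl
    · intro v; rw [hz1 7 (by decide) (by decide)]; rfl
    · intro v; rw [hz1 8 (by decide) (by decide)]; simp [Skel.start]
    · rw [k1.1 19 (by decide), h19]; simp [Skel.start]
    · intro i hi; simp [Skel.start] at hi
    · rw [k1.1 18 (by decide), h18]; rfl
    · intro v; exact le_rfl
    · simp [Skel.start]
    · simp [Skel.start]
  refine does_seq (does_each (ch := chOf a b c) (M := 2 ^ m) El.init (fun _ => True)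
    (fun _ _ _ _ => trivial) (by decide) (by decide) (by decide) (by decide)
    (fun v i p s hst hs hi hp _ hv => does_pInit hst hs hi hp hv _ _) st1 hs1 (i := 0) (by omega) r1 trivial) ?_
  intro s2 hs2 k2 r2
  rw [Nat.zero_add] at r2
  have st2 := st1.keep k2 (by decide) (by decide)
  have hl2 : OpsRep l s2 := by
    intro i; rw [k2.2 1 (by decide), k1.2 1 (by decide)]; exact hl i
  have h42 : s2.vars 4 = l.length := by rw [k2.1 4 (by decide), k1.1 4 (by decide)]; exact h4
  set p0 := runFrom θ (chOf a b c) (2 ^ m) cap τ ((List.finRange n).map El.init) 0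
    (Skel.start n, fun _ => false) with hp0
  have hmain := does_loop (X := X) (B := B) (i := 16) (N := 4) (body := pOp)
    (by decide) (by decide) (by decide) hs2 h42 hlX (lt_two_pow_of_le hlB)
    (fun i s' => State m (n + ((l.take i).flatMap Op.expand).length)
      (runFrom θ (chOf a b c) (2 ^ m) cap τ ((l.take i).flatMap Op.expand) n p0) s')
    (r2.setVar (by decide) (by decide)) (by
      intro i hi s' hs' hk hi' hI
      -- The step counter advances by the length of the expansion of each operation, so that tape
      -- entries and elementary operations stay aligned.
      have hstep : (l.take (i + 1)).flatMap Op.expand = (l.take i).flatMap Op.expand ++ l[i].expand := by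
        rw [List.take_succ_eq_append_getElem hi, List.flatMap_append]; simp
      have hle : ((l.take (i + 1)).flatMap Op.expand).length ≤ (l.flatMap Op.expand).length := by
        conv_rhs => rw [← List.take_append_drop (i + 1) l, List.flatMap_append, List.length_append]
        exact Nat.le_add_right _ _
      have hl' : OpsRep l s' := fun j => by rw [hk.2 1 (by decide)]; exact hl2 j
      rw [hstep, List.length_append] at hle
      refine (does_pOp (st2.keep hk (by decide) (by decide)) hs' hl' hi hi' (by omega) hI).mono ?_
      intro s'' _ _ hQ
      rw [hstep, List.length_append, runFrom_append, ← Nat.add_assoc]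
      exact hQ.setVar (by decide) (by decide))
  refine does_seq hmain ?_
  intro s3 hs3 k3 r3
  rw [List.take_length] at r3
  have hq : runFrom θ (chOf a b c) (2 ^ m) cap τ
      ((List.finRange n).map El.init ++ l.flatMap Op.expand) 0 (Skel.start n, fun _ => false)
      = runFrom θ (chOf a b c) (2 ^ m) cap τ (l.flatMap Op.expand) n p0 := by
    rw [runFrom_append, ← hp0]; simp
  rw [hq]
  set q := runFrom θ (chOf a b c) (2 ^ m) cap τ (l.flatMap Op.expand) n p0
  have st3 := st2.keep k3 (by decide) (by decide)
  refine (does_loop (by decide) (by decide) (by decide) hs3 st3.v0 hnX (lt_two_pow_of_le hnB)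
    (fun j s' => ∀ v : Fin n, (v : ℕ) < j → s'.arrs 2 v = bit (readout q.1 q.2 v)) (by simp) (by
      intro j hj s' hs' hk hj' hI
      have hval : (Expr.get 7 (.get 4 (.var 17)) + .get 5 (.var 17) : Expr).eval s' % 2
          = bit (readout q.1 q.2 ⟨j, hj⟩) := by
        simp only [Expr.eval_add, Expr.eval_get, Expr.eval_var, hj', Int.toNat_natCast]
        rw [hk.2 7 (by decide), hk.2 4 (by decide), hk.2 5 (by decide)]
        have c1 := r3.1.cur ⟨j, hj⟩
        have c2 := r3.1.fl ⟨j, hj⟩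
        simp only at c1 c2
        rw [c1, c2, Int.toNat_natCast, r3.1.bits, bit_add_mod]
        rfl
      refine does_run hs' ⟨⟨by decide, by decide⟩, ?_⟩ ?_
      · rw [Expr.eval_mod, Expr.eval_ofNat, hval]; exact natAbs_bit_lt st3.pos _
      · intro v hv
        simp only [Prog.run, Expr.eval_mod, Expr.eval_ofNat]
        rw [hval]
        simp only [Expr.eval_var, hj', Int.toNat_natCast, Store.setVar_arrs,
          Store.setArr_arrs, reduceIte, Function.update_apply]
        split_ifs with hvj
        · congr 2; exact Fin.ext hvj.symm
        · exact hI v (by omega))).mono ?_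
  intro s4 _ _ h4
  funext v
  unfold readOutput
  rw [h4 v v.2]
  cases readout q.1 q.2 v <;> simp

end

section

variable {X B m : ℕ} {s s' : Store} {Q P : Store → Prop} {α β : Type}

/-! ### The random tape -/

theorem doesR_mono {c : Prog} {g : Store → α} {κ : PMF α} (h : DoesR X B c s g κ P)
    (hPQ : ∀ s', P s' → Q s') : DoesR X B c s g κ Q := by
  obtain ⟨μ, h1, h2, h3⟩ := h
  exact ⟨μ, h1, fun s' hs' => ⟨(h2 s' hs').1, (h2 s' hs').2.1, hPQ s' (h2 s' hs').2.2⟩, h3⟩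

theorem doesR_flip {x : ℕ} (hs : Bdd B s) (hB : 0 < B) (g : Store → α)
    (hQ : ∀ b, Q (s.setVar x (bit b))) :
    DoesR X B (.flip x) s g ((PMF.uniformOfFintype Bool).map fun b => g (s.setVar x (bit b))) Q := by
  refine ⟨_, Runs.mono _ _ _ _ _ (Runs.flip s x) ?_, ?_, ?_⟩
  · have : 1 ≤ (B + 1) ^ 2 := Nat.one_le_pow _ _ (by omega)
    simp only [Prog.tm, stepCost]; omega
  · intro t ht
    rw [PMF.mem_support_map_iff] at ht
    obtain ⟨b, -, rfl⟩ := ht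
    refine ⟨hs.setVar x (natAbs_bit_lt hB b), ⟨?_, fun _ _ => rfl⟩, hQ b⟩
    intro y hy
    have : y ≠ x := by simpa [Prog.wv] using hy
    simp [this]
  · rw [PMF.map_comp]; rfl

theorem doesR_seq_det {c d : Prog} {g : Store → α} {κ : PMF α} (hc : Does X B c s P)
    (hd : ∀ s', Bdd B s' → Keep c s s' → P s' → DoesR X B d s' g κ Q) :
    DoesR X B (.seq c d) s g κ Q := by
  have := doesR_seq (g := fun _ => ()) (κ' := fun _ => κ)
    (doesR_of_does (hc.mono fun s' _ _ h => ⟨rfl, h⟩)) hd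
  rwa [PMF.pure_bind] at this

def pDigit : Prog := .seq (.flip 33) (.set 32 (.var 32 + .var 32 + .var 33))

def pEntry : Prog :=
  .seq (.set 32 0) <| .seq (.loop 31 3 pDigit) <| .store 3 (.var 30) (.var 32)

def pTape : Prog := .loop 30 8 pEntry

theorem doesR_pDigit (hs : Bdd B s) {l : ℕ} (hl : l + 1 < B) {x : ℕ} (h32 : s.vars 32 = x)
    (hx : x < 2 ^ l) : DoesR X B pDigit s (fun s => s.vars 32) (bitK (s.vars 32)) fun s' =>
      ∃ y : ℕ, s'.vars 32 = y ∧ y < 2 ^ (l + 1) := by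
  have h1 := doesR_flip (X := X) (x := 33) (Q := fun s' => s'.vars 32 = x ∧ ∃ b, s'.vars 33 = bit b)
    hs (by omega) (fun s => s.vars 32 + s.vars 32 + s.vars 33)
    (fun b => ⟨by simpa using h32, b, by simp⟩)
  have h2 := doesR_seq (d := .set 32 (.var 32 + .var 32 + .var 33)) (h := fun s => s.vars 32)
    (κ' := PMF.pure) (Q := fun s' => ∃ y : ℕ, s'.vars 32 = y ∧ y < 2 ^ (l + 1)) h1 (by
      rintro s' hs' - ⟨h3, b, h4⟩
      have e : ((x : ℤ) + x + bit b) = (x + x + b.toNat : ℕ) := by cases b <;> simp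
      have hlt : x + x + b.toNat < 2 ^ (l + 1) := by
        have := b.toNat_le
        rw [pow_succ]; omega
      have hB : (2 : ℕ) ^ (l + 1) ≤ 2 ^ B := Nat.pow_le_pow_right (by norm_num) hl.le
      apply doesR_of_does
      refine does_run hs' ⟨by decide, ?_⟩ ⟨?_, x + x + b.toNat, ?_, hlt⟩
      · simp only [Expr.eval_add, Expr.eval_var, h3, h4, e, Int.natAbs_natCast]
        omega
      · simp [Prog.run]
      · simp [Prog.run, h3, h4, e])
  rw [PMF.bind_pure] at h2
  have e : ((PMF.uniformOfFintype Bool).map fun b =>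
      (s.setVar 33 (bit b)).vars 32 + (s.setVar 33 (bit b)).vars 32 + (s.setVar 33 (bit b)).vars 33)
      = bitK (s.vars 32) := by
    unfold bitK
    congr 1
  rwa [e] at h2

/-- Besides the law, nonnegativity of the entries is recorded: the steps of the sampler read an
entry through `Int.toNat`. -/
theorem doesR_pEntry (hs : Bdd B s) (hm : s.vars 3 = m) (hmX : m ≤ X) (hmB : m + 1 < B) {i : ℕ}
    (h30 : s.vars 30 = i) (hpos : ∀ j, 0 ≤ s.arrs 3 j) :
    DoesR X B pEntry s (fun s => s.arrs 3) (tapeK m i (s.arrs 3)) fun s' => ∀ j, 0 ≤ s'.arrs 3 j := by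
  refine doesR_seq_det (P := fun s' => s'.vars 32 = 0) (does_run hs ⟨by decide, by simp⟩
    (by simp [Prog.run])) ?_
  intro s1 hs1 k1 h1
  have hm1 : s1.vars 3 = m := by rw [k1.1 3 (by decide)]; exact hm
  have hloop := doesR_loop (X := X) (B := B) (i := 31) (N := 3) (body := pDigit) (by decide)
    (by decide) (by decide) hs1 hm1 hmX (lt_two_pow_of_le (by omega)) (fun s => s.vars 32)
    (fun s z => by simp) (fun _ => bitK)
    (fun l s' => ∃ y : ℕ, s'.vars 32 = y ∧ y < 2 ^ l) ⟨0, by simpa using h1, by simp⟩ (by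
      rintro l hl s' hs' - - ⟨y, hy, hyl⟩
      refine doesR_mono (doesR_pDigit hs' (by omega) hy hyl) ?_
      rintro s'' ⟨y, hy, hyl⟩
      exact ⟨y, by simpa using hy, hyl⟩)
  rw [h1] at hloop
  have h2 := doesR_seq (d := .store 3 (.var 30) (.var 32)) (h := fun s => s.arrs 3)
    (κ' := fun x => PMF.pure (Function.update (s.arrs 3) i x))
    (Q := fun s' => ∀ j, 0 ≤ s'.arrs 3 j) hloop (by
      rintro s' hs' k' ⟨y, hy, -⟩
      have h30' : s'.vars 30 = i := by rw [k'.1 30 (by decide), k1.1 30 (by decide)]; exact h30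
      have h3 : s'.arrs 3 = s.arrs 3 := by rw [k'.2 3 (by decide), k1.2 3 (by decide)]
      apply doesR_of_does
      refine does_run hs' ⟨⟨by decide, by decide⟩, hs'.1 _⟩ ⟨?_, ?_⟩
      · simp [Prog.run, h30', h3]
      · intro j
        simp only [Prog.run, Store.setArr_arrs, reduceIte, Expr.eval_var, h30', Int.toNat_natCast,
          h3, Function.update_apply, hy]
        split_ifs
        · omega
        · exact hpos j)
  exact h2

theorem doesR_pTape (hs : Bdd B s) {T : ℕ} (hm : s.vars 3 = m) (hmX : m ≤ X) (hmB : m + 1 < B)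
    (h8 : s.vars 8 = T) (hTX : T ≤ X) (hTB : T ≤ B) (hpos : ∀ j, 0 ≤ s.arrs 3 j) :
    DoesR X B pTape s (fun s => s.arrs 3) (iterK (tapeK m) T 0 (s.arrs 3)) fun s' =>
      ∀ j, 0 ≤ s'.arrs 3 j :=
  doesR_loop (by decide) (by decide) (by decide) hs h8 hTX (lt_two_pow_of_le hTB)
    (fun s => s.arrs 3) (fun s z => rfl) (tapeK m) (fun _ s' => ∀ j, 0 ≤ s'.arrs 3 j) hpos
    fun k _ s' hs' hk hk' hI =>
      doesR_pEntry hs' ((hk.1 3 (by decide)).trans hm) hmX hmB hk' hI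

/-! ### The whole program -/

/-- Variable 8 is T = (number of operations + 1)·n, which bounds the elementary operations: an
operation expands into at most n of them, and n more prepare the qubits. Variable 11 is the cap
4·T·n(r+1)·k, chosen so that twice the expected number of large clusters is at most 1/k. -/
def pSetup : Prog :=
  .seq (.seq (.set 8 ((.var 4 + 1) * .var 0)) (.set 9 1)) <|
  .seq (.loop 31 3 (.set 9 (.var 9 + .var 9))) <|
  .seq (.set 10 (.var 0 * (.var 8 + 1))) <|
  .seq (.set 11 (4 * (.var 8 * (.var 0 * (.var 1 + 1)) * .var 2)))
    (.set 12 (.var 5 + .lt (.var 6) (.var 5) * (.var 6 - .var 5)))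

def sampler : Prog := .seq pSetup <| .seq pTape pMain

theorem does_pSetup (hs : Bdd B s) {r k nops a b T cap : ℕ} (h0 : s.vars 0 = n) (h1 : s.vars 1 = r)
    (h2 : s.vars 2 = k) (h3 : s.vars 3 = m) (h4 : s.vars 4 = nops) (h5 : s.vars 5 = a)
    (h6 : s.vars 6 = b) (hT : T = (nops + 1) * n) (hcap : cap = 4 * (T * (n * (r + 1)) * k))
    (hmX : m ≤ X) (hB : T + n * (T + 1) + cap + m + 2 ≤ B) :
    Does X B pSetup s fun s' => s'.vars 8 = T ∧ s'.vars 9 = (2 ^ m : ℕ) ∧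
      s'.vars 10 = (n * (T + 1) : ℕ) ∧ s'.vars 11 = cap ∧ s'.vars 12 = (min a b : ℕ) := by
  have hTe : ((nops : ℤ) + 1) * n = T := by rw [hT]; push_cast; ring
  have hbd : ∀ x : ℕ, x ≤ B → (x : ℤ).natAbs < 2 ^ B := fun x hx => by
    rw [Int.natAbs_natCast]; exact lt_two_pow_of_le hx
  refine does_seq (P := fun s' => s'.vars 8 = T ∧ s'.vars 9 = 1) (does_run hs ?_ ?_) ?_
  · simp only [Prog.Ok, Prog.run, Expr.eval_add, Expr.eval_mul, Expr.eval_var, Expr.eval_one, h0, h4, hTe]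
    exact ⟨⟨by decide, hbd T (by omega)⟩, by decide, natAbs_bit_lt (by omega) true⟩
  · simp [Prog.run, h0, h4, hTe]
  rintro s1 hs1 k1 ⟨v8, v9⟩
  refine does_seq (does_loop (X := X) (B := B) (by decide) (by decide) (by decide) hs1
    ((k1.1 3 (by decide)).trans h3) hmX (lt_two_pow_of_le (by omega))
    (fun l s' => s'.vars 9 = (2 ^ l : ℕ)) (by simpa using v9) ?_) ?_
  · intro l hl s' hs' _ _ hI
    have e : (Expr.var 9 + .var 9 : Expr).eval s' = (2 ^ (l + 1) : ℕ) := by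
      simp only [Expr.eval_add, Expr.eval_var, hI]; push_cast; ring
    refine does_run hs' ⟨by decide, ?_⟩ ?_
    · rw [e, Int.natAbs_natCast]
      exact Nat.pow_lt_pow_right (by norm_num) (by omega)
    · simp only [Prog.run]
      rw [e]; simp
  intro s2 hs2 k2 v9'
  have v8' : s2.vars 8 = T := by rw [k2.1 8 (by decide)]; exact v8
  have v0 : s2.vars 0 = n := by rw [k2.1 0 (by decide), k1.1 0 (by decide)]; exact h0
  have v1 : s2.vars 1 = r := by rw [k2.1 1 (by decide), k1.1 1 (by decide)]; exact h1
  have v2 : s2.vars 2 = k := by rw [k2.1 2 (by decide), k1.1 2 (by decide)]; exact h2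
  have v5 : s2.vars 5 = a := by rw [k2.1 5 (by decide), k1.1 5 (by decide)]; exact h5
  have v6 : s2.vars 6 = b := by rw [k2.1 6 (by decide), k1.1 6 (by decide)]; exact h6
  have e10 : (n : ℤ) * (T + 1) = (n * (T + 1) : ℕ) := by push_cast; ring
  have e11 : (4 : ℤ) * (T * (n * (r + 1)) * k) = cap := by rw [hcap]; push_cast; ring
  have e12 : (a : ℤ) + (if (b : ℤ) < a then 1 else 0) * (b - a) = (min a b : ℕ) := by
    split_ifs with h <;> push_cast <;> omega
  have hb12 : ((min a b : ℕ) : ℤ).natAbs < 2 ^ B := by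
    have q1 := hs2.1 5
    rw [v5] at q1
    have : min a b ≤ a := min_le_left _ _
    rw [Int.natAbs_natCast] at q1 ⊢
    omega
  refine does_run hs2 ?_ ?_
  · simp only [Prog.Ok, Prog.run, Expr.eval_add, Expr.eval_sub, Expr.eval_mul, Expr.eval_var,
      Expr.eval_one, Expr.eval_ofNat, Expr.eval_lt, Store.setVar_vars, Nat.reduceEqDiff, reduceIte,
      v0, v1, v2, v5, v6, v8', e10, e11, e12]
    exact ⟨⟨by decide, hbd _ (by omega)⟩, ⟨by decide, hbd _ (by omega)⟩, by decide, hb12⟩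
  · simp only [Prog.run, Expr.eval_add, Expr.eval_sub, Expr.eval_mul, Expr.eval_var,
      Expr.eval_one, Expr.eval_ofNat, Expr.eval_lt, Store.setVar_vars, Nat.reduceEqDiff, reduceIte,
      v0, v1, v2, v5, v6, v8', v9', e10, e11, e12, and_self, Nat.succ_ne_self]

end

/-! ### The run of the sampler on a circuit -/

section

variable {G : SimpleGraph (Fin n)} (Q : MaxCutCircuit G r) (N : PauliNoise)

theorem abs_truncated_le (m : ℕ) {x : ℝ} (hx : |x| ≤ 1) : |(truncated m x : ℝ)| ≤ 2 ^ m := by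
  have h := (truncated_bounds m hx).1
  have h2 : (0 : ℝ) < 2 ^ m := by positivity
  rwa [abs_mul, abs_of_pos (inv_pos.2 h2), inv_mul_le_iff₀ h2, mul_one] at h

theorem intGates_le (m : ℕ) : (Q.intGates m).Le (2 ^ m) := fun _ =>
  ⟨abs_truncated_le m (Real.abs_cos_le_one _), abs_truncated_le m (Real.abs_sin_le_one _),
    abs_truncated_le m (Real.abs_cos_le_one _), abs_truncated_le m (Real.abs_sin_le_one _)⟩

theorem encodeAngles_getD (m : ℕ) (j : Fin r) {t : ℕ} (ht : t < 4) :
    (Q.encodeAngles m).getD (4 * j + t) 0 = ([truncated m (Real.cos (Q.gamma j)),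
      truncated m (Real.sin (Q.gamma j)), truncated m (Real.cos (Q.beta j)),
      truncated m (Real.sin (Q.beta j))] : List ℤ).getD t 0 := by
  unfold MaxCutCircuit.encodeAngles
  rw [getD_flatMap_four _ (fun _ => rfl) _ (by simp) ht]
  simp

theorem natAbs_getD_lt {B : ℕ} {l : List ℤ} (h : ∀ z ∈ l, z.natAbs < 2 ^ B) (i : ℕ) :
    (l.getD i 0).natAbs < 2 ^ B := by
  rcases Nat.lt_or_ge i l.length with hi | hi
  · rw [List.getD_eq_getElem _ _ hi]; exact h _ (List.getElem_mem hi)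
  · rw [List.getD_eq_default _ _ hi]; simp

theorem truncated_toNat {m : ℕ} {x : ℝ} (hx : 0 ≤ x) :
    truncated m x = ((truncated m x).toNat : ℤ) :=
  (Int.toNat_of_nonneg (Int.floor_nonneg.2 (by positivity))).symm

theorem PauliNoise.abs_le_one (N : PauliNoise) : |N.pX| ≤ 1 ∧ |N.pY| ≤ 1 ∧ |N.pZ| ≤ 1 := by
  have h1 := N.pX_nonneg
  have h2 := N.pY_nonneg
  have h3 := N.pZ_nonneg
  have h4 := N.half_le_pI
  refine ⟨?_, ?_, ?_⟩ <;> rw [abs_le] <;> constructor <;> linarith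

theorem bdd_input {B k m : ℕ} (hB : n + r + k + m + Q.ops.length + 2 ≤ B) : Bdd B (Q.input N k m) := by
  have hn : ∀ x : ℕ, x ≤ B → (x : ℤ).natAbs < 2 ^ B := fun x hx => by
    rw [Int.natAbs_natCast]; exact lt_two_pow_of_le hx
  have ht : ∀ x : ℝ, |x| ≤ 1 → (truncated m x).natAbs < 2 ^ B := fun x hx =>
    natAbs_lt_of_abs_le m (abs_truncated_le m hx) (by omega)
  obtain ⟨h1, h2, h3⟩ := N.abs_le_one
  constructor
  · intro x
    refine natAbs_getD_lt ?_ x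
    simp only [List.mem_cons, List.not_mem_nil, or_false]
    rintro z (rfl | rfl | rfl | rfl | rfl | rfl | rfl | rfl)
    · exact hn _ (by omega)
    · exact hn _ (by omega)
    · exact hn _ (by omega)
    · exact hn _ (by omega)
    · exact hn _ (by omega)
    · exact ht _ h1
    · exact ht _ h2
    · exact ht _ h3
  · intro a i
    simp only [MaxCutCircuit.input]
    split_ifs
    · refine natAbs_getD_lt ?_ i
      unfold MaxCutCircuit.encodeAngles
      simp only [List.mem_flatMap, List.mem_cons, List.not_mem_nil, or_false]
      rintro z ⟨j, -, rfl | rfl | rfl | rfl⟩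
      · exact ht _ (Real.abs_cos_le_one _)
      · exact ht _ (Real.abs_sin_le_one _)
      · exact ht _ (Real.abs_cos_le_one _)
      · exact ht _ (Real.abs_sin_le_one _)
    · refine natAbs_getD_lt ?_ i
      simp only [List.mem_flatMap]
      rintro z ⟨o, -, hz⟩
      cases o with
      | zz j u v =>
        simp only [Op.encode, List.mem_cons, List.not_mem_nil, or_false] at hz
        have := j.2
        have := u.2
        have := v.2
        rcases hz with rfl | rfl | rfl | rfl
        · simp
        · exact hn _ (by omega)
        · exact hn _ (by omega)
        · exact hn _ (by omega)
      | noise =>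
        simp only [Op.encode, List.mem_cons, List.not_mem_nil, or_false] at hz
        rcases hz with rfl | rfl | rfl | rfl
        · exact hn 1 (by omega)
        all_goals simp
      | mix j =>
        simp only [Op.encode, List.mem_cons, List.not_mem_nil, or_false] at hz
        have := j.2
        rcases hz with rfl | rfl | rfl | rfl
        · exact hn 2 (by omega)
        · exact hn _ (by omega)
        all_goals simp
    · simp

/-- The branch of the noise channel that the machine selects. -/
def noiseChoice (N : PauliNoise) (m : ℕ) : ℕ → Fin 5 :=
  chOf (truncated m N.pX).toNat (truncated m N.pY).toNat (truncated m N.pZ).toNat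

theorem length_els_le (hn : 0 < n) : Q.els.length ≤ Q.ops.length * n := by
  unfold MaxCutCircuit.els
  induction Q.ops with
  | nil => simp
  | cons o l ih =>
    rw [List.flatMap_cons, List.length_append, List.length_cons, Nat.succ_mul, Nat.add_comm]
    refine Nat.add_le_add ih ?_
    cases o <;> simp [Op.expand]
    omega

/-- Randomness enters only through the tape. Array 3 is the abstraction handed from the random part
to the main part, which is a deterministic function of it. -/
theorem doesR_sampler {X B k m T cap : ℕ} (hn : 0 < n) (hT : T = (Q.ops.length + 1) * n)
    (hcap : cap = 4 * (T * (n * (r + 1)) * k))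
    (hB : (m + 1) * T + 2 * T + cap + n * (T + 1) + 2 * m + n + r + k + Q.ops.length + 8 ≤ B)
    (hX : n * (T + 1) + T + cap + m + Q.ops.length ≤ X) :
    DoesR X B sampler (Q.input N k m) (readOutput n)
      ((iterK (tapeK m) T 0 fun _ => 0).map fun τ =>
        let q := runFrom (Q.intGates m) (noiseChoice N m) (2 ^ m) cap τ Q.allEls 0
          (Skel.start n, fun _ => false)
        readout q.1 q.2) fun _ => True := by
  have hs0 : Bdd B (Q.input N k m) := bdd_input Q N (by omega)
  have g5 : (Q.input N k m).vars 5 = ((truncated m N.pX).toNat : ℕ) := truncated_toNat N.pX_nonneg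
  have g6 : (Q.input N k m).vars 6 = ((truncated m N.pY).toNat : ℕ) := truncated_toNat N.pY_nonneg
  have g7 : (Q.input N k m).vars 7 = ((truncated m N.pZ).toNat : ℕ) := truncated_toNat N.pZ_nonneg
  refine doesR_seq_det (does_pSetup (X := X) (n := n) (r := r) (k := k) (m := m) (nops := Q.ops.length)
    hs0 rfl rfl rfl rfl rfl g5 g6 hT hcap (by omega) (by omega)) ?_
  rintro s1 hs1 k1 ⟨v8, v9, v10, v11, v12⟩
  have ha1 : s1.arrs = (Q.input N k m).arrs := by
    funext a
    exact k1.2 a (by simp [pSetup, Prog.loop, Prog.wa])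
  have h3 : s1.arrs 3 = fun _ => 0 := by rw [ha1]; rfl
  have htape := doesR_pTape (X := X) (m := m) (T := T) hs1 (by rw [k1.1 3 (by decide)]; rfl)
    (by omega) (by omega) v8 (by omega) (by omega) (by rw [h3]; simp)
  rw [h3] at htape
  rw [← PMF.bind_pure_comp]
  refine doesR_seq htape ?_
  intro s2 hs2 k2 hpos
  have ha2 : ∀ x, x ≠ 3 → s2.arrs x = (Q.input N k m).arrs x := by
    intro x hx
    rw [k2.2 x (by simpa [pTape, pEntry, pDigit, Prog.loop, Prog.wa] using hx), ha1]
  have hv : ∀ x ∈ [0, 1, 2, 3, 4, 5, 6, 7, 18, 19], s2.vars x = (Q.input N k m).vars x := by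
    intro x hx
    rw [k2.1 x, k1.1 x]
    · revert x; decide
    · revert x; decide
  have hst : Static X B m cap T (Q.intGates m) (truncated m N.pX).toNat (truncated m N.pY).toNat
      (truncated m N.pZ).toNat (s2.arrs 3) n s2 := by
    refine ⟨?_, ?_, ?_, ?_, ?_, ?_, ?_, ?_, ?_, fun i _ => ⟨rfl, hpos i⟩, intGates_le Q m, by omega,
      by omega, by omega, by omega⟩
    · rw [hv 0 (by decide)]; rfl
    · rw [hv 5 (by decide)]; exact g5
    · rw [hv 6 (by decide)]; exact g6
    · rw [hv 7 (by decide)]; exact g7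
    · rw [k2.1 9 (by decide)]; exact v9
    · rw [k2.1 10 (by decide)]; exact v10
    · rw [k2.1 11 (by decide)]; exact v11
    · rw [k2.1 12 (by decide)]; exact v12
    · intro j
      have hang : ∀ t < 4, s2.arrs 0 (4 * j + t) = ([truncated m (Real.cos (Q.gamma j)),
          truncated m (Real.sin (Q.gamma j)), truncated m (Real.cos (Q.beta j)),
          truncated m (Real.sin (Q.beta j))] : List ℤ).getD t 0 := by
        intro t ht
        rw [ha2 0 (by decide)]
        exact encodeAngles_getD Q m j ht
      have q0 := hang 0 (by decide)
      rw [Nat.add_zero] at q0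
      rw [q0, hang 1 (by decide), hang 2 (by decide), hang 3 (by decide)]
      exact ⟨⟨rfl, rfl⟩, rfl, rfl⟩
  have hfin := does_pMain hst hs2 (l := Q.ops) (by intro i; rw [ha2 1 (by decide)]; rfl)
    (by rw [hv 4 (by decide)]; rfl) (by omega) (by omega)
    (by
      have := length_els_le Q hn
      unfold MaxCutCircuit.els at this
      rw [hT, Nat.succ_mul]
      omega) (by rw [hv 18 (by decide)]; rfl) (by rw [hv 19 (by decide)]; rfl)
    (by
      intro x hx y
      rw [ha2 x (by omega)]
      simp only [MaxCutCircuit.input]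
      rw [if_neg (by omega), if_neg (by omega)])
  exact doesR_of_does (hfin.mono fun s' _ _ h => ⟨h, trivial⟩)

theorem exists_runs_sampler {X B k m T cap : ℕ} (hn : 0 < n) (hT : T = (Q.ops.length + 1) * n)
    (hcap : cap = 4 * (T * (n * (r + 1)) * k))
    (hB : (m + 1) * T + 2 * T + cap + n * (T + 1) + 2 * m + n + r + k + Q.ops.length + 8 ≤ B)
    (hX : n * (T + 1) + T + cap + m + Q.ops.length ≤ X) :
    ∃ μ, Runs sampler (Q.input N k m) μ (sampler.tm X * stepCost B) ∧
      ∀ y, ((μ.map (readOutput n)) y).toReal = law (Q.intGates m) (noiseChoice N m) (2 ^ m) cap y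
        Q.allEls (Skel.start n, fun _ => false) := by
  obtain ⟨μ, h1, -, h3⟩ := doesR_sampler Q N hn hT hcap hB hX
  refine ⟨μ, h1, fun y => ?_⟩
  have hlen : Q.allEls.length ≤ T := by
    have := length_els_le Q hn
    unfold MaxCutCircuit.allEls
    rw [hT, Nat.succ_mul, List.length_append, List.length_map, List.length_finRange]
    omega
  have := expect_run (Q.intGates m) (noiseChoice N m) m cap y Q.allEls T 0 hlen (fun _ => 0)
    (Skel.start n, fun _ => false)
  rw [h3, map_apply_eq_expect]
  unfold hit at this
  rw [this, ENNReal.toReal_ofReal (law_nonneg _ _ _ _ _ _ _)]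

/-! ### Running time -/

/-- The size of a program. -/
def Prog.nodes : Prog → ℕ
  | .skip => 0
  | .set _ _ => 0
  | .store _ _ _ => 0
  | .flip _ => 0
  | .seq c d => c.nodes + d.nodes + 1
  | .ite _ c d => c.nodes + d.nodes + 2
  | .while _ c => c.nodes + 2

/-- A loop multiplies the time by at most a power of X + 2 and other constructors add, so the number
of nodes bounds the degree of the polynomial. -/
theorem Prog.tm_le (X : ℕ) (c : Prog) : c.tm X ≤ (X + 2) ^ c.nodes := by
  have hpos : ∀ e, 1 ≤ (X + 2) ^ e := fun e => Nat.one_le_pow _ _ (by omega)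
  have hmono : ∀ {a b}, a ≤ b → (X + 2) ^ a ≤ (X + 2) ^ b := fun h =>
    Nat.pow_le_pow_right (by omega) h
  have hsum : ∀ c d : Prog, c.tm X ≤ (X + 2) ^ c.nodes → d.tm X ≤ (X + 2) ^ d.nodes →
      c.tm X + d.tm X ≤ (X + 2) ^ (c.nodes + d.nodes + 1) := by
    intro c d hc hd
    have h1 := hmono (Nat.le_add_right c.nodes d.nodes)
    have h2 := hmono (Nat.le_add_left d.nodes c.nodes)
    rw [pow_succ]
    nlinarith
  induction c with
  | skip => exact hpos _
  | set x e => exact hpos _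
  | store a i e => exact hpos _
  | flip x => exact hpos _
  | seq c d hc hd => exact hsum c d hc hd
  | ite b c d hc hd =>
    have h1 := hsum c d hc hd
    have h2 := hpos (c.nodes + d.nodes + 1)
    simp only [tm, nodes]
    rw [show c.nodes + d.nodes + 2 = (c.nodes + d.nodes + 1) + 1 by ring, pow_succ]
    nlinarith
  | _ b c hc =>
    have h1 := hpos c.nodes
    simp only [tm, nodes]
    rw [pow_add]
    nlinarith [Nat.zero_le (X * X)]

end

/-- Put x = pd, so that x > 10 log p⁻¹ ≥ 10 log 2. Then (1-2p)^d ≤ e^(-2x), while d + 2 = x p⁻¹ + 2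
≤ 2 e^(x/2) e^(x/10). The product is at most 4 e^(-4x/5) ≤ 4/8. -/
theorem sq_mul_pow_le_half {p : ℝ} {d : ℕ} (hp : 0 < p) (hp2 : p ≤ 1 / 2)
    (hd : 10 * (p⁻¹ * Real.log p⁻¹) < d) :
    ((d : ℝ) + 2) ^ 2 * (1 - 2 * p) ^ d ≤ 1 / 2 := by
  set l := Real.log p⁻¹ with hl
  have hpi : 2 ≤ p⁻¹ := by
    rw [le_inv_comm₀ two_pos hp]
    linarith
  have hexp : Real.exp l = p⁻¹ := Real.exp_log (by positivity)
  have hl2 : Real.log 2 ≤ l := Real.log_le_log two_pos hpi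
  have hlog2 : 0 < Real.log 2 := Real.log_pos one_lt_two
  have hx : 10 * l < p * d := by
    have := mul_lt_mul_of_pos_left hd hp
    rwa [show p * (10 * (p⁻¹ * l)) = 10 * l by field_simp] at this
  set x := p * d with hxd
  have hx0 : 0 < x := by linarith
  have hdx : (d : ℝ) = x * Real.exp l := by
    rw [hexp, hxd]
    field_simp
  have h1 : (1 - 2 * p) ^ d ≤ Real.exp (-(2 * x)) := by
    have h : 1 - 2 * p ≤ Real.exp (-(2 * p)) := by linarith [Real.add_one_le_exp (-(2 * p))]
    refine (pow_le_pow_left₀ (by linarith) h d).trans_eq ?_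
    rw [← Real.exp_nat_mul, hxd]
    congr 1
    ring
  -- The factor x is absorbed by e^(x/2), and p⁻¹ = e^l by e^(x/10).
  have h2 : (d : ℝ) + 2 ≤ 2 * Real.exp (x / 2 + x / 10) := by
    rw [hdx, Real.exp_add]
    have ha := Real.add_one_le_exp (x / 2)
    have hb : Real.exp l ≤ Real.exp (x / 10) := Real.exp_le_exp.2 (by linarith)
    calc x * Real.exp l + 2 ≤ 2 * (x / 2 + 1) * Real.exp l := by nlinarith [hexp]
      _ ≤ 2 * Real.exp (x / 2) * Real.exp (x / 10) := by gcongr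
      _ = _ := by ring
  have h3 : Real.exp (-(8 / 10 * x)) ≤ 1 / 8 := by
    have h : Real.exp (-(3 * Real.log 2)) = 1 / 8 := by
      rw [Real.exp_neg, show (3 : ℝ) * Real.log 2 = ((3 : ℕ) : ℝ) * Real.log 2 by norm_num,
        Real.exp_nat_mul, Real.exp_log two_pos]
      norm_num
    rw [← h]
    exact Real.exp_le_exp.2 (by linarith)
  calc ((d : ℝ) + 2) ^ 2 * (1 - 2 * p) ^ d
      ≤ (2 * Real.exp (x / 2 + x / 10)) ^ 2 * Real.exp (-(2 * x)) := by
        have : 0 ≤ 1 - 2 * p := by linarith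
        gcongr
    _ = 4 * Real.exp (-(8 / 10 * x)) := by
        rw [mul_pow, ← Real.exp_nat_mul, mul_assoc, ← Real.exp_add]
        norm_num
        ring
    _ ≤ 1 / 2 := by linarith

/-! ### Size of the circuit and choice of the parameters -/

section Sizes

variable {G : SimpleGraph (Fin n)} (Q : MaxCutCircuit G r)

theorem le_depth : r ≤ Q.depth := by
  unfold MaxCutCircuit.depth
  calc r = ∑ _j : Fin r, 1 := by simp
    _ ≤ _ := Finset.sum_le_sum fun j _ => Nat.le_add_left _ _

/-- The edges of a layer have distinct endpoints, so a layer has at most n gates, and one noise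
operation follows; the mixer part has at most two operations. -/
theorem length_roundOps_le (j : Fin r) :
    (Q.roundOps j).length ≤ ((Q.layers j).length + 1) * (n + 2) := by
  unfold MaxCutCircuit.roundOps
  rw [List.length_append, Nat.succ_mul]
  refine Nat.add_le_add ?_ (by split_ifs <;> simp)
  have h : ∀ L ∈ Q.layers j, L.length ≤ n := by
    intro L hL
    have h1 := (Q.disjoint_in_layer j L hL).length_le_card
    rw [Fintype.card_fin] at h1
    refine le_trans ?_ h1
    clear h1 hL
    induction L with
    | nil => simp
    | cons e L ih =>
      simp only [List.flatMap_cons, List.length_append, List.length_cons, List.length_nil]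
      omega
  generalize Q.layers j = l at h
  induction l with
  | nil => simp
  | cons L l ih =>
    have h1 := h L (by simp)
    have h2 := ih fun L' hL' => h L' (by simp [hL'])
    simp only [List.flatMap_cons, List.length_append, List.length_cons, List.length_map,
      List.length_nil, Nat.succ_mul] at h2 ⊢
    omega

theorem length_ops_le : Q.ops.length ≤ Q.depth * (n + 2) := by
  unfold MaxCutCircuit.ops MaxCutCircuit.depth
  rw [List.length_flatMap, Finset.sum_mul, ← List.sum_ofFn, List.ofFn_eq_map]
  exact List.sum_le_sum fun j _ => length_roundOps_le Q j

end Sizes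

/-- With o + 1 ≤ S² one gets T ≤ S³ and cap ≤ 4S⁶. Precision needs 3T and more digits, for which S⁵
suffices. The largest term is then (S⁵+1)T ≤ S⁸ + S³, and S ≥ 3 gives 81 S⁸ ≤ S¹², enough for the
whole sum. -/
theorem size_bounds {n r D k o T cap S : ℕ} (hn : 1 ≤ n) (hD : 1 ≤ D) (hk : 1 ≤ k) (hr : r ≤ D)
    (ho : o ≤ D * (n + 2)) (hS : S = n + D + k) (hT : T = (o + 1) * n)
    (hcap : cap = 4 * (T * (n * (r + 1)) * k)) :
    (S ^ 5 + 1) * T + 2 * T + cap + n * (T + 1) + 2 * S ^ 5 + n + r + k + o + 8 ≤ S ^ 12 ∧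
      n * (T + 1) + T + cap + S ^ 5 + o ≤ S ^ 12 ∧ 5 + n + k + 3 * T ≤ S ^ 5 := by
  have h3 : 3 ≤ S := by omega
  have hm : ∀ i j, i ≤ j → S ^ i ≤ S ^ j := fun i j h => Nat.pow_le_pow_right (by omega) h
  have ho1 : o + 1 ≤ S ^ 2 := by
    have : (D + 2) * (n + 2) ≤ S * S := Nat.mul_le_mul (by omega) (by omega)
    nlinarith
  have hT3 : T ≤ S ^ 3 := by
    rw [hT, pow_succ S 2]
    exact Nat.mul_le_mul ho1 (by omega)
  have hc : cap ≤ 4 * S ^ 6 := by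
    rw [hcap, show S ^ 6 = S ^ 3 * (S * S) * S by ring]
    have : n ≤ S := by omega
    have : r + 1 ≤ S := by omega
    have : k ≤ S := by omega
    gcongr
  have hnT : n * (T + 1) ≤ S ^ 4 + S := by
    calc n * (T + 1) ≤ S * (S ^ 3 + 1) := Nat.mul_le_mul (by omega) (by omega)
      _ = _ := by ring
  have hmT : (S ^ 5 + 1) * T ≤ S ^ 8 + S ^ 3 := by
    calc (S ^ 5 + 1) * T ≤ (S ^ 5 + 1) * S ^ 3 := Nat.mul_le_mul_left _ hT3
      _ = _ := by ring
  have a1 := hm 1 8 (by norm_num)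
  have a2 := hm 2 8 (by norm_num)
  have a3 := hm 3 8 (by norm_num)
  have a4 := hm 4 8 (by norm_num)
  have a5 := hm 5 8 (by norm_num)
  have a6 := hm 6 8 (by norm_num)
  have b1 := hm 1 3 (by norm_num)
  have b12 : 81 * S ^ 8 ≤ S ^ 12 := by
    rw [show S ^ 12 = S ^ 4 * S ^ 8 by ring]
    exact Nat.mul_le_mul_right _ (Nat.pow_le_pow_left h3 4)
  have b5 : 9 * S ^ 3 ≤ S ^ 5 := by
    rw [show S ^ 5 = S ^ 2 * S ^ 3 by ring]
    exact Nat.mul_le_mul_right _ (Nat.pow_le_pow_left h3 2)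
  rw [pow_one] at a1 b1
  refine ⟨?_, ?_, ?_⟩ <;> omega

theorem time_le (X S : ℕ) (hS : 3 ≤ S) (hX : X = S ^ 12) (c : Prog) :
    c.tm X * stepCost X
      ≤ (10 ^ 6 + 13 * c.nodes + 26) * S ^ (10 ^ 6 + 13 * c.nodes + 26) := by
  have h : X + 2 ≤ S ^ 13 := by
    have : 3 * S ^ 12 ≤ S ^ 13 := by
      rw [pow_succ S 12, mul_comm]
      exact Nat.mul_le_mul_left _ hS
    have : 1 ≤ S ^ 12 := Nat.one_le_pow _ _ (by omega)
    omega
  calc c.tm X * stepCost X ≤ (S ^ 13) ^ c.nodes * (10 ^ 6 * (S ^ 13) ^ 2) := by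
        refine Nat.mul_le_mul ((Prog.tm_le X c).trans (Nat.pow_le_pow_left h _)) ?_
        exact Nat.mul_le_mul_left _ (Nat.pow_le_pow_left (by omega) _)
    _ = 10 ^ 6 * S ^ (13 * c.nodes + 26) := by
        rw [← pow_mul, ← pow_mul, mul_left_comm, ← pow_add]
    _ ≤ _ := by
        refine Nat.mul_le_mul (by omega) (Nat.pow_le_pow_right (by omega) (by omega))

/-- The error budget: 1/(2k) for the rounding of probabilities to multiples of 2^(-m), 1/k for
clusters that are too large, 1/(2k) for truncated gate parameters. -/
theorem sum_abs_law_sub_outputProb_le {G : SimpleGraph (Fin n)} [DecidableRel G.Adj]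
    (Q : MaxCutCircuit G r) (N : PauliNoise) {m k T cap : ℕ} (hn : 0 < n) (hk : 0 < k)
    (hT : T = (Q.ops.length + 1) * n) (hcap : cap = 4 * (T * (n * (r + 1)) * k))
    (hm : 5 + n + k + 3 * T ≤ m)
    (hx : ((G.maxDegree : ℝ) + 2) ^ 2 * (1 - 2 * N.strength) ^ G.maxDegree ≤ 1 / 2) :
    ∑ y, |law (Q.intGates m) (noiseChoice N m) (2 ^ m) cap y Q.allEls
        (Skel.start n, fun _ => false) - Q.outputProb N y| ≤ 2 / k := by
  have hk' : (0 : ℝ) < k := by exact_mod_cast hk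
  have hT0 : 0 < T := by rw [hT]; positivity
  have hT' : (0 : ℝ) < T := by exact_mod_cast hT0
  have hL : n + Q.els.length ≤ T := by
    have := length_els_le Q hn
    rw [hT, Nat.succ_mul]
    omega
  -- The precision pays for 2^n outcomes, the factor 4^T of the perturbation bound, and the accuracy
  -- T·k.
  have hpow : (32 : ℝ) * 2 ^ n * (T * k) * 4 ^ T ≤ 2 ^ m := by
    have h : 32 * 2 ^ n * (T * k) * 4 ^ T ≤ 2 ^ m := by
      calc 32 * 2 ^ n * (T * k) * 4 ^ T ≤ 2 ^ 5 * 2 ^ n * (2 ^ T * 2 ^ k) * (2 ^ 2) ^ T := by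
            have h1 : T ≤ 2 ^ T := Nat.lt_two_pow_self.le
            have h2 : k ≤ 2 ^ k := Nat.lt_two_pow_self.le
            gcongr <;> norm_num
        _ = 2 ^ (5 + n + k + 3 * T) := by
            rw [← pow_mul, ← pow_add, ← pow_add, ← pow_add, ← pow_add]
            congr 1
            ring
        _ ≤ 2 ^ m := Nat.pow_le_pow_right two_pos hm
    exact_mod_cast h
  have hTk : (0 : ℝ) < T * k := by positivity
  have hsmall : (32 : ℝ) * (T * k) ≤ 2 ^ m := by
    refine le_trans ?_ hpow
    have h1 : (1 : ℝ) ≤ 2 ^ n := one_le_pow₀ one_le_two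
    have h2 : (1 : ℝ) ≤ 4 ^ T := one_le_pow₀ (by norm_num)
    calc (32 : ℝ) * (T * k) = 32 * 1 * (T * k) * 1 := by ring
      _ ≤ _ := by gcongr
  have hels : (Q.els.length : ℝ) ≤ T := by exact_mod_cast (Nat.le_add_left _ n).trans hL
  have htr : ∀ x : ℝ, 0 ≤ x → ((truncated m x).toNat : ℝ) ≤ (2 ^ m : ℕ) * x ∧
      (2 ^ m : ℕ) * x < ((truncated m x).toNat : ℝ) + 1 := by
    intro x hx
    have h : ((truncated m x : ℤ) : ℝ) = ((truncated m x).toNat : ℝ) := by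
      conv_lhs => rw [truncated_toNat hx]
      rfl
    rw [← h]
    push_cast
    exact ⟨Int.floor_le _, Int.lt_floor_add_one _⟩
  have hM : (2 ^ m : ℕ) ≠ 0 := by positivity
  have e1 := sum_abs_law_sub_ideal_le (Q.intGates m) N (noiseChoice N m) hM
    (Nat.even_pow.2 ⟨even_two, by omega⟩) cap (η := 12 / (2 ^ m : ℕ)) (by gcongr; norm_num)
    (sum_abs_chOf_sub_wt_le N hM (htr _ N.pX_nonneg).1 (htr _ N.pX_nonneg).2
      (htr _ N.pY_nonneg).1 (htr _ N.pY_nonneg).2 (htr _ N.pZ_nonneg).1 (htr _ N.pZ_nonneg).2)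
    Q.allEls (Skel.start n) (fun _ => false)
  have e2 := badness_circuit_le Q (Q.intGates m) N cap
  have e3 := sum_abs_ideal_sub_outputProb_le Q N m
  have f1 : (Q.allEls.length : ℝ) * (12 / (2 ^ m : ℕ)) ≤ 1 / (2 * k) := by
    have h : (Q.allEls.length : ℝ) ≤ T := by
      have : Q.allEls.length = n + Q.els.length := by simp [MaxCutCircuit.allEls]
      rw [this]
      exact_mod_cast hL
    rw [mul_div_assoc', div_le_div_iff₀ (by positivity) (by positivity)]
    push_cast
    calc (Q.allEls.length : ℝ) * 12 * (2 * k) ≤ T * 12 * (2 * k) := by gcongr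
      _ ≤ 1 * 2 ^ m := by nlinarith
  have f2 : 2 * badness (Q.intGates m) N cap Q.allEls (Skel.start n) ≤ 1 / k := by
    have hcap0 : cap ≠ 0 := by rw [hcap]; positivity
    have hcap' : (0 : ℝ) < cap := by exact_mod_cast Nat.pos_of_ne_zero hcap0
    -- The integer part of the logarithm loses at most a factor 2.
    have h1 : (((G.maxDegree : ℝ) + 2) ^ 2 * (1 - 2 * N.strength) ^ G.maxDegree) ^ Nat.log 2 cap
        ≤ 2 / cap := by
      have h0 : 0 ≤ 1 - 2 * N.strength := by linarith [(strength_bounds N).2]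
      refine (pow_le_pow_left₀ (by positivity) hx _).trans ?_
      have h : (cap : ℝ) ≤ 2 ^ (Nat.log 2 cap + 1) := by
        exact_mod_cast (Nat.lt_pow_succ_log_self one_lt_two cap).le
      rw [one_div, inv_pow, ← one_div, div_le_div_iff₀ (by positivity) hcap']
      rw [pow_succ] at h
      linarith
    have h2 : (cap : ℝ) = 4 * (T * (n * (r + 1)) * k) := by exact_mod_cast hcap
    have hn' : (0 : ℝ) < n := by exact_mod_cast hn
    calc 2 * badness (Q.intGates m) N cap Q.allEls (Skel.start n)
        ≤ 2 * (T * (n * (r + 1) * (2 / cap))) := by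
          have h0 : 0 ≤ 1 - 2 * N.strength := by linarith [(strength_bounds N).2]
          refine mul_le_mul_of_nonneg_left (e2.trans ?_) two_pos.le
          gcongr
      _ = 1 / k := by
          rw [h2]
          field_simp
          norm_num
  have f3 : 2 * (2 ^ n * (Q.els.length * (8 * (2 ^ m : ℝ)⁻¹) * 4 ^ Q.els.length))
      ≤ 1 / (2 * k) := by
    calc 2 * (2 ^ n * (Q.els.length * (8 * (2 ^ m : ℝ)⁻¹) * 4 ^ Q.els.length))
        ≤ 2 * (2 ^ n * (T * (8 * (2 ^ m : ℝ)⁻¹) * 4 ^ T)) := by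
          have h : (4 : ℝ) ^ Q.els.length ≤ 4 ^ T :=
            pow_le_pow_right₀ (by norm_num) (by omega)
          gcongr
      _ = (32 * 2 ^ n * (T * k) * 4 ^ T) / 2 ^ m * (1 / (2 * k)) := by
          field_simp
          norm_num
      _ ≤ 1 * (1 / (2 * k)) := by
          gcongr
          exact (div_le_one (by positivity)).2 hpow
      _ = _ := one_mul _
  calc ∑ y, |law (Q.intGates m) (noiseChoice N m) (2 ^ m) cap y Q.allEls
        (Skel.start n, fun _ => false) - Q.outputProb N y|
      ≤ ∑ y, (|law (Q.intGates m) (noiseChoice N m) (2 ^ m) cap y Q.allEls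
          (Skel.start n, fun _ => false)
            - ideal (Q.intGates m) N y Q.allEls (Skel.start n) (fun _ => false)|
        + |ideal (Q.intGates m) N y Q.allEls (Skel.start n) (fun _ => false)
            - Q.outputProb N y|) := Finset.sum_le_sum fun y _ => abs_sub_le _ _ _
    _ ≤ 1 / (2 * k) + 1 / k + 1 / (2 * k) := by
        rw [Finset.sum_add_distrib]
        linarith
    _ = 2 / k := by
        field_simp
        norm_num

theorem exists_sampler_close {G : SimpleGraph (Fin n)} [DecidableRel G.Adj] (N : PauliNoise)
    (Q : MaxCutCircuit G r) {k : ℕ} (hr : 1 ≤ r) (hp : 0 < N.strength) (hk : 0 < k)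
    (hd : 10 * (N.strength⁻¹ * Real.log (r * N.strength⁻¹)) < (G.maxDegree : ℝ)) :
    ∃ μ : PMF Store,
      Runs sampler (Q.input N k ((n + Q.depth + k) ^ 5)) μ
        ((10 ^ 6 + 13 * sampler.nodes + 26)
          * (n + Q.depth + k) ^ (10 ^ 6 + 13 * sampler.nodes + 26)) ∧
      tvDist (μ.map (readOutput n)) (Q.outputProb N) ≤ 1 / k := by
  obtain ⟨-, hp2⟩ := strength_bounds N
  have hpi : 2 ≤ N.strength⁻¹ := by
    rw [le_inv_comm₀ two_pos hp]
    linarith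
  have hlog : Real.log N.strength⁻¹ ≤ Real.log (r * N.strength⁻¹) := by
    have hr' : (1 : ℝ) ≤ r := by exact_mod_cast hr
    exact Real.log_le_log (by positivity) (le_mul_of_one_le_left (by positivity) hr')
  have hd' : 10 * (N.strength⁻¹ * Real.log N.strength⁻¹) < (G.maxDegree : ℝ) := by
    refine lt_of_le_of_lt ?_ hd
    gcongr
  -- Without qubits the maximal degree is 0, which does not exceed the positive threshold.
  have hn : 0 < n := by
    rcases Nat.eq_zero_or_pos n with rfl | h
    · have h1 : 0 < Real.log N.strength⁻¹ := Real.log_pos (by linarith)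
      have h2 : (0 : ℝ) < G.maxDegree := lt_trans (by positivity) hd'
      simp [SimpleGraph.maxDegree] at h2
    · exact h
  have hrd := le_depth Q
  obtain ⟨hB, hX, hm⟩ := size_bounds hn (hr.trans hrd) hk hrd (length_ops_le Q) rfl rfl rfl
  obtain ⟨μ, h1, h2⟩ := exists_runs_sampler Q N hn rfl rfl hB hX
  refine ⟨μ, Runs.mono _ _ _ _ _ h1 (time_le _ _ (by omega) rfl _), ?_⟩
  have h3 := sum_abs_law_sub_outputProb_le Q N hn hk rfl rfl hm (sq_mul_pow_le_half hp hp2 hd')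
  unfold tvDist
  simp only [h2]
  calc _ ≤ 1 / 2 * (2 / (k : ℝ)) := mul_le_mul_of_nonneg_left h3 (by norm_num)
    _ = 1 / k := by ring

end QAOA

end

theorem mainTheorem7 :
    ∃ (Δstar : ℝ → ℕ → ℝ) (C : ℝ) (prog : QAOA.Prog) (a c : ℕ),
      (∀ (p : ℝ) (r : ℕ), 0 < p → p ≤ 1 / 2 → 1 ≤ r →
        Δstar p r ≤ C * (p⁻¹ * Real.log ((r : ℝ) * p⁻¹))) ∧
      ∀ (n r : ℕ) (G : SimpleGraph (Fin n)) [DecidableRel G.Adj] (N : QAOA.PauliNoise)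
        (Q : QAOA.MaxCutCircuit G r) (ε : ℝ),
        1 ≤ r → 0 < N.strength → 0 < ε → Δstar N.strength r < (G.maxDegree : ℝ) →
        ∃ μ : PMF QAOA.Store,
          QAOA.Runs prog
            (Q.input N ⌈1 / ε⌉₊ ((n + Q.depth + ⌈1 / ε⌉₊) ^ a)) μ
            (c * (n + Q.depth + ⌈1 / ε⌉₊) ^ c) ∧
          QAOA.tvDist (μ.map (QAOA.readOutput n)) (Q.outputProb N) ≤ ε := by
  -- The factor 10 is the one in `sq_mul_pow_le_half`, the exponent 5 comes from `size_bounds`, and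
  -- c from `time_le` applied to the fixed program.
  refine ⟨fun p r => 10 * (p⁻¹ * Real.log (r * p⁻¹)), 10, QAOA.sampler, 5,
    10 ^ 6 + 13 * QAOA.sampler.nodes + 26, fun p r _ _ _ => le_rfl, ?_⟩
  intro n r G _ N Q ε hr hp hε hd
  obtain ⟨μ, h1, h2⟩ := QAOA.exists_sampler_close N Q hr hp
    (Nat.ceil_pos.2 (one_div_pos.2 hε)) hd
  refine ⟨μ, h1, h2.trans ?_⟩
  rw [one_div_le (by exact_mod_cast Nat.ceil_pos.2 (one_div_pos.2 hε)) hε]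
  exact Nat.le_ceil _
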